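/- Let $\Bbbk$ be a field, let $n\ge 1$ be an integer which is invertible in $\Bbbk$, and let $\mathcal A$ be a small DG category over $\Bbbk$. For objects $a,b$ write ${}_a\mathcal A_b$ for the complex of morphisms $b\to a$ (with differential of degree $1$), so that composition is ${}_a\mathcal A_b\otimes{}_b\mathcal A_c\to{}_a\mathcal A_c$, $\alpha\otimes\beta\mapsto\alpha\beta$. The DG category $\mathcal A^{\otimes n}$ has as objects the $n$-tuples of objects of $\mathcal A$ and as morphism complexes the tensor products ${}_{a_1}\mathcal A_{b_1}\otimes\dots\otimes{}_{a_n}\mathcal A_{b_n}$, with factorwise composition. Throughout, whenever homogeneous morphisms are reordered, the Koszul sign of the reordering is understood. Let $t=t_n$ be the automorphism $a_1\otimes a_2\otimes\dots\otimes a_n\mapsto a_n\otimes a_1\otimes\dots\otimes a_{n-1}$ of $\mathcal A^{\otimes n}$ (on objects and on morphisms). **Complexes.** For a DG functor $F:\mathcal B\to\mathcal B$ let $$C_{k}(\mathcal B;F)=\bigoplus_{x_0,\dots,x_k}{}_{Fx_0}\mathcal B_{x_1}\otimes{}_{x_1}\mathcal B_{x_2}\otimes\dots\otimes{}_{x_k}\mathcal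 B_{x_0}\qquad(k\ge 0),$$ and let $C_\bullet(\mathcal B;F)=\bigoplus_k C_k(\mathcal B;F)$ with the differential $d=b+(-1)^k d_{\mathrm{int}}$ on $C_k$, where $d_{\mathrm{int}}$ is the differential of the tensor product of complexes, and $b=0$ on $C_0$ and $$b(\alpha_0\otimes\dots\otimes\alpha_k)=\sum_{i=0}^{k-1}(-1)^i\alpha_0\otimes\dots\otimes\alpha_i\alpha_{i+1}\otimes\dots\otimes\alpha_k+(-1)^{k+|\alpha_k|(|\alpha_0|+\dots+|\alpha_{k-1}|)}F(\alpha_k)\alpha_0\otimes\alpha_1\otimes\dots\otimes\alpha_{k-1}$$ for $k\ge1$. Write $C_\bullet(\mathcal B)=C_\bullet(\mathcal B;\mathrm{id})$. The functor $t$ acts on $C_\bullet(\mathcal A^{\otimes n};t)$ factorwise; $C_\bullet(\mathcal A^{\otimes n};t)_t$ denotes the quotient by the subspace generated by all $\underline\alpha-t.\underline\alpha$. For $m\ge 1$, a basic chain in $C_{m-1}(\mathcal A^{\otimes n};t)$ is written as an $m\times n$ matrix $\underline\alpha=(\alpha_{ij})$, which stands for $(\alpha_{11}\otimes\dots\otimes\alpha_{1n})\otimes\dots\otimes(\alpha_{m1}\otimes\dots\otimes\alpha_{mn})$;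 its entries are composable in the cyclic *composable order*: down the first column, then down the second column, and so on, and from the end of the last column back to $\alpha_{11}$. A basic chain in $C_{m-1}(\mathcal A)$ is written as a column $(\alpha_1,\dots,\alpha_m)$. Products such as $\alpha_{ij}\cdots\alpha_{kl}$ run over consecutive entries in the composable order. The symbol $\mathrm{id}$ denotes the identity morphism of the object for which the matrix is composable. For a tuple $c=(c_1,\dots,c_r)$ of integers let $\sigma_c\in S_r$ be the permutation for which $\sigma_c(i)$ is the number of $k$ with $c_k<c_i$, or with $c_k=c_i$ and $k\le i$. For disjoint $P,Q\subset\{1,\dots,N\}$ let $S_{P,Q}\subset S_N$ be the set of permutations which are increasing on $P$ and on $Q$ and fix all elements outside $P\cup Q$. The symbol $(-1)^{\sigma}$ is the sign of a permutation $\sigma$. Permutations $\sigma\in S_N$ act on matrices with $N$ rows by moving the $i$-th row to the position $\sigma(i)$. **The map $f_n$.** $f_n:C_\bullet(\mathcal A^{\otimes n};t)\to C_\bullet(\mathcal A)$ sends an $m\times n$ matrix $(\alpha_{ij})$ to $$\frac1n\sum_{s=1}^n\bigl(\alpha_{1(s+1)}\cdots\alpha_{m(s-1)}\alpha_{1s},\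 \alpha_{2s},\ \dots,\ \alpha_{ms}\bigr),$$ where the first entry is the product of all the entries of the columns $s+1,\dots,n,1,\dots,s-1$, in this order, and of $\alpha_{1s}$. **The map $g_n$.** $g_n:C_\bullet(\mathcal A)\to C_\bullet(\mathcal A^{\otimes n};t)_t$ sends $(\alpha_1,\dots,\alpha_m)$ to the class of $\sum_c(-1)^{\sigma_c}(\beta^c_{ij})$, where $c$ runs over the $c\in\{1,\dots,n\}^m$ with $c_1=1$, and where $(\beta^c_{ij})$ is the $m\times n$ matrix with $\beta^c_{ij}=\alpha_{\sigma_c(i)}$ if $j=c_i$ and $\beta^c_{ij}=\mathrm{id}$ otherwise. **The map $\Phi_n$.** Let $p\in\{1,\dots,m\}$, $q\in\{2,\dots,n\}$, $d\in\{1,\dots,p\}$, $r\in\{0,\dots,d-1\}$ (and $r=0$ if $q=n$), and $c\in\{1,\dots,n-q\}^r$. For an $m\times n$ matrix $\underline\alpha$ let $B_{p,q,d,r,c}(\underline\alpha)$ be the $(m+1)\times n$ matrix $(\beta_{ij})$ all of whose entries are $\mathrm{id}$, except for the following: 1. $\beta_{11}=\alpha_{(p+1)q}\cdots\alpha_{mn}\,\alpha_{11}$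 (the entries of the column $q$ below the row $p$, then all the entries of the columns $q+1,\dots,n$, then $\alpha_{11}$); 2. $\beta_{i\,c_{i-1}}=\alpha_{(\sigma_c(i-1)+1)\,1}$ for $2\le i\le r+1$; 3. $\beta_{i\,(n-q+1)}=\alpha_{i1}$ for $r+2\le i\le d$; 4. $\beta_{ij}=\alpha_{(i+p-d)(j-n+q-1)}$ for $d+1\le i\le m+d-p$ and $n-q+2\le j\le n$; 5. $\beta_{ij}=\alpha_{1(j-n+q)}\cdots\alpha_{d(j-n+q)}$ for $i=m+d-p+1$ and $n-q+2\le j\le n$; 6. $\beta_{ij}=\alpha_{(i-m+p-1)(j-n+q)}$ for $m+d-p+2\le i\le m+1$ and $n-q+1\le j\le n$. Let $\Phi'_n:C_{m-1}(\mathcal A^{\otimes n};t)\to C_m(\mathcal A^{\otimes n};t)$ be the map $$\Phi'_n(\underline\alpha)=\sum_{p,q,d,r,c}\ \sum_{\tau}\ \sum_{\upsilon}(-1)^{\sigma_c}(-1)^{\tau}(-1)^{\upsilon}(-1)^{m+(m+d)(p+d)}\ \tau\upsilon B_{p,q,d,r,c}(\underline\alpha),$$ where $\tau$ runs over $S_{\{2,\dots,r+1\},\{r+2,\dots,m+1\}}\subset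 S_{m+1}$ and $\upsilon$ over $S_{\{r+2,\dots,d\},\{d+1,\dots,m-p+d\}}\subset S_{m+1}$ ($\upsilon$ is applied first), and let $$\Phi_n=\frac1n\sum_{s=1}^n\Phi'_n\circ t^{s-1}.$$ **Theorem.** The differential of $C_\bullet(\mathcal A^{\otimes n};t)$ and the maps $f_n$ and $\Phi_n$ descend to the coinvariants $C_\bullet(\mathcal A^{\otimes n};t)_t$, and $\Phi_n$ is a homotopy from $\mathrm{id}$ to $g_nf_n$ there: $$d\,\Phi_n+\Phi_n\,d=g_nf_n-\mathrm{id}\qquad\text{as maps } C_\bullet(\mathcal A^{\otimes n};t)_t\to C_\bullet(\mathcal A^{\otimes n};t)_t .$$ -/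

import Mathlib

open scoped TensorProduct DirectSum

universe u v w

noncomputable section

namespace DG

/-- The sign `(-1) ^ p` for a parity `p`. -/
def ksgn (p : ZMod 2) : ℤ := if p = 0 then 1 else -1

theorem ksgn_add (p q : ZMod 2) : ksgn (p + q) = ksgn p * ksgn q := by
  revert p q; decide

theorem ksgn_zero : ksgn 0 = 1 := by decide

/-- A small DG category over `k`.  Here `Mor a b` is the complex of
morphisms `b ⟶ a`, and the product `α β` of `α : Mor a b` and `β : Mor b c` is in `Mor a c`.
A complex of vector spaces is given by its total space `Mor a b`, the internal direct sum of its
homogeneous components `deg a b i` (`i : ℤ`), and a differential of degree `1`. -/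
structure DGCategory (k : Type w) [Field k] where
  /-- objects -/
  Obj : Type u
  /-- the total space of the complex of morphisms `b ⟶ a` -/
  Mor : Obj → Obj → Type v
  [grp : ∀ a b, AddCommGroup (Mor a b)]
  [mod : ∀ a b, Module k (Mor a b)]
  /-- the homogeneous components -/
  deg : ∀ a b, ℤ → Submodule k (Mor a b)
  internal : ∀ a b, DirectSum.IsInternal (deg a b)
  /-- the differential -/
  d : ∀ {a b}, Mor a b →ₗ[k] Mor a b
  /-- the composition -/
  comp : ∀ {a b c}, Mor a b →ₗ[k] Mor b c →ₗ[k] Mor a c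
  /-- the identities -/
  one : ∀ a, Mor a a
  d_mem : ∀ {a b i} {α : Mor a b}, α ∈ deg a b i → d α ∈ deg a b (i + 1)
  d_d : ∀ {a b} (α : Mor a b), d (d α) = 0
  comp_mem : ∀ {a b c i j} {α : Mor a b} {β : Mor b c},
    α ∈ deg a b i → β ∈ deg b c j → comp α β ∈ deg a c (i + j)
  one_mem : ∀ a, one a ∈ deg a a 0
  assoc : ∀ {a b c e} (α : Mor a b) (β : Mor b c) (γ : Mor c e),
    comp (comp α β) γ = comp α (comp β γ)
  one_comp : ∀ {a b} (α : Mor a b), comp (one a) α = α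
  comp_one : ∀ {a b} (α : Mor a b), comp α (one b) = α
  leibniz : ∀ {a b c i} {α : Mor a b} (β : Mor b c), α ∈ deg a b i →
    d (comp α β) = comp (d α) β + (ksgn (i : ZMod 2) : k) • comp α (d β)

attribute [instance] DGCategory.grp DGCategory.mod

variable {k : Type w} [Field k]

namespace DGCategory

variable (A : DGCategory.{u, v} k)

/-- A complex of morphisms as the direct sum of its homogeneous components. -/
def decEquiv (a b : A.Obj) : A.Mor a b ≃ₗ[k] ⨁ i : ℤ, A.deg a b i :=
  (LinearEquiv.ofBijective (DirectSum.coeLinearMap (A.deg a b))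
    (show Function.Bijective _ from A.internal a b)).symm

theorem decEquiv_of_mem {a b : A.Obj} {i : ℤ} {α : A.Mor a b} (h : α ∈ A.deg a b i) :
    A.decEquiv a b α = DirectSum.lof k ℤ (fun i => A.deg a b i) i ⟨α, h⟩ := by
  rw [decEquiv, LinearEquiv.symm_apply_eq, LinearEquiv.ofBijective_apply,
    DirectSum.coeLinearMap_lof]

/-- The projection of `Mor a b` onto its even (`p = 0`) or odd (`p = 1`) part. -/
def par (p : ZMod 2) {a b : A.Obj} : A.Mor a b →ₗ[k] A.Mor a b :=
  DirectSum.toModule k ℤ (A.Mor a b)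
      (fun i => if (i : ZMod 2) = p then (A.deg a b i).subtype else 0) ∘ₗ
    (A.decEquiv a b).toLinearMap

/-- The operator `α ↦ (-1) ^ |α| α`. -/
def eps {a b : A.Obj} : A.Mor a b →ₗ[k] A.Mor a b := A.par 0 - A.par 1

variable {A}

theorem par_of_mem (p : ZMod 2) {a b : A.Obj} {i : ℤ} {α : A.Mor a b} (h : α ∈ A.deg a b i) :
    A.par p α = if (i : ZMod 2) = p then α else 0 := by
  simp only [par, LinearMap.comp_apply, LinearEquiv.coe_coe, A.decEquiv_of_mem h, DirectSum.toModule_lof]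
  split_ifs <;> simp

theorem eps_of_mem {a b : A.Obj} {i : ℤ} {α : A.Mor a b} (h : α ∈ A.deg a b i) :
    A.eps α = (ksgn (i : ZMod 2) : k) • α := by
  rw [eps, LinearMap.sub_apply, par_of_mem _ h, par_of_mem _ h]
  obtain h0 | h0 : (i : ZMod 2) = 0 ∨ (i : ZMod 2) = 1 := by
    generalize (i : ZMod 2) = p
    revert p; decide
  · simp [h0, ksgn]
  · simp [h0, ksgn]

variable {ι : Type} [Fintype ι]

/-- A sum over all parities picks out the term of the actual parities of a homogeneous family. -/
theorem sum_par [DecidableEq ι] {N : Type*} [AddCommGroup N] [Module k N] {s t : ι → A.Obj}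
    (φ : MultilinearMap k (fun j => A.Mor (s j) (t j)) N) (c : (ι → ZMod 2) → ℤ)
    {a : ι → ℤ} {α : ∀ j, A.Mor (s j) (t j)} (h : ∀ j, α j ∈ A.deg (s j) (t j) (a j)) :
    ∑ e : ι → ZMod 2, (c e : k) • φ (fun j => A.par (e j) (α j)) =
      (c (fun j => (a j : ZMod 2)) : k) • φ α := by
  rw [Fintype.sum_eq_single (fun j => (a j : ZMod 2))]
  · congr 2
    funext j
    rw [par_of_mem _ (h j), if_pos rfl]
  · intro e he
    obtain ⟨j, hj⟩ := Function.ne_iff.1 he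
    rw [φ.map_coord_zero j, smul_zero]
    rw [par_of_mem _ (h j), if_neg (fun h => hj h.symm)]

/-- Homogeneous elements of `Mor a b`. -/
def Homog (A : DGCategory.{u, v} k) (a b : A.Obj) : Type (max v) :=
  Σ i : ℤ, A.deg a b i

theorem span_homog (a b : A.Obj) :
    Submodule.span k (Set.range (fun x : Homog A a b => (x.2 : A.Mor a b))) = ⊤ := by
  rw [eq_top_iff, ← (A.internal a b).submodule_iSup_eq_top, iSup_le_iff]
  intro i x hx
  exact Submodule.subset_span ⟨⟨i, x, hx⟩, rfl⟩

/-- Linear maps on a tensor product of morphism spaces agree if they agree on tensors of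
homogeneous elements. -/
theorem tensor_ext {N : Type*} [AddCommGroup N] [Module k N] {s t : ι → A.Obj}
    {φ ψ : (⨂[k] j, A.Mor (s j) (t j)) →ₗ[k] N}
    (h : ∀ (a : ι → ℤ) (α : ∀ j, A.Mor (s j) (t j)),
      (∀ j, α j ∈ A.deg (s j) (t j) (a j)) →
        φ (PiTensorProduct.tprod k α) = ψ (PiTensorProduct.tprod k α)) : φ = ψ :=
  PiTensorProduct.ext_of_span_eq_top
    (g := fun j (x : Homog A (s j) (t j)) => (x.2 : A.Mor (s j) (t j)))
    (fun _ => span_homog _ _)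
    (fun x => h (fun j => (x j).1) _ (fun j => (x j).2.2))

/-! ### Tensor products of morphism complexes -/

variable (A) in
/-- The component of degree `i` of a tensor product of morphism complexes. -/
def tensorDeg (s t : ι → A.Obj) (i : ℤ) : Submodule k (⨂[k] j, A.Mor (s j) (t j)) :=
  Submodule.span k {x | ∃ (a : ι → ℤ) (α : ∀ j, A.Mor (s j) (t j)),
    (∀ j, α j ∈ A.deg (s j) (t j) (a j)) ∧ ∑ j, a j = i ∧ x = PiTensorProduct.tprod k α}

theorem tprod_mem_tensorDeg {s t : ι → A.Obj} {a : ι → ℤ} {α : ∀ j, A.Mor (s j) (t j)}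
    (h : ∀ j, α j ∈ A.deg (s j) (t j) (a j)) {i : ℤ} (hi : ∑ j, a j = i) :
    PiTensorProduct.tprod k α ∈ A.tensorDeg s t i :=
  Submodule.subset_span ⟨a, α, h, hi, rfl⟩

theorem tensorDeg_internal (s t : ι → A.Obj) : DirectSum.IsInternal (A.tensorDeg s t) := by
  classical
  have hincl : ∀ (e : ι → ℤ) (x : ⨂[k] j, A.deg (s j) (t j) (e j)),
      PiTensorProduct.map (fun j => (A.deg (s j) (t j) (e j)).subtype) x
        ∈ A.tensorDeg s t (∑ j, e j) := by
    intro e x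
    induction x using PiTensorProduct.induction_on with
    | smul_tprod r f =>
      rw [map_smul, PiTensorProduct.map_tprod]
      exact Submodule.smul_mem _ _ (tprod_mem_tensorDeg (fun j => (f j).2) rfl)
    | add x y hx hy => rw [map_add]; exact Submodule.add_mem _ hx hy
  let inv : (⨂[k] j, A.Mor (s j) (t j)) →ₗ[k] ⨁ i : ℤ, A.tensorDeg s t i :=
    DirectSum.toModule k (ι → ℤ) _ (fun e =>
      DirectSum.lof k ℤ (fun i => A.tensorDeg s t i) (∑ j, e j) ∘ₗ
        LinearMap.codRestrict _ (PiTensorProduct.map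
          (fun j => (A.deg (s j) (t j) (e j)).subtype)) (hincl e)) ∘ₗ
    PiTensorProduct.ofDirectSumEquiv.toLinearMap ∘ₗ
    PiTensorProduct.map (fun j => (A.decEquiv (s j) (t j)).toLinearMap)
  have hinv : ∀ (a : ι → ℤ) (α : ∀ j, A.Mor (s j) (t j))
      (h : ∀ j, α j ∈ A.deg (s j) (t j) (a j)),
      inv (PiTensorProduct.tprod k α) =
        DirectSum.lof k ℤ (fun i => A.tensorDeg s t i) (∑ j, a j)
          ⟨PiTensorProduct.tprod k α, tprod_mem_tensorDeg h rfl⟩ := by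
    intro a α h
    simp only [inv, LinearMap.comp_apply, PiTensorProduct.map_tprod, LinearEquiv.coe_coe]
    have : (fun j => A.decEquiv (s j) (t j) (α j)) =
        fun j => DirectSum.lof k ℤ (fun i => A.deg (s j) (t j) i) (a j) ⟨α j, h j⟩ :=
      funext fun j => A.decEquiv_of_mem (h j)
    rw [this, PiTensorProduct.ofDirectSumEquiv_tprod_lof, DirectSum.toModule_lof]
    simp only [LinearMap.comp_apply]
    congr 1
    apply Subtype.ext
    simp [PiTensorProduct.map_tprod]
  have h1 : DirectSum.coeLinearMap (A.tensorDeg s t) ∘ₗ inv = LinearMap.id := by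
    apply tensor_ext
    intro a α h
    rw [LinearMap.comp_apply, hinv a α h]
    simp
  have h2 : inv ∘ₗ DirectSum.coeLinearMap (A.tensorDeg s t) = LinearMap.id := by
    apply DirectSum.linearMap_ext
    intro i
    ext ⟨x, hx⟩ : 1
    simp only [LinearMap.comp_apply, DirectSum.coeLinearMap_lof, LinearMap.id_apply]
    induction hx using Submodule.span_induction with
    | mem x hx =>
      obtain ⟨a, α, h, rfl, rfl⟩ := hx
      exact hinv a α h
    | zero => rw [map_zero]; exact (map_zero _).symm
    | add x y hx hy ihx ihy =>
      rw [map_add, ihx, ihy, ← map_add]; rfl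
    | smul c x hx ih => rw [map_smul, ih, ← map_smul]; rfl
  exact ⟨Function.LeftInverse.injective (g := inv) (fun x => LinearMap.congr_fun h2 x),
    Function.RightInverse.surjective (g := inv) (fun x => LinearMap.congr_fun h1 x)⟩

variable (A) in
/-- The differential of a tensor product of morphism complexes (Leibniz rule with Koszul signs):
`α₁ ⊗ ⋯ ⊗ αₙ ↦ ∑ⱼ (-1) ^ (|α₁| + ⋯ + |αⱼ₋₁|) α₁ ⊗ ⋯ ⊗ d αⱼ ⊗ ⋯ ⊗ αₙ`. -/
def tensorD [LinearOrder ι] (s t : ι → A.Obj) :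
    (⨂[k] j, A.Mor (s j) (t j)) →ₗ[k] ⨂[k] j, A.Mor (s j) (t j) :=
  ∑ j, PiTensorProduct.map (fun i => if i < j then A.eps else if i = j then A.d else LinearMap.id)

/-- The Koszul sign of `(α₁ ⊗ ⋯ ⊗ αₙ) (β₁ ⊗ ⋯ ⊗ βₙ) = ± α₁ β₁ ⊗ ⋯ ⊗ αₙ βₙ`, where `e` and `e'` are
the parities of the `αᵢ` and of the `βⱼ`: each `αᵢ` passes the `βⱼ` with `j < i`. -/
def compSign [LinearOrder ι] (e e' : ι → ZMod 2) : ℤ :=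
  ksgn (∑ i, ∑ j, if j < i then e i * e' j else 0)

variable (A) in
/-- The composition `(α₁ ⊗ ⋯ ⊗ αₙ) (β₁ ⊗ ⋯ ⊗ βₙ) = ± α₁ β₁ ⊗ ⋯ ⊗ αₙ βₙ`. -/
def tensorComp [LinearOrder ι] (s t r : ι → A.Obj) :
    (⨂[k] j, A.Mor (s j) (t j)) →ₗ[k] (⨂[k] j, A.Mor (t j) (r j)) →ₗ[k]
      ⨂[k] j, A.Mor (s j) (r j) :=
  ∑ e : ι → ZMod 2, ∑ e' : ι → ZMod 2, (compSign e e' : k) •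
    PiTensorProduct.map₂ (fun j => A.comp.compl₁₂ (A.par (e j)) (A.par (e' j)))

theorem tensorComp_tprod [LinearOrder ι] {s t r : ι → A.Obj} {a b : ι → ℤ}
    {α : ∀ j, A.Mor (s j) (t j)} {β : ∀ j, A.Mor (t j) (r j)}
    (hα : ∀ j, α j ∈ A.deg (s j) (t j) (a j)) (hβ : ∀ j, β j ∈ A.deg (t j) (r j) (b j)) :
    A.tensorComp s t r (PiTensorProduct.tprod k α) (PiTensorProduct.tprod k β) =
      (compSign (fun j => (a j : ZMod 2)) (fun j => (b j : ZMod 2)) : k) •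
        PiTensorProduct.tprod k (fun j => A.comp (α j) (β j)) := by
  have h0 : A.tensorComp s t r (PiTensorProduct.tprod k α) (PiTensorProduct.tprod k β) =
      ∑ e : ι → ZMod 2, ∑ e' : ι → ZMod 2, (compSign e e' : k) •
        PiTensorProduct.tprod k (fun j => A.comp (A.par (e j) (α j)) (A.par (e' j) (β j))) := by
    rw [tensorComp, LinearMap.sum_apply, LinearMap.sum_apply]
    refine Finset.sum_congr rfl fun e _ => ?_
    rw [LinearMap.sum_apply, LinearMap.sum_apply]
    refine Finset.sum_congr rfl fun e' _ => ?_
    rw [LinearMap.smul_apply, LinearMap.smul_apply, PiTensorProduct.map₂_tprod_tprod]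
    rfl
  rw [h0]
  have h1 : ∀ e : ι → ZMod 2, ∑ e' : ι → ZMod 2, (compSign e e' : k) •
      PiTensorProduct.tprod k (fun j => A.comp (A.par (e j) (α j)) (A.par (e' j) (β j))) =
      (compSign e (fun j => (b j : ZMod 2)) : k) •
        PiTensorProduct.tprod k (fun j => A.comp (A.par (e j) (α j)) (β j)) := fun e =>
    sum_par ((PiTensorProduct.tprod k).compLinearMap (fun j => A.comp (A.par (e j) (α j))))
      (fun e' => compSign e e') hβ
  rw [Finset.sum_congr rfl (fun e _ => h1 e)]
  exact sum_par ((PiTensorProduct.tprod k).compLinearMap (fun j => A.comp.flip (β j)))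
      (fun e => compSign e (fun j => (b j : ZMod 2))) hα

theorem tensorD_tprod [LinearOrder ι] {s t : ι → A.Obj} {a : ι → ℤ}
    {α : ∀ j, A.Mor (s j) (t j)} (hα : ∀ j, α j ∈ A.deg (s j) (t j) (a j)) :
    A.tensorD s t (PiTensorProduct.tprod k α) =
      ∑ j, (ksgn (∑ i, if i < j then (a i : ZMod 2) else 0) : k) •
        PiTensorProduct.tprod k (Function.update α j (A.d (α j))) := by
  rw [tensorD, LinearMap.sum_apply]
  refine Finset.sum_congr rfl fun j _ => ?_
  rw [PiTensorProduct.map_tprod]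
  have h1 : (fun i => (if i < j then A.eps else if i = j then A.d else LinearMap.id :
      A.Mor (s i) (t i) →ₗ[k] A.Mor (s i) (t i)) (α i)) =
      fun i => ((if i < j then ksgn (a i : ZMod 2) else 1 : ℤ) : k) •
        (Function.update α j (A.d (α j)) i) := by
    funext i
    rcases lt_trichotomy i j with h | rfl | h
    · rw [if_pos h, if_pos h, eps_of_mem (hα i), Function.update_of_ne h.ne]
    · simp
    · rw [if_neg h.not_gt, if_neg h.ne', if_neg h.not_gt, Function.update_of_ne h.ne']; simp
  rw [h1, MultilinearMap.map_smul_univ, ← Int.cast_prod]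
  congr 2
  have : ∀ S : Finset ι, ∏ i ∈ S, (if i < j then ksgn (a i : ZMod 2) else 1) =
      ksgn (∑ i ∈ S, if i < j then (a i : ZMod 2) else 0) := by
    intro S
    induction S using Finset.induction_on with
    | empty => simp [ksgn_zero]
    | insert x S hx ih =>
      rw [Finset.prod_insert hx, Finset.sum_insert hx, ksgn_add, ih]
      split_ifs <;> simp [ksgn_zero]
  exact this Finset.univ


/-! ### Signs -/

theorem sum_split [LinearOrder ι] (a : ι → ZMod 2) (j : ι) :
    ∑ i, a i = (∑ i, if i < j then a i else 0) + a j + ∑ i, if j < i then a i else 0 := by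
  have : a j = ∑ i, if i = j then a i else 0 := by simp
  rw [this, ← Finset.sum_add_distrib, ← Finset.sum_add_distrib]
  refine Finset.sum_congr rfl fun i _ => ?_
  rcases lt_trichotomy i j with h | rfl | h
  · simp [h, h.ne, h.not_gt]
  · simp
  · simp [h, h.ne', h.not_gt]

theorem sum_lt_add [LinearOrder ι] (a b : ι → ZMod 2) (j : ι) :
    (∑ i, if i < j then (a + b) i else 0) =
      (∑ i, if i < j then a i else 0) + ∑ i, if i < j then b i else 0 := by
  rw [← Finset.sum_add_distrib]
  refine Finset.sum_congr rfl fun i _ => ?_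
  split_ifs <;> simp

theorem sum_lt_single [LinearOrder ι] (l j : ι) :
    (∑ i, if i < j then (Pi.single l 1 : ι → ZMod 2) i else 0) = if l < j then 1 else 0 := by
  rw [Finset.sum_eq_single l]
  · simp
  · intro b _ hb; simp [hb]
  · simp

theorem compSign_add_left [LinearOrder ι] (a a' b : ι → ZMod 2) :
    compSign (a + a') b = compSign a b * compSign a' b := by
  rw [compSign, compSign, compSign, ← ksgn_add, ← Finset.sum_add_distrib]
  congr 1
  refine Finset.sum_congr rfl fun i _ => ?_
  rw [← Finset.sum_add_distrib]
  refine Finset.sum_congr rfl fun j _ => ?_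
  split_ifs <;> simp [add_mul]

theorem compSign_add_right [LinearOrder ι] (a b b' : ι → ZMod 2) :
    compSign a (b + b') = compSign a b * compSign a b' := by
  rw [compSign, compSign, compSign, ← ksgn_add, ← Finset.sum_add_distrib]
  congr 1
  refine Finset.sum_congr rfl fun i _ => ?_
  rw [← Finset.sum_add_distrib]
  refine Finset.sum_congr rfl fun j _ => ?_
  split_ifs <;> simp [mul_add]

theorem compSign_single_left [LinearOrder ι] (l : ι) (b : ι → ZMod 2) :
    compSign (Pi.single l 1) b = ksgn (∑ i, if i < l then b i else 0) := by
  rw [compSign, Finset.sum_eq_single l]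
  · simp
  · intro i _ hi; simp [hi]
  · simp

theorem compSign_single_right [LinearOrder ι] (l : ι) (a : ι → ZMod 2) :
    compSign a (Pi.single l 1) = ksgn (∑ i, if l < i then a i else 0) := by
  rw [compSign]
  congr 1
  refine Finset.sum_congr rfl fun i _ => ?_
  rw [Finset.sum_eq_single l]
  · simp
  · intro j _ hj; simp [hj]
  · simp

theorem compSign_zero_left [LinearOrder ι] (b : ι → ZMod 2) : compSign 0 b = 1 := by
  simp [compSign, ksgn_zero]

theorem compSign_zero_right [LinearOrder ι] (a : ι → ZMod 2) : compSign a 0 = 1 := by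
  simp [compSign, ksgn_zero]

theorem ksgn_mul_self (p : ZMod 2) : ksgn p * ksgn p = 1 := by
  revert p; decide

theorem update_mem [DecidableEq ι] {s t : ι → A.Obj} {a : ι → ℤ} {α : ∀ j, A.Mor (s j) (t j)}
    (hα : ∀ j, α j ∈ A.deg (s j) (t j) (a j)) (l j : ι) :
    Function.update α l (A.d (α l)) j ∈
      A.deg (s j) (t j) ((a + Pi.single l 1 : ι → ℤ) j) := by
  by_cases h : j = l
  · subst h; simpa using A.d_mem (hα j)
  · simpa [h] using hα j

theorem cast_add_single [DecidableEq ι] (a : ι → ℤ) (l : ι) :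
    (fun j => (((a + Pi.single l 1 : ι → ℤ) j : ℤ) : ZMod 2)) =
      (fun j => (a j : ZMod 2)) + Pi.single l 1 := by
  funext j
  by_cases h : j = l
  · subst h; simp
  · simp [h]

variable (A) in
/-- The tensor power `A ^ ⊗ n`: objects are `n`-tuples of objects, morphism complexes are tensor
products of morphism complexes, the composition obeys the Koszul sign rule. -/
@[reducible] def tensorPower (n : ℕ) : DGCategory.{u, max v w} k where
  Obj := Fin n → A.Obj
  Mor s t := ⨂[k] j, A.Mor (s j) (t j)
  deg s t := A.tensorDeg s t
  internal s t := tensorDeg_internal s t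
  d {s t} := A.tensorD s t
  comp {s t r} := A.tensorComp s t r
  one s := PiTensorProduct.tprod k (fun j => A.one (s j))
  d_mem := by
    intro s t i x hx
    induction hx using Submodule.span_induction with
    | mem x hx =>
      obtain ⟨a, α, h, rfl, rfl⟩ := hx
      rw [tensorD_tprod h]
      refine Submodule.sum_mem _ fun j _ => Submodule.smul_mem _ _ ?_
      exact tprod_mem_tensorDeg (update_mem h j) (by simp [Finset.sum_add_distrib])
    | zero => rw [map_zero]; exact Submodule.zero_mem _
    | add x y _ _ ihx ihy => rw [map_add]; exact Submodule.add_mem _ ihx ihy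
    | smul c x _ ih => rw [map_smul]; exact Submodule.smul_mem _ _ ih
  d_d := by
    intro s t x
    have : A.tensorD s t ∘ₗ A.tensorD s t = 0 := by
      apply tensor_ext
      intro a α h
      rw [LinearMap.comp_apply, LinearMap.zero_apply, tensorD_tprod h, map_sum]
      have h1 : ∀ j, A.tensorD s t ((ksgn (∑ i, if i < j then (a i : ZMod 2) else 0) : k) •
          PiTensorProduct.tprod k (Function.update α j (A.d (α j)))) =
          ∑ l, ((ksgn ((∑ i, if i < j then (a i : ZMod 2) else 0) +
              (∑ i, if i < l then (a i : ZMod 2) else 0) + if j < l then 1 else 0) : ℤ) : k) •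
            PiTensorProduct.tprod k (Function.update (Function.update α j (A.d (α j))) l
              (A.d (Function.update α j (A.d (α j)) l))) := by
        intro j
        rw [map_smul, tensorD_tprod (update_mem h j), Finset.smul_sum]
        refine Finset.sum_congr rfl fun l _ => ?_
        have h2 : ∀ i, (((a + Pi.single j 1 : Fin n → ℤ) i : ℤ) : ZMod 2) =
            ((fun i => (a i : ZMod 2)) + Pi.single j 1 : Fin n → ZMod 2) i :=
          congrFun (cast_add_single a j)
        simp only [h2]
        rw [sum_lt_add, sum_lt_single, smul_smul, ← Int.cast_mul, ← ksgn_add, add_assoc]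
      rw [Finset.sum_congr rfl (fun j _ => h1 j), ← Finset.sum_product']
      refine Finset.sum_involution (fun p _ => (p.2, p.1)) ?_ ?_ ?_ ?_
      · rintro ⟨j, l⟩ _
        by_cases hjl : j = l
        · subst hjl
          have : PiTensorProduct.tprod k (Function.update (Function.update α j (A.d (α j))) j
              (A.d (Function.update α j (A.d (α j)) j))) = 0 := by
            apply MultilinearMap.map_coord_zero _ j
            rw [Function.update_self, Function.update_self, A.d_d]
          simp only [this, smul_zero, add_zero]
        · simp only [Function.update_of_ne hjl, Function.update_of_ne (Ne.symm hjl)]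
          rw [Function.update_comm hjl, ← add_smul, ← Int.cast_add]
          have : ksgn ((∑ i, if i < j then (a i : ZMod 2) else 0) +
              (∑ i, if i < l then (a i : ZMod 2) else 0) + if j < l then 1 else 0) +
              ksgn ((∑ i, if i < l then (a i : ZMod 2) else 0) +
              (∑ i, if i < j then (a i : ZMod 2) else 0) + if l < j then 1 else 0) = 0 := by
            generalize (∑ i, if i < j then (a i : ZMod 2) else 0) = x
            generalize (∑ i, if i < l then (a i : ZMod 2) else 0) = y
            rcases lt_or_gt_of_ne hjl with h' | h'
            · rw [if_pos h', if_neg h'.not_gt]; revert x y; decide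
            · rw [if_neg h'.not_gt, if_pos h']; revert x y; decide
          rw [this, Int.cast_zero, zero_smul]
      · rintro ⟨j, l⟩ _ hne heq
        apply hne
        have hjl : l = j := congrArg Prod.fst heq
        subst hjl
        have : PiTensorProduct.tprod k (Function.update (Function.update α l (A.d (α l))) l
              (A.d (Function.update α l (A.d (α l)) l))) = 0 := by
            apply MultilinearMap.map_coord_zero _ l
            rw [Function.update_self, Function.update_self, A.d_d]
        simp only [this, smul_zero]
      · intro p _; exact Finset.mem_univ _
      · intro p _; rfl
    exact LinearMap.congr_fun this x
  comp_mem := by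
    intro s t r i j x y hx hy
    induction hx using Submodule.span_induction with
    | mem x hx =>
      obtain ⟨a, α, ha, rfl, rfl⟩ := hx
      induction hy using Submodule.span_induction with
      | mem y hy =>
        obtain ⟨b, β, hb, rfl, rfl⟩ := hy
        rw [tensorComp_tprod ha hb]
        refine Submodule.smul_mem _ _ ?_
        exact tprod_mem_tensorDeg (fun l => A.comp_mem (ha l) (hb l)) Finset.sum_add_distrib
      | zero => rw [map_zero]; exact Submodule.zero_mem _
      | add x y _ _ ihx ihy => rw [map_add]; exact Submodule.add_mem _ ihx ihy
      | smul c x _ ih => rw [map_smul]; exact Submodule.smul_mem _ _ ih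
    | zero => rw [map_zero, LinearMap.zero_apply]; exact Submodule.zero_mem _
    | add x y _ _ ihx ihy => rw [map_add, LinearMap.add_apply]; exact Submodule.add_mem _ ihx ihy
    | smul c x _ ih => rw [map_smul, LinearMap.smul_apply]; exact Submodule.smul_mem _ _ ih
  one_mem s := tprod_mem_tensorDeg (fun j => A.one_mem (s j)) (by simp)
  assoc := by
    intro s t r q x y z
    have h1 : ∀ (a b c : Fin n → ℤ) (α : ∀ j, A.Mor (s j) (t j)) (β : ∀ j, A.Mor (t j) (r j))
        (γ : ∀ j, A.Mor (r j) (q j)), (∀ j, α j ∈ A.deg _ _ (a j)) →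
        (∀ j, β j ∈ A.deg _ _ (b j)) → (∀ j, γ j ∈ A.deg _ _ (c j)) →
        A.tensorComp s r q (A.tensorComp s t r (PiTensorProduct.tprod k α)
          (PiTensorProduct.tprod k β)) (PiTensorProduct.tprod k γ) =
        A.tensorComp s t q (PiTensorProduct.tprod k α) (A.tensorComp t r q
          (PiTensorProduct.tprod k β) (PiTensorProduct.tprod k γ)) := by
      intro a b c α β γ hα hβ hγ
      rw [tensorComp_tprod hα hβ, tensorComp_tprod hβ hγ, map_smul, map_smul,
        LinearMap.smul_apply, tensorComp_tprod (fun j => A.comp_mem (hα j) (hβ j)) hγ,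
        tensorComp_tprod hα (fun j => A.comp_mem (hβ j) (hγ j)), smul_smul, smul_smul]
      simp only [A.assoc]
      congr 1
      have e1 : (fun j => ((a j + b j : ℤ) : ZMod 2)) =
          (fun j => (a j : ZMod 2)) + fun j => (b j : ZMod 2) := by funext; simp
      have e2 : (fun j => ((b j + c j : ℤ) : ZMod 2)) =
          (fun j => (b j : ZMod 2)) + fun j => (c j : ZMod 2) := by funext; simp
      rw [e1, e2, compSign_add_left, compSign_add_right, ← Int.cast_mul, ← Int.cast_mul]
      congr 1
      ring
    have h2 : ∀ (a b : Fin n → ℤ) (α : ∀ j, A.Mor (s j) (t j)) (β : ∀ j, A.Mor (t j) (r j)),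
        (∀ j, α j ∈ A.deg _ _ (a j)) → (∀ j, β j ∈ A.deg _ _ (b j)) →
        A.tensorComp s r q (A.tensorComp s t r (PiTensorProduct.tprod k α)
          (PiTensorProduct.tprod k β)) =
        A.tensorComp s t q (PiTensorProduct.tprod k α) ∘ₗ A.tensorComp t r q
          (PiTensorProduct.tprod k β) := fun a b α β hα hβ =>
      tensor_ext fun c γ hγ => h1 a b c α β γ hα hβ hγ
    have h3 : ∀ (a : Fin n → ℤ) (α : ∀ j, A.Mor (s j) (t j)), (∀ j, α j ∈ A.deg _ _ (a j)) →
        (A.tensorComp s r q).flip z ∘ₗ A.tensorComp s t r (PiTensorProduct.tprod k α) =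
        A.tensorComp s t q (PiTensorProduct.tprod k α) ∘ₗ (A.tensorComp t r q).flip z :=
      fun a α hα => tensor_ext fun b β hβ => LinearMap.congr_fun (h2 a b α β hα hβ) z
    have h4 : (A.tensorComp s r q).flip z ∘ₗ (A.tensorComp s t r).flip y =
        (A.tensorComp s t q).flip (A.tensorComp t r q y z) :=
      tensor_ext fun a α hα => LinearMap.congr_fun (h3 a α hα) y
    exact LinearMap.congr_fun h4 x
  one_comp := by
    intro s t x
    have : A.tensorComp s s t (PiTensorProduct.tprod k (fun j => A.one (s j))) =
        LinearMap.id := by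
      apply tensor_ext
      intro a α h
      rw [tensorComp_tprod (fun j => A.one_mem (s j)) h]
      simp only [A.one_comp, LinearMap.id_apply]
      have : (fun _ : Fin n => ((0 : ℤ) : ZMod 2)) = 0 := by funext; simp
      rw [this, compSign_zero_left, Int.cast_one, one_smul]
    exact LinearMap.congr_fun this x
  comp_one := by
    intro s t x
    have : (A.tensorComp s t t).flip (PiTensorProduct.tprod k (fun j => A.one (t j))) =
        LinearMap.id := by
      apply tensor_ext
      intro a α h
      rw [LinearMap.flip_apply, tensorComp_tprod h (fun j => A.one_mem (t j))]
      simp only [A.comp_one, LinearMap.id_apply]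
      have : (fun _ : Fin n => ((0 : ℤ) : ZMod 2)) = 0 := by funext; simp
      rw [this, compSign_zero_right, Int.cast_one, one_smul]
    exact LinearMap.congr_fun this x
  leibniz := by
    intro s t r i x y hx
    induction hx using Submodule.span_induction with
    | mem x hx =>
      obtain ⟨a, α, hα, rfl, rfl⟩ := hx
      have : A.tensorD s r ∘ₗ A.tensorComp s t r (PiTensorProduct.tprod k α) =
          A.tensorComp s t r (A.tensorD s t (PiTensorProduct.tprod k α)) +
          (ksgn ((∑ j, a j : ℤ) : ZMod 2) : k) •
            (A.tensorComp s t r (PiTensorProduct.tprod k α) ∘ₗ A.tensorD t r) := by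
        apply tensor_ext
        intro b β hβ
        rw [LinearMap.add_apply, LinearMap.smul_apply, LinearMap.comp_apply, LinearMap.comp_apply,
          tensorComp_tprod hα hβ, map_smul, tensorD_tprod (fun j => A.comp_mem (hα j) (hβ j)),
          tensorD_tprod hα, tensorD_tprod hβ, map_sum, map_sum, LinearMap.sum_apply,
          Finset.smul_sum, Finset.smul_sum, ← Finset.sum_add_distrib]
        refine Finset.sum_congr rfl fun j _ => ?_
        rw [map_smul, map_smul, LinearMap.smul_apply, tensorComp_tprod (update_mem hα j) hβ,
          tensorComp_tprod hα (update_mem hβ j), A.leibniz _ (hα j),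
          MultilinearMap.map_update_add, MultilinearMap.map_update_smul]
        have u1 : (fun l => A.comp (Function.update α j (A.d (α j)) l) (β l)) =
            Function.update (fun l => A.comp (α l) (β l)) j (A.comp (A.d (α j)) (β j)) := by
          funext l
          by_cases h : l = j
          · subst h; simp
          · simp [h]
        have u2 : (fun l => A.comp (α l) (Function.update β j (A.d (β j)) l)) =
            Function.update (fun l => A.comp (α l) (β l)) j (A.comp (α j) (A.d (β j))) := by
          funext l
          by_cases h : l = j
          · subst h; simp
          · simp [h]
        rw [u1, u2, cast_add_single, cast_add_single, smul_add, smul_add, smul_smul, smul_smul,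
          smul_smul, smul_smul, smul_smul, compSign_add_left, compSign_add_right,
          compSign_single_left, compSign_single_right]
        have e1 : (fun i => if i < j then ((a i + b i : ℤ) : ZMod 2) else 0) =
          fun i => if i < j then ((fun i => (a i : ZMod 2)) + fun i => (b i : ZMod 2)) i else 0 := by
          funext i; simp
        have e2 : ((∑ j, a j : ℤ) : ZMod 2) = ∑ j, (a j : ZMod 2) := by simp
        rw [e1, e2, sum_lt_add, sum_split (fun i => (a i : ZMod 2)) j]
        generalize (∑ i, if i < j then (a i : ZMod 2) else 0) = S
        generalize (∑ i, if i < j then (b i : ZMod 2) else 0) = S'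
        generalize (∑ i, if j < i then (a i : ZMod 2) else 0) = G
        generalize compSign (fun j => (a j : ZMod 2)) (fun j => (b j : ZMod 2)) = χ
        generalize (a j : ZMod 2) = p
        simp only [smul_smul, ← Int.cast_mul]
        have k1 : χ * ksgn (S + S') = ksgn S * (χ * ksgn S') := by rw [ksgn_add]; ring
        have k2 : χ * ksgn (S + S') * ksgn p = ksgn (S + p + G) * (ksgn S' * (χ * ksgn G)) := by
          rw [ksgn_add, ksgn_add, ksgn_add]
          linear_combination (-χ * ksgn S * ksgn S' * ksgn p) * ksgn_mul_self G
        congr 3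
        linear_combination k2
      exact LinearMap.congr_fun this y
    | zero => simp only [map_zero, LinearMap.zero_apply, smul_zero, add_zero]
    | add x x' _ _ ihx ihy =>
      simp only [map_add, LinearMap.add_apply, smul_add, ihx, ihy]; abel
    | smul c x _ ih =>
      simp only [map_smul, LinearMap.smul_apply, ih, smul_add, smul_comm c]

end DGCategory

/-! ### DG functors -/

/-- A DG functor. -/
structure DGFunctor (A B : DGCategory.{u, v} k) where
  /-- the action on objects -/
  obj : A.Obj → B.Obj
  /-- the action on morphisms -/
  map : ∀ {a b}, A.Mor a b →ₗ[k] B.Mor (obj a) (obj b)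
  map_mem : ∀ {a b i} {α : A.Mor a b}, α ∈ A.deg a b i → map α ∈ B.deg (obj a) (obj b) i
  map_d : ∀ {a b} (α : A.Mor a b), map (A.d α) = B.d (map α)
  map_one : ∀ a, map (A.one a) = B.one (obj a)
  map_comp : ∀ {a b c} (α : A.Mor a b) (β : A.Mor b c),
    map (A.comp α β) = B.comp (map α) (map β)

/-- The identity functor. -/
def DGFunctor.id (A : DGCategory.{u, v} k) : DGFunctor A A where
  obj a := a
  map := LinearMap.id
  map_mem h := h
  map_d _ := rfl
  map_one _ := rfl
  map_comp _ _ := rfl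

/-- The Koszul sign of the permutation of tensor factors `α₁ ⊗ ⋯ ⊗ αₙ ↦ ± ⋯` which moves the
`i`-th factor to the position `σ i`, where `e` are the parities of the factors. -/
def permSign {n : ℕ} (σ : Equiv.Perm (Fin n)) (e : Fin n → ZMod 2) : ℤ :=
  ksgn (∑ i, ∑ j, if i < j ∧ σ j < σ i then e i * e j else 0)

namespace DGCategory

variable (A : DGCategory.{u, v} k) {n : ℕ} (σ : Equiv.Perm (Fin n))

/-- The permutation of the factors of a tensor product of morphism complexes; the `i`-th
factor is moved to the position `σ i`. -/
def tensorPerm (s t : Fin n → A.Obj) : (⨂[k] j, A.Mor (s j) (t j)) →ₗ[k]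
    ⨂[k] j, A.Mor (s (σ.symm j)) (t (σ.symm j)) :=
  ∑ e : Fin n → ZMod 2, (permSign σ e : k) •
    ((PiTensorProduct.reindex k (fun j => A.Mor (s j) (t j)) σ).toLinearMap ∘ₗ
      PiTensorProduct.map (fun j => A.par (e j)))

variable {A}

theorem tensorPerm_tprod {s t : Fin n → A.Obj} {a : Fin n → ℤ}
    {α : ∀ j, A.Mor (s j) (t j)} (hα : ∀ j, α j ∈ A.deg (s j) (t j) (a j)) :
    A.tensorPerm σ s t (PiTensorProduct.tprod k α) =
      (permSign σ (fun j => (a j : ZMod 2)) : k) •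
        PiTensorProduct.tprod k (fun j => α (σ.symm j)) := by
  have h0 : A.tensorPerm σ s t (PiTensorProduct.tprod k α) =
      ∑ e : Fin n → ZMod 2, (permSign σ e : k) •
        PiTensorProduct.reindex k (fun j => A.Mor (s j) (t j)) σ
          (PiTensorProduct.tprod k (fun j => A.par (e j) (α j))) := by
    rw [tensorPerm, LinearMap.sum_apply]
    refine Finset.sum_congr rfl fun e _ => ?_
    rw [LinearMap.smul_apply, LinearMap.comp_apply, PiTensorProduct.map_tprod]
    rfl
  rw [h0]
  have := sum_par ((PiTensorProduct.reindex k (fun j => A.Mor (s j) (t j)) σ).toLinearMap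
    |>.compMultilinearMap (PiTensorProduct.tprod k)) (fun e => permSign σ e) hα
  refine this.trans ?_
  congr 1
  exact PiTensorProduct.reindex_tprod _ _

theorem permSign_add (a b : Fin n → ZMod 2) :
    permSign σ (a + b) * compSign a b =
      permSign σ a * permSign σ b *
        compSign (fun j => a (σ.symm j)) (fun j => b (σ.symm j)) := by
  have h1 : compSign (fun j => a (σ.symm j)) (fun j => b (σ.symm j)) =
      ksgn (∑ i, ∑ j, if σ j < σ i then a i * b j else 0) := by
    rw [compSign]
    congr 1
    rw [← Equiv.sum_comp σ]
    refine Finset.sum_congr rfl fun i _ => ?_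
    rw [← Equiv.sum_comp σ]
    simp
  rw [h1]
  simp only [permSign, compSign, ← ksgn_add]
  congr 1
  have h2 : ∑ i, ∑ j, (if i < j ∧ σ j < σ i then b i * a j else 0) =
      ∑ i, ∑ j, (if j < i ∧ σ i < σ j then a i * b j else 0) := by
    rw [Finset.sum_comm]
    refine Finset.sum_congr rfl fun i _ => Finset.sum_congr rfl fun j _ => ?_
    rw [mul_comm]
  have h3 : ∑ i, ∑ j, (if i < j ∧ σ j < σ i then (a + b) i * (a + b) j else 0) =
      (∑ i, ∑ j, if i < j ∧ σ j < σ i then a i * a j else 0) +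
      (∑ i, ∑ j, if i < j ∧ σ j < σ i then b i * b j else 0) +
      (∑ i, ∑ j, if i < j ∧ σ j < σ i then a i * b j else 0) +
      ∑ i, ∑ j, if j < i ∧ σ i < σ j then a i * b j else 0 := by
    rw [← h2]
    simp only [← Finset.sum_add_distrib]
    refine Finset.sum_congr rfl fun i _ => Finset.sum_congr rfl fun j _ => ?_
    split_ifs
    · simp only [Pi.add_apply]; ring
    · simp
  have h4 : (∑ i, ∑ j, if i < j ∧ σ j < σ i then a i * b j else 0) +
      (∑ i, ∑ j, if j < i ∧ σ i < σ j then a i * b j else 0) +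
      (∑ i, ∑ j, if j < i then a i * b j else 0) =
      ∑ i, ∑ j, if σ j < σ i then a i * b j else 0 := by
    simp only [← Finset.sum_add_distrib]
    refine Finset.sum_congr rfl fun i _ => Finset.sum_congr rfl fun j _ => ?_
    generalize a i * b j = x
    have hx : x + x = 0 := CharTwo.add_self_eq_zero x
    rcases lt_trichotomy i j with h | rfl | h
    · simp [h, h.not_gt]
    · simp
    · have hne : σ i ≠ σ j := fun h' => h.ne' (σ.injective h')
      rcases lt_or_gt_of_ne hne with h' | h'
      · simp [h, h.not_gt, h', h'.not_gt, hx]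
      · simp [h, h.not_gt, h', h'.not_gt]
  rw [h3, ← h4]
  ring

theorem permSign_single (a : Fin n → ZMod 2) (j : Fin n) :
    ksgn (∑ i, if i < j then a i else 0) * permSign σ (a + Pi.single j 1) =
      permSign σ a * ksgn (∑ i, if i < σ j then a (σ.symm i) else 0) := by
  have h0 := permSign_add σ a (Pi.single j 1)
  have h1 : permSign σ (Pi.single j 1) = 1 := by
    rw [permSign, ← ksgn_zero]
    congr 1
    refine Finset.sum_eq_zero fun i _ => Finset.sum_eq_zero fun l _ => ?_
    split_ifs with h
    · by_cases hi : i = j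
      · have : l ≠ j := fun hl => h.1.ne (hi.trans hl.symm)
        simp [this]
      · simp [hi]
    · rfl
  have h2 : (fun i => (Pi.single j 1 : Fin n → ZMod 2) (σ.symm i)) = Pi.single (σ j) 1 := by
    funext i
    by_cases h : i = σ j
    · subst h; simp
    · have : σ.symm i ≠ j := fun h' => h (by rw [← h']; simp)
      simp [h, this]
  rw [h1, h2, compSign_single_right, compSign_single_right, mul_one] at h0
  have s1 := sum_split a j
  have s2 := sum_split (fun i => a (σ.symm i)) (σ j)
  rw [Equiv.sum_comp σ.symm a, Equiv.symm_apply_apply] at s2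
  rw [s2] at s1
  revert h0 s1
  generalize (∑ i, if i < j then a i else 0) = x
  generalize (∑ i, if j < i then a i else 0) = y
  generalize (∑ i, if i < σ j then a (σ.symm i) else 0) = x'
  generalize (∑ i, if σ j < i then a (σ.symm i) else 0) = y'
  generalize a j = z
  intro h0 s1
  have s3 : x' + y' = x + y := by linear_combination s1
  have k1 : ksgn x' * ksgn y' = ksgn x * ksgn y := by rw [← ksgn_add, ← ksgn_add, s3]
  have e1 := ksgn_mul_self y
  have e2 := ksgn_mul_self y'
  linear_combination ksgn x * ksgn y * h0 - ksgn x * permSign σ (a + Pi.single j 1) * e1 -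
    permSign σ a * ksgn y' * k1 + permSign σ a * ksgn x' * e2

theorem tensorPerm_mem {s t : Fin n → A.Obj} {i : ℤ} {x : ⨂[k] j, A.Mor (s j) (t j)}
    (hx : x ∈ A.tensorDeg s t i) : A.tensorPerm σ s t x ∈
      A.tensorDeg (fun j => s (σ.symm j)) (fun j => t (σ.symm j)) i := by
  induction hx using Submodule.span_induction with
  | mem x hx =>
    obtain ⟨a, α, h, rfl, rfl⟩ := hx
    rw [tensorPerm_tprod σ h]
    refine Submodule.smul_mem _ _ ?_
    exact tprod_mem_tensorDeg (fun j => h (σ.symm j)) (Equiv.sum_comp σ.symm a)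
  | zero => rw [map_zero]; exact Submodule.zero_mem _
  | add x y _ _ ihx ihy => rw [map_add]; exact Submodule.add_mem _ ihx ihy
  | smul c x _ ih => rw [map_smul]; exact Submodule.smul_mem _ _ ih

theorem tensorPerm_d (s t : Fin n → A.Obj) : A.tensorPerm σ s t ∘ₗ A.tensorD s t =
    A.tensorD (fun j => s (σ.symm j)) (fun j => t (σ.symm j)) ∘ₗ A.tensorPerm σ s t := by
  apply tensor_ext
  intro a α h
  rw [LinearMap.comp_apply, LinearMap.comp_apply, tensorD_tprod h, tensorPerm_tprod σ h,
    map_smul, tensorD_tprod (fun j => h (σ.symm j)), map_sum, Finset.smul_sum]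
  refine Eq.trans (Finset.sum_congr rfl fun j _ => ?_) (Equiv.sum_comp σ _)
  rw [map_smul, tensorPerm_tprod σ (update_mem h j), cast_add_single, smul_smul, smul_smul,
    ← Int.cast_mul, ← Int.cast_mul, permSign_single σ (fun i => (a i : ZMod 2)) j]
  congr 2
  funext i
  by_cases hi : i = σ j
  · subst hi
    rw [Function.update_self]
    generalize hl : σ.symm (σ j) = l
    have : l = j := by rw [← hl]; simp
    subst this
    simp
  · have : σ.symm i ≠ j := fun h' => hi (by rw [← h']; simp)
    rw [Function.update_of_ne this, Function.update_of_ne hi]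

theorem tensorPerm_one (s : Fin n → A.Obj) :
    A.tensorPerm σ s s (PiTensorProduct.tprod k (fun j => A.one (s j))) =
      PiTensorProduct.tprod k (fun j => A.one (s (σ.symm j))) := by
  rw [tensorPerm_tprod σ (fun j => A.one_mem (s j))]
  have : permSign σ (fun _ : Fin n => ((0 : ℤ) : ZMod 2)) = 1 := by
    simp [permSign, ksgn_zero]
  rw [this, Int.cast_one, one_smul]

theorem tensorPerm_comp (s t r : Fin n → A.Obj) (x : ⨂[k] j, A.Mor (s j) (t j))
    (y : ⨂[k] j, A.Mor (t j) (r j)) :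
    A.tensorPerm σ s r (A.tensorComp s t r x y) =
      A.tensorComp (fun j => s (σ.symm j)) (fun j => t (σ.symm j)) (fun j => r (σ.symm j))
        (A.tensorPerm σ s t x) (A.tensorPerm σ t r y) := by
  have h1 : ∀ (a : Fin n → ℤ) (α : ∀ j, A.Mor (s j) (t j)), (∀ j, α j ∈ A.deg _ _ (a j)) →
      A.tensorPerm σ s r ∘ₗ A.tensorComp s t r (PiTensorProduct.tprod k α) =
      A.tensorComp (fun j => s (σ.symm j)) (fun j => t (σ.symm j)) (fun j => r (σ.symm j))
        (A.tensorPerm σ s t (PiTensorProduct.tprod k α)) ∘ₗ A.tensorPerm σ t r := by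
    intro a α hα
    apply tensor_ext
    intro b β hβ
    rw [LinearMap.comp_apply, LinearMap.comp_apply, tensorComp_tprod hα hβ,
      tensorPerm_tprod σ hα, tensorPerm_tprod σ hβ, map_smul, map_smul, map_smul,
      LinearMap.smul_apply,
      tensorPerm_tprod σ (fun j => A.comp_mem (hα j) (hβ j)),
      tensorComp_tprod (fun j => hα (σ.symm j)) (fun j => hβ (σ.symm j)),
      smul_smul, smul_smul, smul_smul]
    congr 1
    have e1 : (fun j => ((a j + b j : ℤ) : ZMod 2)) =
        (fun j => (a j : ZMod 2)) + fun j => (b j : ZMod 2) := by funext; simp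
    have := permSign_add σ (fun j => (a j : ZMod 2)) (fun j => (b j : ZMod 2))
    rw [e1]
    simp only [← Int.cast_mul]
    congr 1
    linear_combination this
  have h2 : A.tensorPerm σ s r ∘ₗ (A.tensorComp s t r).flip y =
      (A.tensorComp (fun j => s (σ.symm j)) (fun j => t (σ.symm j))
        (fun j => r (σ.symm j))).flip (A.tensorPerm σ t r y) ∘ₗ A.tensorPerm σ s t :=
    tensor_ext fun a α hα => LinearMap.congr_fun (h1 a α hα) y
  exact LinearMap.congr_fun h2 x

variable (A) in
/-- The action of `σ ∈ Sₙ` on `A ^ ⊗ n` by the permutation of factors. -/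
@[reducible] def permFunctor : DGFunctor (A.tensorPower n) (A.tensorPower n) where
  obj s j := s (σ.symm j)
  map {s t} := A.tensorPerm σ s t
  map_mem h := tensorPerm_mem σ h
  map_d {s t} x := LinearMap.congr_fun (tensorPerm_d σ s t) x
  map_one s := tensorPerm_one σ s
  map_comp {s t r} x y := tensorPerm_comp σ s t r x y

end DGCategory

/-! ### Tables

All the maps below are given on basic tensors by tables: each entry of the result is a product of
entries of the argument, or an identity if it is an empty product. -/

/-- A table with rows and columns indexed by `Q`, the entries of which are words (products) in
letters from `P`, such that every letter occurs exactly once in the table. -/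
structure Table (P Q : Type) where
  /-- the entries -/
  word : Q → List P
  nodup : ∀ q, (word q).Nodup
  unique : ∀ p, ∃! q, p ∈ word q

/-- The Koszul sign of the permutation of homogeneous factors, with parities `e`, from the order
`lt` into the order of the list: a factor `(-1) ^ (|p| |p'|)` for each pair which is exchanged. -/
def koszul {P : Type} (lt : P → P → Prop) [DecidableRel lt] (e : P → ZMod 2) : List P → ℤ
  | [] => 1
  | p :: l => (l.map (fun p' => if lt p' p then ksgn (e p * e p') else 1)).prod * koszul lt e l

namespace DGCategory

variable (A : DGCategory.{u, v} k) {P Q : Type}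

open scoped Classical in
/-- The identity of `a` as an element of `Mor a b` if `a = b` (and zero otherwise, which does not
occur for composable words). -/
def oneHom (a b : A.Obj) : A.Mor a b := if h : a = b then h ▸ A.one a else 0

/-- The product in `Mor a b` of the `α p`, where `p` runs through a word; the identity for the empty
word. -/
def evalWord {T S : P → A.Obj} (α : ∀ p, A.Mor (T p) (S p)) : List P → ∀ a b, A.Mor a b
  | [], a, b => A.oneHom a b
  | p :: l, a, b => A.comp (A.comp (A.oneHom a (T p)) (α p)) (evalWord α l (S p) b)

variable {A}

theorem evalWord_update_of_notMem [DecidableEq P] {T S : P → A.Obj}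
    (α : ∀ p, A.Mor (T p) (S p)) (p : P) (x : A.Mor (T p) (S p)) (l : List P) (h : p ∉ l)
    (a b : A.Obj) : A.evalWord (Function.update α p x) l a b = A.evalWord α l a b := by
  induction l generalizing a with
  | nil => rfl
  | cons p' l ih =>
    simp only [List.mem_cons, not_or] at h
    simp only [evalWord]
    rw [ih h.2, Function.update_of_ne (Ne.symm h.1)]

theorem evalWord_update_linear [DecidableEq P] {T S : P → A.Obj}
    (α : ∀ p, A.Mor (T p) (S p)) (p : P) (l : List P) (h : p ∈ l) (hl : l.Nodup)
    (a b : A.Obj) : ∃ φ : A.Mor (T p) (S p) →ₗ[k] A.Mor a b,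
      ∀ x, A.evalWord (Function.update α p x) l a b = φ x := by
  induction l generalizing a with
  | nil => simp at h
  | cons p' l ih =>
    rw [List.nodup_cons] at hl
    by_cases hp : p = p'
    · subst hp
      refine ⟨A.comp.flip (A.evalWord α l (S p) b) ∘ₗ A.comp (A.oneHom a (T p)), fun x => ?_⟩
      simp only [evalWord]
      rw [evalWord_update_of_notMem α p x l hl.1, Function.update_self]
      rfl
    · have h' : p ∈ l := (List.mem_cons.1 h).resolve_left hp
      obtain ⟨φ, hφ⟩ := ih h' hl.2 (S p')
      refine ⟨A.comp (A.comp (A.oneHom a (T p')) (α p')) ∘ₗ φ, fun x => ?_⟩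
      simp only [evalWord]
      rw [hφ, Function.update_of_ne (Ne.symm hp)]
      rfl

theorem evalTable_aux [DecidableEq P] (tb : Table P Q) {T S : P → A.Obj} (a b : Q → A.Obj)
    (α : ∀ p, A.Mor (T p) (S p)) (p : P) :
    ∃ φ : A.Mor (T p) (S p) →ₗ[k] ⨂[k] q, A.Mor (a q) (b q), ∀ x,
      PiTensorProduct.tprod k
        (fun q => A.evalWord (Function.update α p x) (tb.word q) (a q) (b q)) = φ x := by
  classical
  obtain ⟨q, hq, huniq⟩ := tb.unique p
  obtain ⟨φ, hφ⟩ := evalWord_update_linear α p (tb.word q) hq (tb.nodup q) (a q) (b q)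
  refine ⟨(PiTensorProduct.tprod k).toLinearMap
    (fun q => A.evalWord α (tb.word q) (a q) (b q)) q ∘ₗ φ, fun x => ?_⟩
  rw [LinearMap.comp_apply, MultilinearMap.toLinearMap_apply]
  congr 1
  funext q'
  by_cases h : q' = q
  · subst h; rw [Function.update_self, hφ]
  · rw [Function.update_of_ne h]
    exact evalWord_update_of_notMem α p x _ (fun h' => h (huniq q' h')) _ _

variable (A) in
/-- The tensor of the entries of a table, without Koszul signs, as a multilinear map. -/
def evalTable (tb : Table P Q) (T S : P → A.Obj) (a b : Q → A.Obj) :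
    MultilinearMap k (fun p => A.Mor (T p) (S p)) (⨂[k] q, A.Mor (a q) (b q)) where
  toFun α := PiTensorProduct.tprod k (fun q => A.evalWord α (tb.word q) (a q) (b q))
  map_update_add' α p x y := by
    obtain ⟨φ, hφ⟩ := evalTable_aux tb a b α p
    rw [hφ, hφ, hφ, map_add]
  map_update_smul' α p c x := by
    obtain ⟨φ, hφ⟩ := evalTable_aux tb a b α p
    rw [hφ, hφ, map_smul]

variable (A) in
/-- The tensor of the entries of a table, with the Koszul sign: the order of the factors is `lt`
in the argument, and it is the order in which the words are read off along `read` in the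
result. -/
def koszulTable [Fintype P] [DecidableEq P] (tb : Table P Q) (lt : P → P → Prop) [DecidableRel lt]
    (read : List Q) (T S : P → A.Obj) (a b : Q → A.Obj) :
    MultilinearMap k (fun p => A.Mor (T p) (S p)) (⨂[k] q, A.Mor (a q) (b q)) :=
  ∑ e : P → ZMod 2, (koszul lt e (read.flatMap tb.word) : k) •
    (A.evalTable tb T S a b).compLinearMap (fun p => A.par (e p))

variable (A) in
/-- The source object of the last letter of the words at a list of positions. -/
def lastSource [Inhabited P] (S : P → A.Obj) (w : Q → List P) (l : List Q) : A.Obj :=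
  S ((l.flatMap w).getLastD default)

end DGCategory

/-! ### The twisted Hochschild complex -/

variable {A : DGCategory.{u, v} k}

/-- The target objects of the factors of a Hochschild chain twisted by `F`: the factors are
`α₀ : Mor (F x₀) x₁` and `αᵢ : Mor xᵢ xᵢ₊₁` for `i > 0`, with `xₘ₊₁ = x₀`. -/
def DGFunctor.tw (F : DGFunctor A A) {m : ℕ} (x : Fin (m + 1) → A.Obj) (i : Fin (m + 1)) : A.Obj :=
  if i = 0 then F.obj (x i) else x i

/-- The term of degree `m` of the `F`-twisted Hochschild complex of `A`. -/
abbrev Chain (F : DGFunctor A A) (m : ℕ) : Type (max u v w) :=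
  ⨁ x : Fin (m + 1) → A.Obj, ⨂[k] i, A.Mor (F.tw x i) (x (i + 1))

open scoped Classical in
/-- The Hochschild chain given by a table; its objects are determined by the composability. -/
def chainTable {P : Type} [Fintype P] [DecidableEq P] [Inhabited P] (F : DGFunctor A A) {m : ℕ}
    (tb : Table P (Fin (m + 1))) (lt : P → P → Prop) [DecidableRel lt] (T S : P → A.Obj) :
    MultilinearMap k (fun p => A.Mor (T p) (S p)) (Chain F m) :=
  let y : Fin (m + 1) → A.Obj := fun i =>
    A.lastSource S tb.word ((List.finRange (m + 1)).filter (fun i' => i' ≤ i - 1))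
  (DirectSum.lof k (Fin (m + 1) → A.Obj) (fun x => ⨂[k] i, A.Mor (F.tw x i) (x (i + 1)))
      y).compMultilinearMap
    (A.koszulTable tb lt (List.finRange (m + 1)) T S (F.tw y) (fun i => y (i + 1)))

/-- The table `α₀ ⊗ ⋯ ⊗ αᵢ αᵢ₊₁ ⊗ ⋯ ⊗ αₘ₊₁`. -/
def faceTable (m : ℕ) (i : Fin (m + 1)) : Table (Fin (m + 2)) (Fin (m + 1)) where
  word j := if j < i then [j.castSucc] else if j = i then [j.castSucc, j.succ] else [j.succ]
  nodup j := by
    split_ifs <;> simp [Fin.ext_iff]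
  unique p := by
    have key : ∀ j : Fin (m + 1), (p ∈ (if j < i then [j.castSucc] else if j = i then
        [j.castSucc, j.succ] else [j.succ])) ↔
        (j : ℕ) = if (p : ℕ) ≤ i then (p : ℕ) else p - 1 := by
      intro j
      have hp := p.2
      split_ifs <;> simp only [List.mem_cons, List.not_mem_nil, or_false, Fin.ext_iff,
        Fin.val_castSucc, Fin.val_succ, Fin.lt_def] at * <;> omega
    have hp := p.2
    have hi := i.2
    refine ⟨⟨if (p : ℕ) ≤ i then (p : ℕ) else p - 1, by split_ifs <;> omega⟩, (key _).2 rfl, ?_⟩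
    intro j hj
    exact Fin.ext ((key j).1 hj)

/-- The table `αₘ₊₁ α₀ ⊗ α₁ ⊗ ⋯ ⊗ αₘ`. -/
def lastFaceTable (m : ℕ) : Table (Fin (m + 2)) (Fin (m + 1)) where
  word j := if j = 0 then [Fin.last (m + 1), 0] else [j.castSucc]
  nodup j := by
    split_ifs <;> simp [Fin.ext_iff]
  unique p := by
    have key : ∀ j : Fin (m + 1), (p ∈ (if j = 0 then [Fin.last (m + 1), 0] else
        [j.castSucc])) ↔ (j : ℕ) = if (p : ℕ) = m + 1 then 0 else (p : ℕ) := by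
      intro j
      have hp := p.2
      split_ifs <;> simp only [List.mem_cons, List.not_mem_nil, or_false, Fin.ext_iff,
        Fin.val_castSucc, Fin.val_last, Fin.val_zero] at * <;> omega
    have hp := p.2
    refine ⟨⟨if (p : ℕ) = m + 1 then 0 else (p : ℕ), by split_ifs <;> omega⟩, (key _).2 rfl, ?_⟩
    intro j hj
    exact Fin.ext ((key j).1 hj)

/-- The table `α₀ ⊗ ⋯ ⊗ αₘ`. -/
def idTable (m : ℕ) : Table (Fin (m + 1)) (Fin (m + 1)) where
  word j := [j]
  nodup _ := List.nodup_singleton _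
  unique p := ⟨p, by simp, fun q h => (List.mem_singleton.1 h).symm⟩

open scoped Classical in
/-- The Hochschild differential: it sends `α₀ ⊗ ⋯ ⊗ αₘ₊₁` to
`∑ᵢ (-1) ^ i α₀ ⊗ ⋯ ⊗ αᵢ αᵢ₊₁ ⊗ ⋯ ⊗ αₘ₊₁ ± F(αₘ₊₁) α₀ ⊗ α₁ ⊗ ⋯ ⊗ αₘ`, where `±` is `(-1) ^ (m + 1)`
times the Koszul sign of moving `αₘ₊₁` past all other factors. -/
def hochB (F : DGFunctor A A) (m : ℕ) : Chain F (m + 1) →ₗ[k] Chain F m :=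
  DirectSum.toModule k (Fin (m + 2) → A.Obj) (Chain F m) fun x =>
    (∑ i : Fin (m + 1), (-1 : k) ^ (i : ℕ) • PiTensorProduct.lift
      (chainTable F (faceTable m i) (· < ·) (F.tw x) (fun i => x (i + 1)))) +
    (-1 : k) ^ (m + 1) • PiTensorProduct.lift
      (let G : Fin (m + 2) → DGFunctor A A :=
        fun i => if i = Fin.last (m + 1) then F else DGFunctor.id A
      (chainTable F (lastFaceTable m) (· < ·) (fun i => (G i).obj (F.tw x i))
        (fun i => (G i).obj (x (i + 1)))).compLinearMap (fun i => (G i).map))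

open scoped Classical in
/-- The internal differential of the terms of the Hochschild complex. -/
def intD (F : DGFunctor A A) (m : ℕ) : Chain F m →ₗ[k] Chain F m :=
  DirectSum.toModule k (Fin (m + 1) → A.Obj) (Chain F m) fun x =>
    DirectSum.lof k (Fin (m + 1) → A.Obj) (fun x => ⨂[k] i, A.Mor (F.tw x i) (x (i + 1))) x ∘ₗ
      A.tensorD (F.tw x) (fun i => x (i + 1))

open scoped Classical in
/-- The action of `F` on its twisted Hochschild complex: `α₀ ⊗ ⋯ ⊗ αₘ ↦ F(α₀) ⊗ ⋯ ⊗ F(αₘ)`. -/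
def act (F : DGFunctor A A) (m : ℕ) : Chain F m →ₗ[k] Chain F m :=
  DirectSum.toModule k (Fin (m + 1) → A.Obj) (Chain F m) fun x => PiTensorProduct.lift
    ((chainTable F (idTable m) (· < ·) (fun i => F.obj (F.tw x i))
      (fun i => F.obj (x (i + 1)))).compLinearMap (fun _ => F.map))

/-! ### Chains in matrix form -/

section Nest

variable {ι κ : Type} [Finite ι] [Finite κ] {V : ι → κ → Type v}
  [∀ i j, AddCommGroup (V i j)] [∀ i j, Module k (V i j)]

theorem nest_aux [DecidableEq ι] [DecidableEq κ] [DecidableEq (ι × κ)]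
    (α : ∀ p : ι × κ, V p.1 p.2) (i : ι) (j : κ) (x : V i j) :
    (fun i' => PiTensorProduct.tprod k fun j' => Function.update α (i, j) x (i', j')) =
      Function.update (fun i' => PiTensorProduct.tprod k fun j' => α (i', j')) i
        (PiTensorProduct.tprod k (Function.update (fun j' => α (i, j')) j x)) := by
  funext i'
  by_cases hi : i' = i
  · subst hi
    rw [Function.update_self]
    congr 1
    funext j'
    by_cases hj : j' = j
    · subst hj; simp
    · have : (i', j') ≠ (i', j) := fun h => hj (congrArg Prod.snd h)
      rw [Function.update_of_ne this, Function.update_of_ne hj]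
  · rw [Function.update_of_ne hi]
    congr 1
    funext j'
    have : (i', j') ≠ (i, j) := fun h => hi (congrArg Prod.fst h)
    rw [Function.update_of_ne this]

/-- The map which sends a matrix to the tensor product of the tensor products of its rows. -/
def nest : MultilinearMap k (fun p : ι × κ => V p.1 p.2) (⨂[k] i, ⨂[k] j, V i j) where
  toFun α := PiTensorProduct.tprod k fun i => PiTensorProduct.tprod k fun j => α (i, j)
  map_update_add' := by
    classical
    rintro _ α ⟨i, j⟩ x y
    rw [nest_aux, nest_aux, nest_aux, MultilinearMap.map_update_add,
      MultilinearMap.map_update_add]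
  map_update_smul' := by
    classical
    rintro _ α ⟨i, j⟩ c x
    rw [nest_aux, nest_aux, MultilinearMap.map_update_smul,
      MultilinearMap.map_update_smul]

theorem nest_bijective : Function.Bijective
    (PiTensorProduct.lift (nest (k := k) (V := V)) :
      (⨂[k] p : ι × κ, V p.1 p.2) →ₗ[k] ⨂[k] i, ⨂[k] j, V i j) := by
  let b := fun i j => Module.Basis.ofVectorSpace k (V i j)
  let b1 := Basis.piTensorProduct (fun p : ι × κ => b p.1 p.2)
  let b2 := Basis.piTensorProduct (fun i => Basis.piTensorProduct (b i))
  let e : (∀ p : ι × κ, Module.Basis.ofVectorSpaceIndex k (V p.1 p.2)) ≃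
      ∀ i j, Module.Basis.ofVectorSpaceIndex k (V i j) :=
    ⟨fun f i j => f (i, j), fun g p => g p.1 p.2, fun _ => rfl, fun _ => rfl⟩
  have : (PiTensorProduct.lift (nest (k := k) (V := V)) :
      (⨂[k] p : ι × κ, V p.1 p.2) →ₗ[k] ⨂[k] i, ⨂[k] j, V i j) = (b1.equiv b2 e).toLinearMap := by
    refine b1.ext fun f => ?_
    rw [LinearEquiv.coe_coe, Module.Basis.equiv_apply]
    simp only [b1, b2, Basis.piTensorProduct_apply, PiTensorProduct.lift.tprod]
    rfl
  rw [this]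
  exact (b1.equiv b2 e).bijective

variable (k V) in
/-- The identification of tensors of matrices with tensor products of tensor products of rows. -/
def nestEquiv : (⨂[k] p : ι × κ, V p.1 p.2) ≃ₗ[k] ⨂[k] i, ⨂[k] j, V i j :=
  LinearEquiv.ofBijective (PiTensorProduct.lift nest) nest_bijective

end Nest

/-- The row by row order of the entries of a matrix. -/
def rowLt {m n : ℕ} (x y : Fin m × Fin n) : Prop := x.1 < y.1 ∨ x.1 = y.1 ∧ x.2 < y.2

instance {m n : ℕ} : DecidableRel (rowLt (m := m) (n := n)) :=
  fun _ _ => inferInstanceAs (Decidable (_ ∨ _))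

/-- The list of the entries of a matrix, row by row. -/
def byRows (m n : ℕ) : List (Fin m × Fin n) :=
  (List.finRange m).flatMap fun i => (List.finRange n).map fun j => (i, j)

/-- The list of the entries of a matrix, column by column: this is the order in which the entries
of a chain in matrix form can be composed. -/
def byCols (m n : ℕ) : List (Fin m × Fin n) :=
  (List.finRange n).flatMap fun j => (List.finRange m).map fun i => (i, j)

theorem byCols_nodup (m n : ℕ) : (byCols m n).Nodup := by
  rw [byCols, List.nodup_flatMap]
  refine ⟨fun j _ => (List.nodup_finRange m).map fun a b h => congrArg Prod.fst h, ?_⟩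
  refine (List.nodup_finRange n).imp ?_
  intro a b hab
  simp only [Function.onFun, List.disjoint_left, List.mem_map, not_exists, not_and]
  rintro _ ⟨i, _, rfl⟩ i' _ h
  exact hab (congrArg Prod.snd h).symm

theorem mem_byCols {m n : ℕ} (x : Fin m × Fin n) : x ∈ byCols m n := by
  simp only [byCols, List.mem_flatMap, List.mem_map]
  exact ⟨x.2, List.mem_finRange _, x.1, List.mem_finRange _, rfl⟩

variable (A) in
/-- The long cycle `tₙ`, acting on `A ^ ⊗ n` by `a₁ ⊗ a₂ ⊗ ⋯ ⊗ aₙ ↦ aₙ ⊗ a₁ ⊗ ⋯ ⊗ aₙ₋₁`. -/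
@[reducible] def cyc (n : ℕ) : DGFunctor (A.tensorPower n) (A.tensorPower n) :=
  A.permFunctor (finRotate n)

open scoped Classical in
/-- The chain in `C_m(A ^ ⊗ n; tₙ)` given by a table in matrix form; its objects are determined by
the composability. -/
def matrixTable {P : Type} [Fintype P] [DecidableEq P] [Inhabited P] {m n : ℕ}
    (tb : Table P (Fin (m + 1) × Fin n)) (lt : P → P → Prop) [DecidableRel lt] (T S : P → A.Obj) :
    MultilinearMap k (fun p => A.Mor (T p) (S p)) (Chain (cyc A n) m) :=
  let y : Fin (m + 1) → (A.tensorPower n).Obj := fun i j =>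
    A.lastSource S tb.word ((byCols (m + 1) n).filter
      (fun q => q.2 < j ∨ q.2 = j ∧ q.1 ≤ i - 1))
  (DirectSum.lof k (Fin (m + 1) → (A.tensorPower n).Obj)
      (fun x => ⨂[k] i, (A.tensorPower n).Mor ((cyc A n).tw x i) (x (i + 1))) y ∘ₗ
    (nestEquiv k (fun i j => A.Mor ((cyc A n).tw y i j) (y (i + 1) j))).toLinearMap).compMultilinearMap
    (A.koszulTable tb lt (byRows (m + 1) n) T S
      (fun q => (cyc A n).tw y q.1 q.2) (fun q => y (q.1 + 1) q.2))

open scoped Classical in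
/-- The linear map on `C_m(A ^ ⊗ n; tₙ)` with given values on matrices. -/
def ofMatrix {m n : ℕ} {N : Type*} [AddCommGroup N] [Module k N]
    (φ : ∀ x : Fin (m + 1) → Fin n → A.Obj, MultilinearMap k (fun q : Fin (m + 1) × Fin n =>
      A.Mor ((cyc A n).tw x q.1 q.2) (x (q.1 + 1) q.2)) N) :
    Chain (cyc A n) m →ₗ[k] N :=
  DirectSum.toModule k (Fin (m + 1) → (A.tensorPower n).Obj) N fun x =>
    PiTensorProduct.lift (φ x) ∘ₗ
      (nestEquiv k (fun i j => A.Mor ((cyc A n).tw x i j) (x (i + 1) j))).symm.toLinearMap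

/-! ### The permutation of a choice of columns -/

/-- The (zero-based) number of the `i`-th element in the ordering by columns: there are
`rank c i + 1` indices `i'` with `c i' < c i`, or with `c i' = c i` and `i' ≤ i`. -/
def rank {r N : ℕ} (c : Fin r → Fin N) (i : Fin r) : ℕ :=
  (Finset.univ.filter fun i' => c i' < c i ∨ c i' = c i ∧ i' ≤ i).card - 1

theorem rank_lt {r N : ℕ} (c : Fin r → Fin N) (i : Fin r) : rank c i < r := by
  have h := Finset.card_le_univ (Finset.univ.filter fun i' => c i' < c i ∨ c i' = c i ∧ i' ≤ i)
  rw [Fintype.card_fin] at h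
  have := i.2
  simp only [rank]
  omega

theorem rank_lt_rank {r N : ℕ} (c : Fin r → Fin N) {i i' : Fin r}
    (h : c i < c i' ∨ c i = c i' ∧ i < i') : rank c i < rank c i' := by
  have h1 : (Finset.univ.filter fun l => c l < c i ∨ c l = c i ∧ l ≤ i) ⊂
      Finset.univ.filter fun l => c l < c i' ∨ c l = c i' ∧ l ≤ i' := by
    rw [Finset.ssubset_iff_of_subset]
    · refine ⟨i', by simp, ?_⟩
      simp only [Finset.mem_filter, Finset.mem_univ, true_and]
      omega
    · intro l
      simp only [Finset.mem_filter, Finset.mem_univ, true_and]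
      omega
  have h2 := Finset.card_lt_card h1
  have h3 : 0 < (Finset.univ.filter fun l => c l < c i ∨ c l = c i ∧ l ≤ i).card :=
    Finset.card_pos.2 ⟨i, by simp⟩
  simp only [rank]
  omega

/-- The permutation `σ_c`: `σ_c i` is the number of `i'` with `c i' < c i`, or with `c i' = c i` and
`i' ≤ i` (minus one, since we count from zero). -/
def sigmaC {r N : ℕ} (c : Fin r → Fin N) : Equiv.Perm (Fin r) :=
  Equiv.ofBijective (fun i => ⟨rank c i, rank_lt c i⟩) <| by
    rw [← Finite.injective_iff_bijective]
    intro i i' h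
    have h' : rank c i = rank c i' := congrArg Fin.val h
    by_contra hne
    rcases lt_trichotomy (c i) (c i') with h1 | h1 | h1
    · exact (rank_lt_rank c (Or.inl h1)).ne h'
    · rcases lt_or_gt_of_ne hne with h2 | h2
      · exact (rank_lt_rank c (Or.inr ⟨h1, h2⟩)).ne h'
      · exact (rank_lt_rank c (Or.inr ⟨h1.symm, h2⟩)).ne h'.symm
    · exact (rank_lt_rank c (Or.inl h1)).ne h'.symm

/-! ### The map `f` -/

/-- The table of the `s`-th summand of `f`: the first entry is the product of all entries of the
columns `s + 1, …, n, 1, …, s - 1`, in this order, and of the first entry of the column `s`; the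
other entries are those of the column `s`. -/
def fTable (m n : ℕ) [NeZero n] (s : Fin n) : Table (Fin (m + 1) × Fin n) (Fin (m + 1)) where
  word i := if i = 0 then
      (((List.finRange n).filter fun u => u ≠ 0).flatMap fun u =>
        (List.finRange (m + 1)).map fun i' => (i', s + u)) ++ [(0, s)]
    else [(i, s)]
  nodup i := by
    split_ifs
    · rw [List.nodup_append]
      refine ⟨?_, List.nodup_singleton _, ?_⟩
      · rw [List.nodup_flatMap]
        refine ⟨fun j _ => (List.nodup_finRange _).map fun a b h => congrArg Prod.fst h, ?_⟩
        refine ((List.nodup_finRange n).filter _).imp ?_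
        intro a b hab
        simp only [Function.onFun, List.disjoint_left, List.mem_map, not_exists, not_and]
        rintro _ ⟨i, _, rfl⟩ i' _ h
        exact hab (add_left_cancel (congrArg Prod.snd h)).symm
      · simp only [List.mem_flatMap, List.mem_filter, List.mem_map, List.mem_singleton]
        rintro _ ⟨u, ⟨_, hu⟩, i', _, rfl⟩ _ rfl h
        have h2 : s + u = s := congrArg Prod.snd h
        simp at hu
        exact hu (by simpa using h2)
    · exact List.nodup_singleton _
  unique := by
    rintro ⟨a, b⟩
    have key : ∀ i : Fin (m + 1), ((a, b) ∈ if i = 0 then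
        (((List.finRange n).filter fun u => u ≠ 0).flatMap fun u =>
          (List.finRange (m + 1)).map fun i' => (i', s + u)) ++ [(0, s)]
        else [(i, s)]) ↔ i = if b = s then a else 0 := by
      intro i
      split_ifs with h1 h2 h2
      · subst h2
        simp only [List.mem_append, List.mem_flatMap, List.mem_filter, List.mem_map,
          List.mem_singleton, Prod.mk.injEq]
        constructor
        · rintro (⟨u, ⟨_, hu⟩, i', _, _, h3⟩ | ⟨h3, _⟩)
          · simp only [decide_eq_true_eq] at hu
            exact absurd (by simpa using h3) hu
          · rw [h1, h3]
        · intro h3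
          exact Or.inr ⟨by rw [← h3, h1], trivial⟩
      · simp only [List.mem_append, List.mem_flatMap, List.mem_filter, List.mem_map, h1, iff_true]
        refine Or.inl ⟨b - s, ⟨List.mem_finRange _, ?_⟩, a, List.mem_finRange _, by simp⟩
        simpa using sub_ne_zero.2 h2
      · simp [h2, eq_comm]
      · simp [h1, h2]
    exact ⟨_, (key _).2 rfl, fun i hi => (key i).1 hi⟩

/-- The map `f : C_m(A ^ ⊗ n; tₙ) ⟶ C_m(A)`. -/
def mapF (A : DGCategory.{u, v} k) (n : ℕ) [NeZero n] (m : ℕ) :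
    Chain (cyc A n) m →ₗ[k] Chain (DGFunctor.id A) m :=
  ofMatrix fun x => ((n : k)⁻¹) • ∑ s : Fin n,
    chainTable (DGFunctor.id A) (fTable m n s) rowLt
      (fun y => (cyc A n).tw x y.1 y.2) (fun y => x (y.1 + 1) y.2)

/-! ### The map `g` -/

/-- The table of the summand of `g` of a choice `c` of a column in each row: the entry in the row
`i` and the column `c i` is `α_{σ_c(i)}`, all other entries are identities. -/
def gTable {m n : ℕ} (c : Fin (m + 1) → Fin n) :
    Table (Fin (m + 1)) (Fin (m + 1) × Fin n) where
  word q := if q.2 = c q.1 then [sigmaC c q.1] else []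
  nodup q := by split_ifs <;> simp
  unique p := by
    refine ⟨((sigmaC c).symm p, c ((sigmaC c).symm p)), by simp, ?_⟩
    rintro ⟨i, j⟩ h
    split_ifs at h with h1
    · have h2 : p = sigmaC c i := by simpa using h
      subst h2
      simp only at h1
      simp [h1]
    · simp at h

open scoped Classical in
/-- The map `g : C_m(A) ⟶ C_m(A ^ ⊗ n; tₙ)` (before the projection onto the coinvariants). -/
def mapG (A : DGCategory.{u, v} k) (n : ℕ) [NeZero n] (m : ℕ) :
    Chain (DGFunctor.id A) m →ₗ[k] Chain (cyc A n) m :=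
  DirectSum.toModule k (Fin (m + 1) → A.Obj) _ fun x => PiTensorProduct.lift <|
    ∑ c ∈ (Finset.univ : Finset (Fin (m + 1) → Fin n)).filter (fun c => c 0 = 0),
      ((Equiv.Perm.sign (sigmaC c) : ℤ) : k) • matrixTable (gTable c) (· < ·)
        ((DGFunctor.id A).tw x) (fun i => x (i + 1))

/-! ### The homotopy -/

/-- The entry in the row `i` and the column `j` of the table `B_{p, q, d, r, c}`.  The chain has
`m + 1` rows and `n` columns; all the indices of rows and columns are counted from one here, and
`α a b` is the word which consists of the single letter in the row `a` and the column `b`. -/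
def bWord (m n p q d r : ℕ) [NeZero n] (c : Fin r → Fin (n - q)) (i j : ℕ) :
    List (Fin (m + 1) × Fin n) :=
  let α : ℕ → ℕ → List (Fin (m + 1) × Fin n) := fun a b =>
    (byCols (m + 1) n).filter fun x => (x.1 : ℕ) + 1 = a ∧ (x.2 : ℕ) + 1 = b
  if i = 1 then
    if j = 1 then
      ((byCols (m + 1) n).filter fun x =>
        (x.2 : ℕ) + 1 = q ∧ p + 1 ≤ (x.1 : ℕ) + 1 ∨ q < (x.2 : ℕ) + 1) ++ [(0, 0)]
    else []
  else if h : 2 ≤ i ∧ i ≤ r + 1 then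
    if j = (c ⟨i - 2, by omega⟩ : ℕ) + 1 then
      α ((sigmaC c ⟨i - 2, by omega⟩ : ℕ) + 1 + 1) 1
    else []
  else if i ≤ d then
    if j = n - q + 1 then α i 1 else []
  else if i ≤ m + 1 + d - p then
    if n - q + 2 ≤ j then α (i + p - d) (j + q - 1 - n) else []
  else if i = m + 1 + d - p + 1 then
    if n - q + 2 ≤ j then
      (byCols (m + 1) n).filter fun x => (x.1 : ℕ) + 1 ≤ d ∧ (x.2 : ℕ) + 1 = j + q - n
    else []
  else
    if n - q + 1 ≤ j then α (i + p - (m + 1) - 1) (j + q - n) else []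

/-- The rows from `a` to `b` (counted from one). -/
def rowSet (N a b : ℕ) : Finset (Fin N) :=
  Finset.univ.filter fun i => a ≤ (i : ℕ) + 1 ∧ (i : ℕ) + 1 ≤ b

open scoped Classical in
/-- The set `S_{P, Q}` of shuffles of two disjoint sets `P` and `Q` of rows. -/
def shuffles {N : ℕ} (P Q : Finset (Fin N)) : Finset (Equiv.Perm (Fin N)) :=
  Finset.univ.filter fun σ =>
    (∀ i j, i < j → (i ∈ P ∧ j ∈ P ∨ i ∈ Q ∧ j ∈ Q) → σ i < σ j) ∧
      ∀ i, i ∉ P ∪ Q → σ i = i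

theorem bWord_nodup (m n p q d r : ℕ) [NeZero n] (hq : 2 ≤ q) (c : Fin r → Fin (n - q))
    (i j : ℕ) : (bWord m n p q d r c i j).Nodup := by
  have h0 := byCols_nodup (m + 1) n
  unfold bWord
  split_ifs
  · rw [List.nodup_append]
    refine ⟨h0.filter _, List.nodup_singleton _, ?_⟩
    simp only [List.mem_filter, List.mem_singleton]
    rintro x ⟨_, hx⟩ _ rfl rfl
    simp at hx
    omega
  all_goals first | exact List.nodup_nil | exact h0.filter _

/-- The positions of a letter in the table `B_{p, q, d, r, c}`. -/
theorem mem_bWord (m n p q d r : ℕ) [NeZero n] (hpm : p ≤ m + 1) (hq : 2 ≤ q) (hqn : q ≤ n)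
    (hdp : d ≤ p) (c : Fin r → Fin (n - q)) (i j : ℕ) (hi : 1 ≤ i) (hj : 1 ≤ j)
    (x : Fin (m + 1) × Fin n) : x ∈ bWord m n p q d r c i j ↔
      (i = 1 ∧ j = 1 ∧ ((x.1 : ℕ) = 0 ∧ (x.2 : ℕ) = 0 ∨
        ((x.2 : ℕ) + 1 = q ∧ p + 1 ≤ (x.1 : ℕ) + 1 ∨ q < (x.2 : ℕ) + 1))) ∨
      (∃ h : 2 ≤ i ∧ i ≤ r + 1, j = (c ⟨i - 2, by omega⟩ : ℕ) + 1 ∧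
        (x.1 : ℕ) + 1 = (sigmaC c ⟨i - 2, by omega⟩ : ℕ) + 1 + 1 ∧ (x.2 : ℕ) + 1 = 1) ∨
      (r + 2 ≤ i ∧ i ≤ d ∧ j + q = n + 1 ∧ (x.1 : ℕ) + 1 = i ∧ (x.2 : ℕ) = 0) ∨
      (r + 2 ≤ i ∧ d + 1 ≤ i ∧ i + p ≤ m + 1 + d ∧ n + 2 ≤ j + q ∧
        (x.1 : ℕ) + 1 + d = i + p ∧ (x.2 : ℕ) + 2 + n = j + q) ∨
      (r + 2 ≤ i ∧ d + 1 ≤ i ∧ i + p = m + 2 + d ∧ n + 2 ≤ j + q ∧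
        (x.1 : ℕ) + 1 ≤ d ∧ (x.2 : ℕ) + 1 + n = j + q) ∨
      (r + 2 ≤ i ∧ d + 1 ≤ i ∧ m + 2 + d < i + p ∧ n + 1 ≤ j + q ∧
        (x.1 : ℕ) + 3 + m = i + p ∧ (x.2 : ℕ) + 1 + n = j + q) := by
  have h00 : x = (0, 0) ↔ (x.1 : ℕ) = 0 ∧ (x.2 : ℕ) = 0 := by
    rw [Prod.ext_iff, Fin.ext_iff, Fin.ext_iff]; simp
  unfold bWord
  by_cases h1 : i = 1
  · have h1' : ¬ (2 ≤ i ∧ i ≤ r + 1) := by omega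
    have h1'' : ¬ (r + 2 ≤ i) := by omega
    by_cases h2 : j = 1
    · simp [h1, h2, mem_byCols, h00, or_comm]
    · simp [h1, h2]
  · rw [if_neg h1]
    by_cases h2 : 2 ≤ i ∧ i ≤ r + 1
    · rw [dif_pos h2]
      have h1'' : ¬ (r + 2 ≤ i) := by omega
      split_ifs with h3
      · simp only [List.mem_filter, mem_byCols, true_and, decide_eq_true_eq]
        constructor
        · intro h; exact Or.inr (Or.inl ⟨h2, h3, h.1, h.2⟩)
        · rintro (h | ⟨_, _, h⟩ | h | h | h | h)
          · exact absurd h.1 h1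
          · exact h
          all_goals exact absurd h.1 h1''
      · constructor
        · intro h; simp at h
        · rintro (h | ⟨_, h, _⟩ | h | h | h | h)
          · exact absurd h.1 h1
          · exact absurd h h3
          all_goals exact absurd h.1 h1''
    · rw [dif_neg h2]
      have h1'' : r + 2 ≤ i := by omega
      have hne : ¬ ∃ h : 2 ≤ i ∧ i ≤ r + 1, j = (c ⟨i - 2, by omega⟩ : ℕ) + 1 ∧
        (x.1 : ℕ) + 1 = (sigmaC c ⟨i - 2, by omega⟩ : ℕ) + 1 + 1 ∧ (x.2 : ℕ) + 1 = 1 :=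
        fun ⟨h, _⟩ => h2 h
      simp only [h1, hne, h1'', false_and, false_or, true_and]
      clear hne h00
      have hx := x.1.2
      have hx' := x.2.2
      split_ifs <;>
        simp only [List.mem_filter, mem_byCols, true_and, decide_eq_true_eq, List.not_mem_nil,
          false_iff] <;> omega

/-- Every letter occurs exactly once in the table `B_{p, q, d, r, c}`. -/
theorem bWord_unique (m n p q d r : ℕ) [NeZero n] (hp : 1 ≤ p) (hpm : p ≤ m + 1) (hq : 2 ≤ q)
    (hqn : q ≤ n) (hd : 1 ≤ d) (hdp : d ≤ p) (hr : r + 1 ≤ d) (c : Fin r → Fin (n - q))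
    (x : Fin (m + 1) × Fin n) : ∃! y : Fin (m + 2) × Fin n,
      x ∈ bWord m n p q d r c ((y.1 : ℕ) + 1) ((y.2 : ℕ) + 1) := by
  have hx1 := x.1.2
  have hx2 := x.2.2
  have hmem : ∀ i' j' : ℕ, x ∈ bWord m n p q d r c (i' + 1) (j' + 1) ↔ _ := fun i' j' =>
    mem_bWord m n p q d r hpm hq hqn hdp c (i' + 1) (j' + 1) (by omega) (by omega) x
  by_cases hC : (x.2 : ℕ) = 0 ∧ 1 ≤ (x.1 : ℕ) ∧ (x.1 : ℕ) ≤ r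
  · obtain ⟨l, hl⟩ := (sigmaC c).surjective ⟨(x.1 : ℕ) - 1, by omega⟩
    have hl' : (sigmaC c l : ℕ) = (x.1 : ℕ) - 1 := congrArg Fin.val hl
    have hl2 := l.2
    have hcl := (c l).2
    refine ⟨(⟨(l : ℕ) + 1, by omega⟩, ⟨c l, by omega⟩), ?_, ?_⟩
    · dsimp only
      rw [hmem]
      refine Or.inr (Or.inl ⟨by omega, ?_⟩)
      have : (⟨(l : ℕ) + 1 + 1 - 2, by omega⟩ : Fin r) = l := Fin.ext (by simp)
      rw [this]
      omega
    · rintro ⟨⟨i, hi⟩, ⟨j, hj⟩⟩ h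
      dsimp only at h
      rw [hmem] at h
      rcases h with h | ⟨h, h1, h2, _⟩ | h | h | h | h
      · omega
      · have h3 : sigmaC c ⟨i + 1 - 2, by omega⟩ = sigmaC c l := by
          apply Fin.ext
          omega
        have h4 := (sigmaC c).injective h3
        rw [h4] at h1
        have h5 : i + 1 - 2 = l := congrArg Fin.val h4
        simp only [Prod.mk.injEq, Fin.mk.injEq]
        omega
      all_goals omega
  · have h2 : ∀ i' j' : ℕ, ¬ ∃ h : 2 ≤ i' + 1 ∧ i' + 1 ≤ r + 1,
        j' + 1 = (c ⟨i' + 1 - 2, by omega⟩ : ℕ) + 1 ∧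
        (x.1 : ℕ) + 1 = (sigmaC c ⟨i' + 1 - 2, by omega⟩ : ℕ) + 1 + 1 ∧
        (x.2 : ℕ) + 1 = 1 := by
      rintro i' j' ⟨h, _, h3, h4⟩
      have := (sigmaC c ⟨i' + 1 - 2, by omega⟩).2
      omega
    simp only [h2, false_or] at hmem
    have key : ∃ i j : ℕ, i < m + 2 ∧ j < n ∧ ∀ i' j' : ℕ, i' < m + 2 → j' < n →
        (x ∈ bWord m n p q d r c (i' + 1) (j' + 1) ↔ i' = i ∧ j' = j) := by
      simp only [hmem]
      clear h2 hmem
      generalize (x.1 : ℕ) = a at *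
      generalize (x.2 : ℕ) = b at *
      by_cases c1 : a = 0 ∧ b = 0 ∨ (b + 1 = q ∧ p + 1 ≤ a + 1 ∨ q < b + 1)
      · exact ⟨0, 0, by omega, by omega, fun i' j' hi hj => by
          constructor
          · rintro (h | h | h | h | h) <;> omega
          · intro h; exact Or.inl (by omega)⟩
      · by_cases c3 : b = 0 ∧ a + 1 ≤ d
        · exact ⟨a, n - q, by omega, by omega, fun i' j' hi hj => by
            constructor
            · rintro (h | h | h | h | h) <;> omega
            · intro h; exact Or.inr (Or.inl (by omega))⟩
        · by_cases c4 : p + 1 ≤ a + 1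
          · exact ⟨a + d - p, b + n + 1 - q, by omega, by omega, fun i' j' hi hj => by
              constructor
              · rintro (h | h | h | h | h) <;> omega
              · intro h; exact Or.inr (Or.inr (Or.inl (by omega)))⟩
          · by_cases c5 : a + 1 ≤ d
            · exact ⟨m + 1 + d - p, b + n - q, by omega, by omega, fun i' j' hi hj => by
                constructor
                · rintro (h | h | h | h | h) <;> omega
                · intro h; exact Or.inr (Or.inr (Or.inr (Or.inl (by omega))))⟩
            · exact ⟨a + (m + 1) + 1 - p, b + n - q, by omega, by omega, fun i' j' hi hj => by
                constructor
                · rintro (h | h | h | h | h) <;> omega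
                · intro h; exact Or.inr (Or.inr (Or.inr (Or.inr (by omega))))⟩
    obtain ⟨i, j, hi, hj, h⟩ := key
    refine ⟨(⟨i, hi⟩, ⟨j, hj⟩), (h i j hi hj).2 ⟨rfl, rfl⟩, ?_⟩
    rintro ⟨⟨i', hi'⟩, ⟨j', hj'⟩⟩ hy
    have := (h i' j' hi' hj').1 hy
    simp only [Prod.mk.injEq, Fin.mk.injEq]
    exact this

/-- The table `τ υ B_{p, q, d, r, c}`, where `ρ = τ υ` permutes the rows. -/
def bTable (m n p q d r : ℕ) [NeZero n] (hp : 1 ≤ p) (hpm : p ≤ m + 1) (hq : 2 ≤ q)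
    (hqn : q ≤ n) (hd : 1 ≤ d) (hdp : d ≤ p) (hr : r + 1 ≤ d) (c : Fin r → Fin (n - q))
    (ρ : Equiv.Perm (Fin (m + 2))) :
    Table (Fin (m + 1) × Fin n) (Fin (m + 2) × Fin n) where
  word y := bWord m n p q d r c ((ρ.symm y.1 : ℕ) + 1) ((y.2 : ℕ) + 1)
  nodup _ := bWord_nodup m n p q d r hq c _ _
  unique x := by
    obtain ⟨y, hy, huniq⟩ := bWord_unique m n p q d r hp hpm hq hqn hd hdp hr c x
    refine ⟨(ρ y.1, y.2), by simpa using hy, fun z hz => ?_⟩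
    have := huniq (ρ.symm z.1, z.2) hz
    rw [← this]
    simp

/-- The map `Φ'`.  With `M = m + 1` the number of rows, the sum runs over `p ∈ {1, …, M}`,
`q ∈ {2, …, n}`, `d ∈ {1, …, p}`, `r ∈ {0, …, d - 1}` (`r = 0` if `q = n`), `c ∈ {1, …, n - q} ^ r`, over
the shuffles `υ` of the rows `{r + 2, …, d}` and `{d + 1, …, M - p + d}`, and over the shuffles `τ` of
the rows `{2, …, r + 1}` and `{r + 2, …, M + 1}`. -/
def mapPhi' (A : DGCategory.{u, v} k) (n : ℕ) [NeZero n] (m : ℕ) :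
    Chain (cyc A n) m →ₗ[k] Chain (cyc A n) (m + 1) :=
  ofMatrix fun x =>
    ∑ p ∈ (Finset.Icc 1 (m + 1)).attach, ∑ q ∈ (Finset.Icc 2 n).attach,
    ∑ d ∈ (Finset.Icc 1 p.1).attach, ∑ r ∈ (Finset.range d.1).attach,
    ∑ c : Fin r.1 → Fin (n - q.1),
    ∑ τ ∈ shuffles (rowSet (m + 2) 2 (r + 1)) (rowSet (m + 2) (r + 2) (m + 2)),
    ∑ υ ∈ shuffles (rowSet (m + 2) (r + 2) d) (rowSet (m + 2) (d + 1) (m + 1 - p + d)),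
      ((Equiv.Perm.sign (sigmaC c) * Equiv.Perm.sign τ * Equiv.Perm.sign υ *
        (-1) ^ (m + 1 + (m + 1 + d) * (p + d)) : ℤ) : k) •
        matrixTable (bTable m n p q d r
          (Finset.mem_Icc.1 p.2).1 (Finset.mem_Icc.1 p.2).2
          (Finset.mem_Icc.1 q.2).1 (Finset.mem_Icc.1 q.2).2
          (Finset.mem_Icc.1 d.2).1 (Finset.mem_Icc.1 d.2).2
          (Finset.mem_range.1 r.2) c (τ * υ)) rowLt
          (fun y => (cyc A n).tw x y.1 y.2) (fun y => x (y.1 + 1) y.2)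

/-- The map `Φₙ = 1/n ∑ₛ Φ' ∘ t ^ (s - 1)`. -/
def mapPhi (A : DGCategory.{u, v} k) (n : ℕ) [NeZero n] (m : ℕ) :
    Chain (cyc A n) m →ₗ[k] Chain (cyc A n) (m + 1) :=
  (n : k)⁻¹ • ∑ s ∈ Finset.range n, mapPhi' A n m ∘ₗ (act (cyc A n) m) ^ s

/-! ### Total complexes and coinvariants -/

instance (F : DGFunctor A A) (m : ℕ) : AddCommGroup (Chain F m) := inferInstance

/-- The total space of the `F`-twisted Hochschild complex. -/
abbrev Hoch (F : DGFunctor A A) : Type (max u v w) := ⨁ m : ℕ, Chain F m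

/-- The differential of the total complex: the Hochschild differential plus `(-1) ^ m` times the
internal differential in the term of degree `m`. -/
def totD (F : DGFunctor A A) : Hoch F →ₗ[k] Hoch F :=
  DirectSum.toModule k ℕ (Hoch F) fun m =>
    (match m with
      | 0 => 0
      | m + 1 => DirectSum.lof k ℕ (fun m => Chain F m) m ∘ₗ hochB F m) +
    (-1 : k) ^ m • (DirectSum.lof k ℕ (fun m => Chain F m) m ∘ₗ intD F m)

/-- The action of `F` on its twisted Hochschild complex. -/
def totAct (F : DGFunctor A A) : Hoch F →ₗ[k] Hoch F :=
  DirectSum.toModule k ℕ (Hoch F) fun m => DirectSum.lof k ℕ (fun m => Chain F m) m ∘ₗ act F m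

/-- The subspace generated by all `α - F.α`. -/
def coinvRel (F : DGFunctor A A) : Submodule k (Hoch F) :=
  Submodule.span k (Set.range fun α => α - totAct F α)

/-- The coinvariants of the action of `F` on its twisted Hochschild complex. -/
abbrev Coinv (F : DGFunctor A A) : Type (max u v w) := Hoch F ⧸ coinvRel F

/-- The map `f` on the total spaces. -/
def totF (A : DGCategory.{u, v} k) (n : ℕ) [NeZero n] :
    Hoch (cyc A n) →ₗ[k] Hoch (DGFunctor.id A) :=
  DirectSum.toModule k ℕ _ fun m => DirectSum.lof k ℕ (fun m => Chain (DGFunctor.id A) m) m ∘ₗ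
    mapF A n m

/-- The map `g` on the total spaces, with values in the coinvariants. -/
def totG (A : DGCategory.{u, v} k) (n : ℕ) [NeZero n] :
    Hoch (DGFunctor.id A) →ₗ[k] Coinv (cyc A n) :=
  (coinvRel (cyc A n)).mkQ ∘ₗ DirectSum.toModule k ℕ _ fun m =>
    DirectSum.lof k ℕ (fun m => Chain (cyc A n) m) m ∘ₗ mapG A n m

/-- The map `Φₙ` on the total spaces. -/
def totPhi (A : DGCategory.{u, v} k) (n : ℕ) [NeZero n] :
    Hoch (cyc A n) →ₗ[k] Hoch (cyc A n) :=
  DirectSum.toModule k ℕ _ fun m => DirectSum.lof k ℕ (fun m => Chain (cyc A n) m) (m + 1) ∘ₗ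
    mapPhi A n m

end DG
end

noncomputable section

namespace DG

section

namespace Shuffle

/-! ### Signed sums over shuffles, cuts and faces of lists

The sums take values in an abelian group; the summand is a function `F` of the list. -/

variable {R S : Type*} {X : Type*} [AddCommGroup X]

/-! A matrix is read as a list of rows, and a row as an `n`-tuple of words in the entries, that is,
as an element of the monoid `Fin n → FreeMonoid P`. The Hochschild differential then becomes the
boundary `bd` of the cyclic bar complex of this monoid, twisted by the rotation `rowT` of the
columns, and the claim becomes combinatorial.

For `1 ≤ q ≤ n` there is a partial subdivision `rowG q`. The columns behind `q` are multiplied up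
and put in front of the corner entry. An initial segment of the first column below the corner is
distributed over `n - q` single columns, and the parts of the columns `2, …, q` beside it are
absorbed into the first row. The remaining rows of the columns `1, …, q` stay together as a block at
the right end. For `q = n` this is the identity (`rowG_self`), for `q = 1` it is `g` after the first
summand of `f` (`rowG_one`, `colSum_letters`).

The part of the homotopy with a given `q` connects the subdivisions `q` and `q - 1` (`phi_bd`). It
cuts the rows below the first one into four segments `U₁`, `U₂`, `V`, `Y` and inserts a middle row.
Faces inside a segment, and those which involve the first row of the list or its last row, are the
homotopy of a face of the argument. Faces at the border between two segments occur twice, with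
opposite signs. Two kinds of faces are left over, in which the middle row is multiplied with the
first row, either directly or around the cycle; they are the two subdivisions. The sum over `q`
telescopes (`rowPhi_bd`).

The formal operators act on functions `F` of lists with values in an abelian group. With `F` the
evaluation of a list of rows as a chain, `rowPhi (bd t F)` is the differential after the homotopy,
and `bd t (rowPhi F)` is the homotopy after the differential.

Two translations connect this with the formulas in the statement. The sums over choices of columns
and over shuffle permutations are turned into recursions on lists by `sum_sigmaC` and
`sum_shuffles`, so that the sum of all tables is `rowPhi` (`sum_bRow_eq_rowPhi`). The Koszul signs
disappear when a chain is given by a matrix of words together with the sign of sorting its letters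
(`wordEl`): merging rows, rotating columns and substituting words then need no further sign
(`hochB_wordEl`, `act_wordEl`, `matrixTable_words`). In the same way the internal differential is a
sum over letters whose signs depend only on the original order of the letters (`intD_wordEl`), hence
it commutes with everything that only rearranges letters.

This gives `d Φ' + Φ' d = g f₁ - 1` on the whole complex, where `f₁` is the first summand of `f`
without the factor `1 / n` (`totD_totPhi'`). Both `f` and `Φ` are averages over the powers of `t`,
of `f₁` and of `Φ'` respectively, and `t` is the identity on coinvariants; averaging the formula
gives the theorem. -/

/-- The signed sum of `F` over all shuffles of two lists. -/
def sh : List R → List R → (List R → X) → X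
  | [], V, F => F V
  | a :: U, [], F => F (a :: U)
  | a :: U, b :: V, F =>
      sh U (b :: V) (fun D => F (a :: D)) +
        (-1 : ℤ) ^ (U.length + 1) • sh (a :: U) V (fun D => F (b :: D))
termination_by U V => U.length + V.length

/-- Splitting off the first element. -/
def hd (H : R → List R → X) : List R → X
  | [] => 0
  | a :: L => H a L

/-- Splitting off the last element. -/
def lst : (R → List R → X) → List R → X
  | _, [] => 0
  | H, [a] => H a []
  | H, a :: b :: L => lst (fun v L' => H v (a :: L')) (b :: L)

/-- The sum over all decompositions of a list into two segments. -/
def cut : (List R → List R → X) → List R → X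
  | K, [] => K [] []
  | K, a :: L => K [] (a :: L) + cut (fun U V => K (a :: U) V) L

/-- The signed sum over all ways to multiply two adjacent elements of a list. -/
def mid [Mul R] : (List R → X) → List R → X
  | _, [] => 0
  | G, a :: L => -hd (fun b L' => G (a * b :: L')) L - mid (fun L' => G (a :: L')) L

@[simp] theorem sh_nil_left (V : List R) (F : List R → X) : sh [] V F = F V := by simp [sh]

@[simp] theorem sh_nil_right (U : List R) (F : List R → X) : sh U [] F = F U := by
  cases U <;> simp [sh]

/-- The recursion of `sh` shortens either of the two lists, so both shorter cases have to be
available at once. -/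
theorem list_two_induction {P : List R → List R → Prop} (h1 : ∀ V, P [] V)
    (h2 : ∀ a U, P (a :: U) [])
    (h3 : ∀ a U b V, P U (b :: V) → P (a :: U) V → P (a :: U) (b :: V)) (U V : List R) :
    P U V := by
  induction U generalizing V with
  | nil => exact h1 V
  | cons a U ihU =>
    induction V with
    | nil => exact h2 a U
    | cons b V ihV => exact h3 a U b V (ihU _) ihV

theorem sh_cons_cons (a b : R) (U V : List R) (F : List R → X) :
    sh (a :: U) (b :: V) F = sh U (b :: V) (fun D => F (a :: D)) +
      (-1 : ℤ) ^ (U.length + 1) • sh (a :: U) V (fun D => F (b :: D)) := by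
  rw [sh]

@[simp] theorem hd_nil (H : R → List R → X) : hd H [] = 0 := rfl
@[simp] theorem hd_cons (H : R → List R → X) (a : R) (L : List R) : hd H (a :: L) = H a L := rfl
@[simp] theorem lst_nil (H : R → List R → X) : lst H [] = 0 := by rw [lst]
@[simp] theorem lst_singleton (H : R → List R → X) (a : R) : lst H [a] = H a [] := by rw [lst]
theorem lst_cons_cons (H : R → List R → X) (a b : R) (L : List R) :
    lst H (a :: b :: L) = lst (fun v L' => H v (a :: L')) (b :: L) := by rw [lst]
theorem lst_cons (H : R → List R → X) (a : R) (L : List R) :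
    lst H (a :: L) = lst (fun v L' => H v (a :: L')) L + if L = [] then H a [] else 0 := by
  cases L with
  | nil => simp
  | cons b L => simp [lst_cons_cons]

@[simp] theorem cut_nil (K : List R → List R → X) : cut K [] = K [] [] := by rw [cut]
theorem cut_cons (K : List R → List R → X) (a : R) (L : List R) :
    cut K (a :: L) = K [] (a :: L) + cut (fun U V => K (a :: U) V) L := by rw [cut]
@[simp] theorem mid_nil [Mul R] (G : List R → X) : mid G [] = 0 := by rw [mid]
theorem mid_cons [Mul R] (G : List R → X) (a : R) (L : List R) :
    mid G (a :: L) = -hd (fun b L' => G (a * b :: L')) L - mid (fun L' => G (a :: L')) L := by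
  rw [mid]

/-! #### Linearity and congruence -/

/-- Only rearrangements of `U ++ V` are ever evaluated. Hence length and membership, though not the
order, may be used when the summand is rewritten. -/
theorem sh_congr (U V : List R) {F G : List R → X} (h : ∀ D, D.Perm (U ++ V) → F D = G D) :
    sh U V F = sh U V G := by
  induction U, V, F using sh.induct generalizing G with
  | case1 V F => simpa using h V (by simp)
  | case2 a U F => simpa using h (a :: U) (by simp)
  | case3 a U b V F ih1 ih2 =>
    rw [sh_cons_cons, sh_cons_cons, ih1 (G := fun D => G (a :: D)) fun D hD => h _ (hD.cons a),
      ih2 (G := fun D => G (b :: D)) fun D hD => h _ ?_]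
    exact (hD.cons b).trans (List.perm_middle (l₁ := a :: U) (a := b) (l₂ := V)).symm

theorem lst_congr (L : List R) {H K : R → List R → X}
    (h : ∀ v L', L = L' ++ [v] → H v L' = K v L') : lst H L = lst K L := by
  induction L generalizing H K with
  | nil => simp
  | cons a L ih =>
    rw [lst_cons, lst_cons, ih fun v L' hL => h v (a :: L') (by rw [hL]; rfl)]
    split_ifs with hL
    · rw [h a [] (by rw [hL]; rfl)]
    · rfl

theorem hd_congr (L : List R) {H K : R → List R → X}
    (h : ∀ v L', L = v :: L' → H v L' = K v L') : hd H L = hd K L := by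
  cases L with
  | nil => rfl
  | cons a L => exact h a L rfl

theorem cut_congr (L : List R) {K K' : List R → List R → X}
    (h : ∀ U V, L = U ++ V → K U V = K' U V) : cut K L = cut K' L := by
  induction L generalizing K K' with
  | nil => simpa using h [] [] rfl
  | cons a L ih =>
    rw [cut_cons, cut_cons, h [] (a :: L) rfl,
      ih fun U V hL => h (a :: U) V (by rw [hL]; rfl)]

section Linear

variable (U V L : List R) (c : ℤ)

theorem sh_add (F G : List R → X) : sh U V (fun D => F D + G D) = sh U V F + sh U V G := by
  induction U, V, F using sh.induct generalizing G with
  | case1 V F => simp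
  | case2 a U F => simp
  | case3 a U b V F ih1 ih2 => simp only [sh_cons_cons, ih1, ih2, smul_add]; abel

theorem sh_smul (F : List R → X) : sh U V (fun D => c • F D) = c • sh U V F := by
  induction U, V, F using sh.induct with
  | case1 V F => simp
  | case2 a U F => simp
  | case3 a U b V F ih1 ih2 => simp only [sh_cons_cons, ih1, ih2, smul_add, smul_comm c]

theorem sh_zero : sh U V (fun _ => (0 : X)) = 0 := by
  simpa using sh_smul U V 0 (fun _ => (0 : X))

theorem sh_neg (F : List R → X) : sh U V (fun D => -F D) = -sh U V F := by
  simpa using sh_smul U V (-1) F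

theorem sh_sub (F G : List R → X) : sh U V (fun D => F D - G D) = sh U V F - sh U V G := by
  simp only [sub_eq_add_neg, sh_add, sh_neg]

theorem hd_add (H K : R → List R → X) : hd (fun v L => H v L + K v L) L = hd H L + hd K L := by
  cases L <;> simp

theorem hd_smul (H : R → List R → X) : hd (fun v L => c • H v L) L = c • hd H L := by
  cases L <;> simp

theorem hd_neg (H : R → List R → X) : hd (fun v L => -H v L) L = -hd H L := by
  cases L <;> simp

theorem lst_add (H K : R → List R → X) :
    lst (fun v L => H v L + K v L) L = lst H L + lst K L := by
  induction L generalizing H K with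
  | nil => simp
  | cons a L ih =>
    simp only [lst_cons, ih]
    split_ifs <;> abel

theorem lst_smul (H : R → List R → X) : lst (fun v L => c • H v L) L = c • lst H L := by
  induction L generalizing H with
  | nil => simp
  | cons a L ih =>
    simp only [lst_cons, ih, smul_add]
    split_ifs <;> simp

theorem lst_neg (H : R → List R → X) : lst (fun v L => -H v L) L = -lst H L := by
  simpa using lst_smul L (-1) H

theorem lst_zero : lst (fun _ _ => (0 : X)) L = 0 := by
  simpa using lst_smul L 0 (fun _ _ => (0 : X))

theorem cut_add (K K' : List R → List R → X) :
    cut (fun U V => K U V + K' U V) L = cut K L + cut K' L := by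
  induction L generalizing K K' with
  | nil => simp
  | cons a L ih => simp only [cut_cons, ih]; abel

theorem cut_smul (K : List R → List R → X) :
    cut (fun U V => c • K U V) L = c • cut K L := by
  induction L generalizing K with
  | nil => simp
  | cons a L ih => simp only [cut_cons, ih, smul_add]

theorem cut_zero : cut (fun _ _ => (0 : X)) L = 0 := by
  simpa using cut_smul L 0 (fun _ _ => (0 : X))

theorem cut_neg (K : List R → List R → X) : cut (fun U V => -K U V) L = -cut K L := by
  simpa using cut_smul L (-1) K

theorem cut_sub (K K' : List R → List R → X) :
    cut (fun U V => K U V - K' U V) L = cut K L - cut K' L := by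
  simp only [sub_eq_add_neg, cut_add, cut_neg]

theorem mid_add [Mul R] (F G : List R → X) :
    mid (fun D => F D + G D) L = mid F L + mid G L := by
  induction L generalizing F G with
  | nil => simp
  | cons a L ih => simp only [mid_cons, ih, hd_add]; abel

theorem mid_smul [Mul R] (F : List R → X) : mid (fun D => c • F D) L = c • mid F L := by
  induction L generalizing F with
  | nil => simp
  | cons a L ih => simp only [mid_cons, ih, hd_smul, smul_sub, smul_neg]

end Linear

/-! #### Faces of shuffles, concatenations and cuts -/

@[simp] theorem lst_append_singleton (H : R → List R → X) (L : List R) (a : R) :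
    lst H (L ++ [a]) = H a L := by
  induction L generalizing H with
  | nil => simp
  | cons b L ih =>
    rw [List.cons_append, lst_cons, ih]
    simp

/-- A shuffle begins with the head of `U` or with the head of `V`; the latter has to pass all of
`U`. -/
theorem hd_sh (U V : List R) (H : R → List R → X) :
    sh U V (hd H) = hd (fun a U' => sh U' V (H a)) U +
      (-1 : ℤ) ^ U.length • hd (fun b V' => sh U V' (H b)) V := by
  rcases U with _ | ⟨a, U⟩
  · simp
  · rcases V with _ | ⟨b, V⟩
    · simp
    · simp [sh_cons_cons]

theorem lst_cons_of_ne (H : R → List R → X) (a : R) {L : List R} (h : L ≠ []) :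
    lst H (a :: L) = lst (fun v L' => H v (a :: L')) L := by
  rw [lst_cons, if_neg h, add_zero]

theorem sh_lst_cons (H : R → List R → X) (a : R) {U V : List R} (h : U ++ V ≠ []) :
    sh U V (fun D => lst H (a :: D)) = sh U V (lst fun v L' => H v (a :: L')) := by
  refine sh_congr _ _ fun D hD => lst_cons_of_ne _ _ ?_
  rintro rfl
  exact h (List.length_eq_zero_iff.1 hD.length_eq.symm)

/-- A shuffle ends with the last element of `V` or with that of `U`; the latter has to pass all of
`V`. Since `sh` recurses at the front, this needs an induction, unlike `hd_sh`. -/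
theorem lst_sh (U V : List R) (H : R → List R → X) :
    sh U V (lst H) = lst (fun b V' => sh U V' (H b)) V +
      (-1 : ℤ) ^ V.length • lst (fun a U' => sh U' V (H a)) U := by
  induction U, V using list_two_induction generalizing H with
  | h1 V => simp
  | h2 a U => simp
  | h3 a U b V ih1 ih2 =>
    rw [sh_cons_cons, sh_lst_cons _ _ (by simp), sh_lst_cons _ _ (by simp), ih1, ih2]
    have e1 : lst (fun v V' => sh (a :: U) V' (H v)) (b :: V) =
        lst (fun v V' => sh U (b :: V') (fun D => H v (a :: D)) +
          (-1 : ℤ) ^ (U.length + 1) • sh (a :: U) V' (fun D => H v (b :: D))) V +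
        if V = [] then H b (a :: U) else 0 := by
      rw [lst_cons]
      simp only [sh_cons_cons, sh_nil_right]
    have e2 : lst (fun v U' => sh U' (b :: V) (H v)) (a :: U) =
        lst (fun v U' => sh U' (b :: V) (fun D => H v (a :: D)) +
          (-1 : ℤ) ^ (U'.length + 1) • sh (a :: U') V (fun D => H v (b :: D))) U +
        if U = [] then H a (b :: V) else 0 := by
      rw [lst_cons]
      simp only [sh_cons_cons, sh_nil_left]
    -- The sign refers to the list without its last element, so `U'.length + 1` is the constant
    -- `U.length`.
    have e3 : lst (fun v U' => sh U' (b :: V) (fun D => H v (a :: D)) +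
          (-1 : ℤ) ^ (U'.length + 1) • sh (a :: U') V (fun D => H v (b :: D))) U =
        lst (fun v U' => sh U' (b :: V) (fun D => H v (a :: D))) U +
          (-1 : ℤ) ^ (U.length) • lst (fun v U' => sh (a :: U') V (fun D => H v (b :: D))) U := by
      rw [lst_add, ← lst_smul]
      congr 1
      refine lst_congr _ fun v L' hL => ?_
      rw [hL]; simp
    rw [e1, e2, e3, lst_add, lst_smul, lst_cons (H := fun b_1 V' => sh U V' fun L' => H b_1 (a :: L')),
      lst_cons (H := fun a_1 U' => sh U' V fun L' => H a_1 (b :: L'))]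
    simp only [List.length_cons, sh_nil_right, sh_nil_left]
    rcases V with _ | ⟨b', V⟩ <;> rcases U with _ | ⟨a', U⟩ <;>
      simp only [if_true, if_false, reduceCtorEq, List.length_cons, List.length_nil] <;>
      · simp only [lst_nil, smul_add, smul_smul, add_zero]
        module

theorem mid_congr [Mul R] (L : List R) {F G : List R → X}
    (h : ∀ D : List R, D.length + 1 = L.length → F D = G D) : mid F L = mid G L := by
  induction L generalizing F G with
  | nil => simp
  | cons a L ih =>
    rw [mid_cons, mid_cons, ih fun D hD => h (a :: D) (by simp [← hD])]
    congr 2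
    refine hd_congr _ fun b L' hL => h _ ?_
    rw [hL]; rfl

theorem mid_cons' [Mul R] (G : List R → X) (a : R) :
    (fun D => mid G (a :: D)) = fun D =>
      (-1 : ℤ) • hd (fun b L' => G (a * b :: L')) D + (-1 : ℤ) • mid (fun L' => G (a :: L')) D := by
  funext D
  rw [mid_cons]
  module

/-- One recursion step of `mid` and `sh` together; it isolates the products of the first two
elements, which `mid_sh` has to compare. -/
theorem mid_sh_left_cons [Mul R] (a b : R) (U V : List R) (G : List R → X) :
    mid (fun U' => sh U' (b :: V) G) (a :: U) =
      -(hd (fun c U' => sh U' (b :: V) (fun D => G (a * c :: D))) U +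
          (-1 : ℤ) ^ U.length • hd (fun c U' => sh (a * c :: U') V (fun D => G (b :: D))) U) -
        (mid (fun U' => sh U' (b :: V) (fun D => G (a :: D))) U +
          (-1 : ℤ) ^ U.length • mid (fun U' => sh (a :: U') V (fun D => G (b :: D))) U) := by
  rw [mid_cons, ← hd_smul, ← hd_add, ← mid_smul, ← mid_add]
  congr 1
  · congr 1
    refine hd_congr _ fun c U' hU => ?_
    rw [sh_cons_cons, hU]
    rfl
  · refine mid_congr _ fun D hD => ?_
    rw [sh_cons_cons, hD]

theorem mid_sh_right_cons [Mul R] (a b : R) (U V : List R) (G : List R → X) :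
    mid (fun V' => sh (a :: U) V' G) (b :: V) =
      -(hd (fun c V' => sh U (b * c :: V') (fun D => G (a :: D))) V +
          (-1 : ℤ) ^ (U.length + 1) • hd (fun c V' => sh (a :: U) V' (fun D => G (b * c :: D))) V) -
        (mid (fun V' => sh U (b :: V') (fun D => G (a :: D))) V +
          (-1 : ℤ) ^ (U.length + 1) • mid (fun V' => sh (a :: U) V' (fun D => G (b :: D))) V) := by
  rw [mid_cons, ← hd_smul, ← hd_add, ← mid_smul, ← mid_add]
  simp only [sh_cons_cons]

/-- Two adjacent elements from different lists occur in both orders, in otherwise equal shuffles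
with opposite signs; since they commute, these faces cancel. What remains is the Leibniz rule for
the shuffle product. -/
theorem mid_sh [Mul R] (U V : List R) (G : List R → X)
    (h : ∀ u ∈ U, ∀ v ∈ V, Commute u v) :
    sh U V (mid G) = mid (fun U' => sh U' V G) U +
      (-1 : ℤ) ^ U.length • mid (fun V' => sh U V' G) V := by
  induction U, V using list_two_induction generalizing G with
  | h1 V => simp
  | h2 a U => simp
  | h3 a U b V ih1 ih2 =>
    have hab : a * b = b * a := h a (by simp) b (by simp)
    rw [sh_cons_cons, mid_cons', mid_cons', sh_add, sh_add, sh_smul, sh_smul, sh_smul, sh_smul,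
      hd_sh, hd_sh, ih1 _ fun u hu v hv => h u (List.mem_cons_of_mem _ hu) v hv,
      ih2 _ fun u hu v hv => h u hu v (List.mem_cons_of_mem _ hv), mid_sh_left_cons,
      mid_sh_right_cons, mid_cons, mid_cons]
    simp only [hd_cons, List.length_cons, hab]
    -- The lengths enter only through their parity; after fixing it, the claim is a linear identity.
    rcases neg_one_pow_eq_or ℤ U.length with hs | hs <;> simp only [pow_succ, hs] <;> module

/-- Both sides are the signed sum over the shuffles of three lists; the terms are compared according
to the list which supplies the first element. -/
theorem sh_assoc (U V W : List R) (F : List R → X) :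
    sh U V (fun D => sh D W F) = sh V W (fun D => sh U D F) := by
  induction U generalizing V W F with
  | nil => simp
  | cons a U ihU =>
    induction V generalizing W F with
    | nil => simp
    | cons b V ihV =>
      induction W generalizing F with
      | nil => simp
      | cons c W ihW =>
        have e1 : sh U (b :: V) (fun D => sh (a :: D) (c :: W) F) =
            sh U (b :: V) (fun D => sh D (c :: W) (fun D => F (a :: D))) +
              (-1 : ℤ) ^ (U.length + V.length) •
                sh U (b :: V) (fun D => sh (a :: D) W (fun D => F (c :: D))) := by
          rw [← sh_smul, ← sh_add]
          refine sh_congr _ _ fun D hD => ?_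
          have hl : D.length = U.length + V.length + 1 := by simpa [add_assoc] using hD.length_eq
          rw [sh_cons_cons, hl, pow_succ, pow_succ]
          simp
        have e2 : sh (a :: U) V (fun D => sh (b :: D) (c :: W) F) =
            sh (a :: U) V (fun D => sh D (c :: W) (fun D => F (b :: D))) +
              (-1 : ℤ) ^ (U.length + V.length) •
                sh (a :: U) V (fun D => sh (b :: D) W (fun D => F (c :: D))) := by
          rw [← sh_smul, ← sh_add]
          refine sh_congr _ _ fun D hD => ?_
          have hl : D.length = U.length + V.length + 1 := by
            simpa [add_assoc, add_comm, add_left_comm] using hD.length_eq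
          rw [sh_cons_cons, hl, pow_succ, pow_succ]
          simp
        have e3 := ihW fun D => F (c :: D)
        rw [sh_cons_cons] at e3
        rw [sh_cons_cons, e1, e2, ihU, ihV, sh_cons_cons b c V W fun D => sh (a :: U) D F,
          sh_cons_cons b c V W fun D => sh U D fun D => F (a :: D)]
        simp only [sh_cons_cons a, sh_add, sh_smul]
        rw [← e3]
        rcases neg_one_pow_eq_or ℤ U.length with hs | hs <;>
          rcases neg_one_pow_eq_or ℤ V.length with ht | ht <;>
          simp only [pow_succ, pow_add, hs, ht] <;> module

/-- Besides the faces inside `U` and inside `V` there is one across the junction, the product of the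
last element of `U` with the first element of `V`. -/
theorem mid_append [Mul R] (G : List R → X) (U V : List R) :
    mid G (U ++ V) = mid (fun U' => G (U' ++ V)) U +
      (-1 : ℤ) ^ U.length • lst (fun u U' => hd (fun v V' => G (U' ++ u * v :: V')) V) U +
      (-1 : ℤ) ^ U.length • mid (fun V' => G (U ++ V')) V := by
  induction U generalizing G with
  | nil => simp
  | cons a U ih =>
    rw [List.cons_append, mid_cons, ih, mid_cons, lst_cons]
    rcases U with _ | ⟨b, U⟩
    · simp; abel
    · simp [pow_succ]
      module

theorem lst_append (H : R → List R → X) (U V : List R) :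
    lst H (U ++ V) = lst (fun v V' => H v (U ++ V')) V + if V = [] then lst H U else 0 := by
  induction U generalizing H with
  | nil => cases V <;> simp
  | cons a U ih =>
    rw [List.cons_append, lst_cons, ih]
    rcases V with _ | ⟨b, V⟩
    · simp [lst_cons]
    · simp

theorem hd_append (H : R → List R → X) (U V : List R) :
    hd H (U ++ V) = hd (fun a U' => H a (U' ++ V)) U + if U = [] then hd H V else 0 := by
  cases U <;> simp

/-! #### Faces and cuts -/

/-- A term with empty `U` vanishes, and in all other terms the head of `U` is the head of the whole
list. -/
theorem cut_hd_left (K : R → List R → List R → X) (L : List R) :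
    cut (fun U V => hd (fun a U' => K a U' V) U) L = hd (fun a L' => cut (K a) L') L := by
  cases L with
  | nil => simp
  | cons a L => simp [cut_cons]

/-- A cut after a multiplication puts the product into one of the two segments, so both factors come
from the same segment. The sign counts the elements in front. -/
theorem mid_cut [Mul R] (K : List R → List R → X) (L : List R) :
    mid (cut K) L = cut (fun U V => mid (fun U' => K U' V) U +
      (-1 : ℤ) ^ U.length • mid (fun V' => K U V') V) L := by
  induction L generalizing K with
  | nil => simp
  | cons a L ih =>
    rw [mid_cons]
    simp only [cut_cons, hd_add, mid_add, ← cut_hd_left, mid_nil, List.length_nil, mid_cons _ a,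
      List.length_cons]
    rw [ih fun U V => K (a :: U) V]
    simp only [cut_add, cut_sub, cut_neg, pow_succ, mul_neg, mul_one, neg_smul]
    simp only [pow_zero, one_smul, cut_hd_left]
    abel

theorem cut_lst_right (K : R → List R → List R → X) (L : List R) :
    cut (fun U V => lst (fun v V' => K v U V') V) L = lst (fun v L' => cut (K v) L') L := by
  induction L generalizing K with
  | nil => simp
  | cons a L ih =>
    rw [cut_cons, ih, lst_cons, lst_cons]
    simp only [cut_cons, lst_add, cut_nil]
    abel

/-- Moving the cut by one place turns the head of the right segment into the last element of the
left one. All cancellations between neighbouring segments rest on this. -/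
theorem cut_hd_right (K : List R → R → List R → X) (L : List R) :
    cut (fun U V => hd (fun v V' => K U v V') V) L =
      cut (fun U V => lst (fun u U' => K U' u V) U) L := by
  induction L generalizing K with
  | nil => simp
  | cons a L ih =>
    rw [cut_cons, ih, cut_cons]
    simp only [hd_cons, lst_cons, lst_nil, cut_add]
    have : ∀ (f : List R → X) (M : List R), cut (fun U V => if U = [] then f V else 0) M = f M := by
      intro f M
      cases M with
      | nil => simp
      | cons b M => simp [cut_cons, cut_zero]
    rw [this]
    abel

theorem hd_map {S : Type*} (f : S → R) (H : R → List R → X) (L : List S) :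
    hd H (L.map f) = hd (fun a L' => H (f a) (L'.map f)) L := by
  cases L <;> simp

theorem lst_map {S : Type*} (f : S → R) (H : R → List R → X) (L : List S) :
    lst H (L.map f) = lst (fun a L' => H (f a) (L'.map f)) L := by
  induction L generalizing H with
  | nil => simp
  | cons a L ih => simp [lst_cons, ih]

theorem mid_map {S : Type*} [Mul R] [Mul S] (f : S → R) (hf : ∀ a b, f (a * b) = f a * f b)
    (G : List R → X) (L : List S) :
    mid G (L.map f) = mid (fun L' => G (L'.map f)) L := by
  induction L generalizing G with
  | nil => simp
  | cons a L ih => simp [mid_cons, ih, hd_map, hf]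

end Shuffle

end

section

namespace Shuffle

variable {R : Type*} {X : Type*} [AddCommGroup X]

/-! ### The boundary of a sum over distributions of a list into columns -/

/-- The signed sum over all decompositions of a list into `J` segments, the `j`-th of which is mapped
by `x j`, and over all shuffles of these segments. -/
def colSum (x : ℕ → R → R) : ℕ → List R → (List R → X) → X
  | 0, U, F => if U = [] then F [] else 0
  | J + 1, U, F => cut (fun U₁ U₂ => colSum x J U₁ (fun A => sh A (U₂.map (x J)) F)) U

/-- The boundary of the cyclic bar complex of a monoid, twisted by `t`, as an operator on
functions. -/
def bd [Mul R] (t : R → R) (F : R → List R → X) (ρ : R) (L : List R) : X :=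
  hd (fun a L' => F (ρ * a) L') L + mid (F ρ) L +
    (-1 : ℤ) ^ L.length • lst (fun v L' => F (t v * ρ) L') L

theorem colSum_zero (x : ℕ → R → R) (U : List R) (F : List R → X) :
    colSum x 0 U F = if U = [] then F [] else 0 := rfl

theorem colSum_succ (x : ℕ → R → R) (J : ℕ) (U : List R) (F : List R → X) :
    colSum x (J + 1) U F =
      cut (fun U₁ U₂ => colSum x J U₁ (fun A => sh A (U₂.map (x J)) F)) U := rfl

theorem colSum_add (x : ℕ → R → R) (J : ℕ) (U : List R) (F G : List R → X) :
    colSum x J U (fun A => F A + G A) = colSum x J U F + colSum x J U G := by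
  induction J generalizing U F G with
  | zero => simp only [colSum_zero]; split_ifs <;> simp
  | succ J ih => simp only [colSum_succ, sh_add, ih, cut_add]

theorem colSum_smul (x : ℕ → R → R) (J : ℕ) (U : List R) (c : ℤ) (F : List R → X) :
    colSum x J U (fun A => c • F A) = c • colSum x J U F := by
  induction J generalizing U F with
  | zero => simp only [colSum_zero]; split_ifs <;> simp
  | succ J ih => simp only [colSum_succ, sh_smul, ih, cut_smul]

theorem colSum_zero_right (x : ℕ → R → R) (J : ℕ) (U : List R) :
    colSum x J U (fun _ => (0 : X)) = 0 := by
  simpa using colSum_smul x J U 0 (fun _ => (0 : X))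

theorem colSum_neg (x : ℕ → R → R) (J : ℕ) (U : List R) (F : List R → X) :
    colSum x J U (fun A => -F A) = -colSum x J U F := by
  simpa using colSum_smul x J U (-1) F

/-- An interchange of finite sums. The commutation rules below are of the same kind; they carry the
faces of one list out of the sums over the others. -/
theorem sh_colSum_comm (x : ℕ → R → R) (J : ℕ) (U P Q : List R) (K : List R → List R → X) :
    sh P Q (fun W => colSum x J U (fun A => K A W)) =
      colSum x J U (fun A => sh P Q (fun W => K A W)) := by
  induction P, Q using list_two_induction generalizing K with
  | h1 V => simp
  | h2 a U => simp
  | h3 a P b Q ih1 ih2 => simp only [sh_cons_cons, ih1, ih2, colSum_add, colSum_smul]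

/-- All shuffles of two lists have the same length, so the sign is a constant. -/
theorem sh_sign_smul (P Q : List R) (F : List R → X) :
    sh P Q (fun D => (-1 : ℤ) ^ D.length • F D) =
      (-1 : ℤ) ^ (P.length + Q.length) • sh P Q F := by
  rw [← sh_smul]
  refine sh_congr _ _ fun D hD => ?_
  rw [hD.length_eq, List.length_append]

theorem sh_hd_comm (P Q L : List R) (K : R → List R → List R → X) :
    sh P Q (fun W => hd (fun v L' => K v L' W) L) = hd (fun v L' => sh P Q (K v L')) L := by
  cases L <;> simp [sh_zero]

theorem sh_lst_comm (P Q L : List R) (K : R → List R → List R → X) :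
    sh P Q (fun W => lst (fun v L' => K v L' W) L) = lst (fun v L' => sh P Q (K v L')) L := by
  induction L generalizing K with
  | nil => simp [sh_zero]
  | cons a L ih =>
    simp only [lst_cons, sh_add, ih]
    split_ifs <;> simp [sh_zero]

theorem sh_mid_comm [Mul R] (P Q L : List R) (K : List R → List R → X) :
    sh P Q (fun W => mid (fun L' => K L' W) L) = mid (fun L' => sh P Q (K L')) L := by
  induction L generalizing K with
  | nil => simp [sh_zero]
  | cons a L ih => simp only [mid_cons, sh_sub, sh_neg, ih, sh_hd_comm]

theorem colSum_hd_comm (x : ℕ → R → R) (J : ℕ) (U L : List R) (K : R → List R → List R → X) :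
    colSum x J U (fun W => hd (fun v L' => K v L' W) L) =
      hd (fun v L' => colSum x J U (K v L')) L := by
  cases L <;> simp [colSum_zero_right]

theorem colSum_lst_comm (x : ℕ → R → R) (J : ℕ) (U L : List R) (K : R → List R → List R → X) :
    colSum x J U (fun W => lst (fun v L' => K v L' W) L) =
      lst (fun v L' => colSum x J U (K v L')) L := by
  induction L generalizing K with
  | nil => simp [colSum_zero_right]
  | cons a L ih =>
    simp only [lst_cons, colSum_add, ih]
    split_ifs <;> simp [colSum_zero_right]

theorem colSum_mid_comm [Mul R] (x : ℕ → R → R) (J : ℕ) (U L : List R) (K : List R → List R → X) :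
    colSum x J U (fun W => mid (fun L' => K L' W) L) = mid (fun L' => colSum x J U (K L')) L := by
  induction L generalizing K with
  | nil => simp [colSum_zero_right]
  | cons a L ih =>
    simp only [mid_cons, sub_eq_add_neg, colSum_add, colSum_neg, ih, colSum_hd_comm]

theorem cut_hd_comm (L M : List R) (K : R → List R → List R → List R → X) :
    cut (fun U V => hd (fun v M' => K v M' U V) M) L = hd (fun v M' => cut (K v M') L) M := by
  cases M <;> simp [cut_zero]

theorem cut_lst_comm (L M : List R) (K : R → List R → List R → List R → X) :
    cut (fun U V => lst (fun v M' => K v M' U V) M) L = lst (fun v M' => cut (K v M') L) M := by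
  induction M generalizing K with
  | nil => simp [cut_zero]
  | cons a M ih =>
    simp only [lst_cons, cut_add, ih]
    split_ifs <;> simp [cut_zero]

theorem cut_mid_comm [Mul R] (L M : List R) (K : List R → List R → List R → X) :
    cut (fun U V => mid (fun M' => K M' U V) M) L = mid (fun M' => cut (K M') L) M := by
  induction M generalizing K with
  | nil => simp [cut_zero]
  | cons a M ih => simp only [mid_cons, cut_sub, cut_neg, ih, cut_hd_comm]

/-- Exchanging the last column with the list which is shuffled with the columns. -/
theorem colSum_succ_sh (x : ℕ → R → R) (J : ℕ) (L V : List R) (F : List R → X) :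
    colSum x (J + 1) L (fun A => sh A V F) =
      cut (fun U₁ U₂ => sh (U₂.map (x J)) V (fun W => colSum x J U₁ (fun A => sh A W F))) L := by
  simp only [colSum_succ, sh_assoc, sh_colSum_comm]

/-- Faces which mix two columns, or a column and `V`, cancel as in `mid_sh`. Faces inside a column
come from multiplying neighbours in `L`, because a column is filled by a segment of `L` and each `x
j` is multiplicative. -/
theorem mid_colSum_sh [Mul R] {x : ℕ → R → R} (hx : ∀ j a b, x j (a * b) = x j a * x j b)
    (hc : ∀ i j a b, i ≠ j → Commute (x i a) (x j b)) (J : ℕ) (L V : List R) (G : List R → X)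
    (hV : ∀ j < J, ∀ a, ∀ v ∈ V, Commute (x j a) v) :
    colSum x J L (fun A => sh A V (mid G)) =
      mid (fun L' => colSum x J L' (fun A => sh A V G)) L +
        (-1 : ℤ) ^ L.length • colSum x J L (fun A => mid (fun V' => sh A V' G) V) := by
  induction J generalizing L V with
  | zero =>
    simp only [colSum_zero]
    -- Without columns only `L = []` contributes. A singleton has no inner face, and a face of a
    -- longer list is still nonempty.
    rcases L with _ | ⟨a, _ | ⟨b, L⟩⟩
    · simp
    · simp [mid_cons]
    · have : mid (fun L' => if L' = [] then sh [] V G else 0) (a :: b :: L) = 0 := by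
        refine (mid_congr _ (G := fun _ => 0) fun D hD => ?_).trans ?_
        · rw [if_neg]; rintro rfl; simp at hD
        · simpa using mid_smul (a :: b :: L) 0 (fun _ => (0 : X))
      rw [this]; simp
  | succ J ih =>
    -- The last column, filled by `U₂`, is first shuffled with `V`; the induction hypothesis then
    -- applies to the columns filled by `U₁`, with this shuffle as the outer list.
    have h1 : ∀ U₁ U₂, L = U₁ ++ U₂ →
        sh (U₂.map (x J)) V (fun W => colSum x J U₁ (fun A => sh A W (mid G))) =
        (mid (fun U₁ => sh (U₂.map (x J)) V (fun W => colSum x J U₁ (fun A => sh A W G))) U₁ +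
        (-1 : ℤ) ^ U₁.length •
          mid (fun U₂ => sh (U₂.map (x J)) V (fun W => colSum x J U₁ (fun A => sh A W G))) U₂) +
        (-1 : ℤ) ^ L.length • mid (fun V' =>
          sh (U₂.map (x J)) V' (fun W => colSum x J U₁ (fun A => sh A W G))) V := by
      intro U₁ U₂ hL
      have h2 : sh (U₂.map (x J)) V (fun W => colSum x J U₁ (fun A => sh A W (mid G))) =
          sh (U₂.map (x J)) V (fun W => mid (fun U₁ => colSum x J U₁ (fun A => sh A W G)) U₁ +
            (-1 : ℤ) ^ U₁.length • colSum x J U₁ (fun A => mid (fun V' => sh A V' G) W)) := by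
        refine sh_congr _ _ fun D hD => ih _ _ fun j hj a v hv => ?_
        rcases List.mem_append.1 (hD.mem_iff.1 hv) with h3 | h3
        · obtain ⟨u, _, rfl⟩ := List.mem_map.1 h3
          exact hc _ _ _ _ hj.ne
        · exact hV j (by omega) a v h3
      have h4 : ∀ A, sh (U₂.map (x J)) V (mid fun V' => sh A V' G) =
          mid (fun U₂ => sh (U₂.map (x J)) V fun V' => sh A V' G) U₂ +
          (-1 : ℤ) ^ U₂.length • mid (fun V' => sh (U₂.map (x J)) V' fun V' => sh A V' G) V := by
        intro A
        rw [mid_sh, mid_map _ (hx J), List.length_map]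
        intro u hu v hv
        obtain ⟨u, _, rfl⟩ := List.mem_map.1 hu
        exact hV J (by omega) u v hv
      rw [h2, sh_add, sh_smul, sh_mid_comm, sh_colSum_comm]
      simp only [h4, colSum_add, colSum_smul, colSum_mid_comm, ← sh_colSum_comm]
      rw [hL, List.length_append, smul_add, smul_smul, ← pow_add, add_assoc]
    rw [colSum_succ_sh, cut_congr _ h1, cut_add, ← mid_cut, cut_smul, cut_mid_comm]
    simp only [colSum_mid_comm, colSum_succ_sh]

/-- The outer faces of a sum over distributions into columns: the faces of neighbouring columns
cancel. -/
theorem outer_colSum_sh [Mul R] {x : ℕ → R → R} {t : R → R}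
    (J : ℕ) (ρ : R) (ht : ∀ j < J, ∀ a, t (x j a) * ρ = ρ * x (j + 1) a)
    (F : R → List R → X) (L V : List R) :
    colSum x J L (fun A => sh A V (fun D => hd (fun a D' => F (ρ * a) D') D +
      (-1 : ℤ) ^ D.length • lst (fun v D' => F (t v * ρ) D') D)) =
      hd (fun b L' => colSum x J L' (fun A => sh A V (F (ρ * x 0 b)))) L +
      (-1 : ℤ) ^ L.length • lst (fun b L' => colSum x J L' (fun A => sh A V (F (ρ * x J b)))) L +
      (-1 : ℤ) ^ L.length • colSum x J L (fun A => hd (fun v V' => sh A V' (F (ρ * v))) V +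
        (-1 : ℤ) ^ V.length • lst (fun v V' => sh A V' (F (t v * ρ))) V) := by
  induction J generalizing L V with
  | zero =>
    simp only [colSum_zero]
    rcases L with _ | ⟨a, _ | ⟨b, L⟩⟩
    · simp
    · simp
    · have : ∀ K : R → List R → X, lst (fun b L' => if L' = [] then K b L' else 0) (a :: b :: L) =
          lst (fun _ _ => (0 : ℤ) • (0 : X)) (a :: b :: L) := by
        intro K
        refine lst_congr _ fun v L' hL => ?_
        rw [if_neg, smul_zero]
        rintro rfl
        simpa using congrArg List.length hL
      rw [this, lst_smul]; simp
  | succ J ih =>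
    specialize ih (fun j hj => ht j (by omega))
    have h1 : ∀ U₁ U₂, L = U₁ ++ U₂ →
        sh (U₂.map (x J)) V (fun W => colSum x J U₁ (fun A => sh A W
          (fun D => hd (fun a D' => F (ρ * a) D') D +
            (-1 : ℤ) ^ D.length • lst (fun v D' => F (t v * ρ) D') D))) =
        (hd (fun b U₁ => sh (U₂.map (x J)) V
            (fun W => colSum x J U₁ (fun A => sh A W (F (ρ * x 0 b))))) U₁ +
        ((-1 : ℤ) ^ U₁.length • lst (fun b U₁ => sh (U₂.map (x J)) V
            (fun W => colSum x J U₁ (fun A => sh A W (F (ρ * x J b))))) U₁ +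
        (-1 : ℤ) ^ U₁.length • hd (fun b U₂ => sh (U₂.map (x J)) V
            (fun W => colSum x J U₁ (fun A => sh A W (F (ρ * x J b))))) U₂)) +
        ((-1 : ℤ) ^ L.length • lst (fun b U₂ => sh (U₂.map (x J)) V
            (fun W => colSum x J U₁ (fun A => sh A W (F (ρ * x (J + 1) b))))) U₂ +
        (-1 : ℤ) ^ L.length • (hd (fun v V' => sh (U₂.map (x J)) V'
            (fun W => colSum x J U₁ (fun A => sh A W (F (ρ * v))))) V +
          (-1 : ℤ) ^ V.length • lst (fun v V' => sh (U₂.map (x J)) V'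
            (fun W => colSum x J U₁ (fun A => sh A W (F (t v * ρ))))) V)) := by
      intro U₁ U₂ hL
      simp only [ih]
      simp only [sh_add, sh_smul, sh_hd_comm, sh_lst_comm, sh_colSum_comm, sh_sign_smul, hd_sh, lst_sh,
        hd_map, lst_map, List.length_map, colSum_add, colSum_smul, colSum_hd_comm, colSum_lst_comm,
        ht J (by omega)]
      rw [hL, List.length_append]
      rcases neg_one_pow_eq_or ℤ U₁.length with hs | hs <;>
        rcases neg_one_pow_eq_or ℤ U₂.length with ht | ht <;>
        rcases neg_one_pow_eq_or ℤ V.length with hv | hv <;>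
        simp only [pow_add, hs, ht, hv] <;> module
    -- This is the cancellation between neighbouring columns. The surviving last face of the earlier
    -- columns and the first face of the column `J` both multiply the first row by `x J b`; they
    -- differ by moving the cut over `b`, and in sign.
    have h3 : cut (fun U₁ U₂ => (-1 : ℤ) ^ U₁.length • lst (fun b U₁ => sh (U₂.map (x J)) V
            (fun W => colSum x J U₁ (fun A => sh A W (F (ρ * x J b))))) U₁ +
        (-1 : ℤ) ^ U₁.length • hd (fun b U₂ => sh (U₂.map (x J)) V
            (fun W => colSum x J U₁ (fun A => sh A W (F (ρ * x J b))))) U₂) L = 0 := by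
      have h4 : ∀ (U₁ U₂ : List R), (-1 : ℤ) ^ U₁.length • lst (fun b U₁ => sh (U₂.map (x J)) V
            (fun W => colSum x J U₁ (fun A => sh A W (F (ρ * x J b))))) U₁ =
          lst (fun b U₁ => -((-1 : ℤ) ^ U₁.length • sh (U₂.map (x J)) V
            (fun W => colSum x J U₁ (fun A => sh A W (F (ρ * x J b)))))) U₁ := by
        intro U₁ U₂
        rw [← lst_smul]
        refine lst_congr _ fun v L' h => ?_
        rw [h, List.length_append, List.length_singleton, pow_succ]
        simp
      simp only [h4, cut_add, ← hd_smul]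
      rw [cut_hd_right, ← cut_add]
      simp [← lst_add, lst_zero, cut_zero]
    rw [colSum_succ_sh, cut_congr _ h1, cut_add, cut_add, h3, add_zero, cut_hd_left, cut_add,
      cut_smul, cut_lst_right, cut_smul, cut_add, cut_smul, cut_hd_comm, cut_lst_comm]
    simp only [colSum_add, colSum_smul, colSum_hd_comm, colSum_lst_comm, colSum_succ_sh]
    abel

end Shuffle

end

section

namespace Shuffle

variable {R : Type*} {X : Type*} [AddCommGroup X]

/-! ### The homotopy between two consecutive partial subdivisions -/

/-- The maps of a monoid of rows which enter the homotopy: `x j` moves the first column into the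
column `j`, while `y`, `w` and `z` move blocks of columns to the right end; `e` moves a column and
`k` concatenates columns into the first one, and `t` rotates the columns. -/
structure RowData (R : Type*) [Monoid R] where
  /-- the number of single columns -/
  J : ℕ
  t : R → R
  x : ℕ → R → R
  y : R → R
  w : R → R
  z : R → R
  e : R → R
  k : R → R
  x_mul : ∀ j a b, x j (a * b) = x j a * x j b
  y_mul : ∀ a b, y (a * b) = y a * y b
  w_mul : ∀ a b, w (a * b) = w a * w b
  z_mul : ∀ a b, z (a * b) = z a * z b
  e_mul : ∀ a b, e (a * b) = e a * e b
  e_one : e 1 = 1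
  comm_xx : ∀ i j a b, i ≠ j → Commute (x i a) (x j b)
  comm_xy : ∀ j ≤ J, ∀ a b, Commute (x j a) (y b)
  comm_xw : ∀ j ≤ J, ∀ a b, Commute (x j a) (w b)
  comm_xz : ∀ j < J, ∀ a b, Commute (x j a) (z b)
  comm_xe : ∀ j, 0 < j → ∀ a b, Commute (x j a) (e b)
  comm_xk : ∀ j, 0 < j → ∀ a b, Commute (x j a) (k b)
  comm_ye : ∀ a b, Commute (y a) (e b)
  comm_yk : ∀ a b, Commute (y a) (k b)
  t_x : ∀ j < J, ∀ a, t (x j a) = x (j + 1) a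
  z_eq : ∀ a, z a = x J a * w a
  t_z : ∀ a, t (z a) = y a * e a
  w_t : ∀ a, w (t a) = y a
  k_t : ∀ a b, k (t a * b) * x 0 (t a) = e a * k (b * a)

/-- The sum over all decompositions of a list into four segments. -/
def cut4 (K : List R → List R → List R → List R → X) (L : List R) : X :=
  cut (fun L₁ Y => cut (fun U V => cut (fun U₁ U₂ => K U₁ U₂ V Y) U) L₁) L

theorem cut4_congr (L : List R) {K K' : List R → List R → List R → List R → X}
    (h : ∀ U₁ U₂ V Y, L = U₁ ++ U₂ ++ V ++ Y → K U₁ U₂ V Y = K' U₁ U₂ V Y) :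
    cut4 K L = cut4 K' L := by
  refine cut_congr _ fun L₁ Y h1 => cut_congr _ fun U V h2 => cut_congr _ fun U₁ U₂ h3 => ?_
  subst h3 h2 h1
  exact h _ _ _ _ rfl

theorem cut4_add (L : List R) (K K' : List R → List R → List R → List R → X) :
    cut4 (fun U₁ U₂ V Y => K U₁ U₂ V Y + K' U₁ U₂ V Y) L = cut4 K L + cut4 K' L := by
  simp only [cut4, cut_add]

theorem cut4_smul (L : List R) (c : ℤ) (K : List R → List R → List R → List R → X) :
    cut4 (fun U₁ U₂ V Y => c • K U₁ U₂ V Y) L = c • cut4 K L := by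
  simp only [cut4, cut_smul]

/-- An application of `mid_cut` for each of the three cuts; a face in a segment carries the sign of
the segments in front of it. -/
theorem mid_cut4 [Mul R] (K : List R → List R → List R → List R → X) (L : List R) :
    mid (cut4 K) L = cut4 (fun U₁ U₂ V Y =>
      mid (fun U₁ => K U₁ U₂ V Y) U₁ + (-1 : ℤ) ^ U₁.length • mid (fun U₂ => K U₁ U₂ V Y) U₂ +
      (-1 : ℤ) ^ (U₁.length + U₂.length) • mid (fun V => K U₁ U₂ V Y) V +
      (-1 : ℤ) ^ (U₁.length + U₂.length + V.length) • mid (fun Y => K U₁ U₂ V Y) Y) L := by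
  have h1 : ∀ (V Y L : List R), mid (fun U => cut (fun U₁ U₂ => K U₁ U₂ V Y) U) L = _ :=
    fun V Y L => mid_cut (fun U₁ U₂ => K U₁ U₂ V Y) L
  have h2 : ∀ (Y L : List R), mid (fun L₁ => cut (fun U V => cut (fun U₁ U₂ => K U₁ U₂ V Y) U) L₁) L
      = _ := fun Y L => mid_cut (fun U V => cut (fun U₁ U₂ => K U₁ U₂ V Y) U) L
  refine (mid_cut _ L).trans (cut_congr _ fun L₁ Y _ => ?_)
  rw [h2, ← cut_mid_comm, ← cut_smul, ← cut_add]
  refine cut_congr _ fun U V hL => ?_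
  simp only [← cut_mid_comm]
  rw [h1, ← cut_smul, ← cut_smul, ← cut_add, ← cut_add]
  refine cut_congr _ fun U₁ U₂ hU => ?_
  simp only [hL, hU, List.length_append]

theorem cut4_hd₁ (K : R → List R → List R → List R → List R → X) (L : List R) :
    cut4 (fun U₁ U₂ V Y => hd (fun b U₁ => K b U₁ U₂ V Y) U₁) L =
      hd (fun b L' => cut4 (K b) L') L := by
  simp only [cut4, cut_hd_left]

theorem cut4_lst₄ (K : R → List R → List R → List R → List R → X) (L : List R) :
    cut4 (fun U₁ U₂ V Y => lst (fun b Y => K b U₁ U₂ V Y) Y) L =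
      lst (fun b L' => cut4 (K b) L') L := by
  simp only [cut4, cut_lst_comm, cut_lst_right]

/-- As in `cut_hd_right`, the head of a segment becomes the last element of the preceding one when
the border moves. The next two rules do the same at the other two borders. -/
theorem cut4_hd₂ (K : R → List R → List R → List R → List R → X) (L : List R) :
    cut4 (fun U₁ U₂ V Y => hd (fun b U₂ => K b U₁ U₂ V Y) U₂) L =
      cut4 (fun U₁ U₂ V Y => lst (fun b U₁ => K b U₁ U₂ V Y) U₁) L := by
  simp only [cut4, cut_hd_right (fun U b V => K b U V _ _)]

theorem cut4_hd₃ (K : R → List R → List R → List R → List R → X) (L : List R) :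
    cut4 (fun U₁ U₂ V Y => hd (fun b V => K b U₁ U₂ V Y) V) L =
      cut4 (fun U₁ U₂ V Y => lst (fun b U₂ => K b U₁ U₂ V Y) U₂) L := by
  simp only [cut4, cut_lst_right (fun b U V => K b U V _ _), cut_hd_comm]
  simp only [cut_hd_right (fun U b V => cut (fun U₁ U₂ => K b U₁ U₂ V _) U)]

theorem cut4_hd₄ (K : R → List R → List R → List R → List R → X) (L : List R) :
    cut4 (fun U₁ U₂ V Y => hd (fun b Y => K b U₁ U₂ V Y) Y) L =
      cut4 (fun U₁ U₂ V Y => lst (fun b V => K b U₁ U₂ V Y) V) L := by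
  simp only [cut4, cut_hd_comm, cut_lst_comm, cut_lst_right (fun b U V => cut (fun U₁ U₂ => K b U₁ U₂ V _) U)]
  rw [cut_hd_right (fun U b Y => cut (fun U V => cut (fun U₁ U₂ => K b U₁ U₂ V Y) U) U)]

theorem sh_ite_nil (U V : List R) (c : X) :
    sh U V (fun B => if B = [] then c else 0) = if U = [] ∧ V = [] then c else 0 := by
  by_cases h : U = [] ∧ V = []
  · rw [h.1, h.2]; simp
  · rw [if_neg h]
    refine (sh_congr _ _ (G := fun _ => 0) fun B hB => if_neg ?_).trans (sh_zero _ _)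
    rintro rfl
    exact h (List.append_eq_nil_iff.1 (List.length_eq_zero_iff.1 hB.length_eq.symm))

variable [Monoid R] (D : RowData R)

/-- The terms of the homotopy with given first row and given middle row. -/
def core (F : R → List R → X) (ρ ω : R) (U₁ U₂ V Y : List R) : X :=
  colSum D.x D.J U₁ (fun A => sh (U₂.map (D.x D.J)) (Y.map D.y) (fun B =>
    sh A (B ++ ω :: V.map D.z) (F ρ)))

/-- The homotopy. -/
def phi (F : R → List R → X) (a : R) (L : List R) : X :=
  cut4 (fun U₁ U₂ V Y => (-1 : ℤ) ^ (U₁.length + U₂.length + Y.length + 1 + Y.length * V.length) •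
    core D F (D.e Y.prod * D.k (a * L.prod) * D.x 0 a) (D.w (a * (U₁.prod * U₂.prod))) U₁ U₂ V Y) L

/-- The start of the homotopy. -/
def gFrom (F : R → List R → X) (a : R) (L : List R) : X :=
  cut (fun U V => colSum D.x D.J U (fun A => sh A (V.map D.z)
    (F (D.k (a * L.prod) * D.x 0 a * D.w (a * U.prod))))) L

/-- The end of the homotopy. -/
def gTo (F : R → List R → X) (a : R) (L : List R) : X :=
  cut (fun U Y => colSum D.x (D.J + 1) U (fun A => sh A (Y.map D.y)
    (F (D.t (D.w (a * U.prod)) * (D.e Y.prod * D.k (a * L.prod) * D.x 0 a))))) L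

/-- The inner faces come from `mid_colSum_sh`, the outer ones from `outer_colSum_sh`. Apart from the
faces of the columns, the boundary only concerns `W`, with the sign of passing `U`. -/
theorem colSum_sh_bd {x : ℕ → R → R} {t : R → R} (hx : ∀ j a b, x j (a * b) = x j a * x j b)
    (hc : ∀ i j a b, i ≠ j → Commute (x i a) (x j b)) (J : ℕ) (ρ : R)
    (ht : ∀ j < J, ∀ a, t (x j a) * ρ = ρ * x (j + 1) a) (F : R → List R → X) (U W : List R)
    (hW : ∀ j < J, ∀ a, ∀ v ∈ W, Commute (x j a) v) :
    colSum x J U (fun A => sh A W (bd t F ρ)) =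
      mid (fun U => colSum x J U (fun A => sh A W (F ρ))) U +
      hd (fun b U => colSum x J U (fun A => sh A W (F (ρ * x 0 b)))) U +
      (-1 : ℤ) ^ U.length • lst (fun b U => colSum x J U (fun A => sh A W (F (ρ * x J b)))) U +
      (-1 : ℤ) ^ U.length • bd t (fun ρ W => colSum x J U (fun A => sh A W (F ρ))) ρ W := by
  have h1 : ∀ A : List R, sh A W (bd t F ρ) = sh A W (mid (F ρ)) +
      sh A W (fun D => hd (fun a D' => F (ρ * a) D') D +
        (-1 : ℤ) ^ D.length • lst (fun v D' => F (t v * ρ) D') D) := by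
    intro A
    rw [← sh_add]
    refine sh_congr _ _ fun B _ => ?_
    rw [bd]
    abel
  simp only [h1, colSum_add]
  rw [mid_colSum_sh hx hc J U W _ hW, outer_colSum_sh J ρ ht F U W, bd]
  simp only [colSum_add, colSum_smul, colSum_hd_comm, colSum_lst_comm, colSum_mid_comm]
  module

/-- These are all the faces of a chain with first row `ρ` whose further rows are a shuffle of two
blocks, a marked row `ω` and a third block. The abbreviation `c` allows each face to be written as
the same sum with changed segments or rows. -/
theorem sh_bd_append {x y z t : R → R} (hx : ∀ a b, x (a * b) = x a * x b)
    (hy : ∀ a b, y (a * b) = y a * y b) (hz : ∀ a b, z (a * b) = z a * z b)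
    (hxy : ∀ a b, Commute (x a) (y b)) (Q : R → List R → X) (ρ ω : R) (U V Y : List R)
    {c : R → R → List R → List R → List R → X}
    (hc : ∀ ρ ω U V Y, c ρ ω U V Y =
      sh (U.map x) (Y.map y) (fun B => Q ρ (B ++ ω :: V.map z))) :
    sh (U.map x) (Y.map y) (fun B => bd t Q ρ (B ++ ω :: V.map z)) =
      mid (fun U => c ρ ω U V Y) U + (-1 : ℤ) ^ U.length • mid (fun Y => c ρ ω U V Y) Y +
      (-1 : ℤ) ^ (U.length + Y.length) • lst (fun b Y => c ρ (y b * ω) U V Y) Y +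
      (-1 : ℤ) ^ U.length • lst (fun b U => c ρ (x b * ω) U V Y) U -
      (-1 : ℤ) ^ (U.length + Y.length) • hd (fun b V => c ρ (ω * z b) U V Y) V -
      (-1 : ℤ) ^ (U.length + Y.length) • mid (fun V => c ρ ω U V Y) V +
      hd (fun b U => c (ρ * x b) ω U V Y) U +
      (-1 : ℤ) ^ U.length • hd (fun b Y => c (ρ * y b) ω U V Y) Y +
      (if U = [] ∧ Y = [] then Q (ρ * ω) (V.map z) else 0) -
      (-1 : ℤ) ^ (U.length + Y.length + V.length) • lst (fun b V => c (t (z b) * ρ) ω U V Y) V -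
      (-1 : ℤ) ^ (U.length + Y.length + V.length) •
        (if V = [] then sh (U.map x) (Y.map y) (Q (t ω * ρ)) else 0) := by
  have hcom : ∀ u ∈ U.map x, ∀ v ∈ Y.map y, Commute u v := by
    intro u hu v hv
    obtain ⟨u, _, rfl⟩ := List.mem_map.1 hu
    obtain ⟨v, _, rfl⟩ := List.mem_map.1 hv
    exact hxy u v
  -- The two conditional terms are the faces in which `ω` meets the first row: directly if `B` is
  -- empty, around the cycle if `V` is empty.
  have h1 : ∀ B : List R, bd t Q ρ (B ++ ω :: V.map z) =
      hd (fun a B => Q (ρ * a) (B ++ ω :: V.map z)) B +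
      (if B = [] then Q (ρ * ω) (V.map z) else 0) +
      mid (fun B => Q ρ (B ++ ω :: V.map z)) B +
      (-1 : ℤ) ^ B.length • lst (fun u B => Q ρ (B ++ (u * ω) :: V.map z)) B -
      (-1 : ℤ) ^ B.length • hd (fun b V => Q ρ (B ++ (ω * z b) :: V.map z)) V -
      (-1 : ℤ) ^ B.length • mid (fun V => Q ρ (B ++ ω :: V.map z)) V -
      (-1 : ℤ) ^ B.length • (-1 : ℤ) ^ V.length • lst (fun b V => Q (t (z b) * ρ) (B ++ ω :: V.map z)) V -
      (-1 : ℤ) ^ B.length • (-1 : ℤ) ^ V.length • (if V = [] then Q (t ω * ρ) B else 0) := by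
    intro B
    rw [bd, hd_append, mid_append, mid_cons, lst_append, lst_cons]
    simp only [hd_cons, hd_map, lst_map, mid_map z hz, List.length_append, List.length_cons,
      List.length_map, List.map_eq_nil_iff, reduceCtorEq, if_false, add_zero, List.append_nil]
    simp only [pow_add, pow_one]
    split_ifs <;> module
  simp only [h1, sh_add, sh_sub, sh_sign_smul, sh_smul, hd_sh, lst_sh, sh_ite_nil, mid_sh _ _ _ hcom,
    sh_hd_comm, sh_lst_comm, sh_mid_comm, hc, hd_map, lst_map, mid_map x hx, mid_map y hy,
    List.length_map, List.map_eq_nil_iff]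
  have h2 : sh (U.map x) (Y.map y) (fun B => if V = [] then Q (t ω * ρ) B else 0) =
      if V = [] then sh (U.map x) (Y.map y) (Q (t ω * ρ)) else 0 := by
    split_ifs
    · rfl
    · exact sh_zero _ _
  rw [h2]
  rcases neg_one_pow_eq_or ℤ U.length with hs | hs <;>
    rcases neg_one_pow_eq_or ℤ Y.length with ht | ht <;>
    rcases neg_one_pow_eq_or ℤ V.length with hv | hv <;>
    simp only [pow_add, hs, ht, hv] <;> module

end Shuffle

end

/-! ### The boundary of the homotopy between two consecutive partial subdivisions -/

section

namespace Shuffle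

variable {R : Type*} {X : Type*} [AddCommGroup X] [Monoid R] (D : RowData R)

/-- An inner face shortens a list by one and keeps its product. The first and the middle row of a
term of the homotopy depend on the segments only through products, so inner faces do not affect
them. -/
theorem mid_congr_prod (L : List R) {F G : List R → X}
    (h : ∀ E : List R, E.length + 1 = L.length → E.prod = L.prod → F E = G E) :
    mid F L = mid G L := by
  induction L generalizing F G with
  | nil => simp
  | cons a L ih =>
    rw [mid_cons, mid_cons, ih fun E hE hE' => h (a :: E) (by simp [← hE]) (by simp [hE'])]
    congr 2
    refine hd_congr _ fun b L' hL => h _ ?_ ?_ <;> rw [hL] <;> simp [mul_assoc]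

omit [Monoid R] in
theorem cut4_neg (L : List R) (K : List R → List R → List R → List R → X) :
    cut4 (fun U₁ U₂ V Y => -K U₁ U₂ V Y) L = -cut4 K L := by
  simp only [cut4, cut_neg]

omit [Monoid R] in
theorem cut_ite_right_nil (f : List R → X) (L : List R) :
    cut (fun U V => if V = [] then f U else 0) L = f L := by
  induction L generalizing f with
  | nil => simp
  | cons a L ih => simp [cut_cons, ih fun U => f (a :: U)]

omit [Monoid R] in
theorem cut_ite_left_nil (f : List R → X) (L : List R) :
    cut (fun U V => if U = [] then f V else 0) L = f L := by
  cases L with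
  | nil => simp
  | cons b M => simp [cut_cons, cut_zero]

/-- The sign of a term of the homotopy. -/
def phiSign (U₁ U₂ V Y : List R) : ℤ :=
  (-1 : ℤ) ^ (U₁.length + U₂.length + Y.length + 1 + Y.length * V.length)

section Sign
omit [Monoid R]

variable {U₁ U₂ V Y E : List R}

theorem phiSign_fst (h : E.length + 1 = U₁.length) :
    phiSign U₁ U₂ V Y = -phiSign E U₂ V Y := by
  simp only [phiSign, ← h, pow_add, pow_one]; ring

theorem phiSign_snd (h : E.length + 1 = U₂.length) :
    phiSign U₁ U₂ V Y = -phiSign U₁ E V Y := by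
  simp only [phiSign, ← h, pow_add, pow_one]; ring

/-- The exponent contains `Y.length * V.length`, the sign of exchanging two blocks: `Y` follows `V`
in the argument and precedes it in the result. Hence shortening one of them brings in the length of
the other. -/
theorem phiSign_trd (h : E.length + 1 = V.length) :
    phiSign U₁ U₂ V Y = (-1) ^ Y.length * phiSign U₁ U₂ E Y := by
  simp only [phiSign, ← h, pow_add, pow_one, mul_add, mul_one]; ring

theorem phiSign_fth (h : E.length + 1 = Y.length) :
    phiSign U₁ U₂ V Y = -((-1) ^ V.length * phiSign U₁ U₂ V E) := by
  simp only [phiSign, ← h, pow_add, pow_one, add_mul, one_mul]; ring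

end Sign

theorem core_comm (F : R → List R → X) (ρ ω : R) (U₁ U₂ V Y : List R) :
    core D F ρ ω U₁ U₂ V Y = sh (U₂.map (D.x D.J)) (Y.map D.y) (fun B =>
      colSum D.x D.J U₁ (fun A => sh A (B ++ ω :: V.map D.z) (F ρ))) := by
  rw [sh_colSum_comm]; rfl

/-- The first row of a term of the homotopy. -/
def phiRow (u a : R) (Y : List R) : R := D.e Y.prod * D.k u * D.x 0 a

/-- The middle row of a term of the homotopy. -/
def phiMid (a : R) (U₁ U₂ : List R) : R := D.w (a * (U₁.prod * U₂.prod))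

/-- The columns filled by `U₁` are treated by `colSum_sh_bd`, with everything else as the outer
list; the boundary of the outer list is given by `sh_bd_append`. -/
theorem core_bd (F : R → List R → X) (ρ ω : R)
    (ht : ∀ j < D.J, ∀ a, D.t (D.x j a) * ρ = ρ * D.x (j + 1) a) (U₁ U₂ V Y : List R)
    (hω : ∀ j < D.J, ∀ a, Commute (D.x j a) ω) :
    core D (bd D.t F) ρ ω U₁ U₂ V Y =
      mid (fun U₁ => core D F ρ ω U₁ U₂ V Y) U₁ +
      hd (fun b U₁ => core D F (ρ * D.x 0 b) ω U₁ U₂ V Y) U₁ +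
      (-1 : ℤ) ^ U₁.length • lst (fun b U₁ => core D F (ρ * D.x D.J b) ω U₁ U₂ V Y) U₁ +
      (-1 : ℤ) ^ U₁.length • (
      mid (fun U₂ => core D F ρ ω U₁ U₂ V Y) U₂ +
      (-1 : ℤ) ^ U₂.length • mid (fun Y => core D F ρ ω U₁ U₂ V Y) Y +
      (-1 : ℤ) ^ (U₂.length + Y.length) • lst (fun b Y => core D F ρ (D.y b * ω) U₁ U₂ V Y) Y +
      (-1 : ℤ) ^ U₂.length • lst (fun b U₂ => core D F ρ (D.x D.J b * ω) U₁ U₂ V Y) U₂ -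
      (-1 : ℤ) ^ (U₂.length + Y.length) • hd (fun b V => core D F ρ (ω * D.z b) U₁ U₂ V Y) V -
      (-1 : ℤ) ^ (U₂.length + Y.length) • mid (fun V => core D F ρ ω U₁ U₂ V Y) V +
      hd (fun b U₂ => core D F (ρ * D.x D.J b) ω U₁ U₂ V Y) U₂ +
      (-1 : ℤ) ^ U₂.length • hd (fun b Y => core D F (ρ * D.y b) ω U₁ U₂ V Y) Y +
      (if U₂ = [] ∧ Y = [] then
        colSum D.x D.J U₁ (fun A => sh A (V.map D.z) (F (ρ * ω))) else 0) -
      (-1 : ℤ) ^ (U₂.length + Y.length + V.length) •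
        lst (fun b V => core D F (D.t (D.z b) * ρ) ω U₁ U₂ V Y) V -
      (-1 : ℤ) ^ (U₂.length + Y.length + V.length) •
        (if V = [] then sh (U₂.map (D.x D.J)) (Y.map D.y)
          (fun W => colSum D.x D.J U₁ (fun A => sh A W (F (D.t ω * ρ)))) else 0)) := by
  have h1 := sh_bd_append (t := D.t) (D.x_mul D.J) D.y_mul D.z_mul (D.comm_xy D.J le_rfl)
    (fun ρ W => colSum D.x D.J U₁ (fun A => sh A W (F ρ))) ρ ω U₂ V Y
    (c := fun ρ ω U₂ V Y => core D F ρ ω U₁ U₂ V Y)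
    (fun ρ ω U₂ V Y => core_comm D F ρ ω U₁ U₂ V Y)
  rw [← h1, core_comm]
  -- The single columns have to commute with every row of the outer list. As `B` is a rearrangement,
  -- each of its rows is of the form `x J b` or `y b`.
  have h2 : ∀ B : List R, B.Perm (U₂.map (D.x D.J) ++ Y.map D.y) → _ := fun B hB =>
    colSum_sh_bd D.x_mul D.comm_xx D.J ρ ht F U₁ (B ++ ω :: V.map D.z) (by
      intro j hj a v hv
      rcases List.mem_append.1 hv with hv | hv
      · rcases List.mem_append.1 (hB.mem_iff.1 hv) with hv | hv
        · obtain ⟨b, _, rfl⟩ := List.mem_map.1 hv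
          exact D.comm_xx _ _ _ _ hj.ne
        · obtain ⟨b, _, rfl⟩ := List.mem_map.1 hv
          exact D.comm_xy j hj.le _ _
      · rcases List.mem_cons.1 hv with rfl | hv
        · exact hω j hj a
        · obtain ⟨b, _, rfl⟩ := List.mem_map.1 hv
          exact D.comm_xz j hj _ _)
  rw [sh_congr _ _ h2]
  simp only [sh_add, sh_smul, sh_mid_comm, sh_hd_comm, sh_lst_comm, ← core_comm]

variable (F : R → List R → X)

theorem phi_eq (a : R) (L : List R) : phi D F a L = cut4 (fun U₁ U₂ V Y =>
    phiSign U₁ U₂ V Y • core D F (phiRow D (a * L.prod) a Y) (phiMid D a U₁ U₂) U₁ U₂ V Y) L :=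
  rfl

/-- Faces inside a segment keep all products, hence the first and the middle row. They change
`phiSign` in such a way that together they are minus the inner faces of the argument. -/
theorem mid_phi (a : R) (L : List R) :
    cut4 (fun U₁ U₂ V Y => phiSign U₁ U₂ V Y • (
      mid (fun E => core D F (phiRow D (a * L.prod) a Y) (phiMid D a U₁ U₂) E U₂ V Y) U₁ +
      (-1 : ℤ) ^ U₁.length • (
        mid (fun E => core D F (phiRow D (a * L.prod) a Y) (phiMid D a U₁ U₂) U₁ E V Y) U₂ +
        (-1 : ℤ) ^ U₂.length •
          mid (fun E => core D F (phiRow D (a * L.prod) a Y) (phiMid D a U₁ U₂) U₁ U₂ V E) Y -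
        (-1 : ℤ) ^ (U₂.length + Y.length) •
          mid (fun E => core D F (phiRow D (a * L.prod) a Y) (phiMid D a U₁ U₂) U₁ U₂ E Y) V))) L =
    -mid (phi D F a) L := by
  have h1 : mid (phi D F a) L = mid (cut4 (fun U₁ U₂ V Y => phiSign U₁ U₂ V Y •
      core D F (phiRow D (a * L.prod) a Y) (phiMid D a U₁ U₂) U₁ U₂ V Y)) L :=
    mid_congr_prod L fun E _ hE => by rw [phi_eq, hE]
  rw [h1, mid_cut4, ← cut4_neg]
  refine cut4_congr _ fun U₁ U₂ V Y _ => ?_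
  have e₁ : mid (fun E => phiSign E U₂ V Y •
      core D F (phiRow D (a * L.prod) a Y) (phiMid D a E U₂) E U₂ V Y) U₁ =
      mid (fun E => (-phiSign U₁ U₂ V Y) •
        core D F (phiRow D (a * L.prod) a Y) (phiMid D a U₁ U₂) E U₂ V Y) U₁ :=
    mid_congr_prod U₁ fun E h h' => by rw [phiSign_fst h, neg_neg, phiMid, phiMid, h']
  have e₂ : mid (fun E => phiSign U₁ E V Y •
      core D F (phiRow D (a * L.prod) a Y) (phiMid D a U₁ E) U₁ E V Y) U₂ =
      mid (fun E => (-phiSign U₁ U₂ V Y) •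
        core D F (phiRow D (a * L.prod) a Y) (phiMid D a U₁ U₂) U₁ E V Y) U₂ :=
    mid_congr_prod U₂ fun E h h' => by rw [phiSign_snd h, neg_neg, phiMid, phiMid, h']
  have e₃ : mid (fun E => phiSign U₁ U₂ E Y •
      core D F (phiRow D (a * L.prod) a Y) (phiMid D a U₁ U₂) U₁ U₂ E Y) V =
      mid (fun E => ((-1) ^ Y.length * phiSign U₁ U₂ V Y) •
        core D F (phiRow D (a * L.prod) a Y) (phiMid D a U₁ U₂) U₁ U₂ E Y) V :=
    mid_congr_prod V fun E h h' => by
      rw [phiSign_trd h, ← mul_assoc, ← pow_add, Even.neg_one_pow ⟨_, rfl⟩, one_mul]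
  have e₄ : mid (fun E => phiSign U₁ U₂ V E •
      core D F (phiRow D (a * L.prod) a E) (phiMid D a U₁ U₂) U₁ U₂ V E) Y =
      mid (fun E => (-((-1) ^ V.length * phiSign U₁ U₂ V Y)) •
        core D F (phiRow D (a * L.prod) a Y) (phiMid D a U₁ U₂) U₁ U₂ V E) Y :=
    mid_congr_prod Y fun E h h' => by
      rw [phiSign_fth h, mul_neg, neg_neg, ← mul_assoc, ← pow_add, Even.neg_one_pow ⟨_, rfl⟩,
        one_mul, phiRow, phiRow, h']
  rw [e₁, e₂, e₃, e₄]
  simp only [mid_smul]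
  rcases neg_one_pow_eq_or ℤ U₁.length with h₁ | h₁ <;>
    rcases neg_one_pow_eq_or ℤ U₂.length with h₂ | h₂ <;>
    rcases neg_one_pow_eq_or ℤ V.length with h₃ | h₃ <;>
    rcases neg_one_pow_eq_or ℤ Y.length with h₄ | h₄ <;>
    simp only [pow_add, h₁, h₂, h₃, h₄] <;> module

/-- A row `b` which meets the first row in the column `0` gives `x 0 a * x 0 b = x 0 (a * b)`; so
this is the homotopy of the first face of the argument. -/
theorem hd_phi (a : R) (L : List R) :
    cut4 (fun U₁ U₂ V Y => phiSign U₁ U₂ V Y • hd (fun b E =>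
      core D F (phiRow D (a * L.prod) a Y * D.x 0 b) (phiMid D a U₁ U₂) E U₂ V Y) U₁) L =
    -hd (fun b E => phi D F (a * b) E) L := by
  rw [cut4_congr (K' := fun U₁ U₂ V Y => hd (fun b E => (-phiSign E U₂ V Y) •
    core D F (phiRow D (a * L.prod) (a * b) Y) (phiMid D (a * b) E U₂) E U₂ V Y) U₁)]
  · rw [cut4_hd₁ fun b U₁ U₂ V Y => (-phiSign U₁ U₂ V Y) •
      core D F (phiRow D (a * L.prod) (a * b) Y) (phiMid D (a * b) U₁ U₂) U₁ U₂ V Y, ← hd_neg]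
    refine hd_congr _ fun b E h => ?_
    rw [phi_eq, ← cut4_neg, h]
    refine cut4_congr _ fun U₁ U₂ V Y _ => ?_
    rw [List.prod_cons, ← mul_assoc]
    module
  · intro U₁ U₂ V Y _
    rw [← hd_smul]
    refine hd_congr _ fun b E h => ?_
    rw [phiSign_fst (E := E) (by rw [h]; rfl), h]
    simp only [phiRow, phiMid, List.prod_cons, D.x_mul, mul_assoc]

/-- The last face of the single columns and the first face of the column `J` both multiply the first
row by `x J b`. Moving the border between `U₁` and `U₂` over `b` matches them, with opposite signs.
-/
theorem hd_lst_columns (u a : R) (L : List R) :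
    cut4 (fun U₁ U₂ V Y => phiSign U₁ U₂ V Y • (-1 : ℤ) ^ U₁.length • (lst (fun b E =>
      core D F (phiRow D u a Y * D.x D.J b) (phiMid D a U₁ U₂) E U₂ V Y) U₁ + hd (fun b E =>
      core D F (phiRow D u a Y * D.x D.J b) (phiMid D a U₁ U₂) U₁ E V Y) U₂)) L = 0 := by
  rw [cut4_congr (K' := fun U₁ U₂ V Y => lst (fun b E => (phiSign E U₂ V Y * (-1) ^ E.length) •
      core D F (phiRow D u a Y * D.x D.J b) (phiMid D a E (b :: U₂)) E U₂ V Y) U₁ +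
    (-1 : ℤ) • hd (fun b E => (phiSign U₁ E V Y * (-1) ^ U₁.length) •
      core D F (phiRow D u a Y * D.x D.J b) (phiMid D a U₁ (b :: E)) U₁ E V Y) U₂)]
  · rw [cut4_add, cut4_smul, cut4_hd₂ fun b U₁ U₂ V Y => (phiSign U₁ U₂ V Y * (-1) ^ U₁.length) •
      core D F (phiRow D u a Y * D.x D.J b) (phiMid D a U₁ (b :: U₂)) U₁ U₂ V Y]
    module
  · intro U₁ U₂ V Y _
    simp only [← lst_smul, ← hd_smul, smul_add]
    congr 1
    · refine lst_congr _ fun b E h => ?_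
      rw [phiSign_fst (E := E) (by rw [h]; simp), h, smul_smul]
      congr 1
      · simp [pow_succ]
      · simp [phiMid, mul_assoc]
    · refine hd_congr _ fun b E h => ?_
      rw [phiSign_snd (E := E) (by rw [h]; rfl), h]
      module

/-- The last row `b` of `Y` is the last row of the whole list. By `w_t`, multiplying the middle row
by `y b` has the same effect as replacing `a` by `t b * a`, and `k_t` gives the same for the first
row. So this is the homotopy of the cyclic last face of the argument. -/
theorem lst_phi (a : R) (L : List R) :
    cut4 (fun U₁ U₂ V Y => phiSign U₁ U₂ V Y • (-1 : ℤ) ^ U₁.length •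
      (-1 : ℤ) ^ (U₂.length + Y.length) • lst (fun b E =>
      core D F (phiRow D (a * L.prod) a Y) (D.y b * phiMid D a U₁ U₂) U₁ U₂ V E) Y) L =
    -((-1 : ℤ) ^ L.length • lst (fun b E => phi D F (D.t b * a) E) L) := by
  rw [cut4_congr (K' := fun U₁ U₂ V Y => lst (fun b E =>
    ((-1) ^ (U₁ ++ U₂ ++ V ++ E).length * phiSign U₁ U₂ V E) •
    core D F (D.e (E.prod * b) * D.k (a * L.prod) * D.x 0 a) (D.y b * phiMid D a U₁ U₂)
      U₁ U₂ V E) Y)]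
  · rw [cut4_lst₄ fun b U₁ U₂ V Y => ((-1) ^ (U₁ ++ U₂ ++ V ++ Y).length * phiSign U₁ U₂ V Y) •
      core D F (D.e (Y.prod * b) * D.k (a * L.prod) * D.x 0 a) (D.y b * phiMid D a U₁ U₂)
        U₁ U₂ V Y, ← lst_smul, ← lst_neg]
    refine lst_congr _ fun b E h => ?_
    rw [phi_eq, ← cut4_smul, ← cut4_neg]
    refine cut4_congr _ fun U₁ U₂ V Y hE => ?_
    -- Here `k_t` rebrackets cyclically: on one side `t b` stands in front of the product of the
    -- columns, on the other side `b` stands behind it and a factor `e b` appears.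
    have h3 : phiRow D (D.t b * a * E.prod) (D.t b * a) Y =
        D.e (Y.prod * b) * D.k (a * L.prod) * D.x 0 a := by
      have := D.k_t b (a * E.prod)
      rw [h, List.prod_append, List.prod_singleton, ← mul_assoc a, D.e_mul, phiRow, D.x_mul]
      calc _ = D.e Y.prod * (D.k (D.t b * (a * E.prod)) * D.x 0 (D.t b)) * D.x 0 a := by
            simp only [mul_assoc]
        _ = _ := by rw [this]; simp only [mul_assoc]
    have h4 : phiMid D (D.t b * a) U₁ U₂ = D.y b * phiMid D a U₁ U₂ := by
      rw [phiMid, phiMid, mul_assoc, D.w_mul (D.t b), D.w_t]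
    rw [h3, h4, h, ← hE, List.length_append (bs := [b])]
    simp only [List.length_singleton, pow_succ]
    module
  · intro U₁ U₂ V Y _
    simp only [← lst_smul]
    refine lst_congr _ fun b E h => ?_
    rw [phiSign_fth (E := E) (by rw [h]; simp), h, smul_smul, smul_smul]
    congr 1
    · simp only [List.length_append, pow_add, List.length_singleton, pow_one]; ring
    · simp [phiRow]

/-- The last row of `U₂` meets the middle row as `x J b * ω`, the first row of `V` as `ω * z b`.
Since `z b = x J b * w b` and `x J b` commutes with `ω`, these are the same terms with the border
moved over `b`. -/
theorem lst_hd_middle (u a : R) (L : List R) :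
    cut4 (fun U₁ U₂ V Y => phiSign U₁ U₂ V Y • (-1 : ℤ) ^ U₁.length • ((-1 : ℤ) ^ U₂.length •
      lst (fun b E => core D F (phiRow D u a Y) (D.x D.J b * phiMid D a U₁ U₂) U₁ E V Y) U₂ -
      (-1 : ℤ) ^ (U₂.length + Y.length) •
        hd (fun b E => core D F (phiRow D u a Y) (phiMid D a U₁ U₂ * D.z b) U₁ U₂ E Y) V)) L =
      0 := by
  rw [cut4_congr (K' := fun U₁ U₂ V Y => lst (fun b E =>
      (phiSign U₁ E V Y * (-1) ^ (U₁.length + E.length)) •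
      core D F (phiRow D u a Y) (D.x D.J b * phiMid D a U₁ (E ++ [b])) U₁ E V Y) U₂ +
    (-1 : ℤ) • hd (fun b E => (phiSign U₁ U₂ E Y * (-1) ^ (U₁.length + U₂.length)) •
      core D F (phiRow D u a Y) (D.x D.J b * phiMid D a U₁ (U₂ ++ [b])) U₁ U₂ E Y) V)]
  · rw [cut4_add, cut4_smul, cut4_hd₃ fun b U₁ U₂ V Y =>
      (phiSign U₁ U₂ V Y * (-1) ^ (U₁.length + U₂.length)) •
      core D F (phiRow D u a Y) (D.x D.J b * phiMid D a U₁ (U₂ ++ [b])) U₁ U₂ V Y]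
    module
  · intro U₁ U₂ V Y _
    simp only [smul_sub, ← lst_smul, ← hd_smul]
    rw [sub_eq_add_neg, ← hd_neg]
    congr 1
    · refine lst_congr _ fun b E h => ?_
      rw [phiSign_snd (E := E) (by rw [h]; simp), h]
      simp only [List.length_append, pow_add, List.length_singleton, pow_one]
      module
    · refine hd_congr _ fun b E h => ?_
      have h1 : phiMid D a U₁ U₂ * D.z b = D.x D.J b * phiMid D a U₁ (U₂ ++ [b]) := by
        rw [D.z_eq, ← mul_assoc, phiMid, ← (D.comm_xw D.J le_rfl b _).eq, mul_assoc, ← D.w_mul,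
          phiMid, List.prod_append, List.prod_singleton]
        simp only [mul_assoc]
      rw [phiSign_trd (E := E) (by rw [h]; rfl), h1]
      rcases neg_one_pow_eq_or ℤ Y.length with h₄ | h₄ <;> simp only [pow_add, h₄] <;> module

/-- The first row of `Y` gives `ρ * y b`; the last row of `V`, around the cycle, gives `t (z b) * ρ`
with `t (z b) = y b * e b`. The factor `e b` is exactly what the first row gains when `b` passes
from `V` to `Y`. -/
theorem hd_lst_right (u a : R) (L : List R) :
    cut4 (fun U₁ U₂ V Y => phiSign U₁ U₂ V Y • (-1 : ℤ) ^ U₁.length • ((-1 : ℤ) ^ U₂.length •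
      hd (fun b E => core D F (phiRow D u a Y * D.y b) (phiMid D a U₁ U₂) U₁ U₂ V E) Y -
      (-1 : ℤ) ^ (U₂.length + Y.length + V.length) •
        lst (fun b E => core D F (D.t (D.z b) * phiRow D u a Y) (phiMid D a U₁ U₂) U₁ U₂ E Y) V))
      L = 0 := by
  rw [cut4_congr (K' := fun U₁ U₂ V Y => (-1 : ℤ) • hd (fun b E =>
      (phiSign U₁ U₂ V E * (-1) ^ (U₁.length + U₂.length + V.length)) •
      core D F (phiRow D u a (b :: E) * D.y b) (phiMid D a U₁ U₂) U₁ U₂ V E) Y +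
    lst (fun b E => (phiSign U₁ U₂ E Y * (-1) ^ (U₁.length + U₂.length + E.length)) •
      core D F (phiRow D u a (b :: Y) * D.y b) (phiMid D a U₁ U₂) U₁ U₂ E Y) V)]
  · rw [cut4_add, cut4_smul, cut4_hd₄ fun b U₁ U₂ V Y =>
      (phiSign U₁ U₂ V Y * (-1) ^ (U₁.length + U₂.length + V.length)) •
      core D F (phiRow D u a (b :: Y) * D.y b) (phiMid D a U₁ U₂) U₁ U₂ V Y]
    module
  · intro U₁ U₂ V Y _
    simp only [smul_sub, ← lst_smul, ← hd_smul]
    rw [sub_eq_add_neg, ← lst_neg]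
    congr 1
    · refine hd_congr _ fun b E h => ?_
      rw [phiSign_fth (E := E) (by rw [h]; simp), h]
      simp only [pow_add]
      module
    · refine lst_congr _ fun b E h => ?_
      have h1 : D.t (D.z b) * phiRow D u a Y = phiRow D u a (b :: Y) * D.y b := by
        rw [D.t_z, phiRow, phiRow, List.prod_cons, D.e_mul]
        have h2 : Commute (D.e b * D.e Y.prod * D.k u * D.x 0 a) (D.y b) :=
          ((((D.comm_ye b _).symm.mul_left (D.comm_ye b _).symm).mul_left
            (D.comm_yk b u).symm).mul_left (D.comm_xy 0 (Nat.zero_le _) a b))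
        rw [h2.eq]
        simp only [mul_assoc]
      rw [phiSign_trd (E := E) (by rw [h]; simp), h1, h]
      simp only [List.length_append, List.length_singleton]
      rcases neg_one_pow_eq_or ℤ Y.length with h₄ | h₄ <;>
        simp only [pow_add, pow_one, h₄] <;> module

/-- With `U₂` and `Y` empty, the middle row can be multiplied directly with the first row. The
result is the subdivision where the homotopy starts, and the sign reduces to `-1`. -/
theorem ends_from (a : R) (L : List R) :
    cut4 (fun U₁ U₂ V Y => phiSign U₁ U₂ V Y • (-1 : ℤ) ^ U₁.length •
      (if U₂ = [] ∧ Y = [] then colSum D.x D.J U₁ (fun A => sh A (V.map D.z)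
        (F (phiRow D (a * L.prod) a Y * phiMid D a U₁ U₂))) else 0)) L = -gFrom D F a L := by
  rw [cut4_congr (K' := fun U₁ U₂ V Y => if Y = [] then (if U₂ = [] then
    -colSum D.x D.J U₁ (fun A => sh A (V.map D.z)
        (F (D.k (a * L.prod) * D.x 0 a * D.w (a * U₁.prod)))) else 0) else 0)]
  · have h : ∀ L₁ Y : List R, cut (fun U V => cut (fun U₁ U₂ => if Y = [] then (if U₂ = [] then
        -colSum D.x D.J U₁ (fun A => sh A (V.map D.z)
        (F (D.k (a * L.prod) * D.x 0 a * D.w (a * U₁.prod)))) else 0) else 0) U) L₁ =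
        if Y = [] then cut (fun U V => -colSum D.x D.J U (fun A => sh A (V.map D.z)
        (F (D.k (a * L.prod) * D.x 0 a * D.w (a * U.prod))))) L₁ else 0 := by
      intro L₁ Y
      split_ifs
      · refine cut_congr _ fun U V _ => ?_
        rw [cut_ite_right_nil fun U₁ => -colSum D.x D.J U₁ (fun A => sh A (V.map D.z)
          (F (D.k (a * L.prod) * D.x 0 a * D.w (a * U₁.prod))))]
      · simp [cut_zero]
    simp only [cut4, h]
    rw [cut_ite_right_nil fun L₁ => cut (fun U V => -colSum D.x D.J U (fun A => sh A (V.map D.z)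
        (F (D.k (a * L.prod) * D.x 0 a * D.w (a * U.prod))))) L₁, cut_neg]
    rfl
  · intro U₁ U₂ V Y _
    split_ifs with h1 h2 h3 h4 h5
    · obtain ⟨rfl, rfl⟩ := h1
      rw [smul_smul]
      simp only [phiSign, phiRow, phiMid, List.prod_nil, D.e_one, one_mul, mul_one,
        List.length_nil, add_zero, zero_mul]
      rw [← pow_add, add_right_comm, ← two_mul, pow_add, pow_mul]
      simp
    all_goals first | (exfalso; tauto) | simp

/-- With `V` empty, the middle row meets the first row around the cycle. The segments `U₁` and `U₂`
then form one distribution over `J + 1` columns, which is the subdivision where the homotopy ends.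
-/
theorem ends_to (a : R) (L : List R) :
    cut4 (fun U₁ U₂ V Y => phiSign U₁ U₂ V Y • (-1 : ℤ) ^ U₁.length •
      (-1 : ℤ) ^ (U₂.length + Y.length + V.length) •
        (if V = [] then sh (U₂.map (D.x D.J)) (Y.map D.y)
          (fun W => colSum D.x D.J U₁ (fun A => sh A W
            (F (D.t (phiMid D a U₁ U₂) * phiRow D (a * L.prod) a Y)))) else 0)) L =
      -gTo D F a L := by
  rw [cut4_congr (K' := fun U₁ U₂ V Y => if V = [] then -sh (U₂.map (D.x D.J)) (Y.map D.y)
          (fun W => colSum D.x D.J U₁ (fun A => sh A W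
            (F (D.t (phiMid D a U₁ U₂) * phiRow D (a * L.prod) a Y)))) else 0)]
  · rw [cut4, gTo, ← cut_neg]
    refine cut_congr _ fun L₁ Y h => ?_
    rw [cut_congr (K' := fun U V => if V = [] then cut (fun U₁ U₂ =>
      -sh (U₂.map (D.x D.J)) (Y.map D.y) (fun W => colSum D.x D.J U₁ (fun A => sh A W
            (F (D.t (phiMid D a U₁ U₂) * phiRow D (a * L.prod) a Y))))) U else 0)]
    · rw [cut_ite_right_nil fun U => cut (fun U₁ U₂ =>
      -sh (U₂.map (D.x D.J)) (Y.map D.y) (fun W => colSum D.x D.J U₁ (fun A => sh A W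
            (F (D.t (phiMid D a U₁ U₂) * phiRow D (a * L.prod) a Y))))) U, colSum_succ_sh, ← cut_neg]
      refine cut_congr _ fun U₁ U₂ hU => ?_
      rw [phiMid, phiRow, hU, List.prod_append]
    · intro U V _
      split_ifs
      · rfl
      · simp [cut_zero]
  · intro U₁ U₂ V Y _
    split_ifs with h
    · subst h
      rw [smul_smul, smul_smul, phiSign, ← neg_one_zsmul]
      simp only [List.length_nil, mul_zero, add_zero, pow_add, pow_one]
      rcases neg_one_pow_eq_or ℤ U₁.length with h₁ | h₁ <;>
      rcases neg_one_pow_eq_or ℤ U₂.length with h₂ | h₂ <;>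
      rcases neg_one_pow_eq_or ℤ Y.length with h₄ | h₄ <;> simp [h₁, h₂, h₄]
    · simp

/-- The homotopy relates the two partial subdivisions. -/
theorem phi_bd (a : R) (L : List R) :
    phi D (bd D.t F) a L + bd D.t (phi D F) a L = gTo D F a L - gFrom D F a L := by
  have hcomm : ∀ j, 0 < j → ∀ (u a b : R) (Y : List R),
      Commute (D.x j a) (phiRow D u b Y) := fun j hj u a b Y =>
    ((D.comm_xe j hj a _).mul_right (D.comm_xk j hj a u)).mul_right (D.comm_xx j 0 a b hj.ne')
  have h1 := mid_phi D F a L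
  have h2 := hd_phi D F a L
  have h3 := hd_lst_columns D F (a * L.prod) a L
  have h4 := lst_phi D F a L
  have h5 := lst_hd_middle D F (a * L.prod) a L
  have h6 := hd_lst_right D F (a * L.prod) a L
  have h7 := ends_from D F a L
  have h8 := ends_to D F a L
  -- The three cancelling families are subtracted as zeros, and all other terms are rewritten as
  -- sums over the same four segments. The identity then holds term by term, by `core_bd`.
  rw [← sub_zero (phi D (bd D.t F) a L), ← h3, ← sub_zero (phi D (bd D.t F) a L), ← h5,
    ← sub_zero (phi D (bd D.t F) a L), ← h6, bd, ← neg_neg (gTo D F a L), ← h8,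
    sub_eq_add_neg (-cut4 _ L), ← h7, ← neg_neg (hd _ L), ← h2, ← neg_neg (mid _ L), ← h1,
    ← neg_neg ((-1 : ℤ) ^ L.length • _), ← h4, phi_eq]
  simp only [sub_eq_add_neg, ← cut4_neg, ← cut4_add]
  refine cut4_congr _ fun U₁ U₂ V Y _ => ?_
  -- By `t_x`, rotation turns `x j` into `x (j + 1)`, which commutes with the first row because its
  -- index is positive.
  rw [core_bd D F _ (phiMid D a U₁ U₂) (fun j hj a => by
    rw [D.t_x j hj, (hcomm (j + 1) (Nat.succ_pos j) _ _ _ _).eq]) _ _ _ _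
    (fun j hj a => D.comm_xw j hj.le _ _)]
  simp only [smul_add, smul_sub, smul_neg]
  module

end Shuffle

end

section

namespace Shuffle

section

variable {R : Type*} {X : Type*} [AddCommGroup X]

theorem bd_zero [Mul R] (t : R → R) (ρ : R) (L : List R) :
    bd t (fun _ _ => (0 : X)) ρ L = 0 := by
  have h1 : mid (fun _ => (0 : X)) L = 0 := by simpa using mid_smul L 0 (fun _ => (0 : X))
  have h2 : hd (fun _ _ => (0 : X)) L = 0 := by cases L <;> rfl
  simp only [bd, h1, h2, lst_zero, smul_zero, add_zero]

theorem bd_add [Mul R] (t : R → R) (F G : R → List R → X) (ρ : R) (L : List R) :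
    bd t (fun ρ L => F ρ L + G ρ L) ρ L = bd t F ρ L + bd t G ρ L := by
  simp only [bd, hd_add, mid_add, lst_add, smul_add]
  abel

theorem cut_ite_left_nil_dep (f : List R → List R → X) (L : List R) :
    cut (fun U V => if U = [] then f U V else 0) L = f [] L := by
  rw [← cut_ite_left_nil (f []) L]
  refine cut_congr _ fun U V _ => ?_
  split_ifs with h
  · rw [h]
  · rfl

end

/-! ### Rows with entries in a monoid -/

section Rows

variable {M : Type*} [Monoid M] {n : ℕ}

/-- The entry of a row in a given column. -/
def entry (a : Fin n → M) (i : ℕ) : M := if h : i < n then a ⟨i, h⟩ else 1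

/-- The row with given entries. -/
def mkRow (f : ℕ → M) : Fin n → M := fun c => f c

theorem entry_mkRow (f : ℕ → M) {i : ℕ} (h : i < n) : entry (mkRow f : Fin n → M) i = f i := by
  rw [entry, dif_pos h]; rfl

theorem entry_mul (a b : Fin n → M) (i : ℕ) : entry (a * b) i = entry a i * entry b i := by
  unfold entry; split_ifs <;> simp

theorem entry_one (i : ℕ) : entry (1 : Fin n → M) i = 1 := by
  unfold entry; split_ifs <;> simp

theorem row_ext {a b : Fin n → M} (h : ∀ i < n, entry a i = entry b i) : a = b := by
  funext c
  simpa [entry] using h c c.2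

/-- The rotation of the columns. -/
def rowT (a : Fin n → M) : Fin n → M :=
  mkRow fun c => if c = 0 then entry a (n - 1) else entry a (c - 1)

/-- The first column is moved to the column `j`. -/
def rowX (j : ℕ) (a : Fin n → M) : Fin n → M := mkRow fun c => if c = j then entry a 0 else 1

/-- The columns in front of the column `q` (counted from one) are moved to the right end. -/
def rowY (q : ℕ) (a : Fin n → M) : Fin n → M :=
  mkRow fun c => if n + 1 ≤ c + q then entry a (c + q - n - 1) else 1

/-- The columns `2, …, q` are moved to the right end. -/
def rowW (q : ℕ) (a : Fin n → M) : Fin n → M :=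
  mkRow fun c => if n + 1 ≤ c + q then entry a (c + q - n) else 1

/-- The columns `1, …, q` are moved to the right end. -/
def rowZ (q : ℕ) (a : Fin n → M) : Fin n → M :=
  mkRow fun c => if n ≤ c + q then entry a (c + q - n) else 1

/-- The column `q` is moved to the first column. -/
def rowE (q : ℕ) (a : Fin n → M) : Fin n → M :=
  mkRow fun c => if c = 0 then entry a (q - 1) else 1

/-- The product of the entries in the columns behind the column `q`, in the first column. -/
def rowK (q : ℕ) (a : Fin n → M) : Fin n → M :=
  mkRow fun c => if c = 0 then ((List.range' q (n - q)).map (entry a)).prod else 1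

/-- The entries need not commute: it is enough that in each column one of the two rows is trivial.
-/
theorem commute_row {a b : Fin n → M} (h : ∀ i < n, entry a i = 1 ∨ entry b i = 1) :
    Commute a b := by
  refine row_ext fun i hi => ?_
  rw [entry_mul, entry_mul]
  rcases h i hi with h | h <;> simp [h]

/-- One alternating product, bracketed in two ways. It is the content of `k_t`, where the rotation
shifts the index of one of the factors by one. -/
theorem prod_telescope (f g : ℕ → M) (s l : ℕ) :
    ((List.range' (s + 1) l).map fun i => f (i - 1) * g i).prod * f (s + l) =
      f s * ((List.range' (s + 1) l).map fun i => g i * f i).prod := by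
  induction l generalizing s with
  | zero => simp
  | succ l ih =>
    rw [List.range'_succ]
    have h := ih (s + 1)
    rw [show s + 1 + l = s + (l + 1) by omega] at h
    simp only [List.map_cons, List.prod_cons, mul_assoc, h]
    simp

/-- The operations on rows which enter the homotopy. -/
def rowData (q : ℕ) (hq : 2 ≤ q) (hn : q ≤ n) : RowData (Fin n → M) where
  J := n - q
  t := rowT
  x := rowX
  y := rowY q
  w := rowW q
  z := rowZ q
  e := rowE q
  k := rowK q
  x_mul j a b := row_ext fun i hi => by
    rw [entry_mul]; simp only [rowX, entry_mkRow _ hi]; split_ifs <;> simp [entry_mul]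
  y_mul a b := row_ext fun i hi => by
    rw [entry_mul]; simp only [rowY, entry_mkRow _ hi]; split_ifs <;> simp [entry_mul]
  w_mul a b := row_ext fun i hi => by
    rw [entry_mul]; simp only [rowW, entry_mkRow _ hi]; split_ifs <;> simp [entry_mul]
  z_mul a b := row_ext fun i hi => by
    rw [entry_mul]; simp only [rowZ, entry_mkRow _ hi]; split_ifs <;> simp [entry_mul]
  e_mul a b := row_ext fun i hi => by
    rw [entry_mul]; simp only [rowE, entry_mkRow _ hi]; split_ifs <;> simp [entry_mul]
  e_one := row_ext fun i hi => by
    simp only [rowE, entry_mkRow _ hi]; split_ifs <;> simp [entry_one]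
  comm_xx i j a b h := commute_row fun c hc => by
    simp only [rowX, entry_mkRow _ hc, ite_eq_right_iff]
    by_cases h1 : c = i
    · right; omega
    · left; simp [h1]
  comm_xy j hj a b := commute_row fun c hc => by
    simp only [rowX, rowY, entry_mkRow _ hc]
    by_cases h1 : c = j
    · right; rw [if_neg]; omega
    · left; rw [if_neg h1]
  comm_xw j hj a b := commute_row fun c hc => by
    simp only [rowX, rowW, entry_mkRow _ hc]
    by_cases h1 : c = j
    · right; rw [if_neg]; omega
    · left; rw [if_neg h1]
  comm_xz j hj a b := commute_row fun c hc => by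
    simp only [rowX, rowZ, entry_mkRow _ hc]
    by_cases h1 : c = j
    · right; rw [if_neg]; omega
    · left; rw [if_neg h1]
  comm_xe j hj a b := commute_row fun c hc => by
    simp only [rowX, rowE, entry_mkRow _ hc]
    by_cases h1 : c = j
    · right; rw [if_neg]; omega
    · left; rw [if_neg h1]
  comm_xk j hj a b := commute_row fun c hc => by
    simp only [rowX, rowK, entry_mkRow _ hc]
    by_cases h1 : c = j
    · right; rw [if_neg]; omega
    · left; rw [if_neg h1]
  comm_ye a b := commute_row fun c hc => by
    simp only [rowY, rowE, entry_mkRow _ hc]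
    by_cases h1 : c = 0
    · left; rw [if_neg]; omega
    · right; rw [if_neg h1]
  comm_yk a b := commute_row fun c hc => by
    simp only [rowY, rowK, entry_mkRow _ hc]
    by_cases h1 : c = 0
    · left; rw [if_neg]; omega
    · right; rw [if_neg h1]
  t_x j hj a := row_ext fun c hc => by
    simp only [rowT, rowX, entry_mkRow _ hc]
    rw [entry_mkRow _ (by omega), entry_mkRow _ (by omega)]
    split_ifs <;> first | rfl | omega
  z_eq a := row_ext fun c hc => by
    rw [entry_mul]
    simp only [rowX, rowW, rowZ, entry_mkRow _ hc]
    split_ifs <;> first | omega | simp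
    rename_i h1 h2 _
    rw [h2, show n - q + q - n = 0 by omega]
  t_z a := row_ext fun c hc => by
    rw [entry_mul]
    simp only [rowT, rowY, rowE, rowZ, entry_mkRow _ hc]
    rw [entry_mkRow _ (by omega), entry_mkRow _ (by omega)]
    split_ifs <;> first | omega | simp
    · rw [show n - 1 + q - n = q - 1 by omega]
    · rw [show c - 1 + q - n = c + q - n - 1 by omega]
  w_t a := row_ext fun c hc => by
    simp only [rowT, rowY, rowW, entry_mkRow _ hc]
    split_ifs with h
    · rw [entry_mkRow _ (by omega), if_neg (by omega)]
    · rfl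
  k_t a b := row_ext fun c hc => by
    rw [entry_mul, entry_mul]
    simp only [rowK, rowE, rowX, entry_mkRow _ hc]
    split_ifs
    -- All the content is in the column `0`: behind `q`, the columns of `rowT a * b` contain `a`
    -- shifted by one, and the last entry of `a` is supplied by `rowT a` in the column `0`.
    · have h1 := prod_telescope (entry a) (entry b) (q - 1) (n - q)
      rw [show q - 1 + 1 = q by omega, show q - 1 + (n - q) = n - 1 by omega] at h1
      have h2 : (List.range' q (n - q)).map (entry (rowT a * b)) =
          (List.range' q (n - q)).map fun i => entry a (i - 1) * entry b i := by
        refine List.map_congr_left fun i hi => ?_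
        have hi := List.mem_range'_1.1 hi
        rw [entry_mul, rowT, entry_mkRow _ (by omega), if_neg (by omega)]
      have h3 : entry (rowT a) 0 = entry a (n - 1) := by
        rw [rowT, entry_mkRow _ (by omega), if_pos rfl]
      rw [h2, h3, h1]
      congr 3
      funext i
      rw [entry_mul]
    · simp

variable {X : Type*} [AddCommGroup X]

/-- A partial subdivision. -/
def rowG (q : ℕ) (F : (Fin n → M) → List (Fin n → M) → X) (a : Fin n → M)
    (L : List (Fin n → M)) : X :=
  cut (fun U V => colSum rowX (n - q) U (fun A => sh A (V.map (rowZ q))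
    (F (rowK q (a * L.prod) * rowX 0 a * rowW q (a * U.prod))))) L

/-- For `q = n` there are no single columns, so `U` is empty, and the first column together with the
columns `2, …, n` makes up the whole first row. -/
theorem rowG_self (F : (Fin n → M) → List (Fin n → M) → X) (a : Fin n → M)
    (L : List (Fin n → M)) : rowG n F a L = F a L := by
  have h1 : rowK n (a * L.prod) * rowX 0 a * rowW n a = a := by
    refine row_ext fun i hi => ?_
    rw [entry_mul, entry_mul]
    simp only [rowK, rowX, rowW, entry_mkRow _ hi]
    split_ifs <;> first | omega | simp
    rename_i h _
    rw [h]
  have h2 : (rowZ n : (Fin n → M) → _) = id := by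
    funext a
    refine row_ext fun i hi => ?_
    simp [rowZ, entry_mkRow _ hi]
  rw [rowG]
  simp only [Nat.sub_self, colSum_zero]
  rw [cut_ite_left_nil_dep, List.prod_nil, mul_one, h1, h2, List.map_id, sh_nil_left]

/-- For `q = 1` nothing is absorbed into the first row and the remaining block is a single column.
The cut into `U` and `V` is therefore the last step of the recursion of `colSum`. -/
theorem rowG_one [NeZero n] (F : (Fin n → M) → List (Fin n → M) → X) (a : Fin n → M)
    (L : List (Fin n → M)) :
    rowG 1 F a L = colSum rowX n L (F (rowK 1 (a * L.prod) * rowX 0 a)) := by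
  have hn : 1 ≤ n := Nat.one_le_iff_ne_zero.2 (NeZero.ne n)
  obtain ⟨m, rfl⟩ : ∃ m, n = m + 1 := ⟨n - 1, by omega⟩
  rw [rowG, colSum_succ]
  refine cut_congr _ fun U V _ => ?_
  have h1 : rowW 1 (a * U.prod) = 1 := row_ext fun i hi => by
    simp only [rowW, entry_mkRow _ hi]
    rw [if_neg (by omega), entry_one]
  have h2 : (rowZ 1 : (Fin (m + 1) → M) → _) = rowX m := by
    funext a
    refine row_ext fun i hi => ?_
    simp only [rowZ, rowX, entry_mkRow _ hi]
    split_ifs <;> first | omega | simp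
    rw [show i - m = 0 by omega]
  rw [h1, h2, mul_one]
  rfl

theorem gFrom_rowData (q : ℕ) (hq : 2 ≤ q) (hn : q ≤ n)
    (F : (Fin n → M) → List (Fin n → M) → X) (a : Fin n → M) (L : List (Fin n → M)) :
    gFrom (rowData q hq hn) F a L = rowG q F a L := rfl

/-- Adding the column `q` to the product of the columns behind it leads from `q` to `q - 1`. The
blocks agree after reindexing; the first rows differ only in the way in which the product of the
columns from `q` on is assembled. -/
theorem gTo_rowData (q : ℕ) (hq : 2 ≤ q) (hn : q ≤ n)
    (F : (Fin n → M) → List (Fin n → M) → X) (a : Fin n → M) (L : List (Fin n → M)) :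
    gTo (rowData q hq hn) F a L = rowG (q - 1) F a L := by
  refine cut_congr _ fun U Y hL => ?_
  have h1 : (rowY q : (Fin n → M) → _) = rowZ (q - 1) := by
    funext a
    refine row_ext fun i hi => ?_
    simp only [rowY, rowZ, entry_mkRow _ hi]
    rw [show i + q - n - 1 = i + (q - 1) - n by omega]
    split_ifs <;> first | omega | rfl
  have h2 : rowT (rowW q (a * U.prod)) * (rowE q Y.prod * rowK q (a * L.prod) * rowX 0 a) =
      rowK (q - 1) (a * L.prod) * rowX 0 a * rowW (q - 1) (a * U.prod) := by
    refine row_ext fun i hi => ?_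
    simp only [entry_mul]
    simp only [rowT, rowE, rowK, rowX, rowW, entry_mkRow _ hi]
    rw [entry_mkRow _ (by omega), entry_mkRow _ (by omega)]
    -- In the first column, the entry of the column `q` comes in two pieces: from the rotated middle
    -- row for `a` and `U`, and from `rowE` for `Y`. As `L = U ++ Y`, they combine to the column `q`
    -- of `a * L.prod`.
    by_cases h : i = 0
    · rw [if_pos h, if_pos h, if_pos h, if_pos h, if_pos h, if_pos (by omega), if_neg (by omega),
        mul_one, show n - (q - 1) = n - q + 1 by omega, List.range'_succ, List.map_cons,
        List.prod_cons, show q - 1 + 1 = q by omega, show n - 1 + q - n = q - 1 by omega, hL]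
      simp only [List.prod_append, entry_mul, mul_assoc]
    · simp only [if_neg h, mul_one, one_mul]
      rw [show i - 1 + q - n = i + (q - 1) - n by omega]
      split_ifs <;> first | omega | rfl
  change colSum rowX (n - q + 1) U (fun A => sh A (Y.map (rowY q)) (F (rowT (rowW q (a * U.prod)) *
    (rowE q Y.prod * rowK q (a * L.prod) * rowX 0 a)))) = _
  rw [h1, h2, show n - q + 1 = n - (q - 1) by omega]

/-- The homotopy between the identity and the subdivision. -/
def rowPhi (F : (Fin n → M) → List (Fin n → M) → X) (a : Fin n → M) (L : List (Fin n → M)) : X :=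
  ∑ q ∈ (Finset.Icc 2 n).attach, phi (rowData q.1 (Finset.mem_Icc.1 q.2).1 (Finset.mem_Icc.1 q.2).2)
    F a L

/-- The part for `q` connects the subdivisions `q` and `q - 1` by `phi_bd`, so the sum over `q`
telescopes from the identity to the full subdivision. -/
theorem rowPhi_bd [NeZero n] (F : (Fin n → M) → List (Fin n → M) → X) (a : Fin n → M)
    (L : List (Fin n → M)) :
    rowPhi (bd rowT F) a L + bd rowT (rowPhi F) a L =
      colSum rowX n L (F (rowK 1 (a * L.prod) * rowX 0 a)) - F a L := by
  have h1 : bd rowT (rowPhi F) a L = ∑ q ∈ (Finset.Icc 2 n).attach, bd rowT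
      (phi (rowData q.1 (Finset.mem_Icc.1 q.2).1 (Finset.mem_Icc.1 q.2).2) F) a L := by
    have : ∀ s : Finset {x // x ∈ Finset.Icc 2 n}, bd rowT (fun a L => ∑ q ∈ s,
        phi (rowData q.1 (Finset.mem_Icc.1 q.2).1 (Finset.mem_Icc.1 q.2).2) F a L) a L =
        ∑ q ∈ s, bd rowT
          (phi (rowData q.1 (Finset.mem_Icc.1 q.2).1 (Finset.mem_Icc.1 q.2).2) F) a L := by
      intro s
      classical
      induction s using Finset.induction_on with
      | empty => simp [bd_zero]
      | insert q s hq ih => simp only [Finset.sum_insert hq, bd_add, ih]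
    exact this _
  rw [h1, rowPhi, ← Finset.sum_add_distrib]
  have h2 : ∀ q ∈ (Finset.Icc 2 n).attach, phi (rowData q.1 (Finset.mem_Icc.1 q.2).1
      (Finset.mem_Icc.1 q.2).2) (bd rowT F) a L + bd rowT (phi (rowData q.1
      (Finset.mem_Icc.1 q.2).1 (Finset.mem_Icc.1 q.2).2) F) a L =
      rowG (q.1 - 1) F a L - rowG q.1 F a L := by
    intro q _
    rw [← gTo_rowData q.1 (Finset.mem_Icc.1 q.2).1 (Finset.mem_Icc.1 q.2).2 F,
      ← gFrom_rowData q.1 (Finset.mem_Icc.1 q.2).1 (Finset.mem_Icc.1 q.2).2 F]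
    exact phi_bd _ F a L
  rw [Finset.sum_congr rfl h2,
    Finset.sum_attach (Finset.Icc 2 n) fun q => rowG (q - 1) F a L - rowG q F a L,
    ← rowG_one, ← rowG_self F a L]
  have hn : 1 ≤ n := Nat.one_le_iff_ne_zero.2 (NeZero.ne n)
  have h3 : ∀ m : ℕ, ∑ q ∈ Finset.Icc 2 (m + 1), (rowG (q - 1) F a L - rowG q F a L) =
      rowG 1 F a L - rowG (m + 1) F a L := by
    intro m
    induction m with
    | zero => simp
    | succ m ih =>
      rw [Finset.sum_Icc_succ_top (by omega), ih]
      simp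
  have := h3 (n - 1)
  rwa [show n - 1 + 1 = n by omega] at this

end Rows

end Shuffle

end

section

namespace Shuffle

/-! ### Choices of columns as words -/

section Words

variable {R : Type*} {X : Type*} [AddCommGroup X]

/-- The sum over all words of length `r` in the letters `0, …, J - 1`. -/
def wordSum (J : ℕ) : ℕ → (List ℕ → X) → X
  | 0, H => H []
  | r + 1, H => ∑ j ∈ Finset.range J, wordSum J r fun c => H (j :: c)

/-- The number of letters of a word which are smaller than `j`. -/
def below (j : ℕ) (c : List ℕ) : ℕ := c.countP (· < j)

/-- The sign of the sorting permutation of a word. -/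
def wordSign : List ℕ → ℤ
  | [] => 1
  | j :: c => (-1) ^ below j c * wordSign c

/-- The elements of a list, distributed into columns by a word. -/
def wordRows [Inhabited R] (x : ℕ → R → R) : List ℕ → List R → List R
  | [], _ => []
  | j :: c, U => x j (U.getD (below j c) default) :: wordRows x c (U.eraseIdx (below j c))

/-- The sum over all shuffles of a word with `s` copies of the letter `J`. -/
def wordShuffle (J : ℕ) : List ℕ → ℕ → (List ℕ → X) → X
  | [], s, H => H (List.replicate s J)
  | j :: c, 0, H => H (j :: c)
  | j :: c, s + 1, H => wordShuffle J c (s + 1) (fun e => H (j :: e)) +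
      wordShuffle J (j :: c) s fun e => H (J :: e)
termination_by c s => c.length + s

theorem wordShuffle_congr (J : ℕ) (c : List ℕ) (s : ℕ) {H K : List ℕ → X}
    (h : ∀ e : List ℕ, e.Perm (c ++ List.replicate s J) → H e = K e) :
    wordShuffle J c s H = wordShuffle J c s K := by
  induction c, s, H using wordShuffle.induct (J := J) generalizing K with
  | case1 s H => simpa [wordShuffle] using h _ (by simp)
  | case2 j c H => simpa [wordShuffle] using h _ (by simp)
  | case3 j c s H ih1 ih2 =>
    rw [wordShuffle, wordShuffle, ih1 (K := fun e => K (j :: e)) fun e he => h _ (he.cons j),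
      ih2 (K := fun e => K (J :: e)) fun e he => h _ ?_]
    refine (he.cons J).trans ?_
    rw [List.replicate_succ]
    exact List.perm_middle.symm

theorem wordShuffle_zero_right (J : ℕ) (c : List ℕ) (H : List ℕ → X) :
    wordShuffle J c 0 H = H c := by
  cases c <;> simp [wordShuffle]

theorem wordShuffle_smul (J : ℕ) (c : List ℕ) (s : ℕ) (z : ℤ) (H : List ℕ → X) :
    wordShuffle J c s (fun e => z • H e) = z • wordShuffle J c s H := by
  induction c, s, H using wordShuffle.induct (J := J) with
  | case1 s H => simp [wordShuffle]
  | case2 j c H => simp [wordShuffle]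
  | case3 j c s H ih1 ih2 => rw [wordShuffle, wordShuffle, ih1, ih2, smul_add]

theorem wordSum_add (J r : ℕ) (H K : List ℕ → X) :
    wordSum J r (fun c => H c + K c) = wordSum J r H + wordSum J r K := by
  induction r generalizing H K with
  | zero => rfl
  | succ r ih => simp only [wordSum, ih, Finset.sum_add_distrib]

theorem wordSum_congr (J r : ℕ) {H K : List ℕ → X}
    (h : ∀ c : List ℕ, c.length = r → (∀ j ∈ c, j < J) → H c = K c) :
    wordSum J r H = wordSum J r K := by
  induction r generalizing H K with
  | zero => exact h [] rfl (by simp)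
  | succ r ih =>
    refine Finset.sum_congr rfl fun j hj => ih fun c hc hc' => h _ (by simp [hc]) ?_
    intro i hi
    rcases List.mem_cons.1 hi with rfl | hi
    · exact Finset.mem_range.1 hj
    · exact hc' i hi

/-- The last letter of the alphabet is shuffled with the words in the other letters. -/
theorem wordSum_succ_left (J r : ℕ) (H : List ℕ → X) :
    wordSum (J + 1) r H =
      ∑ l ∈ Finset.range (r + 1), wordSum J l fun c => wordShuffle J c (r - l) H := by
  induction r generalizing H with
  | zero => simp [wordSum, wordShuffle]
  | succ r ih =>
    -- The first letter of a shuffle comes from the word or is a `J`. The latter is impossible if no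
    -- `J` is left, that is, for `l = r`.
    have h1 : ∀ l ∈ Finset.range (r + 1), wordSum J (l + 1) (fun c =>
        wordShuffle J c (r + 1 - (l + 1)) H) =
        ∑ j ∈ Finset.range J, wordSum J l (fun c => wordShuffle J c (r - l) fun e => H (j :: e)) +
        if l = r then 0 else
          wordSum J (l + 1) (fun c => wordShuffle J c (r - (l + 1)) fun e => H (J :: e)) := by
      intro l hl
      have hl := Finset.mem_range.1 hl
      split_ifs with h
      · subst h
        simp only [wordSum, Nat.sub_self, wordShuffle_zero_right, add_zero]
      · simp only [wordSum, ← Finset.sum_add_distrib, ← wordSum_add]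
        refine Finset.sum_congr rfl fun j _ => wordSum_congr _ _ fun c _ _ => ?_
        rw [show r + 1 - (l + 1) = r - (l + 1) + 1 by omega, wordShuffle,
          show r - (l + 1) + 1 = r - l by omega]
    rw [Finset.sum_range_succ', Finset.sum_congr rfl h1, Finset.sum_add_distrib]
    have h2 : ∑ l ∈ Finset.range (r + 1), (if l = r then (0 : X) else
          wordSum J (l + 1) (fun c => wordShuffle J c (r - (l + 1)) fun e => H (J :: e))) =
        ∑ l ∈ Finset.range r,
          wordSum J (l + 1) (fun c => wordShuffle J c (r - (l + 1)) fun e => H (J :: e)) := by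
      rw [Finset.sum_range_succ, if_pos rfl, add_zero]
      refine Finset.sum_congr rfl fun l hl => if_neg (Finset.mem_range.1 hl).ne
    have h0 : wordSum (J + 1) (r + 1) H = ∑ j ∈ Finset.range J, ∑ l ∈ Finset.range (r + 1),
          wordSum J l (fun c => wordShuffle J c (r - l) fun e => H (j :: e)) +
        ∑ l ∈ Finset.range (r + 1),
          wordSum J l (fun c => wordShuffle J c (r - l) fun e => H (J :: e)) := by
      rw [wordSum, Finset.sum_range_succ]
      simp only [ih]
    rw [h0, h2, Finset.sum_comm, add_assoc]
    congr 1
    rw [Finset.sum_range_succ']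
    simp [wordSum, wordShuffle, List.replicate_succ]

theorem below_perm {j : ℕ} {c e : List ℕ} (h : c.Perm e) : below j c = below j e :=
  h.countP_eq _

theorem below_append (j : ℕ) (c e : List ℕ) : below j (c ++ e) = below j c + below j e :=
  List.countP_append

theorem below_replicate {j J : ℕ} (s : ℕ) (h : j ≤ J) : below j (List.replicate s J) = 0 := by
  rw [below, List.countP_replicate, if_neg]; simpa using h

theorem below_eq_length {J : ℕ} {c : List ℕ} (h : ∀ j ∈ c, j < J) : below J c = c.length :=
  List.countP_eq_length.2 fun j hj => by simpa using h j hj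

theorem below_le (j : ℕ) (c : List ℕ) : below j c ≤ c.length := List.countP_le_length

variable [Inhabited R] (x : ℕ → R → R)

theorem length_wordRows (c : List ℕ) (U : List R) : (wordRows x c U).length = c.length := by
  induction c generalizing U with
  | nil => rfl
  | cons j c ih => simp [wordRows, ih]

theorem wordRows_replicate (J : ℕ) (U : List R) :
    wordRows x (List.replicate U.length J) U = U.map (x J) := by
  induction U with
  | nil => rfl
  | cons a U ih =>
    rw [List.length_cons, List.replicate_succ, wordRows, below_replicate _ le_rfl]
    simp [ih]

theorem wordSign_replicate (J s : ℕ) : wordSign (List.replicate s J) = 1 := by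
  induction s with
  | zero => rfl
  | succ s ih => rw [List.replicate_succ, wordSign, below_replicate _ le_rfl, ih]; simp

/-- As `J` exceeds all letters of `c`, sorting a shuffle assigns the elements of `U` to the letters
of `c` and those of `V` to the copies of `J`. A leading `J` has all the remaining letters of `c`
below it, which accounts for the sign of the shuffle. -/
theorem wordShuffle_rows (J : ℕ) (c : List ℕ) (s : ℕ) (hc : ∀ j ∈ c, j < J) (U V : List R)
    (hU : U.length = c.length) (hV : V.length = s) (F : List R → X) :
    wordShuffle J c s (fun e => wordSign e • F (wordRows x e (U ++ V))) =
      wordSign c • sh (wordRows x c U) (V.map (x J)) F := by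
  induction c generalizing s U V F with
  | nil =>
    obtain rfl := List.length_eq_zero_iff.1 hU
    subst hV
    simp [wordShuffle, wordSign_replicate, wordRows_replicate, wordSign, wordRows]
  | cons j c ihc =>
    induction s generalizing V F with
    | zero =>
      obtain rfl := List.length_eq_zero_iff.1 hV
      simp [wordShuffle]
    | succ s ihs =>
      obtain ⟨b, V, rfl⟩ := List.exists_cons_of_length_eq_add_one hV
      have hj : j < J := hc j (by simp)
      have hc' : ∀ i ∈ c, i < J := fun i hi => hc i (List.mem_cons_of_mem _ hi)
      have hk : below j c < U.length := by
        rw [hU]; exact Nat.lt_succ_of_le (below_le j c)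
      rw [wordShuffle, wordRows, List.map_cons, sh_cons_cons]
      have h1 : wordShuffle J c (s + 1) (fun e => wordSign (j :: e) •
          F (wordRows x (j :: e) (U ++ b :: V))) =
          wordShuffle J c (s + 1) (fun e => (-1 : ℤ) ^ below j c • (wordSign e •
            F (x j (U.getD (below j c) default) ::
              wordRows x e (U.eraseIdx (below j c) ++ b :: V)))) := by
        refine wordShuffle_congr _ _ _ fun e he => ?_
        -- Copies of `J` are never below `j`, so shuffling them in does not change the count.
        have hb : below j e = below j c := by
          rw [below_perm he, below_append, below_replicate _ hj.le, add_zero]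
        rw [wordSign, wordRows, hb, mul_smul, List.getD_append _ _ _ _ hk,
          List.eraseIdx_append_of_lt_length hk]
      have h2 : wordShuffle J (j :: c) s (fun e => wordSign (J :: e) •
          F (wordRows x (J :: e) (U ++ b :: V))) =
          wordShuffle J (j :: c) s (fun e => (-1 : ℤ) ^ (c.length + 1) • (wordSign e •
            F (x J b :: wordRows x e (U ++ V)))) := by
        refine wordShuffle_congr _ _ _ fun e he => ?_
        have hb : below J e = U.length := by
          rw [below_perm he, below_append, below_replicate _ le_rfl, add_zero,
            below_eq_length hc, hU]
        rw [wordSign, wordRows, hb, mul_smul, List.getD_append_right _ _ _ _ le_rfl,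
          List.eraseIdx_append_of_length_le le_rfl, ← List.length_cons (a := j), ← hU]
        simp
      rw [h1, h2, wordShuffle_smul, wordShuffle_smul,
        ihc (s + 1) hc' (U.eraseIdx (below j c)) (b :: V)
          (by rw [List.length_eraseIdx_of_lt hk, hU]; simp) hV
          (fun D => F (x j (U.getD (below j c) default) :: D)),
        ihs V (by simpa using hV) (fun D => F (x J b :: D)), wordSign, length_wordRows, smul_add,
        smul_smul, smul_smul, smul_smul, wordRows]
      congr 2
      ring

theorem cut_eq_sum {S : Type*} (K : List S → List S → X) (L : List S) :
    cut K L = ∑ i ∈ Finset.range (L.length + 1), K (L.take i) (L.drop i) := by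
  induction L generalizing K with
  | nil => simp
  | cons a L ih =>
    rw [cut_cons, ih, List.length_cons, Finset.sum_range_succ' _ (L.length + 1), add_comm]
    simp

/-- Sums over distributions into columns as sums over words. -/
theorem colSum_eq_wordSum (J : ℕ) (U : List R) (F : List R → X) :
    colSum x J U F = wordSum J U.length fun c => wordSign c • F (wordRows x c U) := by
  induction J generalizing U F with
  | zero =>
    rcases U with _ | ⟨a, U⟩
    · simp [colSum_zero, wordSum, wordSign, wordRows]
    · simp [colSum_zero, wordSum]
  | succ J ih =>
    rw [wordSum_succ_left, colSum_succ, cut_eq_sum]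
    refine Finset.sum_congr rfl fun l hl => ?_
    have hl := Finset.mem_range.1 hl
    have hl' : (U.take l).length = l := by rw [List.length_take]; omega
    rw [ih, hl']
    refine wordSum_congr _ _ fun c hc hc' => ?_
    have := wordShuffle_rows x J c (U.length - l) hc' (U.take l) (U.drop l) (by rw [hl', hc])
      (by simp) F
    rw [List.take_append_drop] at this
    exact this.symm

theorem sum_eq_wordSum (J r : ℕ) (H : List ℕ → X) :
    ∑ c : Fin r → Fin J, H (List.ofFn fun i => (c i : ℕ)) = wordSum J r H := by
  induction r generalizing H with
  | zero => simp [wordSum]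
  | succ r ih =>
    rw [wordSum, ← (Fin.consEquiv fun _ : Fin (r + 1) => Fin J).sum_comp, Fintype.sum_prod_type,
      Finset.sum_range]
    refine Finset.sum_congr rfl fun j _ => ?_
    rw [← ih]
    refine Finset.sum_congr rfl fun c _ => ?_
    rw [List.ofFn_succ]
    simp [Fin.consEquiv]

end Words

/-! ### The sorting permutation of a word -/

section Sorting

variable {r J : ℕ} (j : Fin J) (c : Fin r → Fin J)

theorem below_ofFn (j : ℕ) (c : Fin r → ℕ) :
    below j (List.ofFn c) = (Finset.univ.filter fun i => c i < j).card := by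
  rw [below, List.ofFn_eq_map, List.countP_map, Finset.card_def, Finset.filter_val,
    ← Multiset.countP_eq_card_filter]
  rw [show (Finset.univ : Finset (Fin r)).val = (List.finRange r : Multiset (Fin r)) from rfl,
    Multiset.coe_countP]
  rfl

theorem rank_cons_zero : rank (Fin.cons j c : Fin (r + 1) → Fin J) 0 =
    (Finset.univ.filter fun i => c i < j).card := by
  rw [rank]
  have : (Finset.univ.filter fun i' : Fin (r + 1) => (Fin.cons j c : Fin (r + 1) → Fin J) i' <
      (Fin.cons j c : Fin (r + 1) → Fin J) 0 ∨ (Fin.cons j c : Fin (r + 1) → Fin J) i' =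
      (Fin.cons j c : Fin (r + 1) → Fin J) 0 ∧ i' ≤ 0) =
      insert 0 ((Finset.univ.filter fun i => c i < j).map (Fin.succEmb r)) := by
    ext i
    refine Fin.cases ?_ (fun i => ?_) i
    · simp
    · simp [Fin.succ_ne_zero]
  rw [this, Finset.card_insert_of_notMem (by simp [Fin.succ_ne_zero]), Finset.card_map]
  rfl

theorem rank_cons_succ (i : Fin r) : rank (Fin.cons j c : Fin (r + 1) → Fin J) i.succ =
    if j ≤ c i then rank c i + 1 else rank c i := by
  have hpos : 0 < (Finset.univ.filter fun l => c l < c i ∨ c l = c i ∧ l ≤ i).card :=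
    Finset.card_pos.2 ⟨i, by simp⟩
  have hmap : ∀ l : Fin r, l.succ ∈ (Finset.univ.filter fun i' : Fin (r + 1) =>
      (Fin.cons j c : Fin (r + 1) → Fin J) i' < (Fin.cons j c : Fin (r + 1) → Fin J) i.succ ∨
      (Fin.cons j c : Fin (r + 1) → Fin J) i' = (Fin.cons j c : Fin (r + 1) → Fin J) i.succ ∧
      i' ≤ i.succ) ↔ c l < c i ∨ c l = c i ∧ l ≤ i := by
    intro l; simp
  rw [rank, rank]
  split_ifs with h
  · have : (Finset.univ.filter fun i' : Fin (r + 1) => (Fin.cons j c : Fin (r + 1) → Fin J) i' <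
        (Fin.cons j c : Fin (r + 1) → Fin J) i.succ ∨ (Fin.cons j c : Fin (r + 1) → Fin J) i' =
        (Fin.cons j c : Fin (r + 1) → Fin J) i.succ ∧ i' ≤ i.succ) =
        insert 0 ((Finset.univ.filter fun l => c l < c i ∨ c l = c i ∧ l ≤ i).map
          (Fin.succEmb r)) := by
      ext l
      refine Fin.cases ?_ (fun l => ?_) l
      · simpa using lt_or_eq_of_le h
      · rw [hmap]; simp [Fin.succ_ne_zero]
    rw [this, Finset.card_insert_of_notMem (by simp [Fin.succ_ne_zero]), Finset.card_map]
    omega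
  · have : (Finset.univ.filter fun i' : Fin (r + 1) => (Fin.cons j c : Fin (r + 1) → Fin J) i' <
        (Fin.cons j c : Fin (r + 1) → Fin J) i.succ ∨ (Fin.cons j c : Fin (r + 1) → Fin J) i' =
        (Fin.cons j c : Fin (r + 1) → Fin J) i.succ ∧ i' ≤ i.succ) =
        (Finset.univ.filter fun l => c l < c i ∨ c l = c i ∧ l ≤ i).map (Fin.succEmb r) := by
      ext l
      refine Fin.cases ?_ (fun l => ?_) l
      · have h' : c i < j := not_le.1 h
        simp [h'.le, h'.ne', Fin.succ_ne_zero]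
      · rw [hmap]; simp
    rw [this, Finset.card_map]

/-- The letters below `j` occupy exactly the first ranks. This decides on which side of the inserted
position an element lies. -/
theorem le_rank_iff (i : Fin r) :
    (Finset.univ.filter fun i => c i < j).card ≤ rank c i ↔ j ≤ c i := by
  have hpos : 0 < (Finset.univ.filter fun l => c l < c i ∨ c l = c i ∧ l ≤ i).card :=
    Finset.card_pos.2 ⟨i, by simp⟩
  constructor
  · intro h
    by_contra h'
    have h1 := Finset.card_le_card (show
      (Finset.univ.filter fun l => c l < c i ∨ c l = c i ∧ l ≤ i) ⊆
        Finset.univ.filter fun i => c i < j from fun l => by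
        simp only [Finset.mem_filter, Finset.mem_univ, true_and]; omega)
    rw [rank] at h
    omega
  · intro h
    have h1 := Finset.card_lt_card (show (Finset.univ.filter fun i => c i < j) ⊂
      (Finset.univ.filter fun l => c l < c i ∨ c l = c i ∧ l ≤ i) by
        rw [Finset.ssubset_iff_of_subset]
        · exact ⟨i, by simp, by simpa using h⟩
        · intro l
          simp only [Finset.mem_filter, Finset.mem_univ, true_and]; omega)
    rw [rank]
    omega

/-- A new first letter `j` gets the rank `k` and raises by one the ranks of all letters which are
not below `j`. This is an insertion at the position `k`, hence an inverse cycle after the old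
permutation; its sign is `(-1) ^ k`. -/
theorem sigmaC_cons (k : Fin (r + 1))
    (hk : (k : ℕ) = (Finset.univ.filter fun i => c i < j).card) :
    sigmaC (Fin.cons j c : Fin (r + 1) → Fin J) =
      (Fin.cycleRange k)⁻¹ * Equiv.Perm.decomposeFin.symm (0, sigmaC c) := by
  ext i
  refine Fin.cases ?_ (fun i => ?_) i
  · rw [Equiv.Perm.mul_apply, Equiv.Perm.decomposeFin_symm_apply_zero]
    change rank _ 0 = ((Fin.cycleRange k).symm 0 : ℕ)
    rw [rank_cons_zero, Fin.cycleRange_symm_zero, hk]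
  · rw [Equiv.Perm.mul_apply, Equiv.Perm.decomposeFin_symm_apply_succ, Equiv.swap_self]
    change rank _ i.succ = ((Fin.cycleRange k).symm (sigmaC c i).succ : ℕ)
    rw [rank_cons_succ, Fin.cycleRange_symm_succ]
    have h1 : (sigmaC c i : ℕ) = rank c i := rfl
    split_ifs with h
    · rw [Fin.succAbove_of_le_castSucc, Fin.val_succ, h1]
      rw [Fin.le_def, Fin.val_castSucc, h1, hk]
      exact (le_rank_iff j c i).2 h
    · rw [Fin.succAbove_of_castSucc_lt, Fin.val_castSucc, h1]
      rw [Fin.lt_def, Fin.val_castSucc, h1, hk]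
      exact not_le.1 fun h' => h ((le_rank_iff j c i).1 h')

theorem sigmaC_cons_zero : ((sigmaC (Fin.cons j c : Fin (r + 1) → Fin J)) 0 : ℕ) =
    below j (List.ofFn fun i => (c i : ℕ)) := by
  rw [below_ofFn]
  exact rank_cons_zero j c

theorem sign_sigmaC_cons : Equiv.Perm.sign (sigmaC (Fin.cons j c : Fin (r + 1) → Fin J)) =
    (-1) ^ below j (List.ofFn fun i => (c i : ℕ)) * Equiv.Perm.sign (sigmaC c) := by
  have hlt : (Finset.univ.filter fun i => c i < j).card < r + 1 :=
    Nat.lt_succ_of_le ((Finset.card_le_univ _).trans (by simp))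
  rw [sigmaC_cons j c ⟨_, hlt⟩ rfl, map_mul, Equiv.Perm.sign_inv, Fin.sign_cycleRange,
    Equiv.Perm.decomposeFin.symm_sign, if_pos rfl, one_mul, below_ofFn]
  rfl

theorem wordSign_ofFn (c : Fin r → Fin J) :
    wordSign (List.ofFn fun i => (c i : ℕ)) = (Equiv.Perm.sign (sigmaC c) : ℤ) := by
  induction r with
  | zero => simp [wordSign, Subsingleton.elim (sigmaC c) 1]
  | succ r ih =>
    rw [← Fin.cons_self_tail c, sign_sigmaC_cons, List.ofFn_succ]
    simp only [Fin.cons_zero, Fin.cons_succ, wordSign, ih]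
    simp

/-- Erasing the element at the position `k` of the list matches the gap at the rank `k` in
`rank_cons_succ`. -/
theorem wordRows_ofFn {R : Type*} [Inhabited R] (x : ℕ → R → R) (c : Fin r → Fin J)
    (U : List R) (hU : U.length = r) :
    wordRows x (List.ofFn fun i => (c i : ℕ)) U =
      List.ofFn fun i => x (c i) (U.getD (sigmaC c i) default) := by
  induction r generalizing U with
  | zero => simp [wordRows]
  | succ r ih =>
    have hlt : (Finset.univ.filter fun i => Fin.tail c i < c 0).card < r + 1 :=
      Nat.lt_succ_of_le ((Finset.card_le_univ _).trans (by simp))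
    obtain ⟨j, c, rfl⟩ : ∃ j c', c = Fin.cons j c' := ⟨_, _, (Fin.cons_self_tail c).symm⟩
    rw [List.ofFn_succ, List.ofFn_succ]
    simp only [Fin.cons_zero, Fin.cons_succ, wordRows, sigmaC_cons_zero]
    have hk : below j (List.ofFn fun i => (c i : ℕ)) < U.length := by
      rw [hU]
      exact Nat.lt_succ_of_le ((below_le _ _).trans (by simp))
    rw [ih c _ (by rw [List.length_eraseIdx_of_lt hk, hU]; rfl)]
    congr 2
    funext i
    congr 1
    have h1 : (sigmaC (Fin.cons j c : Fin (r + 1) → Fin J) i.succ : ℕ) = _ := rank_cons_succ j c i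
    have h2 := le_rank_iff j c i
    have h3 : (sigmaC c i : ℕ) = rank c i := rfl
    have h4 : below j (List.ofFn fun i => (c i : ℕ)) =
      (Finset.univ.filter fun i => c i < j).card := below_ofFn _ _
    rw [h1, h3, List.getD_eq_getElem?_getD, List.getElem?_eraseIdx, h4,
      List.getD_eq_getElem?_getD]
    split_ifs <;> first | rfl | omega

/-- This identifies the sums over choices of columns, in `g` as well as in the homotopy, with the
recursive sum `colSum`. -/
theorem sum_sigmaC {R X : Type*} [AddCommGroup X] [Inhabited R] (x : ℕ → R → R)
    (U : List R) (hU : U.length = r) (F : List R → X) :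
    ∑ c : Fin r → Fin J, (Equiv.Perm.sign (sigmaC c) : ℤ) •
      F (List.ofFn fun i => x (c i) (U.getD (sigmaC c i) default)) = colSum x J U F := by
  rw [colSum_eq_wordSum, hU, ← sum_eq_wordSum]
  refine Finset.sum_congr rfl fun c _ => ?_
  rw [wordSign_ofFn, wordRows_ofFn x c U hU]

end Sorting

end Shuffle

end

section

namespace Shuffle

/-! ### Shuffle permutations -/

section Perm

variable {R : Type*} {X : Type*} [AddCommGroup X] {N : ℕ}

/-- The shuffles of two neighbouring intervals. -/
theorem mem_shuffles_iff {a u v : ℕ} {σ : Equiv.Perm (Fin N)} :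
    σ ∈ shuffles (rowSet N (a + 1) (a + u)) (rowSet N (a + u + 1) (a + u + v)) ↔
      (∀ i j : Fin N, i < j → (a ≤ (i : ℕ) ∧ (j : ℕ) < a + u ∨ a + u ≤ (i : ℕ) ∧ (j : ℕ) < a + u + v) →
        σ i < σ j) ∧ ∀ i : Fin N, ((i : ℕ) < a ∨ a + u + v ≤ (i : ℕ)) → σ i = i := by
  simp only [shuffles, rowSet, Finset.mem_filter, Finset.mem_univ, true_and, Finset.mem_union,
    not_or, not_and, not_le]
  constructor
  · rintro ⟨h1, h2⟩
    refine ⟨fun i j hij h => h1 i j hij ?_, fun i h => h2 i ?_⟩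
    · rw [Fin.lt_def] at hij; omega
    · omega
  · rintro ⟨h1, h2⟩
    refine ⟨fun i j hij h => h1 i j hij ?_, fun i h => h2 i ?_⟩
    · rw [Fin.lt_def] at hij; omega
    · omega

/-- All positions outside the interval are fixed, so the interval is mapped to itself, increasingly;
hence the permutation is strictly monotone on all positions. -/
theorem eq_one_of_increasing {a v : ℕ} {σ : Equiv.Perm (Fin N)}
    (h1 : ∀ i j : Fin N, i < j → a ≤ (i : ℕ) → (j : ℕ) < a + v → σ i < σ j)
    (h2 : ∀ i : Fin N, ((i : ℕ) < a ∨ a + v ≤ (i : ℕ)) → σ i = i) : σ = 1 := by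
  have h3 : ∀ i : Fin N, a ≤ (i : ℕ) → (i : ℕ) < a + v → a ≤ (σ i : ℕ) ∧ (σ i : ℕ) < a + v := by
    intro i hi hi'
    by_contra h
    have h4 := h2 (σ i) (by omega)
    have h5 := σ.injective h4
    rw [h5] at h
    omega
  have hmono : StrictMono σ := by
    intro i j hij
    have hij' : (i : ℕ) < j := hij
    rw [Fin.lt_def]
    by_cases hi : (i : ℕ) < a ∨ a + v ≤ (i : ℕ)
    · rw [h2 i hi]
      by_cases hj : (j : ℕ) < a ∨ a + v ≤ (j : ℕ)
      · rwa [h2 j hj]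
      · have := h3 j (by omega) (by omega); omega
    · by_cases hj : (j : ℕ) < a ∨ a + v ≤ (j : ℕ)
      · rw [h2 j hj]; have := h3 i (by omega) (by omega); omega
      · exact h1 i j hij (by omega) (by omega)
  ext i
  have := hmono.range_inj (g := id) strictMono_id
  rw [show (σ : Fin N → Fin N) = id from this.1 (by simp [σ.surjective.range_eq])]
  rfl

theorem shuffles_left_zero (a v : ℕ) :
    shuffles (rowSet N (a + 1) (a + 0)) (rowSet N (a + 0 + 1) (a + 0 + v)) = {1} := by
  ext σ
  rw [mem_shuffles_iff, Finset.mem_singleton]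
  constructor
  · rintro ⟨h1, h2⟩
    exact eq_one_of_increasing (a := a) (v := v) (fun i j hij h h' => h1 i j hij (by omega))
      (fun i h => h2 i (by omega))
  · rintro rfl
    exact ⟨fun i j hij _ => hij, fun i _ => rfl⟩

theorem shuffles_right_zero (a u : ℕ) :
    shuffles (rowSet N (a + 1) (a + u)) (rowSet N (a + u + 1) (a + u + 0)) = {1} := by
  ext σ
  rw [mem_shuffles_iff, Finset.mem_singleton]
  constructor
  · rintro ⟨h1, h2⟩
    exact eq_one_of_increasing (a := a) (v := u) (fun i j hij h h' => h1 i j hij (by omega))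
      (fun i h => h2 i (by omega))
  · rintro rfl
    exact ⟨fun i j hij _ => hij, fun i _ => rfl⟩

/-- A shuffle moves the first element of one of the two intervals to the first position. -/
theorem shuffle_first {a u v : ℕ} (ha : a + (u + 1) + (v + 1) ≤ N) {σ : Equiv.Perm (Fin N)}
    (h1 : ∀ i j : Fin N, i < j → (a ≤ (i : ℕ) ∧ (j : ℕ) < a + (u + 1) ∨
      a + (u + 1) ≤ (i : ℕ) ∧ (j : ℕ) < a + (u + 1) + (v + 1)) → σ i < σ j)
    (h2 : ∀ i : Fin N, ((i : ℕ) < a ∨ a + (u + 1) + (v + 1) ≤ (i : ℕ)) → σ i = i)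
    (h : σ ⟨a, by omega⟩ ≠ ⟨a, by omega⟩) : σ ⟨a + u + 1, by omega⟩ = ⟨a, by omega⟩ := by
  -- Consider the preimage `b` of the first position. It lies in one of the two intervals, and since
  -- the permutation increases on each of them, `b` must be the head of its interval.
  obtain ⟨b, hb⟩ := σ.surjective ⟨a, by omega⟩
  have hout : ∀ i : Fin N, a ≤ (i : ℕ) → (i : ℕ) < a + (u + 1) + (v + 1) → ¬ (σ i : ℕ) < a := by
    intro i hi hi' hlt
    have h4 := h2 (σ i) (by omega)
    have h5 := σ.injective h4
    rw [h5] at hlt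
    omega
  have hbr : a ≤ (b : ℕ) ∧ (b : ℕ) < a + (u + 1) + (v + 1) := by
    by_contra hc
    have h3 := h2 b (by omega)
    have : b = ⟨a, by omega⟩ := by rw [← h3, hb]
    rw [this] at hc
    dsimp only at hc
    omega
  have hba : (b : ℕ) ≠ a := by
    intro hc
    have : b = ⟨a, by omega⟩ := Fin.ext hc
    rw [this] at hb
    exact h hb
  by_cases hbu : (b : ℕ) < a + (u + 1)
  · exfalso
    have h3 := h1 ⟨a, by omega⟩ b (by rw [Fin.lt_def]; dsimp only; omega)
      (Or.inl ⟨le_rfl, hbu⟩)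
    rw [hb, Fin.lt_def] at h3
    exact hout _ (by simp) (by dsimp only; omega) h3
  · by_cases hbe : (b : ℕ) = a + u + 1
    · rw [← hb]; congr 1; exact Fin.ext hbe.symm
    · exfalso
      have h3 := h1 ⟨a + u + 1, by omega⟩ b (by rw [Fin.lt_def]; dsimp only; omega)
        (Or.inr ⟨by dsimp only; omega, hbr.2⟩)
      rw [hb, Fin.lt_def] at h3
      exact hout _ (by dsimp only; omega) (by dsimp only; omega) h3

/-- The cycle which moves the first element of the second interval to the front. -/
theorem val_cycleIcc {i j : Fin N} (hij : i ≤ j) (l : Fin N) : (Fin.cycleIcc i j l : ℕ) =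
    if (l : ℕ) < i ∨ (j : ℕ) < l then (l : ℕ) else if (l : ℕ) = j then (i : ℕ) else l + 1 := by
  have : NeZero N := ⟨fun h => by subst h; exact i.elim0⟩
  split_ifs with h1 h2
  · rcases h1 with h1 | h1
    · rw [Fin.cycleIcc_of_lt h1]
    · rw [Fin.cycleIcc_of_gt h1]
  · rw [Fin.ext h2, Fin.cycleIcc_of_last hij]
  · rw [Fin.cycleIcc_of_ge_of_lt (by rw [Fin.le_def]; omega) (by rw [Fin.lt_def]; omega)]
    have := j.2
    rw [Fin.val_add_one_of_lt']
    omega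

/-- A segment of a family. -/
def seg (g : Fin N → R) (a u : ℕ) : List R := ((List.ofFn g).drop a).take u

theorem seg_succ (g : Fin N → R) (a u : ℕ) (h : a < N) :
    seg g a (u + 1) = g ⟨a, h⟩ :: seg g (a + 1) u := by
  rw [seg, List.drop_eq_getElem_cons (by simpa using h), List.take_succ_cons, List.getElem_ofFn]
  rfl

theorem seg_congr {N' : ℕ} {g : Fin N → R} {g' : Fin N' → R} {a a' u : ℕ} (hu : a + u ≤ N)
    (hu' : a' + u ≤ N')
    (h : ∀ i (hi : i < u), g ⟨a + i, by omega⟩ = g' ⟨a' + i, by omega⟩) : seg g a u = seg g' a' u := by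
  induction u generalizing a a' with
  | zero => simp [seg]
  | succ u ih =>
    rw [seg_succ g a u (by omega), seg_succ g' a' u (by omega),
      ih (a := a + 1) (a' := a' + 1) (by omega) (by omega) fun i hi => ?_]
    · congr 1
      exact h 0 (by omega)
    · have := h (i + 1) (by omega)
      simpa only [add_assoc, add_comm 1 i] using this

theorem take_eq_seg (g : Fin N → R) (a : ℕ) : (List.ofFn g).take a = seg g 0 a := rfl

theorem drop_eq_seg (g : Fin N → R) (a : ℕ) : (List.ofFn g).drop a = seg g a (N - a) := by
  rw [seg, List.take_of_length_le]
  simp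

theorem seg_append (g : Fin N → R) (a u v : ℕ) :
    seg g a u ++ seg g (a + u) v = seg g a (u + v) := by
  rw [seg, seg, seg, List.take_add, List.drop_drop]

/-- Induction on `u + v`. A shuffle either fixes the position `a`, and is then a shuffle of shorter
intervals, or it moves the head of the second interval there; in this case a cycle of sign `(-1) ^
(u + 1)` splits off. This is the recursion of `sh`. -/
theorem sum_shuffles (a u v : ℕ) (g : Fin N → R) (h : a + u + v ≤ N) (F : List R → X) :
    ∑ σ ∈ shuffles (rowSet N (a + 1) (a + u)) (rowSet N (a + u + 1) (a + u + v)),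
      (Equiv.Perm.sign σ : ℤ) • F (List.ofFn fun i => g (σ.symm i)) =
    sh (seg g a u) (seg g (a + u) v)
      (fun D => F ((List.ofFn g).take a ++ D ++ (List.ofFn g).drop (a + u + v))) := by
  induction hs : u + v generalizing a u v g F with
  | zero =>
    obtain rfl : u = 0 := by omega
    obtain rfl : v = 0 := by omega
    rw [shuffles_left_zero, Finset.sum_singleton]
    have h0 : (fun i => g ((1 : Equiv.Perm (Fin N)).symm i)) = g := rfl
    simp [seg, h0]
  | succ s ih =>
    rcases u with _ | u
    · rw [shuffles_left_zero, Finset.sum_singleton]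
      have h0 : (fun i => g ((1 : Equiv.Perm (Fin N)).symm i)) = g := rfl
      rw [h0, Equiv.Perm.sign_one, show seg g a 0 = [] by simp [seg], sh_nil_left, seg,
        add_zero, ← List.drop_drop, List.append_assoc, List.take_append_drop,
        List.take_append_drop]
      simp
    · rcases v with _ | v
      · rw [shuffles_right_zero, Finset.sum_singleton]
        have h0 : (fun i => g ((1 : Equiv.Perm (Fin N)).symm i)) = g := rfl
        rw [h0, Equiv.Perm.sign_one, show seg g (a + (u + 1)) 0 = [] by simp [seg], sh_nil_right, seg,
          add_zero, ← List.drop_drop, List.append_assoc, List.take_append_drop,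
          List.take_append_drop]
        simp
      · classical
        have hlt : a < N := by omega
        have hlt' : a + u + 1 < N := by omega
        set a₀ : Fin N := ⟨a, hlt⟩
        set b₀ : Fin N := ⟨a + u + 1, hlt'⟩
        have hab : a₀ ≤ b₀ := by rw [Fin.le_def]; change a ≤ a + u + 1; omega
        -- The cycle `c` moves the head of the second interval to the position `a` and the first
        -- interval one step to the right.
        set c : Equiv.Perm (Fin N) := Fin.cycleIcc a₀ b₀ with hc
        have hcv : ∀ l : Fin N, (c l : ℕ) = if (l : ℕ) < a ∨ a + u + 1 < (l : ℕ) then (l : ℕ) else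
            if (l : ℕ) = a + u + 1 then a else l + 1 := fun l => val_cycleIcc hab l
        have hsign : (Equiv.Perm.sign c : ℤ) = (-1) ^ (u + 1) := by
          rw [hc, Fin.sign_cycleIcc_of_le hab]
          change ((((-1) ^ (a + u + 1 - a) : ℤˣ)) : ℤ) = _
          rw [show a + u + 1 - a = u + 1 by omega]
          simp
        -- the permutations which fix the first position
        have e1 : (shuffles (rowSet N (a + 1) (a + (u + 1)))
            (rowSet N (a + (u + 1) + 1) (a + (u + 1) + (v + 1)))).filter (fun σ => σ a₀ = a₀) =
            shuffles (rowSet N (a + 1 + 1) (a + 1 + u))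
              (rowSet N (a + 1 + u + 1) (a + 1 + u + (v + 1))) := by
          ext σ
          rw [Finset.mem_filter, mem_shuffles_iff, mem_shuffles_iff]
          constructor
          · rintro ⟨⟨h1, h2⟩, h3⟩
            refine ⟨fun i j hij hh => h1 i j hij (by omega), fun i hi => ?_⟩
            by_cases hia : (i : ℕ) = a
            · have : i = a₀ := Fin.ext hia
              rw [this, h3]
            · exact h2 i (by omega)
          · rintro ⟨h1, h2⟩
            have h3 : σ a₀ = a₀ := h2 a₀ (Or.inl (Nat.lt_succ_self a))
            refine ⟨⟨fun i j hij hh => ?_, fun i hi => h2 i (by omega)⟩, h3⟩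
            have hij' : (i : ℕ) < j := hij
            by_cases hia : (i : ℕ) = a
            · have hi : i = a₀ := Fin.ext hia
              rw [hi, h3, Fin.lt_def]
              by_contra hc'
              have h5 : (σ j : ℕ) ≤ a := not_lt.1 hc'
              have h6 := σ.injective (h2 (σ j) (by omega))
              rw [h6] at h5
              omega
            · exact h1 i j hij (by omega)
        -- The other shuffles are the products `σ * c`, where `σ` is a shuffle for the positions
        -- after `c`: the position `a` is fixed, the first interval starts at `a + 1`, and the
        -- second one has lost its head.
        have e2 : ∀ σ : Equiv.Perm (Fin N), σ * c ∈ (shuffles (rowSet N (a + 1) (a + (u + 1)))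
            (rowSet N (a + (u + 1) + 1) (a + (u + 1) + (v + 1)))).filter (fun σ => ¬ σ a₀ = a₀) ↔
            σ ∈ shuffles (rowSet N (a + 1 + 1) (a + 1 + (u + 1)))
              (rowSet N (a + 1 + (u + 1) + 1) (a + 1 + (u + 1) + v)) := by
          intro σ
          have hca : c b₀ = a₀ := by
            apply Fin.ext
            rw [hcv]
            change (if a + u + 1 < a ∨ a + u + 1 < a + u + 1 then _ else
              if a + u + 1 = a + u + 1 then a else _) = a
            rw [if_neg (by omega), if_pos rfl]
          rw [Finset.mem_filter, mem_shuffles_iff, mem_shuffles_iff]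
          simp only [Equiv.Perm.mul_apply]
          constructor
          · rintro ⟨⟨h1, h2⟩, h3⟩
            have h4 : σ a₀ = a₀ := by
              have := shuffle_first (σ := σ * c) (by omega) h1 h2 h3
              rwa [Equiv.Perm.mul_apply, hca] at this
            have hfix : ∀ i : Fin N, ((i : ℕ) < a + 1 ∨ a + 1 + (u + 1) + v ≤ (i : ℕ)) → σ i = i := by
              intro i hi
              by_cases hia : (i : ℕ) = a
              · rw [show i = a₀ from Fin.ext hia, h4]
              · have h5 := h2 i (by omega)
                have h6 : c i = i := by
                  apply Fin.ext; rw [hcv, if_pos (by omega)]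
                rwa [h6] at h5
            refine ⟨fun i j hij hh => ?_, hfix⟩
            have hij' : (i : ℕ) < j := hij
            have hi2 := i.2
            have hj2 := j.2
            rcases hh with hh | hh
            · have hi : c ⟨(i : ℕ) - 1, by omega⟩ = i := by
                apply Fin.ext; rw [hcv]; dsimp only
                rw [if_neg (by omega), if_neg (by omega)]; omega
              have hj : c ⟨(j : ℕ) - 1, by omega⟩ = j := by
                apply Fin.ext; rw [hcv]; dsimp only
                rw [if_neg (by omega), if_neg (by omega)]; omega
              have := h1 ⟨(i : ℕ) - 1, by omega⟩ ⟨(j : ℕ) - 1, by omega⟩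
                (by rw [Fin.lt_def]; dsimp only; omega) (by dsimp only; omega)
              rwa [hi, hj] at this
            · have hi : c i = i := by
                apply Fin.ext; rw [hcv, if_pos (by omega)]
              have hj : c j = j := by
                apply Fin.ext; rw [hcv, if_pos (by omega)]
              have := h1 i j hij (by omega)
              rwa [hi, hj] at this
          · rintro ⟨h1, h2⟩
            have h4 : σ a₀ = a₀ := h2 a₀ (Or.inl (Nat.lt_succ_self a))
            refine ⟨⟨fun i j hij hh => ?_, fun i hi => ?_⟩, fun h5 => ?_⟩
            · have hij' : (i : ℕ) < j := hij
              have hi2 := i.2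
              have hj2 := j.2
              by_cases hib : (i : ℕ) = a + u + 1
              · rw [show i = b₀ from Fin.ext hib, hca, h4]
                have hj : c j = j := by
                  apply Fin.ext; rw [hcv, if_pos (by omega)]
                rw [hj, Fin.lt_def]
                by_contra hc'
                have h5 : (σ j : ℕ) ≤ a := not_lt.1 hc'
                have h6 := σ.injective (h2 (σ j) (by omega))
                rw [h6] at h5
                omega
              · refine h1 _ _ ?_ ?_
                · rw [Fin.lt_def, hcv, hcv]
                  split_ifs <;> omega
                · rw [hcv, hcv]
                  split_ifs <;> omega
            · have h6 : c i = i := by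
                apply Fin.ext; rw [hcv, if_pos (by omega)]
              rw [h6]
              exact h2 i (by omega)
            · have h6 : c a₀ = a₀ := σ.injective (h5.trans h4.symm)
              have h7 := congrArg Fin.val h6
              rw [hcv] at h7
              change (if a < a ∨ a + u + 1 < a then _ else if a = a + u + 1 then a else a + 1) = a at h7
              rw [if_neg (by omega), if_neg (by omega)] at h7
              omega
        rw [← Finset.sum_filter_add_sum_filter_not _ (fun σ => σ a₀ = a₀), e1,
          seg_succ g a u hlt, seg_succ g (a + (u + 1)) v (by omega), sh_cons_cons]
        congr 1
        · rw [ih (a + 1) u (v + 1) g (by omega) F (by omega)]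
          rw [← seg_succ g (a + (u + 1)) v (by omega), show a + 1 + u = a + (u + 1) by omega]
          congr 1
          funext D
          rw [take_eq_seg, take_eq_seg, ← seg_append, zero_add, seg_succ g a 0 hlt]
          simp [seg]
        · have e3 : ∑ σ ∈ (shuffles (rowSet N (a + 1) (a + (u + 1)))
              (rowSet N (a + (u + 1) + 1) (a + (u + 1) + (v + 1)))).filter (fun σ => ¬ σ a₀ = a₀),
              (Equiv.Perm.sign σ : ℤ) • F (List.ofFn fun i => g (σ.symm i)) =
              ∑ σ ∈ shuffles (rowSet N (a + 1 + 1) (a + 1 + (u + 1)))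
                (rowSet N (a + 1 + (u + 1) + 1) (a + 1 + (u + 1) + v)),
                (-1 : ℤ) ^ (u + 1) • ((Equiv.Perm.sign σ : ℤ) •
                  F (List.ofFn fun i => g (c.symm (σ.symm i)))) := by
            symm
            refine Finset.sum_bij' (fun σ _ => σ * c) (fun σ _ => σ * c⁻¹)
              (fun σ hσ => (e2 σ).2 hσ) (fun σ hσ => (e2 _).1 (by simpa using hσ))
              (fun σ _ => by simp) (fun σ _ => by simp) (fun σ _ => ?_)
            rw [Equiv.Perm.sign_mul, Units.val_mul, hsign, mul_comm, mul_smul]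
            rfl
          have hcs : ∀ (i j : Fin N), c j = i → c.symm i = j := fun i j hij => by
            rw [← hij, Equiv.symm_apply_apply]
          have hg : ∀ i (hi : i < N), (i < a ∨ a + u + 1 < i) →
              g (c.symm ⟨i, hi⟩) = g ⟨i, hi⟩ := fun i hi hh => by
            rw [hcs ⟨i, hi⟩ ⟨i, hi⟩ (Fin.ext (by rw [hcv, if_pos hh]))]
          have hg0 : g (c.symm ⟨a, hlt⟩) = g ⟨a + u + 1, hlt'⟩ := by
            rw [hcs ⟨a, hlt⟩ ⟨a + u + 1, hlt'⟩ (Fin.ext (by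
              rw [hcv]; dsimp only; rw [if_neg (by omega), if_pos rfl]))]
          rw [e3, ← Finset.smul_sum, ih (a + 1) (u + 1) v (fun i => g (c.symm i)) (by omega) F
            (by omega)]
          have s1 : seg (fun i => g (c.symm i)) (a + 1) (u + 1) = seg g a (u + 1) := by
            refine seg_congr (by omega) (by omega) fun i hi => ?_
            rw [hcs ⟨a + 1 + i, by omega⟩ ⟨a + i, by omega⟩ (Fin.ext (by
              rw [hcv]; dsimp only; rw [if_neg (by omega), if_neg (by omega)]; omega))]
          have s2 : seg (fun i => g (c.symm i)) (a + 1 + (u + 1)) v = seg g (a + (u + 1) + 1) v := by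
            refine seg_congr (by omega) (by omega) fun i hi => ?_
            rw [hg _ _ (by omega)]
            congr 2; omega
          have s3 : (List.ofFn fun i => g (c.symm i)).take (a + 1) =
              (List.ofFn g).take a ++ [g ⟨a + (u + 1), by omega⟩] := by
            rw [take_eq_seg, ← seg_append, zero_add, seg_succ _ a 0 hlt, hg0, take_eq_seg]
            congr 1
            refine seg_congr (by omega) (by omega) fun i hi => ?_
            rw [hg _ _ (by omega)]
          have s4 : (List.ofFn fun i => g (c.symm i)).drop (a + 1 + (u + 1) + v) =
              (List.ofFn g).drop (a + (u + 1) + (v + 1)) := by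
            rw [drop_eq_seg, drop_eq_seg, show a + 1 + (u + 1) + v = a + (u + 1) + (v + 1) by omega]
            refine seg_congr (by omega) (by omega) fun i hi => ?_
            rw [hg _ _ (by omega)]
          rw [s1, s2, s3, s4, seg_succ g a u hlt, show (seg g (a + 1) u).length = u by
            simp [seg]; omega]
          congr 2
          funext D
          simp

end Perm

end Shuffle

end

section

namespace Shuffle

/-! ### The rows of the tables of the homotopy -/

section Lists

variable {M : Type*} [Monoid M] {N n : ℕ}

theorem filter_finRange_lt {S : Type*} (f : Fin N → S) (d : ℕ) :
    ((List.finRange N).filter (fun i : Fin N => (i : ℕ) < d)).map f = (List.ofFn f).take d := by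
  induction N generalizing d with
  | zero => simp
  | succ N ih =>
    rw [List.finRange_succ, List.ofFn_succ]
    rcases d with _ | d
    · simp
    · rw [List.filter_cons_of_pos (by simp), List.map_cons, List.take_succ_cons, ← ih,
        List.filter_map, List.map_map]
      congr 2
      simp [Function.comp_def]

theorem filter_finRange_ge {S : Type*} (f : Fin N → S) (p : ℕ) :
    ((List.finRange N).filter (fun i : Fin N => p ≤ (i : ℕ))).map f = (List.ofFn f).drop p := by
  induction N generalizing p with
  | zero => simp
  | succ N ih =>
    rw [List.finRange_succ, List.ofFn_succ]
    rcases p with _ | p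
    · simp [List.ofFn_eq_map]
    · rw [List.filter_cons_of_neg (by simp), List.drop_succ_cons, ← ih,
        List.filter_map, List.map_map]
      congr 2
      simp [Function.comp_def]

theorem prod_filter_byCols (f : Fin N × Fin n → M) (P : Fin N × Fin n → Prop) [DecidablePred P] :
    (((byCols N n).filter (fun x => P x)).map f).prod =
      ((List.finRange n).map fun j =>
        (((List.finRange N).filter fun i => P (i, j)).map fun i => f (i, j)).prod).prod := by
  rw [byCols]
  generalize List.finRange n = l
  induction l with
  | nil => simp
  | cons j l ih =>
    rw [List.flatMap_cons, List.filter_append, List.map_append, List.prod_append, ih,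
      List.map_cons, List.prod_cons, List.filter_map, List.map_map]
    rfl

theorem prod_range_split (h : ℕ → M) {s : ℕ} (hs : s < n) (h0 : ∀ i < s, h i = 1) :
    ((List.range n).map h).prod = h s * ((List.range' (s + 1) (n - (s + 1))).map h).prod := by
  have h1 : List.range n = List.range s ++ List.range' s (n - s) := by
    have := List.range'_append_1 (s := 0) (m := s) (n := n - s)
    rw [zero_add, show s + (n - s) = n by omega] at this
    rw [List.range_eq_range', List.range_eq_range', this]
  rw [h1, List.map_append, List.prod_append, List.prod_eq_one (l := (List.range s).map h),
    one_mul, show n - s = n - (s + 1) + 1 by omega, List.range'_succ, List.map_cons, List.prod_cons]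
  intro x hx
  obtain ⟨i, hi, rfl⟩ := List.mem_map.1 hx
  exact h0 i (List.mem_range.1 hi)

theorem prod_map_finRange (h : ℕ → M) :
    ((List.finRange n).map fun j : Fin n => h j).prod = ((List.range n).map h).prod := by
  rw [← List.map_coe_finRange_eq_range, List.map_map]
  rfl

/-- The product of a part of a column. -/
theorem prod_filter_col (f : Fin N × Fin n → M) (P : Fin N → Prop) [DecidablePred P] {t : ℕ}
    (ht : 1 ≤ t) (ht' : t ≤ n) :
    (((byCols N n).filter (fun x => P x.1 ∧ (x.2 : ℕ) + 1 = t)).map f).prod =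
      (((List.finRange N).filter fun i => P i).map fun i => f (i, ⟨t - 1, by omega⟩)).prod := by
  rw [prod_filter_byCols f fun x => P x.1 ∧ (x.2 : ℕ) + 1 = t]
  have h1 : ∀ j : Fin n, (((List.finRange N).filter fun i => P i ∧ (j : ℕ) + 1 = t).map
      fun i => f (i, j)).prod = (fun j : ℕ => if j = t - 1 then
        (((List.finRange N).filter fun i => P i).map fun i => f (i, ⟨t - 1, by omega⟩)).prod
        else 1) j := by
    intro j
    dsimp only
    split_ifs with h
    · have : j = ⟨t - 1, by omega⟩ := Fin.ext h
      rw [this]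
      simp [show t - 1 + 1 = t by omega]
    · simp [show ¬ (j : ℕ) + 1 = t by omega]
  simp only [h1]
  rw [prod_map_finRange (fun j => if j = t - 1 then
        (((List.finRange N).filter fun i => P i).map fun i => f (i, ⟨t - 1, by omega⟩)).prod
        else 1), prod_range_split (s := t - 1) _ (by omega), if_pos rfl]
  · refine (congrArg _ (List.prod_eq_one ?_)).trans (mul_one _)
    intro x hx
    obtain ⟨i, hi, rfl⟩ := List.mem_map.1 hx
    have := List.mem_range'_1.1 hi
    rw [if_neg (by omega)]
  · intro i hi
    rw [if_neg (by omega)]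

theorem prod_filter_single (f : Fin N × Fin n → M) {s t : ℕ} (hs : 1 ≤ s) (hs' : s ≤ N)
    (ht : 1 ≤ t) (ht' : t ≤ n) :
    (((byCols N n).filter (fun x => (x.1 : ℕ) + 1 = s ∧ (x.2 : ℕ) + 1 = t)).map f).prod =
      f (⟨s - 1, by omega⟩, ⟨t - 1, by omega⟩) := by
  rw [prod_filter_col f (fun i : Fin N => (i : ℕ) + 1 = s) ht ht']
  have h1 : (List.finRange N).filter (fun i : Fin N => (i : ℕ) + 1 = s) = [⟨s - 1, by omega⟩] := by
    have h2 : (List.finRange N).filter (fun i : Fin N => (i : ℕ) + 1 = s) =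
        (List.finRange N).filter (fun i : Fin N => i == (⟨s - 1, by omega⟩ : Fin N)) := by
      refine List.filter_congr fun i _ => ?_
      simp only [beq_eq_decide, Fin.ext_iff]
      congr 1
      exact propext (by omega)
    rw [h2, List.filter_beq, List.count_eq_one_of_mem (List.nodup_finRange N) (List.mem_finRange _)]
    rfl
  rw [h1]
  simp

theorem entry_prod (L : List (Fin n → M)) (b : ℕ) :
    entry L.prod b = (L.map fun a => entry a b).prod := by
  induction L with
  | nil => simp [entry_one]
  | cons a L ih => simp [entry_mul, ih]

theorem map_seg {R S : Type*} (f : R → S) (g : Fin N → R) (a u : ℕ) :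
    (seg g a u).map f = seg (fun i => f (g i)) a u := by
  rw [seg, seg, List.map_take, List.map_drop, List.map_ofFn]
  rfl

theorem length_seg {R : Type*} (g : Fin N → R) {a u : ℕ} (h : a + u ≤ N) :
    (seg g a u).length = u := by
  simp [seg]; omega

theorem seg_eq_ofFn {R : Type*} (g : Fin N → R) {a u : ℕ} (h : a + u ≤ N) :
    seg g a u = List.ofFn fun i : Fin u => g ⟨a + i, by omega⟩ := by
  rw [← List.take_of_length_le (l := List.ofFn fun i : Fin u => g ⟨a + i, by omega⟩) (i := u)
    (by simp)]
  refine (seg_congr (g' := fun i : Fin u => g ⟨a + i, by omega⟩) (a' := 0) h (by omega)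
    fun i hi => ?_).trans rfl
  simp

theorem getD_seg {R : Type*} (g : Fin N → R) {a u i : ℕ} (h : a + u ≤ N) (hi : i < u) (r : R) :
    (seg g a u).getD i r = g ⟨a + i, by omega⟩ := by
  rw [seg_eq_ofFn g h, List.getD_eq_getElem _ _ (by simpa using hi), List.getElem_ofFn]

end Lists

section Rows

variable {M : Type*} [Monoid M] {m n : ℕ} [NeZero n]

/-- The rows of the table `B_{p, q, d, r, c}`. -/
def bRow (w : Fin (m + 1) → Fin n → M) (p q d r : ℕ) (c : Fin r → Fin (n - q)) :
    Fin (m + 2) → Fin n → M := fun i j =>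
  ((bWord m n p q d r c ((i : ℕ) + 1) ((j : ℕ) + 1)).map fun x => w x.1 x.2).prod

variable (w : Fin (m + 1) → Fin n → M) {q i j l : ℕ} (hq : 2 ≤ q) (hqn : q ≤ n) (hi : i ≤ m)
  (hj : j ≤ i) (hl : l ≤ j) (c : Fin l → Fin (n - q))

omit [NeZero n] in
theorem entry_eq (a : Fin n → M) {b : ℕ} (hb : b < n) : entry a b = a ⟨b, hb⟩ := dif_pos hb

omit [NeZero n] in
theorem entry_tail_prod {b a u : ℕ} (hb : b < n) (h : a + u ≤ m) :
    entry (seg (fun i : Fin m => w i.succ) a u).prod b =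
      (seg (fun i => w i ⟨b, hb⟩) (a + 1) u).prod := by
  rw [entry_prod, map_seg]
  congr 1
  refine seg_congr (by omega) (by omega) fun i hi => ?_
  rw [entry_eq _ hb]
  congr 1
  apply Fin.ext
  simp; omega

include hq hqn hi hj hl

-- The corner entry in terms of the homotopy: the part of the column `q` below the row `p` is `rowE`
-- of the last segment, and the later columns are `rowK` of the whole product.
omit hj hl in
theorem bRow_zero : bRow w (i + 1) q (j + 1) l c 0 =
    rowE q (seg (fun i : Fin m => w i.succ) i (m - i)).prod *
      rowK q (w 0 * (List.ofFn fun i : Fin m => w i.succ).prod) * rowX 0 (w 0) := by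
  have hL : (List.ofFn fun i : Fin m => w i.succ) = seg (fun i : Fin m => w i.succ) 0 m := by
    simp [seg]
  have hfull : ∀ b (hb : b < n), (List.ofFn fun i => w i ⟨b, hb⟩).prod =
      entry (w 0 * (List.ofFn fun i : Fin m => w i.succ).prod) b := by
    intro b hb
    rw [entry_mul, hL, entry_tail_prod w hb (by omega), entry_eq _ hb, List.ofFn_succ,
      List.prod_cons]
    congr 2
    rw [seg_eq_ofFn _ (by omega)]
    congr 1
    funext i
    congr 1
    apply Fin.ext; simp [add_comm]
  refine row_ext fun b hb => ?_
  rw [entry_mul, entry_mul, rowE, rowK, rowX, entry_mkRow _ hb, entry_mkRow _ hb, entry_mkRow _ hb,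
    entry_eq _ hb, bRow, bWord, if_pos (by simp)]
  dsimp only
  by_cases h : b = 0
  · subst h
    rw [if_pos (by simp), if_pos rfl, if_pos rfl, if_pos rfl, List.map_append, List.prod_append]
    congr 1
    · rw [prod_filter_byCols (fun x => w x.1 x.2) fun x : Fin (m + 1) × Fin n =>
        (x.2 : ℕ) + 1 = q ∧ i + 1 + 1 ≤ (x.1 : ℕ) + 1 ∨ q < (x.2 : ℕ) + 1]
      -- Read column by column: nothing before the column `q`, its lower part in the column `q`, and
      -- everything in the later columns.
      have h1 : ∀ b : Fin n, (((List.finRange (m + 1)).filter fun i' : Fin (m + 1) =>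
          (b : ℕ) + 1 = q ∧ i + 1 + 1 ≤ (i' : ℕ) + 1 ∨ q < (b : ℕ) + 1).map fun i => w i b).prod =
          (fun b : ℕ => if b < q - 1 then 1 else if b = q - 1 then
            entry (seg (fun i : Fin m => w i.succ) i (m - i)).prod (q - 1) else
            entry (w 0 * (List.ofFn fun i : Fin m => w i.succ).prod) b) b := by
        intro b
        dsimp only
        split_ifs with h1 h2
        · simp [show ¬ (b : ℕ) + 1 = q by omega, show ¬ q < (b : ℕ) + 1 by omega]
        · have hb : b = ⟨q - 1, by omega⟩ := Fin.ext h2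
          rw [entry_tail_prod w (show q - 1 < n by omega) (by omega)]
          simp only [hb, show q - 1 + 1 = q by omega, true_and, lt_irrefl, or_false,
            Nat.add_le_add_iff_right]
          rw [filter_finRange_ge, drop_eq_seg]
          congr 2; omega
        · simp only [show q < (b : ℕ) + 1 by omega, or_true, decide_true, List.filter_true]
          rw [← hfull b b.2, List.ofFn_eq_map]
      simp only [h1]
      rw [prod_map_finRange (fun b : ℕ => if b < q - 1 then 1 else if b = q - 1 then
            entry (seg (fun i : Fin m => w i.succ) i (m - i)).prod (q - 1) else
            entry (w 0 * (List.ofFn fun i : Fin m => w i.succ).prod) b),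
        prod_range_split (s := q - 1) _ (by omega), if_neg (by omega), if_pos rfl,
        show q - 1 + 1 = q by omega]
      · congr 2
        refine List.map_congr_left fun b hb => ?_
        have := List.mem_range'_1.1 hb
        rw [if_neg (by omega), if_neg (by omega)]
      · intro b hb; rw [if_pos hb]
    · rw [entry_eq _ hb]; simp
  · simp [h]

-- The other kinds of rows of the table are, in order, given by `rowX (c i')`, `rowX (n - q)`, `rowY
-- q`, `rowW q` and `rowZ q`. With `p = i + 1`, `d = j + 1` and `r = l`, the segments `U₁`, `U₂`,
-- `V`, `Y` have the lengths `l`, `j - l`, `i - j`, `m - i`.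
omit hq in
theorem bRow_columns (i' : Fin l) (h : 1 + (i' : ℕ) < m + 2) :
    bRow w (i + 1) q (j + 1) l c ⟨1 + i', h⟩ =
      rowX (c i') (w ⟨(sigmaC c i' : ℕ) + 1, by have := (sigmaC c i').2; omega⟩) := by
  have hσ := (sigmaC c i').2
  have hi' := i'.2
  refine row_ext fun b hb => ?_
  rw [rowX, entry_mkRow _ hb, entry_eq _ hb, bRow, bWord, if_neg (by dsimp only; omega),
    dif_pos (by dsimp only; omega)]
  have h1 : ∀ h, (⟨1 + (i' : ℕ) + 1 - 2, h⟩ : Fin l) = i' := fun h => Fin.ext (by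
    dsimp only; omega)
  simp only [h1]
  by_cases h2 : b = c i'
  · rw [if_pos (by omega), if_pos h2, prod_filter_single (fun x => w x.1 x.2) (by omega) (by omega) le_rfl (by omega),
      entry_eq _ (by omega)]
    rfl
  · rw [if_neg (by omega), if_neg h2]; rfl

omit hq in
theorem bRow_column {i' : ℕ} (h : i' < j - l) :
    bRow w (i + 1) q (j + 1) l c ⟨l + 1 + i', by omega⟩ =
      rowX (n - q) (w ⟨l + i' + 1, by omega⟩) := by
  refine row_ext fun b hb => ?_
  rw [rowX, entry_mkRow _ hb, entry_eq _ hb, bRow, bWord, if_neg (by dsimp only; omega),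
    dif_neg (by dsimp only; omega), if_pos (by dsimp only; omega)]
  dsimp only
  by_cases h2 : b = n - q
  · rw [if_pos (by omega), if_pos h2, prod_filter_single (fun x => w x.1 x.2) (by omega) (by omega) le_rfl (by omega),
      entry_eq _ (by omega)]
    congr 2
    apply Fin.ext; dsimp only; omega
  · rw [if_neg (by omega), if_neg h2]; rfl

omit hq in
theorem bRow_y {i' : ℕ} (h : i' < m - i) :
    bRow w (i + 1) q (j + 1) l c ⟨j + 1 + i', by omega⟩ =
      rowY q (w ⟨i + i' + 1, by omega⟩) := by
  refine row_ext fun b hb => ?_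
  rw [rowY, entry_mkRow _ hb, entry_eq _ hb, bRow, bWord, if_neg (by dsimp only; omega),
    dif_neg (by dsimp only; omega), if_neg (by dsimp only; omega), if_pos (by dsimp only; omega)]
  dsimp only
  by_cases h2 : n + 1 ≤ b + q
  · rw [if_pos (by omega), if_pos h2,
      prod_filter_single (fun x => w x.1 x.2) (by omega) (by omega) (by omega) (by omega),
      entry_eq _ (by omega)]
    dsimp only
    congr 2 <;> omega
  · rw [if_neg (by omega), if_neg h2]; rfl

omit hq in
theorem bRow_mid :
    bRow w (i + 1) q (j + 1) l c ⟨m + 1 + j - i, by omega⟩ =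
      rowW q (w 0 * ((seg (fun i : Fin m => w i.succ) 0 l).prod *
        (seg (fun i : Fin m => w i.succ) l (j - l)).prod)) := by
  refine row_ext fun b hb => ?_
  rw [rowW, entry_mkRow _ hb, entry_eq _ hb, bRow, bWord, if_neg (by dsimp only; omega),
    dif_neg (by dsimp only; omega), if_neg (by dsimp only; omega), if_neg (by dsimp only; omega),
    if_pos (by dsimp only; omega)]
  dsimp only
  by_cases h2 : n + 1 ≤ b + q
  · rw [if_pos (by omega), if_pos h2]
    rw [prod_filter_col (fun x => w x.1 x.2) (fun i : Fin (m + 1) => (i : ℕ) + 1 ≤ j + 1)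
      (by omega) (by omega), ← List.prod_append]
    have h3 := seg_append (fun i : Fin m => w i.succ) 0 l (j - l)
    rw [zero_add] at h3
    rw [h3, entry_mul, entry_tail_prod w (by omega) (by omega), entry_eq _ (by omega)]
    simp only [Nat.succ_le_iff]
    rw [filter_finRange_lt, take_eq_seg, seg_succ _ _ _ (by omega), List.prod_cons]
    congr 2
    · congr 1; omega
    · rw [show l + (j - l) = j by omega]
      refine seg_congr (by omega) (by omega) fun i hi => ?_
      congr 1; apply Fin.ext; dsimp only; omega
  · rw [if_neg (by omega), if_neg h2]; rfl

omit hq in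
theorem bRow_z {i' : ℕ} (h : i' < i - j) :
    bRow w (i + 1) q (j + 1) l c ⟨m + 1 + j - i + 1 + i', by omega⟩ =
      rowZ q (w ⟨j + i' + 1, by omega⟩) := by
  refine row_ext fun b hb => ?_
  rw [rowZ, entry_mkRow _ hb, entry_eq _ hb, bRow, bWord, if_neg (by dsimp only; omega),
    dif_neg (by dsimp only; omega), if_neg (by dsimp only; omega), if_neg (by dsimp only; omega),
    if_neg (by dsimp only; omega)]
  dsimp only
  by_cases h2 : n ≤ b + q
  · rw [if_pos (by omega), if_pos h2,
      prod_filter_single (fun x => w x.1 x.2) (by omega) (by omega) (by omega) (by omega),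
      entry_eq _ (by omega)]
    dsimp only
    congr 2 <;> omega
  · rw [if_neg (by omega), if_neg h2]; rfl

variable {X : Type*} [AddCommGroup X] (F : (Fin n → M) → List (Fin n → M) → X)
  (F' : List (Fin n → M) → X) (hF : ∀ a L, F' (a :: L) = F a L)

include hF

/-- The sum over the shuffles and the choices of columns. -/
theorem sum_bRow : ∑ c : Fin l → Fin (n - q),
    ∑ τ ∈ shuffles (rowSet (m + 2) 2 (l + 1)) (rowSet (m + 2) (l + 2) (m + 2)),
    ∑ υ ∈ shuffles (rowSet (m + 2) (l + 2) (j + 1))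
      (rowSet (m + 2) (j + 1 + 1) (m + 1 - (i + 1) + (j + 1))),
      ((Equiv.Perm.sign (sigmaC c) * Equiv.Perm.sign τ * Equiv.Perm.sign υ : ℤˣ) : ℤ) •
        F' (List.ofFn fun i' => bRow w (i + 1) q (j + 1) l c ((τ * υ).symm i')) =
    core (rowData q hq hqn) F
      (rowE q (seg (fun i : Fin m => w i.succ) i (m - i)).prod *
        rowK q (w 0 * (List.ofFn fun i : Fin m => w i.succ).prod) * rowX 0 (w 0))
      (rowW q (w 0 * ((seg (fun i : Fin m => w i.succ) 0 l).prod *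
        (seg (fun i : Fin m => w i.succ) l (j - l)).prod)))
      (seg (fun i : Fin m => w i.succ) 0 l) (seg (fun i : Fin m => w i.succ) l (j - l))
      (seg (fun i : Fin m => w i.succ) j (i - j)) (seg (fun i : Fin m => w i.succ) i (m - i)) := by
  let _ : Inhabited (Fin n → M) := ⟨1⟩
  refine Eq.trans ?_ (sum_sigmaC (r := l) (J := n - q) rowX _ (length_seg _ (by omega)) _)
  refine Finset.sum_congr rfl fun c _ => ?_
  set g := bRow w (i + 1) q (j + 1) l c with hg
  -- the sum over the shuffles `τ`
  have h1 : ∀ υ : Equiv.Perm (Fin (m + 2)),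
      ∑ τ ∈ shuffles (rowSet (m + 2) 2 (l + 1)) (rowSet (m + 2) (l + 2) (m + 2)),
        (Equiv.Perm.sign τ : ℤ) • F' (List.ofFn fun i' => g ((τ * υ).symm i')) =
      (fun B => sh ((B.drop 1).take l) ((B.drop (l + 1)).take (m + 1 - l))
        fun D => F' (B.take 1 ++ D)) (List.ofFn fun i' => g (υ.symm i')) := by
    intro υ
    have h2 := sum_shuffles 1 l (m + 1 - l) (fun i' => g (υ.symm i')) (by omega) F'
    rw [show 1 + l = l + 1 by omega, show l + 1 + (m + 1 - l) = m + 2 by omega] at h2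
    refine h2.trans ?_
    dsimp only
    rw [seg, seg]
    congr 1
    funext D
    rw [List.drop_of_length_le (i := m + 2) (by simp), List.append_nil]
  -- Since `υ` acts before `τ`, the sum over `τ` is the function which is evaluated on the rows
  -- already shuffled by `υ`.
  have h3 := sum_shuffles (l + 1) (j - l) (m - i) g (by omega) (fun B => sh ((B.drop 1).take l)
    ((B.drop (l + 1)).take (m + 1 - l)) fun D => F' (B.take 1 ++ D))
  rw [show l + 1 + (j - l) = j + 1 by omega, show j + 1 + (m - i) = m + 1 - (i + 1) + (j + 1) by omega]
    at h3
  have h4 : ∑ τ ∈ shuffles (rowSet (m + 2) 2 (l + 1)) (rowSet (m + 2) (l + 2) (m + 2)),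
      ∑ υ ∈ shuffles (rowSet (m + 2) (l + 2) (j + 1))
        (rowSet (m + 2) (j + 1 + 1) (m + 1 - (i + 1) + (j + 1))),
      ((Equiv.Perm.sign (sigmaC c) * Equiv.Perm.sign τ * Equiv.Perm.sign υ : ℤˣ) : ℤ) •
        F' (List.ofFn fun i' => g ((τ * υ).symm i')) =
      (Equiv.Perm.sign (sigmaC c) : ℤ) •
      ∑ υ ∈ shuffles (rowSet (m + 2) (l + 2) (j + 1))
        (rowSet (m + 2) (j + 1 + 1) (m + 1 - (i + 1) + (j + 1))), (Equiv.Perm.sign υ : ℤ) •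
      ∑ τ ∈ shuffles (rowSet (m + 2) 2 (l + 1)) (rowSet (m + 2) (l + 2) (m + 2)),
        (Equiv.Perm.sign τ : ℤ) • F' (List.ofFn fun i' => g ((τ * υ).symm i')) := by
    rw [Finset.sum_comm]
    simp only [Finset.smul_sum, smul_smul]
    refine Finset.sum_congr rfl fun υ _ => Finset.sum_congr rfl fun τ _ => ?_
    congr 1
    push_cast
    ring
  rw [h4]
  congr 1
  simp only [h1]
  refine h3.trans ?_
  have s1 : seg g (l + 1) (j - l) = (seg (fun i : Fin m => w i.succ) l (j - l)).map
      (rowX (n - q)) := by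
    rw [map_seg]
    exact seg_congr (by omega) (by omega) fun i' hi' =>
      bRow_column w hqn hi hj hl c hi'
  have s2 : seg g (j + 1) (m - i) = (seg (fun i : Fin m => w i.succ) i (m - i)).map (rowY q) := by
    rw [map_seg]
    exact seg_congr (by omega) (by omega) fun i' hi' => bRow_y w hqn hi hj hl c hi'
  have s3 : (List.ofFn g).drop (m + 1 - (i + 1) + (j + 1)) =
      rowW q (w 0 * ((seg (fun i : Fin m => w i.succ) 0 l).prod *
        (seg (fun i : Fin m => w i.succ) l (j - l)).prod)) ::
      (seg (fun i : Fin m => w i.succ) j (i - j)).map (rowZ q) := by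
    rw [drop_eq_seg, show m + 2 - (m + 1 - (i + 1) + (j + 1)) = i - j + 1 by omega,
      seg_succ _ _ _ (by omega), map_seg]
    congr 1
    · rw [← bRow_mid w hqn hi hj hl c, hg]
      congr 1; apply Fin.ext; dsimp only; omega
    · refine seg_congr (by omega) (by omega) fun i' hi' => ?_
      refine Eq.trans ?_ (bRow_z w hqn hi hj hl c hi')
      rw [hg]
      congr 1; apply Fin.ext; dsimp only; omega
  have s4 : (List.ofFn g).take (l + 1) = g 0 :: List.ofFn fun i' : Fin l =>
      rowX (c i') ((seg (fun i : Fin m => w i.succ) 0 l).getD (sigmaC c i') default) := by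
    rw [take_eq_seg, seg_succ _ _ _ (by omega), seg_eq_ofFn _ (by omega)]
    congr 1
    congr 1
    funext i'
    have hσ := (sigmaC c i').2
    rw [getD_seg _ (by omega) hσ, hg]
    refine (bRow_columns w hqn hi hj hl c i' (by omega)).trans ?_
    congr 2
    apply Fin.ext; simp
  rw [s1, s2, s3, s4]
  change _ = sh _ _ (fun B => sh _ (B ++ rowW q (w 0 * ((seg (fun i : Fin m => w i.succ) 0 l).prod *
        (seg (fun i : Fin m => w i.succ) l (j - l)).prod)) ::
      (seg (fun i : Fin m => w i.succ) j (i - j)).map (rowZ q)) _)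
  -- The length of `B` is known, so the rows shuffled by `τ` are the first `l` rows after the corner
  -- row and all the remaining ones.
  refine sh_congr _ _ fun B hB => ?_
  have hBl : B.length = j - l + (m - i) := by
    rw [hB.length_eq, List.length_append, List.length_map, List.length_map,
      length_seg _ (by omega), length_seg _ (by omega)]
  simp only [List.cons_append, List.drop_succ_cons, List.drop_zero, List.append_assoc,
    List.take_succ_cons, List.take_zero, List.nil_append, hF]
  rw [List.take_left' (by simp), List.drop_left' (by simp), List.take_of_length_le, hg,
    bRow_zero w hq hqn hi c]
  simp only [List.length_append, hBl, List.length_cons, List.length_map]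
  rw [length_seg _ (by omega)]
  omega

-- The cuts are at `l ≤ j ≤ i`, which are `r`, `d - 1` and `p - 1` in the notation of the tables.
omit hi hj hl hq hqn hF in
theorem cut4_ofFn {R : Type*} (g : Fin m → R) (K : List R → List R → List R → List R → X) :
    cut4 K (List.ofFn g) = ∑ i ∈ Finset.range (m + 1), ∑ j ∈ Finset.range (i + 1),
      ∑ l ∈ Finset.range (j + 1),
        K (seg g 0 l) (seg g l (j - l)) (seg g j (i - j)) (seg g i (m - i)) := by
  rw [cut4, cut_eq_sum, List.length_ofFn]
  refine Finset.sum_congr rfl fun i hi => ?_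
  have hi := Finset.mem_range.1 hi
  have h1 : (List.ofFn g).take i = seg g 0 i := rfl
  rw [h1, drop_eq_seg, cut_eq_sum, length_seg _ (by omega)]
  refine Finset.sum_congr rfl fun j hj => ?_
  have hj := Finset.mem_range.1 hj
  have h2 : (seg g 0 i).take j = seg g 0 j := by
    simp only [seg, List.take_take]; congr 1; omega
  have h3 : (seg g 0 i).drop j = seg g j (i - j) := by
    simp only [seg, List.drop_take, List.drop_zero]
  rw [h2, h3, cut_eq_sum, length_seg _ (by omega)]
  refine Finset.sum_congr rfl fun l hl => ?_
  have hl := Finset.mem_range.1 hl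
  have h4 : (seg g 0 j).take l = seg g 0 l := by
    simp only [seg, List.take_take]; congr 1; omega
  have h5 : (seg g 0 j).drop l = seg g l (j - l) := by
    simp only [seg, List.drop_take, List.drop_zero]
  rw [h4, h5]

omit hi hj hl hq hqn in
/-- The homotopy as a sum over tables. -/
theorem sum_bRow_eq_rowPhi : ∑ p ∈ Finset.Icc 1 (m + 1), ∑ q ∈ Finset.Icc 2 n,
    ∑ d ∈ Finset.Icc 1 p, ∑ r ∈ Finset.range d, ∑ c : Fin r → Fin (n - q),
    ∑ τ ∈ shuffles (rowSet (m + 2) 2 (r + 1)) (rowSet (m + 2) (r + 2) (m + 2)),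
    ∑ υ ∈ shuffles (rowSet (m + 2) (r + 2) d) (rowSet (m + 2) (d + 1) (m + 1 - p + d)),
      (Equiv.Perm.sign (sigmaC c) * Equiv.Perm.sign τ * Equiv.Perm.sign υ *
        (-1) ^ (m + 1 + (m + 1 + d) * (p + d)) : ℤ) •
        F' (List.ofFn fun i => bRow w p q d r c ((τ * υ).symm i)) =
    rowPhi F (w 0) (List.ofFn fun i : Fin m => w i.succ) := by
  rw [Finset.sum_comm, rowPhi, ← Finset.sum_attach (Finset.Icc 2 n)]
  refine Finset.sum_congr rfl fun ⟨q, hq⟩ _ => ?_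
  obtain ⟨hq, hqn⟩ := Finset.mem_Icc.1 hq
  dsimp only
  have hIcc : ∀ (s : ℕ) (f : ℕ → X), ∑ p ∈ Finset.Icc 1 s, f p = ∑ i ∈ Finset.range s, f (i + 1) := by
    intro s f
    rw [Finset.range_eq_Ico, Finset.sum_Ico_add' f 0 s 1]
    rfl
  refine Eq.trans ?_ (cut4_ofFn _ _).symm
  rw [hIcc]
  refine Finset.sum_congr rfl fun i hi => ?_
  have hi := Finset.mem_range.1 hi
  rw [hIcc]
  refine Finset.sum_congr rfl fun j hj => ?_
  have hj := Finset.mem_range.1 hj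
  refine Finset.sum_congr rfl fun l hl => ?_
  have hl := Finset.mem_range.1 hl
  have h1 := sum_bRow w hq hqn (i := i) (j := j) (l := l) (by omega) (by omega) (by omega) F F' hF
  refine Eq.trans ?_ (congrArg (((-1 : ℤ) ^ _) • ·) h1)
  simp only [Finset.smul_sum, smul_smul]
  refine Finset.sum_congr rfl fun c _ => Finset.sum_congr rfl fun τ _ =>
    Finset.sum_congr rfl fun υ _ => ?_
  congr 1
  rw [length_seg _ (by omega), length_seg _ (by omega), length_seg _ (by omega),
    length_seg _ (by omega)]
  push_cast
  rw [mul_comm]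
  congr 1
  obtain ⟨s, rfl⟩ : ∃ s, i = j + s := ⟨i - j, by omega⟩
  obtain ⟨t, rfl⟩ : ∃ t, m = j + s + t := ⟨m - (j + s), by omega⟩
  rw [show l + (j - l) + (j + s + t - (j + s)) + 1 + (j + s + t - (j + s)) * (j + s - j) =
    j + t + 1 + t * s by
      rw [show j + s + t - (j + s) = t by omega, show j + s - j = s by omega]; omega]
  -- With `s` and `t` the lengths of `V` and `Y`, the product `(m + 1 + d) * (p + d)` is `s * s + t
  -- * s` modulo two. As `s * s + s` is even, the two signs agree.
  obtain ⟨e, he⟩ := Nat.even_mul_succ_self s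
  rw [show j + s + t + 1 + (j + s + t + 1 + (j + 1)) * (j + s + 1 + (j + 1)) =
    j + t + 1 + t * s + 2 * (2 * (j + 1) ^ 2 + (j + 1) * (2 * s + t) + e) by linarith,
    pow_add _ _ (2 * _), pow_mul, neg_one_sq, one_pow, mul_one]

end Rows

end Shuffle

end

section

/-! ### Koszul signs -/

section Koszul

variable {P : Type} (lt : P → P → Prop) [DecidableRel lt] (e : P → ZMod 2)

theorem ksgn_listSum {ι : Type*} (l : List ι) (f : ι → ZMod 2) :
    ksgn (l.map f).sum = (l.map fun i => ksgn (f i)).prod := by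
  induction l with
  | nil => simp [ksgn_zero]
  | cons a l ih => simp [ksgn_add, ih]

/-- The parity of a word. -/
def wdeg (l : List P) : ZMod 2 := (l.map e).sum

/-- The sign of the inversions between the letters of two words. -/
def cross (l l' : List P) : ℤ :=
  (l.map fun p => (l'.map fun p' => if lt p' p then ksgn (e p * e p') else 1).prod).prod

theorem cross_append_left (l l' l'' : List P) :
    cross lt e (l ++ l') l'' = cross lt e l l'' * cross lt e l' l'' := by
  simp [cross]

theorem cross_append_right (l l' l'' : List P) :
    cross lt e l (l' ++ l'') = cross lt e l l' * cross lt e l l'' := by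
  simp [cross, List.prod_map_mul]

theorem cross_perm_right {l l' : List P} (h : l.Perm l') (l'' : List P) :
    cross lt e l'' l = cross lt e l'' l' := by
  simp only [cross]
  congr 2
  funext p
  exact (h.map _).prod_eq

theorem list_prod_mul_self {ι : Type*} (l : List ι) (f : ι → ℤ) (h : ∀ i, f i * f i = 1) :
    (l.map f).prod * (l.map f).prod = 1 := by
  rw [← List.prod_map_mul]
  exact List.prod_eq_one (by simp [h])

theorem cross_mul_self (l l' : List P) : cross lt e l l' * cross lt e l l' = 1 :=
  list_prod_mul_self _ _ fun p => list_prod_mul_self _ _ fun p' => by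
    split_ifs
    · exact DGCategory.ksgn_mul_self _
    · rfl

/-- An inversion lies inside one of the two words or between them. -/
theorem koszul_append (l l' : List P) :
    koszul lt e (l ++ l') = koszul lt e l * koszul lt e l' * cross lt e l l' := by
  induction l with
  | nil => simp [koszul, cross]
  | cons p l ih =>
    simp only [List.cons_append, koszul, ih, List.map_append, List.prod_append, cross,
      List.map_cons, List.prod_cons]
    ring

theorem koszul_cons (p : P) (l : List P) :
    koszul lt e (p :: l) = cross lt e [p] l * koszul lt e l := by
  simp [koszul, cross]

theorem koszul_mul_self (l : List P) : koszul lt e l * koszul lt e l = 1 := by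
  induction l with
  | nil => rfl
  | cons p l ih =>
    rw [koszul_cons, mul_mul_mul_comm, ih, cross_mul_self, one_mul]

theorem koszul_eq_one {l : List P} (h : l.Pairwise fun a b => ¬ lt b a) : koszul lt e l = 1 := by
  induction l with
  | nil => rfl
  | cons p l ih =>
    rw [List.pairwise_cons] at h
    rw [koszul, ih h.2, mul_one]
    refine List.prod_eq_one fun x hx => ?_
    obtain ⟨p', hp', rfl⟩ := List.mem_map.1 hx
    rw [if_neg (h.1 p' hp')]

theorem wdeg_append (l l' : List P) : wdeg e (l ++ l') = wdeg e l + wdeg e l' := by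
  simp [wdeg]

theorem wdeg_flatMap {Q : Type*} (l : List Q) (w : Q → List P) :
    wdeg e (l.flatMap w) = (l.map fun q => wdeg e (w q)).sum := by
  induction l with
  | nil => simp [wdeg]
  | cons q l ih => simp [wdeg_append, ih]

/-- A strict total order: of two different letters, exactly one is smaller. -/
class StrictTotal : Prop where
  irrefl : ∀ p : P, ¬ lt p p
  iff_not : ∀ p p' : P, p ≠ p' → (lt p p' ↔ ¬ lt p' p)

-- Two different letters form an inversion in exactly one of the two orders, so each pair
-- contributes its sign to exactly one of the two factors.
variable {lt} in
theorem cross_swap [StrictTotal lt] {l l' : List P} (h : List.Disjoint l l') :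
    cross lt e l l' * cross lt e l' l = ksgn (wdeg e l * wdeg e l') := by
  have h1 : cross lt e l' l =
      (l.map fun p => (l'.map fun p' => if lt p p' then ksgn (e p * e p') else 1).prod).prod := by
    clear h
    induction l with
    | nil => simp [cross]
    | cons p l ih =>
      have h2 : cross lt e l' (p :: l) = cross lt e l' [p] * cross lt e l' l :=
        cross_append_right lt e l' [p] l
      rw [List.map_cons, List.prod_cons, ← ih, h2]
      simp [cross, mul_comm]
  rw [h1, cross, ← List.prod_map_mul]
  simp only [wdeg]
  rw [← List.sum_map_mul_right, ksgn_listSum]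
  congr 1
  refine List.map_congr_left fun p hp => ?_
  rw [← List.prod_map_mul, ← List.sum_map_mul_left, ksgn_listSum]
  congr 1
  refine List.map_congr_left fun p' hp' => ?_
  have hne : p ≠ p' := by rintro rfl; exact h hp hp'
  have := StrictTotal.iff_not (lt := lt) p p' hne
  by_cases h2 : lt p' p
  · rw [if_pos h2, if_neg (by tauto), mul_one]
  · rw [if_neg h2, if_pos (by tauto), one_mul]

/-- The word `u` can be replaced by the permuted word `v` with the sign `s`. -/
structure KRel (s : ℤ) (u v : List P) : Prop where
  perm : u.Perm v
  eq : ∀ l₁ l₂, (l₁ ++ u ++ l₂).Nodup →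
    koszul lt e (l₁ ++ u ++ l₂) = s * koszul lt e (l₁ ++ v ++ l₂)

variable {lt e}

theorem KRel.refl (u : List P) : KRel lt e 1 u u := ⟨List.Perm.refl _, by simp⟩

theorem KRel.nodup {s : ℤ} {u v : List P} (h : KRel lt e s u v) {l₁ l₂ : List P}
    (hn : (l₁ ++ u ++ l₂).Nodup) : (l₁ ++ v ++ l₂).Nodup :=
  (((h.perm.append_left l₁).append_right l₂).nodup_iff).1 hn

theorem KRel.trans {s s' : ℤ} {u v x : List P} (h : KRel lt e s u v) (h' : KRel lt e s' v x) :
    KRel lt e (s * s') u x :=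
  ⟨h.perm.trans h'.perm, fun l₁ l₂ hn => by
    rw [h.eq _ _ hn, h'.eq _ _ (h.nodup hn), mul_assoc]⟩

theorem KRel.append {s s' : ℤ} {u v u' v' : List P} (h : KRel lt e s u v)
    (h' : KRel lt e s' u' v') : KRel lt e (s * s') (u ++ u') (v ++ v') :=
  ⟨h.perm.append h'.perm, fun l₁ l₂ hn => by
    have hn' : (l₁ ++ u ++ (u' ++ l₂)).Nodup := by simpa [List.append_assoc] using hn
    have hn'' : (l₁ ++ v ++ u' ++ l₂).Nodup := by
      simpa [List.append_assoc] using h.nodup hn'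
    have h1 := h.eq _ _ hn'
    have h2 := h'.eq _ _ hn''
    simp only [List.append_assoc] at h1 h2 ⊢
    rw [h1, h2, mul_assoc]⟩

theorem KRel.of_eq {s s' : ℤ} {u v u' v' : List P} (h : KRel lt e s u v) (hs : s = s')
    (hu : u = u') (hv : v = v') : KRel lt e s' u' v' := by
  subst hs hu hv; exact h

theorem KRel.flatMap {ι : Type*} (J : List ι) (s : ι → ℤ) (u v : ι → List P)
    (h : ∀ j ∈ J, KRel lt e (s j) (u j) (v j)) :
    KRel lt e (J.map s).prod (J.flatMap u) (J.flatMap v) := by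
  induction J with
  | nil => exact KRel.refl _
  | cons j J ih =>
    exact ((h j (by simp)).append (ih fun i hi => h i (by simp [hi]))).of_eq (by simp)
      (by simp) (by simp)

theorem KRel.koszul_eq {s : ℤ} {u v : List P} (h : KRel lt e s u v) (hn : u.Nodup) :
    koszul lt e u = s * koszul lt e v := by
  simpa using h.eq [] [] (by simpa using hn)

/-- Inversions with letters outside `u` and `v` are not affected; only the factor between the two
words changes, by `cross_swap`. -/
theorem KRel.swap [StrictTotal lt] (u v : List P) :
    KRel lt e (ksgn (wdeg e u * wdeg e v)) (u ++ v) (v ++ u) := by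
  refine ⟨List.perm_append_comm, fun l₁ l₂ hn => ?_⟩
  have hd : List.Disjoint u v := by
    have : (u ++ v).Nodup := (hn.sublist (List.sublist_append_left _ _)).sublist
      (List.sublist_append_right _ _)
    exact (List.nodup_append'.1 this).2.2
  rw [← cross_swap (lt := lt) e hd]
  have hp : (u ++ v).Perm (v ++ u) := List.perm_append_comm
  simp only [koszul_append, cross_append_left, cross_append_right]
  linear_combination (-koszul lt e l₁ * koszul lt e u * koszul lt e v * cross lt e u v *
    cross lt e l₁ u * cross lt e l₁ v * koszul lt e l₂ * cross lt e l₁ l₂ * cross lt e u l₂ *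
    cross lt e v l₂) * cross_mul_self lt e v u

/-- The sign of `u₁ v₁ u₂ v₂ ⋯ = ± u₁ u₂ ⋯ v₁ v₂ ⋯`. -/
def ilvSign {ι : Type*} (a b : ι → ZMod 2) : List ι → ℤ
  | [] => 1
  | j :: J => ksgn (b j * (J.map a).sum) * ilvSign a b J

/-- Each `v j` moves behind all later `u`. For the entries of two rows, `ilvSign_finRange`
identifies this with the Koszul sign of the composition in the tensor power. -/
theorem KRel.interleave [StrictTotal lt] {ι : Type*} (u v : ι → List P) (J : List ι) :
    KRel lt e (ilvSign (fun j => wdeg e (u j)) (fun j => wdeg e (v j)) J)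
      (J.flatMap fun j => u j ++ v j) (J.flatMap u ++ J.flatMap v) := by
  induction J with
  | nil => exact KRel.refl _
  | cons j J ih =>
    have h1 := (KRel.refl (lt := lt) (e := e) (u j ++ v j)).append ih
    have h2 := ((KRel.refl (lt := lt) (e := e) (u j)).append
      (KRel.swap (v j) (J.flatMap u))).append (KRel.refl (J.flatMap v))
    refine ((h1.of_eq rfl rfl (by simp)).trans h2).of_eq ?_ (by simp) (by simp)
    rw [ilvSign, ← wdeg_flatMap]; ring

theorem ilvSign_map {ι κ : Type*} (f : κ → ι) (a b : ι → ZMod 2) (J : List κ) :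
    ilvSign a b (J.map f) = ilvSign (fun j => a (f j)) (fun j => b (f j)) J := by
  induction J with
  | nil => rfl
  | cons j J ih => simp only [List.map_cons, ilvSign, ih, List.map_map]; rfl

theorem ilvSign_finRange {n : ℕ} (a b : Fin n → ZMod 2) :
    ilvSign a b (List.finRange n) = DGCategory.compSign a b := by
  induction n with
  | zero => simp [ilvSign, DGCategory.compSign, ksgn_zero]
  | succ n ih =>
    rw [List.finRange_succ, ilvSign, ilvSign_map, ih, DGCategory.compSign, DGCategory.compSign,
      ← ksgn_add]
    congr 1
    rw [Fin.sum_univ_succ, List.map_map]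
    simp only [Fin.not_lt_zero, if_false, Finset.sum_const_zero, zero_add, Fin.sum_univ_succ (n := n),
      Fin.succ_pos, if_true, Fin.succ_lt_succ_iff, Finset.sum_add_distrib]
    congr 1
    rw [← Finset.sum_mul, mul_comm, ← List.ofFn_eq_map, List.sum_ofFn]
    rfl

/-- The rotation brings the last word in front of all others, which is a single swap of two words.
-/
theorem KRel.rotate [StrictTotal lt] {n : ℕ} (u : Fin n → List P) :
    KRel lt e (permSign (finRotate n) fun j => wdeg e (u j))
      ((List.finRange n).flatMap fun j => u ((finRotate n).symm j)) ((List.finRange n).flatMap u) := by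
  cases n with
  | zero => exact (KRel.refl _).of_eq (by simp [permSign, ksgn_zero]) rfl rfl
  | succ n =>
    refine (KRel.swap (lt := lt) (e := e) (u (Fin.last n))
      ((List.finRange n).flatMap fun j => u j.castSucc)).of_eq ?_ ?_ ?_
    · rw [permSign, Fin.sum_univ_castSucc]
      congr 1
      have h1 : ∀ j : Fin (n + 1), ¬ Fin.last n < j := fun j => (Fin.le_last j).not_gt
      simp only [h1, false_and, if_false, Finset.sum_const_zero, add_zero]
      rw [wdeg_flatMap, ← List.ofFn_eq_map, List.sum_ofFn, Finset.mul_sum]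
      refine Finset.sum_congr rfl fun i _ => ?_
      rw [Fin.sum_univ_castSucc]
      have h2 : ∀ j : Fin n, finRotate (n + 1) j.castSucc = j.succ := fun j => by
        rw [finRotate_apply]; exact Fin.coeSucc_eq_succ
      simp only [h2, finRotate_last]
      rw [if_pos ⟨Fin.castSucc_lt_last i, Fin.succ_pos i⟩, mul_comm, Finset.sum_eq_zero, zero_add]
      intro j _
      rw [if_neg]
      rintro ⟨h3, h4⟩
      simp only [Fin.lt_def, Fin.val_castSucc, Fin.val_succ] at h3 h4
      omega
    · have h2 : ∀ j : Fin n, (finRotate (n + 1)).symm j.succ = j.castSucc := fun j => by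
        rw [Equiv.symm_apply_eq, finRotate_apply]; exact Fin.coeSucc_eq_succ.symm
      have h3 : (finRotate (n + 1)).symm 0 = Fin.last n := by
        rw [Equiv.symm_apply_eq, finRotate_last]
      rw [List.finRange_succ, List.flatMap_cons, h3, List.flatMap_map]
      simp only [h2]
    · rw [List.finRange_succ_last, List.flatMap_append, List.flatMap_map]
      simp

/-- Permuting words is the same as permuting letters. -/
theorem KRel.blocks [StrictTotal lt] {Q : Type} {ltQ : Q → Q → Prop} [DecidableRel ltQ]
    [StrictTotal ltQ] (w : Q → List P) {L L' : List Q} (h : L.Perm L') (hn : L.Nodup) :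
    KRel lt e (koszul ltQ (fun q => wdeg e (w q)) L * koszul ltQ (fun q => wdeg e (w q)) L')
      (L.flatMap w) (L'.flatMap w) := by
  induction h with
  | nil => exact KRel.refl _
  | @cons q L L' h ih =>
    rw [List.nodup_cons] at hn
    refine ((KRel.refl (lt := lt) (e := e) (w q)).append (ih hn.2)).of_eq ?_ (by simp) (by simp)
    rw [koszul_cons, koszul_cons, cross_perm_right _ _ h]
    linear_combination (-koszul ltQ (fun q => wdeg e (w q)) L *
      koszul ltQ (fun q => wdeg e (w q)) L') *
        cross_mul_self ltQ (fun q => wdeg e (w q)) [q] L'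
  | swap q q' L =>
    refine ((KRel.swap (lt := lt) (e := e) (w q') (w q)).append (KRel.refl (L.flatMap w))).of_eq
      ?_ (by simp) (by simp)
    have hd : List.Disjoint [q'] [q] := by
      simp only [List.nodup_cons, List.mem_cons, not_or] at hn
      simpa using fun h => hn.1.1 h.symm
    have h1 := cross_swap (lt := ltQ) (fun q => wdeg e (w q)) hd
    have h2 : ∀ a b : Q, cross ltQ (fun q => wdeg e (w q)) [a] (b :: L) =
        cross ltQ (fun q => wdeg e (w q)) [a] [b] * cross ltQ (fun q => wdeg e (w q)) [a] L :=
      fun a b => cross_append_right ltQ _ [a] [b] L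
    have h3 : ∀ a : Q, wdeg (fun q => wdeg e (w q)) [a] = wdeg e (w a) := fun a => by simp [wdeg]
    rw [h3, h3] at h1
    simp only [koszul_cons, h2, ← h1]
    have c1 := cross_mul_self ltQ (fun q => wdeg e (w q)) [q] L
    have c2 := cross_mul_self ltQ (fun q => wdeg e (w q)) [q'] L
    have c3 := koszul_mul_self ltQ (fun q => wdeg e (w q)) L
    generalize cross ltQ (fun q => wdeg e (w q)) [q] L = x at *
    generalize cross ltQ (fun q => wdeg e (w q)) [q'] L = y at *
    generalize koszul ltQ (fun q => wdeg e (w q)) L = z at *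
    linear_combination (-cross ltQ (fun q => wdeg e (w q)) [q'] [q] *
      cross ltQ (fun q => wdeg e (w q)) [q] [q']) * (y * y * z * z * c1 + z * z * c2 + c3)
  | trans h h' ih ih' =>
    refine ((ih hn).trans (ih' (h.nodup_iff.1 hn))).of_eq ?_ rfl rfl
    rename_i L K M
    linear_combination koszul ltQ (fun q => wdeg e (w q)) L *
      koszul ltQ (fun q => wdeg e (w q)) M * koszul_mul_self ltQ (fun q => wdeg e (w q)) K

/-- The Koszul sign of a product of tables. -/
theorem koszul_comp [StrictTotal lt] {Q : Type} {ltQ : Q → Q → Prop} [DecidableRel ltQ]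
    [StrictTotal ltQ] (w : Q → List P) {L L' : List Q} (h : L.Perm L') (hn : L'.Nodup)
    (hs : L'.Pairwise fun a b => ¬ ltQ b a) (hw : (L'.flatMap w).Nodup) :
    koszul lt e (L.flatMap w) =
      koszul ltQ (fun q => wdeg e (w q)) L * koszul lt e (L'.flatMap w) := by
  have h1 := (KRel.blocks (lt := lt) (e := e) (ltQ := ltQ) w h.symm hn).koszul_eq hw
  rw [koszul_eq_one ltQ _ hs, one_mul] at h1
  rw [h1, ← mul_assoc, koszul_mul_self, one_mul]

/-- The Koszul sign for a change of the parity of one letter. -/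
theorem koszul_add_single [StrictTotal lt] [DecidableEq P] (p : P) (l₁ l₂ : List P)
    (hn : (l₁ ++ p :: l₂).Nodup) :
    koszul lt (e + Pi.single p 1) (l₁ ++ p :: l₂) * ksgn (wdeg e l₁) =
      koszul lt e (l₁ ++ p :: l₂) *
        ksgn (((l₁ ++ p :: l₂).map fun p' => if lt p' p then e p' else 0).sum) := by
  have hne1 : p ∉ l₁ := fun h => by
    have := List.nodup_append'.1 hn
    exact this.2.2 h (by simp)
  have hne2 : p ∉ l₂ := (List.nodup_cons.1 (List.nodup_append'.1 hn).2.1).1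
  have e1 : ∀ p' ∈ l₁, (e + Pi.single p 1 : P → ZMod 2) p' = e p' := fun p' h => by
    have : p' ≠ p := by rintro rfl; exact hne1 h
    simp [this]
  have e2 : ∀ p' ∈ l₂, (e + Pi.single p 1 : P → ZMod 2) p' = e p' := fun p' h => by
    have : p' ≠ p := by rintro rfl; exact hne2 h
    simp [this]
  have hc : ∀ l l' : List P, (∀ p' ∈ l, (e + Pi.single p 1 : P → ZMod 2) p' = e p') →
      (∀ p' ∈ l', (e + Pi.single p 1 : P → ZMod 2) p' = e p') →
      cross lt (e + Pi.single p 1) l l' = cross lt e l l' := by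
    intro l l' h h'
    simp only [cross]
    congr 1
    refine List.map_congr_left fun a ha => ?_
    congr 1
    refine List.map_congr_left fun b hb => ?_
    rw [h a ha, h' b hb]
  have hk : ∀ l : List P, (∀ p' ∈ l, (e + Pi.single p 1 : P → ZMod 2) p' = e p') →
      koszul lt (e + Pi.single p 1) l = koszul lt e l := by
    intro l h
    induction l with
    | nil => rfl
    | cons a l ih =>
      rw [koszul_cons, koszul_cons, ih fun b hb => h b (by simp [hb]),
        hc [a] l (by simpa using h a (by simp)) fun b hb => h b (by simp [hb])]
  have hx : ∀ l : List P, (∀ p' ∈ l, (e + Pi.single p 1 : P → ZMod 2) p' = e p') →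
      cross lt (e + Pi.single p 1) [p] l =
        cross lt e [p] l * ksgn ((l.map fun p' => if lt p' p then e p' else 0).sum) := by
    intro l h
    rw [ksgn_listSum]
    simp only [cross, List.map_cons, List.map_nil, List.prod_singleton]
    rw [← List.prod_map_mul]
    congr 1
    refine List.map_congr_left fun b hb => ?_
    rw [h b hb]
    split_ifs
    · rw [← ksgn_add]; simp [add_mul]
    · simp [ksgn_zero]
  -- For a letter `b` in front of `p`, raising the parity of `p` adds the sign of `b` exactly if `p`
  -- is smaller than `b`. The additional factor, the sign of all letters in front of `p`, cancels
  -- this and leaves the sign of `b` exactly if `b` is smaller than `p`.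
  have hy : ∀ l : List P, p ∉ l → (∀ p' ∈ l, (e + Pi.single p 1 : P → ZMod 2) p' = e p') →
      cross lt (e + Pi.single p 1) l [p] * ksgn (wdeg e l) =
        cross lt e l [p] * ksgn ((l.map fun p' => if lt p' p then e p' else 0).sum) := by
    intro l hp h
    rw [ksgn_listSum, wdeg, ksgn_listSum]
    simp only [cross, List.map_cons, List.map_nil, List.prod_singleton]
    rw [← List.prod_map_mul, ← List.prod_map_mul]
    congr 1
    refine List.map_congr_left fun b hb => ?_
    have hne : b ≠ p := by rintro rfl; exact hp hb
    have := StrictTotal.iff_not (lt := lt) b p hne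
    rw [h b hb]
    by_cases h2 : lt b p
    · rw [if_pos h2, if_neg (this.1 h2), if_neg (this.1 h2)]
    · have h3 : lt p b := by tauto
      rw [if_neg h2, if_pos h3, if_pos h3, ← ksgn_add, ksgn_zero]
      simp only [Pi.add_apply, Pi.single_eq_same, mul_add, mul_one, add_assoc,
        CharTwo.add_self_eq_zero, add_zero]
  have h2 : ∀ e' : P → ZMod 2, koszul lt e' (l₁ ++ p :: l₂) = koszul lt e' l₁ *
      (cross lt e' [p] l₂ * koszul lt e' l₂) * (cross lt e' l₁ [p] * cross lt e' l₁ l₂) := by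
    intro e'
    rw [koszul_append, koszul_cons, ← cross_append_right]
    rfl
  rw [h2, h2, hk l₁ e1, hk l₂ e2, hc l₁ l₂ e1 e2, hx l₂ e2, List.map_append, List.map_cons,
    List.sum_append, List.sum_cons, if_neg (StrictTotal.irrefl p), zero_add, ksgn_add]
  linear_combination koszul lt e l₁ * cross lt e [p] l₂ * koszul lt e l₂ * cross lt e l₁ l₂ *
    ksgn ((l₂.map fun p' => if lt p' p then e p' else 0).sum) * hy l₁ hne1 e1

instance {n : ℕ} : StrictTotal (fun a b : Fin n => a < b) where
  irrefl := lt_irrefl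
  iff_not p p' h := by
    rw [not_lt]; exact ⟨le_of_lt, fun h' => lt_of_le_of_ne h' h⟩

instance {m n : ℕ} : StrictTotal (rowLt (m := m) (n := n)) where
  irrefl p := by simp [rowLt]
  iff_not p p' h := by
    simp only [ne_eq, Prod.ext_iff, Fin.ext_iff] at h
    simp only [rowLt, Fin.lt_def, Fin.ext_iff]
    omega

end Koszul

end

section

/-! ### Words -/

/-- The sum over the letters of a word of a function of the part of the word in front of the
letter, and of the letter. -/
def splitSum {P X : Type*} [AddCommMonoid X] (G : List P → P → X) : List P → List P → X
  | _, [] => 0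
  | l₁, p :: l => G l₁ p + splitSum G (l₁ ++ [p]) l

section SplitSum

variable {P Q X : Type*} [AddCommMonoid X]

theorem splitSum_append (G : List P → P → X) (l₁ u v : List P) :
    splitSum G l₁ (u ++ v) = splitSum G l₁ u + splitSum G (l₁ ++ u) v := by
  induction u generalizing l₁ with
  | nil => simp [splitSum]
  | cons p u ih => simp [splitSum, ih, add_assoc]

theorem splitSum_flatMap (G : List P → P → X) (w : Q → List P) (L₁ L : List Q) :
    splitSum G (L₁.flatMap w) (L.flatMap w) =
      splitSum (fun L₁ q => splitSum G (L₁.flatMap w) (w q)) L₁ L := by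
  induction L generalizing L₁ with
  | nil => rfl
  | cons q L ih =>
    have := ih (L₁ ++ [q])
    rw [List.flatMap_append, List.flatMap_singleton] at this
    rw [List.flatMap_cons, splitSum_append, splitSum, this]

theorem splitSum_congr (G : List P → P → X) (H : P → X) (l₁ l : List P)
    (h : ∀ u p v, l = u ++ p :: v → G (l₁ ++ u) p = H p) :
    splitSum G l₁ l = (l.map H).sum := by
  induction l generalizing l₁ with
  | nil => rfl
  | cons p l ih =>
    rw [splitSum, List.map_cons, List.sum_cons, ih]
    · congr 1
      simpa using h [] p l rfl
    · intro u p' v hl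
      have := h (p :: u) p' v (by rw [hl]; rfl)
      simpa using this

theorem splitSum_shift (G : List P → P → X) (l₀ l₁ l : List P) :
    splitSum G (l₀ ++ l₁) l = splitSum (fun l₁ p => G (l₀ ++ l₁) p) l₁ l := by
  induction l generalizing l₁ with
  | nil => rfl
  | cons p l ih => rw [splitSum, splitSum, ← ih, List.append_assoc]

theorem splitSum_congr' {G G' : List P → P → X} (l₁ l : List P)
    (h : ∀ u, ∀ p ∈ l, G u p = G' u p) : splitSum G l₁ l = splitSum G' l₁ l := by
  induction l generalizing l₁ with
  | nil => rfl
  | cons p l ih =>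
    rw [splitSum, splitSum, h _ p (by simp), ih _ fun u p' hp' => h u p' (by simp [hp'])]

theorem map_splitSum {Y : Type*} [AddCommMonoid Y] (f : X →+ Y) (G : List P → P → X)
    (l₁ l : List P) : f (splitSum G l₁ l) = splitSum (fun l₁ p => f (G l₁ p)) l₁ l := by
  induction l generalizing l₁ with
  | nil => exact map_zero f
  | cons p l ih => rw [splitSum, splitSum, map_add, ih]

end SplitSum

namespace DGCategory

variable {k : Type w} [Field k] (A : DGCategory.{u, v} k) {P Q : Type}

theorem oneHom_self (a : A.Obj) : A.oneHom a a = A.one a := by simp [oneHom]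

theorem oneHom_mem (a b : A.Obj) : A.oneHom a b ∈ A.deg a b 0 := by
  by_cases h : a = b
  · subst h; rw [oneHom_self]; exact A.one_mem a
  · rw [oneHom, dif_neg h]; exact Submodule.zero_mem _

theorem d_one (a : A.Obj) : A.d (A.one a) = 0 := by
  have h := A.leibniz (A.one a) (A.one_mem a)
  rw [A.one_comp, A.comp_one, A.one_comp, Int.cast_zero, ksgn_zero, Int.cast_one, one_smul] at h
  simpa using h

theorem d_oneHom (a b : A.Obj) : A.d (A.oneHom a b) = 0 := by
  by_cases h : a = b
  · subst h; rw [oneHom_self, d_one]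
  · rw [oneHom, dif_neg h, map_zero]

variable {A} {T S : P → A.Obj}

theorem evalWord_mem {a : P → ℤ} {α : ∀ p, A.Mor (T p) (S p)}
    (hα : ∀ p, α p ∈ A.deg (T p) (S p) (a p)) (l : List P) (x y : A.Obj) :
    A.evalWord α l x y ∈ A.deg x y (l.map a).sum := by
  induction l generalizing x with
  | nil => exact A.oneHom_mem x y
  | cons p l ih =>
    have h := A.comp_mem (A.comp_mem (A.oneHom_mem x (T p)) (hα p)) (ih (S p))
    rw [zero_add] at h
    exact h

variable (α : ∀ p, A.Mor (T p) (S p))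

/-- The intermediate object has to be read off from `u`, hence `u` must not be empty. -/
theorem evalWord_append [Inhabited P] {u : List P} (hu : u ≠ []) (v : List P) (a b : A.Obj) :
    A.evalWord α (u ++ v) a b = A.comp (A.evalWord α u a (S (u.getLastD default)))
      (A.evalWord α v (S (u.getLastD default)) b) := by
  induction u generalizing a with
  | nil => exact absurd rfl hu
  | cons p u ih =>
    rcases u with _ | ⟨p', u⟩
    · change A.comp (A.comp (A.oneHom a (T p)) (α p)) (A.evalWord α v (S p) b) =
        A.comp (A.comp (A.comp (A.oneHom a (T p)) (α p)) (A.oneHom (S p) (S p)))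
          (A.evalWord α v (S p) b)
      rw [oneHom_self, A.comp_one]
    · have h := ih (by simp) (S p)
      change A.comp (A.comp (A.oneHom a (T p)) (α p)) (A.evalWord α (p' :: u ++ v) (S p) b) =
        A.comp (A.comp (A.comp (A.oneHom a (T p)) (α p))
          (A.evalWord α (p' :: u) (S p) (S ((p' :: u).getLastD default))))
          (A.evalWord α v (S ((p' :: u).getLastD default)) b)
      rw [h]
      exact (A.assoc _ _ _).symm

/-- The product of two words. -/
theorem comp_evalWord [Inhabited P] (u v : List P) {a b c : A.Obj} (h1 : u = [] → a = c)
    (h2 : u ≠ [] → c = S (u.getLastD default)) :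
    A.comp (A.evalWord α u a c) (A.evalWord α v c b) = A.evalWord α (u ++ v) a b := by
  by_cases hu : u = []
  · subst hu
    obtain rfl := h1 rfl
    rw [evalWord, oneHom_self, A.one_comp]; rfl
  · rw [evalWord_append α hu, ← h2 hu]

/-- A nonempty product starts with the comparison of `a` with the target of its first letter, so the
comparison may be split off in front. -/
theorem oneHom_comp_evalWord [Inhabited P] {u : List P} (hu : u ≠ []) (a b : A.Obj) :
    A.comp (A.oneHom a (T (u.headD default))) (A.evalWord α u (T (u.headD default)) b) =
      A.evalWord α u a b := by
  obtain ⟨p, u, rfl⟩ := List.exists_cons_of_ne_nil hu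
  change A.comp _ (A.comp (A.comp (A.oneHom (T p) (T p)) (α p)) _) = A.comp (A.comp _ (α p)) _
  rw [oneHom_self, A.one_comp]
  exact (A.assoc _ _ _).symm

/-- A word in words. -/
theorem evalWord_flatMap [Inhabited P] {T' S' : Q → A.Obj} (w : Q → List P)
    (hw : ∀ q, w q ≠ []) (hT : ∀ q, T' q = T ((w q).headD default))
    (hS : ∀ q, S' q = S ((w q).getLastD default)) (l : List Q) (a b : A.Obj) :
    A.evalWord (fun q => A.evalWord α (w q) (T' q) (S' q)) l a b =
      A.evalWord α (l.flatMap w) a b := by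
  induction l generalizing a with
  | nil => rfl
  | cons q l ih =>
    rw [evalWord, ih, List.flatMap_cons, hT, oneHom_comp_evalWord α (hw q), hS,
      evalWord_append α (hw q)]

theorem evalWord_singleton (p : P) : A.evalWord α [p] (T p) (S p) = α p := by
  simp [evalWord, oneHom_self, A.one_comp, A.comp_one]

variable [DecidableEq P]

/-- The graded Leibniz rule, letter by letter. As no letter repeats, updating `p` changes a single
factor. -/
theorem d_evalWord {a : P → ℤ} (hα : ∀ p, α p ∈ A.deg (T p) (S p) (a p)) (l : List P)
    (hl : l.Nodup) (x y : A.Obj) :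
    A.d (A.evalWord α l x y) = splitSum (fun l₁ p =>
      (ksgn (wdeg (fun p => (a p : ZMod 2)) l₁) : k) •
        A.evalWord (Function.update α p (A.d (α p))) l x y) [] l := by
  induction l generalizing x with
  | nil => exact A.d_oneHom x y
  | cons p l ih =>
    rw [List.nodup_cons] at hl
    have h1 := A.leibniz (α p) (A.oneHom_mem x (T p))
    rw [d_oneHom, map_zero, LinearMap.zero_apply, zero_add, Int.cast_zero, ksgn_zero, Int.cast_one,
      one_smul] at h1
    have hm := A.comp_mem (A.oneHom_mem x (T p)) (hα p)
    rw [zero_add] at hm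
    rw [evalWord, A.leibniz _ hm, h1, splitSum, ih hl.2, List.nil_append]
    congr 1
    · simp [wdeg, ksgn_zero, evalWord, evalWord_update_of_notMem _ _ _ _ hl.1]
    -- The sign of the first letter is split off from the signs of the later terms, where it arises
    -- from the Leibniz rule.
    · have h2 : [p] = [p] ++ ([] : List P) := rfl
      rw [h2, splitSum_shift]
      have h3 := map_splitSum (((ksgn (a p : ZMod 2) : k) •
        A.comp (A.comp (A.oneHom x (T p)) (α p))).toAddMonoidHom :
          A.Mor (S p) y →+ A.Mor x y) (fun l₁ p' => (ksgn (wdeg (fun p => (a p : ZMod 2)) l₁) : k) •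
        A.evalWord (Function.update α p' (A.d (α p'))) l (S p) y) [] l
      refine Eq.trans h3 (splitSum_congr' _ _ fun u p' hp' => ?_)
      have hne : p ≠ p' := by rintro rfl; exact hl.1 hp'
      simp only [LinearMap.toAddMonoidHom_coe, LinearMap.smul_apply, map_smul, smul_smul]
      rw [evalWord, Function.update_of_ne hne, wdeg_append, ksgn_add]
      simp [wdeg, mul_comm]

end DGCategory

end

section

open Shuffle

/-! ### Chains given by matrices of words -/

section Prefix

variable {P Q : Type} {m n : ℕ}

/-- The product of the entries in the columns in front of the column `j`. -/
def colPrefix (W : Fin n → FreeMonoid P) (j : ℕ) : FreeMonoid P :=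
  ((List.range j).map (entry W)).prod

/-- The product of the entries in front of the `i`-th row of the column `j`. -/
def prefixWord (w : Fin m → Fin n → FreeMonoid P) (i : ℕ) (j : Fin n) : FreeMonoid P :=
  colPrefix (List.ofFn w).prod j * ((List.ofFn w).take i).prod j

theorem colPrefix_succ (W : Fin n → FreeMonoid P) (j : Fin n) :
    colPrefix W (j + 1) = colPrefix W j * W j := by
  rw [colPrefix, List.range_succ, List.map_append, List.prod_append, colPrefix, List.map_singleton,
    List.prod_singleton, entry_eq W j.2]

theorem prefixWord_succ (w : Fin m → Fin n → FreeMonoid P) (i : Fin m) (j : Fin n) :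
    prefixWord w (i + 1) j = prefixWord w i j * w i j := by
  rw [prefixWord, prefixWord, mul_assoc]
  congr 1
  rw [List.take_succ_eq_append_getElem (by simp), List.prod_append, Pi.mul_apply]
  simp

theorem prefixWord_zero (w : Fin m → Fin n → FreeMonoid P) (j : Fin n) :
    prefixWord w 0 j = colPrefix (List.ofFn w).prod j := by
  simp [prefixWord]

theorem prefixWord_last (w : Fin m → Fin n → FreeMonoid P) (j : Fin n) :
    prefixWord w m j = colPrefix (List.ofFn w).prod (j + 1) := by
  rw [prefixWord, colPrefix_succ, List.take_of_length_le (by simp)]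

/-- Every prefix other than the one at the corner contains the corner entry. -/
theorem prefixWord_ne_one [NeZero n] (w : Fin (m + 1) → Fin n → FreeMonoid P) (h : w 0 0 ≠ 1)
    (i : ℕ) (j : Fin n) (hij : i ≠ 0 ∨ j ≠ 0) : prefixWord w i j ≠ 1 := by
  have hmul : ∀ x y : FreeMonoid P, x * y = 1 → x = 1 ∧ y = 1 := fun x y hxy =>
    List.append_eq_nil_iff.1 hxy
  have hL : List.ofFn w = w 0 :: List.ofFn fun i => w i.succ := by rw [List.ofFn_succ]
  intro h1
  obtain ⟨h2, h3⟩ := hmul _ _ h1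
  by_cases hj : j = 0
  · subst hj
    obtain ⟨i, rfl⟩ := Nat.exists_eq_succ_of_ne_zero (hij.resolve_right (by simp))
    rw [hL, List.take_succ_cons, List.prod_cons, Pi.mul_apply] at h3
    exact h (hmul _ _ h3).1
  · have hj' : (j : ℕ) ≠ 0 := fun h' => hj (Fin.ext (by simpa using h'))
    obtain ⟨l, hl⟩ := Nat.exists_eq_succ_of_ne_zero hj'
    rw [hl, colPrefix, List.range_succ_eq_map, List.map_cons, List.prod_cons, hL, List.prod_cons,
      entry_mul, entry_eq _ (NeZero.pos n)] at h2
    exact h (hmul _ _ (hmul _ _ h2).1).1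

theorem prod_range_split' {M : Type*} [Monoid M] (h : ℕ → M) {s : ℕ} (hs : s < n)
    (h0 : ∀ i, s < i → h i = 1) :
    ((List.range n).map h).prod = ((List.range s).map h).prod * h s := by
  have h1 : List.range n = List.range s ++ List.range' s (n - s) := by
    have := List.range'_append_1 (s := 0) (m := s) (n := n - s)
    rw [zero_add, show s + (n - s) = n by omega] at this
    rw [List.range_eq_range', List.range_eq_range', this]
  rw [h1, List.map_append, List.prod_append, show n - s = n - (s + 1) + 1 by omega,
    List.range'_succ, List.map_cons, List.prod_cons,
    List.prod_eq_one (l := (List.range' (s + 1) (n - (s + 1))).map h), mul_one]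
  intro x hx
  obtain ⟨i, hi, rfl⟩ := List.mem_map.1 hx
  exact h0 i (by have := List.mem_range'_1.1 hi; omega)

/-- This compares prefixes with the filtered lists of positions by which `matrixTable` determines
its objects. -/
theorem prefixWord_eq_filter (w : Fin m → Fin n → FreeMonoid P) (i : ℕ) (j : Fin n) :
    prefixWord w i j = (((byCols m n).filter fun q => q.2 < j ∨ q.2 = j ∧ (q.1 : ℕ) < i).map
      fun q => w q.1 q.2).prod := by
  rw [prod_filter_byCols (fun q => w q.1 q.2) fun q => q.2 < j ∨ q.2 = j ∧ (q.1 : ℕ) < i]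
  have h1 : ∀ j' : Fin n, (((List.finRange m).filter fun i' : Fin m =>
      j' < j ∨ j' = j ∧ (i' : ℕ) < i).map fun i' => w i' j').prod = (fun j' : ℕ =>
        if j' < j then entry (List.ofFn w).prod j' else if j' = j then
          ((List.ofFn w).take i).prod j else 1) j' := by
    intro j'
    dsimp only
    have hp : ∀ L : List (Fin n → FreeMonoid P), L.prod j' = (L.map fun a => a j').prod :=
      fun L => Pi.list_prod_apply _ _
    rcases lt_trichotomy j' j with h | rfl | h
    · rw [if_pos (show (j' : ℕ) < j from h), entry_eq _ j'.2, hp, List.map_ofFn]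
      simp only [h, true_or, decide_true, List.filter_true, List.ofFn_eq_map]
      rfl
    · simp only [lt_irrefl, false_or, true_and, if_false, if_true]
      rw [filter_finRange_lt, hp, List.map_take, List.map_ofFn]
      rfl
    · have h2 : (j : ℕ) < j' := h
      rw [if_neg (by omega), if_neg (by omega)]
      simp [h.not_gt, h.ne']
  simp only [h1]
  rw [prod_map_finRange (fun j' : ℕ => if j' < j then entry (List.ofFn w).prod j' else
    if j' = j then ((List.ofFn w).take i).prod j else 1), prod_range_split' _ j.2, prefixWord,
    colPrefix, if_neg (lt_irrefl _), if_pos rfl]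
  · congr 2
    refine List.map_congr_left fun x hx => ?_
    rw [if_pos (List.mem_range.1 hx)]
  · intro i' hi'
    rw [if_neg (by omega), if_neg (by omega)]

theorem map_prefixWord (φ : FreeMonoid Q →* FreeMonoid P) (w : Fin m → Fin n → FreeMonoid Q)
    (i : ℕ) (j : Fin n) :
    prefixWord (fun i j => φ (w i j)) i j = φ (prefixWord w i j) := by
  rw [prefixWord_eq_filter, prefixWord_eq_filter, map_list_prod, List.map_map]
  rfl

end Prefix

variable {k : Type w} [Field k] {A : DGCategory.{u, v} k} {P Q : Type} {m n : ℕ}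

/-- The source of the last letter of a word. -/
def lastObj [Inhabited P] (S : P → A.Obj) (u : FreeMonoid P) : A.Obj :=
  S (u.toList.getLastD default)

theorem lastObj_mul [Inhabited P] (S : P → A.Obj) (u : FreeMonoid P) {u' : FreeMonoid P}
    (h : u' ≠ 1) : lastObj S (u * u') = lastObj S u' := by
  have h' : u'.toList ≠ [] := h
  rw [lastObj, lastObj, FreeMonoid.toList_mul, List.getLastD_eq_getLast?,
    List.getLast?_append_of_ne_nil _ h', List.getLastD_eq_getLast?]

/-- The objects of the chain given by a matrix of words. -/
def wordObj [Inhabited P] (S : P → A.Obj) (w : Fin (m + 1) → Fin n → FreeMonoid P)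
    (i : Fin (m + 1)) (j : Fin n) : A.Obj :=
  lastObj S (prefixWord w (if i = 0 then m + 1 else (i : ℕ)) j)

/-- After the last row, `i + 1` is `0`. The special clause for `0` in `wordObj` refers to the whole
column and makes the formula uniform in `i`. -/
theorem wordObj_add_one [Inhabited P] (S : P → A.Obj) (w : Fin (m + 1) → Fin n → FreeMonoid P)
    (i : Fin (m + 1)) (j : Fin n) :
    wordObj S w (i + 1) j = lastObj S (prefixWord w (i + 1) j) := by
  rw [wordObj]
  congr 2
  rcases eq_or_ne i (Fin.last m) with rfl | h
  · rw [Fin.last_add_one, if_pos rfl, Fin.val_last]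
  · rw [if_neg (Fin.add_one_pos i (Fin.lt_last_iff_ne_last.2 h)).ne', Fin.val_add_one_of_lt
      (Fin.lt_last_iff_ne_last.2 h)]

theorem wordObj_of_ne [Inhabited P] (S : P → A.Obj) (w : Fin (m + 1) → Fin n → FreeMonoid P)
    {i : Fin (m + 1)} (hi : i ≠ 0) (j : Fin n) :
    wordObj S w i j = lastObj S (prefixWord w i j) := by
  rw [wordObj, if_neg hi]

theorem finRotate_symm_val [NeZero n] (j : Fin n) (hj : j ≠ 0) :
    ((finRotate n).symm j : ℕ) + 1 = j := by
  obtain ⟨n, rfl⟩ := Nat.exists_eq_succ_of_ne_zero (NeZero.ne n)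
  obtain ⟨j, rfl⟩ := Fin.exists_succ_eq.2 hj
  have : (finRotate (n + 1)).symm j.succ = j.castSucc := by
    rw [Equiv.symm_apply_eq, finRotate_apply]; exact Fin.coeSucc_eq_succ.symm
  rw [this]; simp

theorem finRotate_symm_zero [NeZero n] : ((finRotate n).symm 0 : ℕ) + 1 = n := by
  obtain ⟨n, rfl⟩ := Nat.exists_eq_succ_of_ne_zero (NeZero.ne n)
  have : (finRotate (n + 1)).symm 0 = Fin.last n := by
    rw [Equiv.symm_apply_eq, finRotate_last]
  rw [this]; simp

/-- In the row `0` the twist takes the object of the preceding column, and the end of the column `j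
- 1` is the beginning of the column `j`. At the corner no letter precedes, and the formula is not
available. -/
theorem tw_wordObj [Inhabited P] [NeZero n] (S : P → A.Obj)
    (w : Fin (m + 1) → Fin n → FreeMonoid P) (i : Fin (m + 1)) (j : Fin n)
    (hij : i ≠ 0 ∨ j ≠ 0) :
    (cyc A n).tw (wordObj S w) i j = lastObj S (prefixWord w i j) := by
  rw [DGFunctor.tw]
  split_ifs with hi
  · subst hi
    have hj := hij.resolve_left (by simp)
    change wordObj S w 0 ((finRotate n).symm j) = _
    rw [wordObj, if_pos rfl, prefixWord_last, finRotate_symm_val j hj, Fin.val_zero,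
      prefixWord_zero]
  · rw [wordObj_of_ne S w hi]

/-- The target of an entry agrees with its source if the word is empty. -/
theorem tw_wordObj_eq [Inhabited P] [NeZero n] (S : P → A.Obj)
    (w : Fin (m + 1) → Fin n → FreeMonoid P) (h0 : w 0 0 ≠ 1) (i : Fin (m + 1)) (j : Fin n)
    (h : w i j = 1) : (cyc A n).tw (wordObj S w) i j = wordObj S w (i + 1) j := by
  have hij : i ≠ 0 ∨ j ≠ 0 := by
    by_contra! h'
    rw [h'.1, h'.2] at h
    exact h0 h
  rw [tw_wordObj S w i j hij, wordObj_add_one, prefixWord_succ, h, mul_one]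

theorem wordObj_add_one_of_ne [Inhabited P] (S : P → A.Obj)
    (w : Fin (m + 1) → Fin n → FreeMonoid P) (i : Fin (m + 1)) (j : Fin n)
    (h : w i j ≠ 1) : wordObj S w (i + 1) j = lastObj S (w i j) := by
  rw [wordObj_add_one, prefixWord_succ, lastObj_mul S _ h]

open scoped Classical in
/-- The chain given by a matrix of words, without Koszul sign. -/
def matEl {T S : P → A.Obj} (α : ∀ p, A.Mor (T p) (S p)) (w : Fin (m + 1) → Fin n → FreeMonoid P)
    (y : Fin (m + 1) → Fin n → A.Obj) : Chain (cyc A n) m :=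
  DirectSum.lof k (Fin (m + 1) → (A.tensorPower n).Obj)
    (fun x => ⨂[k] i, (A.tensorPower n).Mor ((cyc A n).tw x i) (x (i + 1))) y
    (PiTensorProduct.tprod k fun i => PiTensorProduct.tprod k fun j =>
      A.evalWord α (w i j).toList ((cyc A n).tw y i j) (y (i + 1) j))

/-- The letters of a matrix of words, row by row. -/
def rowsList (w : Fin m → Fin n → FreeMonoid P) : List P :=
  (byRows m n).flatMap fun q => (w q.1 q.2).toList

/-- The chain given by a matrix of words in homogeneous letters with the parities `e`. -/
def wordEl [Inhabited P] (lt : P → P → Prop) [DecidableRel lt] (e : P → ZMod 2) {T S : P → A.Obj}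
    (α : ∀ p, A.Mor (T p) (S p)) (w : Fin (m + 1) → Fin n → FreeMonoid P) :
    Chain (cyc A n) m :=
  (koszul lt e (rowsList w) : k) • matEl α w (wordObj S w)

theorem nestEquiv_tprod {ι κ : Type} [Finite ι] [Finite κ] {V : ι → κ → Type v}
    [∀ i j, AddCommGroup (V i j)] [∀ i j, Module k (V i j)] (α : ∀ p : ι × κ, V p.1 p.2) :
    nestEquiv k V (PiTensorProduct.tprod k α) =
      PiTensorProduct.tprod k fun i => PiTensorProduct.tprod k fun j => α (i, j) := by
  rw [nestEquiv, LinearEquiv.ofBijective_apply, PiTensorProduct.lift.tprod]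
  rfl

theorem koszulTable_apply [Fintype P] [DecidableEq P] (tb : Table P Q) (lt : P → P → Prop)
    [DecidableRel lt] (read : List Q) {T S : P → A.Obj} (a b : Q → A.Obj) {c : P → ℤ}
    {α : ∀ p, A.Mor (T p) (S p)} (hα : ∀ p, α p ∈ A.deg (T p) (S p) (c p)) :
    A.koszulTable tb lt read T S a b α =
      (koszul lt (fun p => (c p : ZMod 2)) (read.flatMap tb.word) : k) •
        PiTensorProduct.tprod k fun q => A.evalWord α (tb.word q) (a q) (b q) := by
  rw [DGCategory.koszulTable, sum_apply]
  exact DGCategory.sum_par (A.evalTable tb T S a b)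
    (fun e => koszul lt e (read.flatMap tb.word)) hα

open scoped Classical in
theorem matrixTable_apply [Fintype P] [DecidableEq P] [Inhabited P]
    (tb : Table P (Fin (m + 1) × Fin n)) (lt : P → P → Prop) [DecidableRel lt] {T S : P → A.Obj}
    {c : P → ℤ} {α : ∀ p, A.Mor (T p) (S p)} (hα : ∀ p, α p ∈ A.deg (T p) (S p) (c p)) :
    matrixTable tb lt T S α = wordEl lt (fun p => (c p : ZMod 2)) α
      fun i j => FreeMonoid.ofList (tb.word (i, j)) := by
  have hy : (fun i j => A.lastSource S tb.word ((byCols (m + 1) n).filter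
      (fun q => q.2 < j ∨ q.2 = j ∧ q.1 ≤ i - 1))) =
      wordObj S fun i j => FreeMonoid.ofList (tb.word (i, j)) := by
    funext i j
    rw [wordObj, prefixWord_eq_filter, lastObj, DGCategory.lastSource]
    congr 2
    rw [FreeMonoid.toList_prod, List.map_map, List.flatMap_def]
    congr 2
    refine List.filter_congr fun q _ => ?_
    congr 2
    rw [eq_iff_iff]
    refine and_congr_right fun _ => ?_
    rw [Fin.le_def]
    split_ifs with h
    · subst h
      -- For `i = 0` the bound `i - 1` is the last row, so the whole column `j` is included, as in
      -- `wordObj`.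
      have h1 : ((0 : Fin (m + 1)) - 1 : Fin (m + 1)) = Fin.last m :=
        sub_eq_iff_eq_add.2 (Fin.last_add_one m).symm
      rw [h1, Fin.val_last]
      omega
    · rw [Fin.val_sub_one_of_ne_zero h]
      have : (i : ℕ) ≠ 0 := fun h' => h (Fin.ext h')
      omega
  have h : ∀ y : Fin (m + 1) → (A.tensorPower n).Obj,
      (DirectSum.lof k (Fin (m + 1) → (A.tensorPower n).Obj)
        (fun x => ⨂[k] i, (A.tensorPower n).Mor ((cyc A n).tw x i) (x (i + 1))) y ∘ₗ
      (nestEquiv k (fun i j => A.Mor ((cyc A n).tw y i j) (y (i + 1) j))).toLinearMap)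
        (A.koszulTable tb lt (byRows (m + 1) n) T S
          (fun q => (cyc A n).tw y q.1 q.2) (fun q => y (q.1 + 1) q.2) α) =
      (koszul lt (fun p => (c p : ZMod 2)) ((byRows (m + 1) n).flatMap tb.word) : k) •
        matEl α (fun i j => FreeMonoid.ofList (tb.word (i, j))) y := by
    intro y
    rw [koszulTable_apply tb lt _ _ _ hα, map_smul, LinearMap.comp_apply]
    congr 1
    rw [LinearEquiv.coe_coe, nestEquiv_tprod]
    rfl
  refine (h _).trans ?_
  rw [hy]
  rfl

theorem table_nodup {K : Type} (tb : Table P K) {L : List K} (hL : L.Nodup) :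
    (L.flatMap tb.word).Nodup := by
  rw [List.nodup_flatMap]
  refine ⟨fun q _ => tb.nodup q, hL.imp fun {a b} hab => ?_⟩
  simp only [Function.onFun, List.disjoint_left]
  exact fun p ha hb => hab ((tb.unique p).unique ha hb)

theorem pairwise_byRows (m n : ℕ) : (byRows m n).Pairwise rowLt := by
  rw [byRows, List.pairwise_flatMap]
  refine ⟨fun i _ => ?_, ?_⟩
  · rw [List.pairwise_map]
    exact (List.pairwise_lt_finRange n).imp fun h => Or.inr ⟨rfl, h⟩
  · refine (List.pairwise_lt_finRange m).imp fun h => ?_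
    simp only [List.mem_map]
    rintro _ ⟨j, _, rfl⟩ _ ⟨j', _, rfl⟩
    exact Or.inl h

theorem nodup_byRows (m n : ℕ) : (byRows m n).Nodup :=
  (pairwise_byRows m n).imp fun {a b} (h : rowLt a b) => by
    rintro rfl
    exact StrictTotal.irrefl (lt := rowLt) a h

theorem sorted_byRows (m n : ℕ) : (byRows m n).Pairwise fun a b => ¬ rowLt b a :=
  (pairwise_byRows m n).imp fun {a b} h hab => by
    have hne : a ≠ b := by rintro rfl; exact StrictTotal.irrefl (lt := rowLt) a h
    exact (StrictTotal.iff_not (lt := rowLt) a b hne).1 h hab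

theorem mem_byRows (q : Fin m × Fin n) : q ∈ byRows m n := by
  simp only [byRows, List.mem_flatMap, List.mem_map]
  exact ⟨q.1, List.mem_finRange _, q.2, List.mem_finRange _, rfl⟩

variable [Fintype Q] [DecidableEq Q] [Inhabited Q] [Inhabited P]

omit [Fintype Q] [DecidableEq Q] in
theorem lastObj_lift {S : P → A.Obj} {S' : Q → A.Obj} (w : Q → FreeMonoid P) (hw : ∀ q, w q ≠ 1)
    (hS : ∀ q, S' q = lastObj S (w q)) {u : FreeMonoid Q} (hu : u ≠ 1) :
    lastObj S (FreeMonoid.lift w u) = lastObj S' u := by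
  have hu' : u.toList ≠ [] := hu
  have h : u = FreeMonoid.ofList u.toList.dropLast * FreeMonoid.of (u.toList.getLast hu') := by
    apply FreeMonoid.toList.injective
    rw [FreeMonoid.toList_mul, FreeMonoid.toList_of, FreeMonoid.toList_ofList,
      List.dropLast_append_getLast]
  rw [h, map_mul, FreeMonoid.lift_eval_of, lastObj_mul _ _ (hw _), ← hS,
    lastObj_mul _ _ (FreeMonoid.of_ne_one _)]
  rfl

/-- A table, applied to a family of words. -/
theorem matrixTable_words [NeZero n] (tb : Table Q (Fin (m + 1) × Fin n)) {ltQ : Q → Q → Prop}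
    [DecidableRel ltQ] [StrictTotal ltQ] {lt : P → P → Prop} [DecidableRel lt] [StrictTotal lt]
    {T S : P → A.Obj} {T' S' : Q → A.Obj} {c : P → ℤ} {α : ∀ p, A.Mor (T p) (S p)}
    (hα : ∀ p, α p ∈ A.deg (T p) (S p) (c p)) (w : Q → FreeMonoid P)
    (hw : ∀ q, w q ≠ 1) (hT : ∀ q, T' q = T ((w q).toList.headD default))
    (hS : ∀ q, S' q = lastObj S (w q)) (L : List Q) (hL : L.Nodup) (hL' : ∀ q, q ∈ L)
    (hs : L.Pairwise fun a b => ¬ ltQ b a) (hn : (L.flatMap fun q => (w q).toList).Nodup)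
    (h0 : tb.word (0, 0) ≠ []) :
    (koszul lt (fun p => (c p : ZMod 2)) (L.flatMap fun q => (w q).toList) : k) •
      matrixTable tb ltQ T' S' (fun q => A.evalWord α (w q).toList (T' q) (S' q)) =
    wordEl lt (fun p => (c p : ZMod 2)) α
      fun i j => FreeMonoid.lift w (FreeMonoid.ofList (tb.word (i, j))) := by
  have hβ : ∀ q, A.evalWord α (w q).toList (T' q) (S' q) ∈
      A.deg (T' q) (S' q) (((w q).toList.map c).sum) := fun q =>
    DGCategory.evalWord_mem hα _ _ _
  have hlift : ∀ l : List Q, (FreeMonoid.lift w (FreeMonoid.ofList l)).toList =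
      l.flatMap fun q => (w q).toList := by
    intro l
    rw [FreeMonoid.lift_apply, FreeMonoid.toList_prod, List.map_map, List.flatMap_def]
    rfl
  rw [matrixTable_apply tb ltQ hβ, wordEl, wordEl, smul_smul]
  have hdeg : (fun q => ((((w q).toList.map c).sum : ℤ) : ZMod 2)) =
      fun q => wdeg (fun p => (c p : ZMod 2)) (w q).toList := by
    funext q
    rw [wdeg]
    induction (w q).toList with
    | nil => simp
    | cons a l ih => simp [ih]
  have hy : wordObj S' (fun (i : Fin (m + 1)) (j : Fin n) => FreeMonoid.ofList (tb.word (i, j))) =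
      wordObj S fun i j => FreeMonoid.lift w (FreeMonoid.ofList (tb.word (i, j))) := by
    funext i j
    rw [wordObj, wordObj, map_prefixWord (FreeMonoid.lift w)
      (fun (i : Fin (m + 1)) (j : Fin n) => FreeMonoid.ofList (tb.word (i, j))),
      lastObj_lift w hw hS]
    -- Substitution is compatible with the source of the last letter only for nonempty prefixes;
    -- this is where the condition on the corner is used.
    refine prefixWord_ne_one _ h0 _ _ (Or.inl ?_)
    split_ifs with h
    · omega
    · exact fun h' => h (Fin.ext h')
  have hlist : rowsList (fun (i : Fin (m + 1)) (j : Fin n) =>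
      FreeMonoid.lift w (FreeMonoid.ofList (tb.word (i, j)))) =
      ((byRows (m + 1) n).flatMap tb.word).flatMap fun q => (w q).toList := by
    simp only [rowsList, hlift, List.flatMap_assoc]
  have hperm : ((byRows (m + 1) n).flatMap tb.word).Perm L := by
    refine (List.perm_ext_iff_of_nodup (table_nodup tb (nodup_byRows _ _)) hL).2 fun q => ?_
    refine ⟨fun _ => hL' q, fun _ => ?_⟩
    obtain ⟨q', hq', -⟩ := tb.unique q
    exact List.mem_flatMap.2 ⟨q', mem_byRows _, hq'⟩
  -- The sign of the resulting list of letters is the sign of the table in the composite letters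
  -- times the sign of the given family of words. Hence the scalars on both sides agree.
  rw [hlist, koszul_comp (lt := lt) (ltQ := ltQ) (fun q => (w q).toList) hperm hL hs hn, hy, hdeg]
  congr 1
  · push_cast
    rw [mul_comm]
    rfl
  · rw [matEl, matEl]
    congr 2
    funext i
    congr 1
    funext j
    rw [hlift]
    exact DGCategory.evalWord_flatMap α (fun q => (w q).toList) hw hT hS _ _ _

end

section

open Shuffle

/-! ### Faces of matrices of words -/

section Faces

variable {R X : Type*} [AddCommGroup X] {m n : ℕ}

/-- Two adjacent rows are multiplied. -/
def mergeRow [Mul R] (w : Fin (m + 2) → R) (i : Fin (m + 1)) (r : Fin (m + 1)) : R :=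
  if (r : ℕ) < i then w r.castSucc else if (r : ℕ) = i then w r.castSucc * w r.succ else w r.succ

/-- The last row is transformed by `t` and multiplied with the first row. -/
def mergeLast [Mul R] (t : R → R) (w : Fin (m + 2) → R) (r : Fin (m + 1)) : R :=
  if (r : ℕ) = 0 then t (w (Fin.last _)) * w 0 else w r.castSucc

/-- The face `0` multiplies the first row with the head of the remaining list, and the other faces
are the inner faces of this list. -/
theorem hd_add_mid_ofFn [Mul R] (w : Fin (m + 2) → R) (G : List R → X) :
    hd (fun a L => G (w 0 * a :: L)) (List.ofFn fun i => w i.succ) +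
      mid (fun L => G (w 0 :: L)) (List.ofFn fun i => w i.succ) =
    ∑ i : Fin (m + 1), (-1 : ℤ) ^ (i : ℕ) • G (List.ofFn (mergeRow w i)) := by
  induction m generalizing G with
  | zero =>
    simp [mid_cons, mergeRow]
  | succ m ih =>
    have h := ih (fun i => w i.succ) fun L => G (w 0 :: L)
    rw [List.ofFn_succ, mid_cons, hd_cons, ← neg_add', Fin.sum_univ_succ]
    simp only [List.ofFn_succ (n := m + 1)] at h ⊢
    rw [h, ← Finset.sum_neg_distrib]
    congr 1
    · simp [mergeRow, List.ofFn_succ]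
    · refine Finset.sum_congr rfl fun i _ => ?_
      rw [Fin.val_succ, pow_succ, mul_neg_one, neg_smul]
      congr 3
      simp [mergeRow, List.ofFn_succ]
      rfl

/-- This links the boundary of lists with the faces of `hochB`, which are numbered by `Fin`. -/
theorem bd_ofFn [Mul R] (t : R → R) (w : Fin (m + 2) → R) (F : R → List R → X) (G : List R → X)
    (hG : ∀ ρ L, G (ρ :: L) = F ρ L) :
    bd t F (w 0) (List.ofFn fun i : Fin (m + 1) => w i.succ) =
      (∑ i : Fin (m + 1), (-1 : ℤ) ^ (i : ℕ) • G (List.ofFn (mergeRow w i))) +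
        (-1 : ℤ) ^ (m + 1) • G (List.ofFn (mergeLast t w)) := by
  rw [← hd_add_mid_ofFn w G, bd]
  simp only [hG, List.length_ofFn]
  congr 2
  rw [List.ofFn_succ_last, lst_append_singleton, List.ofFn_succ, hG]
  simp [mergeLast]

theorem bd_nil [Mul R] (t : R → R) (F : R → List R → X) (ρ : R) : bd t F ρ [] = 0 := by
  simp [bd]

/-- Multiplying the rows `i` and `i + 1` removes exactly one prefix, the one which ends between
them. -/
theorem prod_take_mergeRow [Monoid R] (w : Fin (m + 2) → R) (i : Fin (m + 1)) {t : ℕ}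
    (ht : t ≤ m + 1) : ((List.ofFn (mergeRow w i)).take t).prod =
      ((List.ofFn w).take (if t ≤ i then t else t + 1)).prod := by
  induction t with
  | zero => simp
  | succ t ih =>
    rw [List.prod_take_succ _ _ (by simpa using ht), ih (by omega), List.getElem_ofFn, mergeRow]
    dsimp only
    rcases lt_trichotomy t i with h | h | h
    · rw [if_pos h.le, if_pos h, if_pos (show t + 1 ≤ i from h),
        List.prod_take_succ _ _ (by simp; omega), List.getElem_ofFn]
      rfl
    · rw [if_pos h.le, if_neg (by omega), if_pos h, if_neg (by omega),
        List.prod_take_succ (List.ofFn w) (t + 1) (by simp; omega),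
        List.prod_take_succ (List.ofFn w) t (by simp; omega), List.getElem_ofFn,
        List.getElem_ofFn, mul_assoc]
      rfl
    · rw [if_neg (by omega), if_neg (by omega), if_neg (by omega), if_neg (by omega),
        List.prod_take_succ (List.ofFn w) (t + 1) (by simp; omega), List.getElem_ofFn]
      rfl

theorem prod_take_mergeLast [Monoid R] (t : R → R) (w : Fin (m + 2) → R) {s : ℕ} (hs : s ≤ m) :
    ((List.ofFn (mergeLast t w)).take (s + 1)).prod =
      t (w (Fin.last _)) * ((List.ofFn w).take (s + 1)).prod := by
  induction s with
  | zero => simp [List.ofFn_succ, mergeLast]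
  | succ s ih =>
    rw [List.prod_take_succ _ _ (by simp; omega), ih (by omega),
      List.prod_take_succ (List.ofFn w) (s + 1) (by simp; omega), List.getElem_ofFn,
      List.getElem_ofFn, mergeLast, if_neg (by simp), mul_assoc]
    rfl

variable {P : Type}

theorem rowT_apply {M : Type*} [Monoid M] [NeZero n] (a : Fin n → M) (j : Fin n) :
    rowT a j = a ((finRotate n).symm j) := by
  rw [rowT, mkRow]
  by_cases hj : j = 0
  · subst hj
    have := finRotate_symm_zero (n := n)
    rw [if_pos (by simp), entry_eq _ (by have := NeZero.pos n; omega)]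
    congr 1; apply Fin.ext; dsimp only; omega
  · have := finRotate_symm_val j hj
    rw [if_neg fun h => hj (Fin.ext (by simpa using h)), entry_eq _ (by omega)]
    congr 1; apply Fin.ext; dsimp only; omega

theorem prefixWord_mergeRow (w : Fin (m + 2) → Fin n → FreeMonoid P) (i : Fin (m + 1)) {t : ℕ}
    (ht : t ≤ m + 1) (j : Fin n) :
    prefixWord (mergeRow w i) t j = prefixWord w (if t ≤ i then t else t + 1) j := by
  have h := prod_take_mergeRow w i (le_refl (m + 1))
  rw [if_neg (by omega), List.take_of_length_le (by simp), List.take_of_length_le (by simp)] at h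
  rw [prefixWord, prefixWord, h, prod_take_mergeRow w i ht]

/-- The entries of the last row move from the end of their column to the beginning of the next one,
which only rebrackets the cyclic word. The entry which wraps around appears as a factor in front. -/
theorem colPrefix_mergeLast (u v : Fin n → FreeMonoid P) {j : ℕ} (hj : j < n) :
    colPrefix (rowT u * v) j * entry (rowT u) j =
      entry (rowT u) 0 * colPrefix (v * u) j := by
  induction j with
  | zero => simp [colPrefix]
  | succ j ih =>
    have h1 := colPrefix_succ (rowT u * v) ⟨j, by omega⟩
    have h2 := colPrefix_succ (v * u) ⟨j, by omega⟩
    dsimp only at h1 h2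
    have h3 : entry (rowT u) (j + 1) = u ⟨j, by omega⟩ := by
      rw [rowT, entry_mkRow _ hj, if_neg (by omega), Nat.add_sub_cancel, entry_eq]
    have h4 : entry (rowT u) j = rowT u ⟨j, by omega⟩ := entry_eq _ _
    rw [h1, h2, ← mul_assoc (entry (rowT u) 0), ← ih (by omega), h3, h4]
    simp only [Pi.mul_apply, mul_assoc]

/-- In the last face, all prefixes get the same additional factor in front. It does not affect the
source of the last letter, so the objects of the face are objects of the given chain. -/
theorem prefixWord_mergeLast [NeZero n] (w : Fin (m + 2) → Fin n → FreeMonoid P) {s : ℕ}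
    (hs : s ≤ m) (j : Fin n) : prefixWord (mergeLast rowT w) (s + 1) j =
      rowT (w (Fin.last _)) 0 * prefixWord w (s + 1) j := by
  have h := prod_take_mergeLast rowT w (le_refl m)
  rw [List.take_of_length_le (by simp)] at h
  have h' : (List.ofFn w).prod = ((List.ofFn w).take (m + 1)).prod * w (Fin.last _) := by
    have := List.prod_take_succ (List.ofFn w) (m + 1) (by simp)
    rw [List.take_of_length_le (by simp), List.getElem_ofFn] at this
    exact this
  have h2 := colPrefix_mergeLast (w (Fin.last _)) ((List.ofFn w).take (m + 1)).prod j.2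
  rw [entry_eq _ j.2, entry_eq _ (NeZero.pos n)] at h2
  rw [prefixWord, prefixWord, h, h', prod_take_mergeLast rowT w hs, Pi.mul_apply, ← mul_assoc,
    h2]
  simp only [mul_assoc]
  rfl

variable {k : Type w} [Field k] {A : DGCategory.{u, v} k} [Inhabited P]

theorem wordObj_mergeRow (S : P → A.Obj) (w : Fin (m + 2) → Fin n → FreeMonoid P)
    (i r : Fin (m + 1)) :
    wordObj S (mergeRow w i) r = wordObj S w (i.succ.succAbove r) := by
  funext j
  have hi := i.2
  have hr := r.2
  rw [wordObj, wordObj, prefixWord_mergeRow]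
  · congr 2
    by_cases h : r = 0
    · subst h
      simp [Nat.not_le.2 hi]
    · have h' : (r : ℕ) ≠ 0 := fun h' => h (Fin.ext h')
      have h2 : i.succ.succAbove r ≠ 0 := by
        rw [Ne, Fin.succAbove_eq_zero_iff (Fin.succ_ne_zero i)]; exact h
      rw [if_neg h, if_neg h2, Fin.succAbove]
      by_cases h3 : (r : ℕ) ≤ i
      · rw [if_pos h3, if_pos (show r.castSucc < i.succ from Nat.lt_succ_of_le h3)]; rfl
      · rw [if_neg h3, if_neg (show ¬ r.castSucc < i.succ from fun h4 => h3 (Nat.le_of_lt_succ h4))]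
        rfl
  · split_ifs <;> omega

theorem wordObj_mergeLast [NeZero n] (S : P → A.Obj) (w : Fin (m + 2) → Fin n → FreeMonoid P)
    (h0 : w 0 0 ≠ 1) (r : Fin (m + 1)) :
    wordObj S (mergeLast rowT w) r =
      wordObj S w (if r = 0 then Fin.last (m + 1) else r.castSucc) := by
  funext j
  have hr := r.2
  by_cases h : r = 0
  · rw [if_pos h, wordObj_of_ne S w (by simp [Fin.ext_iff]), wordObj, if_pos h,
      prefixWord_mergeLast w le_rfl, lastObj_mul]
    · rfl
    · exact prefixWord_ne_one w h0 _ _ (Or.inl (by omega))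
  · have h' : (r : ℕ) ≠ 0 := fun h' => h (Fin.ext h')
    obtain ⟨s, hs⟩ := Nat.exists_eq_succ_of_ne_zero h'
    rw [if_neg h, wordObj_of_ne S w (fun h2 => h' (congrArg Fin.val h2)), wordObj_of_ne S _ h, hs,
      Nat.succ_eq_add_one, prefixWord_mergeLast w (by omega), lastObj_mul, Fin.val_castSucc, hs]
    exact prefixWord_ne_one w h0 _ _ (Or.inl (by omega))

end Faces

end

/-! ### Inner faces of chains whose factors are rows of words -/

section

open Shuffle

variable {k : Type w} [Field k]

section ChainTable

variable {A : DGCategory.{u, v} k} {P : Type} {m : ℕ}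

open scoped Classical in
/-- The chain with given factors. -/
def chainEl (F : DGFunctor A A) (y : Fin (m + 1) → A.Obj) (x : ∀ i, A.Mor (F.tw y i) (y (i + 1))) :
    Chain F m :=
  DirectSum.lof k (Fin (m + 1) → A.Obj) (fun x => ⨂[k] i, A.Mor (F.tw x i) (x (i + 1))) y
    (PiTensorProduct.tprod k x)

/-- The decidability instances for tuples of objects may differ, depending on whether the chain is
regarded over `A` or over its tensor power. -/
theorem lof_congr {ι : Type*} {M : ι → Type*} [∀ i, AddCommMonoid (M i)] [∀ i, Module k (M i)]
    (d d' : DecidableEq ι) (i : ι) :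
    @DirectSum.lof k _ ι M _ _ d i = @DirectSum.lof k _ ι M _ _ d' i := by
  rw [Subsingleton.elim d d']

theorem filter_le_finRange (r : Fin (m + 1)) : ∃ l : List (Fin (m + 1)),
    (List.finRange (m + 1)).filter (fun i => i ≤ r) = l ++ [r] := by
  refine ⟨(List.finRange (m + 1)).take r, ?_⟩
  have h := filter_finRange_lt (fun i : Fin (m + 1) => i) (r + 1)
  rw [List.map_id', List.take_succ_eq_append_getElem (by simp; omega), List.getElem_ofFn] at h
  rw [← List.ofFn_id]
  refine Eq.trans (List.filter_congr fun i _ => ?_) h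
  rw [decide_eq_decide, Fin.le_def, Nat.lt_succ_iff]

/-- The Hochschild chain given by a table with nonempty words. -/
theorem chainTable_apply [Fintype P] [DecidableEq P] [Inhabited P] (F : DGFunctor A A)
    (tb : Table P (Fin (m + 1))) (lt : P → P → Prop) [DecidableRel lt] {T S : P → A.Obj}
    {c : P → ℤ} {α : ∀ p, A.Mor (T p) (S p)} (hα : ∀ p, α p ∈ A.deg (T p) (S p) (c p))
    (hw : ∀ r, tb.word r ≠ []) (y : Fin (m + 1) → A.Obj)
    (hy : ∀ r, y (r + 1) = S ((tb.word r).getLastD default)) :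
    chainTable F tb lt T S α =
      (koszul lt (fun p => (c p : ZMod 2)) ((List.finRange (m + 1)).flatMap tb.word) : k) •
        chainEl F y fun r => A.evalWord α (tb.word r) (F.tw y r) (y (r + 1)) := by
  have hy' : (fun i : Fin (m + 1) => A.lastSource S tb.word
      ((List.finRange (m + 1)).filter (fun i' => i' ≤ i - 1))) = y := by
    funext i
    have h := hy (i - 1)
    rw [sub_add_cancel] at h
    obtain ⟨l, hl⟩ := filter_le_finRange (i - 1)
    rw [h, hl, DGCategory.lastSource, List.flatMap_append, List.flatMap_singleton,
      List.getLastD_eq_getLast?, List.getLast?_append_of_ne_nil _ (hw _),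
      ← List.getLastD_eq_getLast?]
  subst hy'
  rw [chainTable, LinearMap.compMultilinearMap_apply, koszulTable_apply tb lt _ _ _ hα, map_smul]
  rfl

end ChainTable

section HochB

variable {A : DGCategory.{u, v} k} {n : ℕ}

variable {P : Type} [Inhabited P] {T S : P → A.Obj} {c : P → ℤ} {α : ∀ p, A.Mor (T p) (S p)}

/-- A row of words. -/
def rowEl (α : ∀ p, A.Mor (T p) (S p)) (u : Fin n → FreeMonoid P) (a b : Fin n → A.Obj) :
    (A.tensorPower n).Mor a b :=
  PiTensorProduct.tprod k fun j => A.evalWord α (u j).toList (a j) (b j)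

/-- The degree of a row of words. -/
def rowDeg (c : P → ℤ) (u : Fin n → FreeMonoid P) : ℤ := ∑ j, ((u j).toList.map c).sum

omit [Inhabited P] in
theorem rowEl_mem (hα : ∀ p, α p ∈ A.deg (T p) (S p) (c p)) (u : Fin n → FreeMonoid P)
    (a b : Fin n → A.Obj) : rowEl α u a b ∈ (A.tensorPower n).deg a b (rowDeg c u) :=
  DGCategory.tprod_mem_tensorDeg (fun _ => DGCategory.evalWord_mem hα _ _ _) rfl

omit [Inhabited P] in
theorem intCast_sum_map (l : List P) :
    (((l.map c).sum : ℤ) : ZMod 2) = wdeg (fun p => (c p : ZMod 2)) l := by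
  rw [wdeg]
  induction l with
  | nil => simp
  | cons a l ih => simp [ih]

/-- The letters of a row. -/
def rowList (u : Fin n → FreeMonoid P) : List P := (List.finRange n).flatMap fun j => (u j).toList

omit [Inhabited P] in
theorem intCast_rowDeg (u : Fin n → FreeMonoid P) :
    ((rowDeg c u : ℤ) : ZMod 2) = wdeg (fun p => (c p : ZMod 2)) (rowList u) := by
  rw [rowDeg, rowList, wdeg_flatMap, Int.cast_sum, ← List.ofFn_eq_map, List.sum_ofFn]
  simp only [intCast_sum_map]

omit [Inhabited P] in
theorem rowsList_eq {m : ℕ} (w : Fin m → Fin n → FreeMonoid P) :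
    rowsList w = (List.finRange m).flatMap fun i => rowList (w i) := by
  simp only [rowsList, byRows, rowList, List.flatMap_assoc, List.flatMap_map]

/-- The parities of the entries of a row. -/
def rowPar (c : P → ℤ) (u : Fin n → FreeMonoid P) (j : Fin n) : ZMod 2 :=
  wdeg (fun p => (c p : ZMod 2)) (u j).toList

/-- The two conditions fix the intermediate objects: a nonempty word has to end there, and an empty
one has to be an identity. -/
theorem comp_rowEl (hα : ∀ p, α p ∈ A.deg (T p) (S p) (c p)) (u u' : Fin n → FreeMonoid P)
    {a b e : Fin n → A.Obj} (h1 : ∀ j, u j = 1 → a j = b j)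
    (h2 : ∀ j, u j ≠ 1 → b j = lastObj S (u j)) :
    (A.tensorPower n).comp (rowEl α u a b) (rowEl α u' b e) =
      (DGCategory.compSign (rowPar c u) (rowPar c u') : k) • rowEl α (u * u') a e := by
  refine (DGCategory.tensorComp_tprod (fun j => DGCategory.evalWord_mem hα _ _ _)
    (fun j => DGCategory.evalWord_mem hα _ _ _)).trans ?_
  simp only [intCast_sum_map]
  rw [rowEl]
  congr 2
  funext j
  rw [Pi.mul_apply, FreeMonoid.toList_mul]
  exact DGCategory.comp_evalWord α _ _ (h1 j) (h2 j)

omit [Inhabited P] in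
theorem cyc_map_rowEl (hα : ∀ p, α p ∈ A.deg (T p) (S p) (c p)) [NeZero n]
    (u : Fin n → FreeMonoid P) (a b : Fin n → A.Obj) :
    (cyc A n).map (rowEl α u a b) =
      (permSign (finRotate n) (rowPar c u) : k) •
        rowEl α (rowT u) ((cyc A n).obj a) ((cyc A n).obj b) := by
  refine (DGCategory.tensorPerm_tprod (finRotate n)
    (fun j => DGCategory.evalWord_mem hα _ _ _)).trans ?_
  simp only [intCast_sum_map]
  rw [rowEl]
  congr 2
  funext j
  rw [rowT_apply]

omit [Inhabited P] in
theorem evalWord_rowEl_single {I : Type} {T' S' : I → (A.tensorPower n).Obj}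
    (β : ∀ i, (A.tensorPower n).Mor (T' i) (S' i)) (i : I) (u : Fin n → FreeMonoid P)
    (hβ : β i = rowEl α u (T' i) (S' i)) {a b : (A.tensorPower n).Obj} (ha : a = T' i)
    (hb : b = S' i) : (A.tensorPower n).evalWord β [i] a b = rowEl α u a b := by
  subst ha hb
  rw [DGCategory.evalWord_singleton, hβ]

theorem evalWord_rowEl_pair (hα : ∀ p, α p ∈ A.deg (T p) (S p) (c p)) {I : Type}
    {T' S' : I → (A.tensorPower n).Obj}
    (β : ∀ i, (A.tensorPower n).Mor (T' i) (S' i)) (i i' : I) (u u' : Fin n → FreeMonoid P)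
    (s : k) (hβ : β i = s • rowEl α u (T' i) (S' i)) (hβ' : β i' = rowEl α u' (T' i') (S' i'))
    {a b : (A.tensorPower n).Obj} (ha : a = T' i) (hb : b = S' i') (hi : S' i = T' i')
    (h1 : ∀ j, u j = 1 → T' i j = S' i j) (h2 : ∀ j, u j ≠ 1 → S' i j = lastObj S (u j)) :
    (A.tensorPower n).evalWord β [i, i'] a b =
      (s * DGCategory.compSign (rowPar c u) (rowPar c u') : k) • rowEl α (u * u') a b := by
  subst ha hb
  have h : (A.tensorPower n).evalWord β [i'] (S' i) (S' i') = rowEl α u' (S' i) (S' i') :=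
    evalWord_rowEl_single β i' u' hβ' hi rfl
  change (A.tensorPower n).comp ((A.tensorPower n).comp
    ((A.tensorPower n).oneHom (T' i) (T' i)) (β i))
      ((A.tensorPower n).evalWord β [i'] (S' i) (S' i')) = _
  rw [h, DGCategory.oneHom_self, (A.tensorPower n).one_comp, hβ, map_smul, LinearMap.smul_apply,
    comp_rowEl hα u u' h1 h2, smul_smul]

omit [Inhabited P] in
theorem matEl_eq {m : ℕ} (w : Fin (m + 1) → Fin n → FreeMonoid P)
    (y : Fin (m + 1) → Fin n → A.Obj) :
    matEl α w y = chainEl (A := A.tensorPower n) (cyc A n) y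
      fun i => rowEl α (w i) ((cyc A n).tw y i) (y (i + 1)) := by
  unfold matEl chainEl
  exact LinearMap.congr_fun (lof_congr _ _ _) _

/-- A chain whose factors are rows of words, up to signs. -/
theorem chainEl_smul {m : ℕ} (y : Fin (m + 1) → (A.tensorPower n).Obj) (s : Fin (m + 1) → k)
    (x : ∀ i, (A.tensorPower n).Mor ((cyc A n).tw y i) (y (i + 1))) :
    chainEl (A := A.tensorPower n) (cyc A n) y (fun i => s i • x i) =
      (∏ i, s i) • chainEl (A := A.tensorPower n) (cyc A n) y x := by
  rw [chainEl, MultilinearMap.map_smul_univ, map_smul]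
  rfl

section

variable {m : ℕ} [NeZero n] (w : Fin (m + 2) → Fin n → FreeMonoid P)
  (hα : ∀ p, α p ∈ A.deg (T p) (S p) (c p))

theorem faceTable_of_lt {i r : Fin (m + 1)} (h : (r : ℕ) < i) :
    (faceTable m i).word r = [r.castSucc] := if_pos h

theorem faceTable_self (i : Fin (m + 1)) : (faceTable m i).word i = [i.castSucc, i.succ] := by
  simp [faceTable]

theorem faceTable_of_gt {i r : Fin (m + 1)} (h : (i : ℕ) < r) :
    (faceTable m i).word r = [r.succ] := by
  have h1 : ¬ r < i := not_lt.2 (le_of_lt h)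
  have h2 : r ≠ i := fun h' => by rw [h'] at h; exact lt_irrefl _ h
  simp [faceTable, h1, h2]

theorem mem_faceTable {i r : Fin (m + 1)} {p : Fin (m + 2)} (h : p ∈ (faceTable m i).word r) :
    (r : ℕ) = if (p : ℕ) ≤ i then (p : ℕ) else p - 1 := by
  rcases lt_trichotomy (r : ℕ) i with h1 | h1 | h1
  · rw [faceTable_of_lt h1, List.mem_singleton] at h
    rw [h, Fin.val_castSucc, if_pos h1.le]
  · obtain rfl : r = i := Fin.ext h1
    rw [faceTable_self, List.mem_cons, List.mem_singleton] at h
    rcases h with rfl | rfl <;> simp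
  · rw [faceTable_of_gt h1, List.mem_singleton] at h
    rw [h, Fin.val_succ, if_neg (by omega), Nat.add_sub_cancel]

/-- Both lists are strictly increasing and have the same elements. Thus an inner face does not
exchange factors and has no Koszul sign as a table. -/
theorem flatMap_faceTable (i : Fin (m + 1)) :
    (List.finRange (m + 1)).flatMap (faceTable m i).word = List.finRange (m + 2) := by
  refine List.Perm.eq_of_pairwise (le := fun a b => a < b)
    (fun a b _ _ h h' => absurd h h'.asymm) ?_ (List.pairwise_lt_finRange (m + 2)) ?_
  · rw [List.pairwise_flatMap]
    constructor
    · intro j _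
      rcases lt_trichotomy (j : ℕ) i with h1 | h1 | h1
      · rw [faceTable_of_lt h1]; simp
      · obtain rfl : j = i := Fin.ext h1
        rw [faceTable_self]; simp
      · rw [faceTable_of_gt h1]; simp
    · refine (List.pairwise_lt_finRange (m + 1)).imp
        fun {j j' : Fin (m + 1)} (h : j < j') a ha b hb => ?_
      have h : (j : ℕ) < j' := h
      have h1 := mem_faceTable ha
      have h2 := mem_faceTable hb
      change (a : ℕ) < b
      split_ifs at h1 h2 <;> omega
  · refine (List.perm_ext_iff_of_nodup (table_nodup _ (List.nodup_finRange _))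
      (List.nodup_finRange _)).2 fun q => ⟨fun _ => List.mem_finRange _, fun _ => ?_⟩
    obtain ⟨q', hq', -⟩ := (faceTable m i).unique q
    exact List.mem_flatMap.2 ⟨q', List.mem_finRange _, hq'⟩

-- The only sign is that of the composition in the tensor power. It is the sign of interleaving the
-- letters of two rows, which is exactly the change of the Koszul sign of the matrix; in terms of
-- `wordEl` no sign is left.
include hα in
theorem chainTable_faceTable (h0 : w 0 0 ≠ 1) (hn : (rowsList w).Nodup) (lt : P → P → Prop)
    [DecidableRel lt] [StrictTotal lt] (i : Fin (m + 1)) :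
    (koszul lt (fun p => (c p : ZMod 2)) (rowsList w) : k) •
      chainTable (A := A.tensorPower n) (cyc A n) (faceTable m i) (· < ·)
        ((cyc A n).tw (wordObj S w)) (fun i => wordObj S w (i + 1))
        (fun i => rowEl α (w i) ((cyc A n).tw (wordObj S w) i) (wordObj S w (i + 1))) =
    wordEl lt (fun p => (c p : ZMod 2)) α (mergeRow w i) := by
  set y := wordObj S w with hy
  have hγ : ∀ i, rowEl α (w i) ((cyc A n).tw y i) (y (i + 1)) ∈
      (A.tensorPower n).deg ((cyc A n).tw y i) (y (i + 1)) (rowDeg c (w i)) :=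
    fun i => rowEl_mem hα _ _ _
  have hi := i.2
  have htw : ∀ r, (cyc A n).tw (wordObj S (mergeRow w i)) r =
      (cyc A n).tw y (i.succ.succAbove r) := by
    intro r
    have h2 : i.succ.succAbove r = 0 ↔ r = 0 := Fin.succAbove_eq_zero_iff (Fin.succ_ne_zero i)
    simp only [DGFunctor.tw, h2, wordObj_mergeRow, ← hy]
  have hsucc : ∀ r : Fin (m + 1), wordObj S (mergeRow w i) (r + 1) =
      y ((if (r : ℕ) < i then r.castSucc else r.succ) + 1) := by
    intro r
    funext j
    rw [hy, wordObj_add_one, wordObj_add_one, prefixWord_mergeRow _ _ r.2]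
    split_ifs <;> first | rfl | omega
  rw [chainTable_apply (A := A.tensorPower n) (cyc A n) (faceTable m i) (· < ·) hγ
    (y := wordObj S (mergeRow w i)), flatMap_faceTable, koszul_eq_one _ _
      ((List.pairwise_lt_finRange _).imp fun h => h.asymm), Int.cast_one, one_smul, wordEl, matEl_eq]
  · have h1 : ∀ r, (A.tensorPower n).evalWord
        (fun i => rowEl α (w i) ((cyc A n).tw y i) (y (i + 1))) ((faceTable m i).word r)
        ((cyc A n).tw (wordObj S (mergeRow w i)) r) (wordObj S (mergeRow w i) (r + 1)) =
        ((if r = i then DGCategory.compSign (rowPar c (w i.castSucc)) (rowPar c (w i.succ)) else 1 : ℤ) : k) •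
          rowEl α (mergeRow w i r) ((cyc A n).tw (wordObj S (mergeRow w i)) r)
            (wordObj S (mergeRow w i) (r + 1)) := by
      intro r
      have hr := htw r
      have hs := hsucc r
      rcases lt_trichotomy (r : ℕ) i with h | h | h
      · have e1 := faceTable_of_lt h
        have e2 : i.succ.succAbove r = r.castSucc := if_pos (Nat.lt_succ_of_lt h)
        rw [if_pos h] at hs
        rw [e2] at hr
        rw [if_neg (fun h' => by rw [h'] at h; exact lt_irrefl _ h), Int.cast_one, one_smul, e1,
          mergeRow, if_pos h]
        exact evalWord_rowEl_single _ _ _ rfl hr hs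
      · obtain rfl : r = i := Fin.ext h
        have e1 := faceTable_self r
        have e2 : r.succ.succAbove r = r.castSucc := if_pos (Nat.lt_succ_self _)
        have e3 : r.castSucc + 1 = r.succ := Fin.coeSucc_eq_succ
        rw [if_neg (lt_irrefl _)] at hs
        rw [e2] at hr
        have h2 := evalWord_rowEl_pair hα
          (fun i => rowEl α (w i) ((cyc A n).tw y i) (y (i + 1))) r.castSucc r.succ (w r.castSucc)
          (w r.succ) 1 (by rw [one_smul]) rfl hr hs ?_ ?_ ?_
        · rw [e1, if_pos rfl, h2, one_mul, mergeRow, if_neg (lt_irrefl _), if_pos rfl]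
        · rw [e3, DGFunctor.tw, if_neg (Fin.succ_ne_zero _)]
        · exact fun j => tw_wordObj_eq S w h0 _ j
        · exact fun j => wordObj_add_one_of_ne S w _ j
      · have e1 := faceTable_of_gt h
        have e2 : i.succ.succAbove r = r.succ := if_neg (not_lt.2 (Nat.succ_le_of_lt h))
        rw [if_neg (not_lt.2 h.le)] at hs
        rw [e2] at hr
        rw [if_neg (fun h' => by rw [h'] at h; exact lt_irrefl _ h), Int.cast_one, one_smul, e1,
          mergeRow, if_neg (not_lt.2 h.le), if_neg h.ne']
        exact evalWord_rowEl_single _ _ _ rfl hr hs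
    simp only [h1]
    rw [chainEl_smul, smul_smul, ← Int.cast_prod, ← Int.cast_mul, Finset.prod_ite_eq',
      if_pos (Finset.mem_univ _)]
    have h2 : KRel lt (fun p => (c p : ZMod 2))
        (DGCategory.compSign (rowPar c (w i.castSucc)) (rowPar c (w i.succ)))
        (rowsList (mergeRow w i)) (rowsList w) := by
      refine (KRel.flatMap (lt := lt) (e := fun p => (c p : ZMod 2)) (List.finRange (m + 1))
        (fun r => if r = i then
          DGCategory.compSign (rowPar c (w i.castSucc)) (rowPar c (w i.succ)) else 1)
        (fun r => rowList (mergeRow w i r))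
        (fun r => ((faceTable m i).word r).flatMap fun r => rowList (w r)) fun r _ => ?_).of_eq
        ?_ ?_ ?_
      · rcases lt_trichotomy (r : ℕ) i with h | h | h
        · have e1 := faceTable_of_lt h
          rw [e1, if_neg (fun h' => by rw [h'] at h; exact lt_irrefl _ h), mergeRow, if_pos h,
            List.flatMap_singleton]
          exact KRel.refl _
        · obtain rfl : r = i := Fin.ext h
          have e1 := faceTable_self r
          rw [e1, if_pos rfl, mergeRow, if_neg (lt_irrefl _), if_pos rfl]
          refine (KRel.interleave (lt := lt) (e := fun p => (c p : ZMod 2))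
            (fun j => (w r.castSucc j).toList) (fun j => (w r.succ j).toList)
            (List.finRange n)).of_eq (ilvSign_finRange _ _) rfl ?_
          simp [rowList]
        · have e1 := faceTable_of_gt h
          rw [e1, if_neg (fun h' => by rw [h'] at h; exact lt_irrefl _ h), mergeRow,
            if_neg (not_lt.2 h.le), if_neg h.ne', List.flatMap_singleton]
          exact KRel.refl _
      · rw [← List.ofFn_eq_map, List.prod_ofFn, Finset.prod_ite_eq', if_pos (Finset.mem_univ _)]
      · rw [rowsList_eq]
      · rw [← List.flatMap_assoc, flatMap_faceTable, rowsList_eq]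
    rw [h2.koszul_eq ((h2.perm.nodup_iff).2 hn), mul_comm]
  · intro r
    rcases lt_trichotomy (r : ℕ) i with h | h | h
    · rw [faceTable_of_lt h]; simp
    · rw [← Fin.ext h, faceTable_self]; simp
    · rw [faceTable_of_gt h]; simp
  · intro r
    rw [hsucc]
    rcases lt_trichotomy (r : ℕ) i with h | h | h
    · rw [faceTable_of_lt h, if_pos h]; rfl
    · obtain rfl : r = i := Fin.ext h
      rw [faceTable_self, if_neg (lt_irrefl _)]; rfl
    · rw [faceTable_of_gt h, if_neg (not_lt.2 h.le)]; rfl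

end

end HochB

end

/-! ### The last face and the Hochschild differential on matrices of words -/

section

open Shuffle

variable {k : Type w} [Field k]

section HochB

variable {A : DGCategory.{u, v} k} {n : ℕ}
variable {P : Type} [Inhabited P] {T S : P → A.Obj} {c : P → ℤ} {α : ∀ p, A.Mor (T p) (S p)}
variable {m : ℕ} [NeZero n] (w : Fin (m + 2) → Fin n → FreeMonoid P)
  (hα : ∀ p, α p ∈ A.deg (T p) (S p) (c p))

omit [NeZero n] [Inhabited P] in
theorem id_map_rowEl {B : DGCategory.{u, v} k} {g : DGFunctor B B} (hg : g = DGFunctor.id B)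
    (a : B.Obj) : g.obj a = a := by
  subst hg; rfl

omit [NeZero n] [Inhabited P] in
theorem map_rowEl_of_eq_id {g : DGFunctor (A.tensorPower n) (A.tensorPower n)}
    (hg : g = DGFunctor.id (A.tensorPower n)) (u : Fin n → FreeMonoid P)
    (a b : Fin n → A.Obj) : g.map (rowEl α u a b) = rowEl α u (g.obj a) (g.obj b) := by
  subst hg; rfl

omit [Inhabited P] in
theorem map_rowEl_of_eq_cyc {g : DGFunctor (A.tensorPower n) (A.tensorPower n)}
    (hg : g = cyc A n) (hα : ∀ p, α p ∈ A.deg (T p) (S p) (c p)) (u : Fin n → FreeMonoid P)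
    (a b : Fin n → A.Obj) : g.map (rowEl α u a b) = (permSign (finRotate n) (rowPar c u) : k) •
        rowEl α (rowT u) (g.obj a) (g.obj b) := by
  subst hg
  exact cyc_map_rowEl hα u a b

theorem lastFaceTable_zero : (lastFaceTable m).word 0 = [Fin.last (m + 1), 0] := by
  simp [lastFaceTable]

theorem lastFaceTable_of_ne {r : Fin (m + 1)} (h : r ≠ 0) :
    (lastFaceTable m).word r = [r.castSucc] := by
  simp [lastFaceTable, h]

theorem mergeLast_zero {R : Type*} [Mul R] (t : R → R) (w : Fin (m + 2) → R) :
    mergeLast t w 0 = t (w (Fin.last _)) * w 0 := by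
  simp [mergeLast]

theorem mergeLast_of_ne {R : Type*} [Mul R] (t : R → R) (w : Fin (m + 2) → R) {r : Fin (m + 1)}
    (h : r ≠ 0) : mergeLast t w r = w r.castSucc := by
  rw [mergeLast, if_neg fun h' : (r : ℕ) = 0 => h (Fin.ext h')]

/-- The functors which are applied to the factors in the last face. -/
def lastFun (F : DGFunctor (A.tensorPower n) (A.tensorPower n)) (i : Fin (m + 2)) :
    DGFunctor (A.tensorPower n) (A.tensorPower n) :=
  if i = Fin.last (m + 1) then F else DGFunctor.id (A.tensorPower n)

theorem one_of_mul {R : Type} {x y : FreeMonoid R} (h : y ≠ 1) : x * y ≠ 1 :=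
  fun h' => h (List.append_eq_nil_iff.1 h').2

-- Three signs arise: from moving the last row to the front, from rotating its columns, and from
-- composing it with the first row. By `koszul_comp`, `KRel.rotate` and `KRel.interleave` they
-- combine to the change of the Koszul sign of the matrix.
include hα in
theorem chainTable_lastFaceTable (h0 : w 0 0 ≠ 1) (hn : (rowsList w).Nodup) (lt : P → P → Prop)
    [DecidableRel lt] [StrictTotal lt] :
    (koszul lt (fun p => (c p : ZMod 2)) (rowsList w) : k) •
      chainTable (A := A.tensorPower n) (cyc A n) (lastFaceTable m) (· < ·)
        (fun i => (lastFun (cyc A n) i).obj ((cyc A n).tw (wordObj S w) i))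
        (fun i => (lastFun (cyc A n) i).obj (wordObj S w (i + 1)))
        (fun i => (lastFun (cyc A n) i).map
          (rowEl α (w i) ((cyc A n).tw (wordObj S w) i) (wordObj S w (i + 1)))) =
    wordEl lt (fun p => (c p : ZMod 2)) α (mergeLast rowT w) := by
  set y := wordObj S w with hy
  set G := lastFun (m := m) (cyc A n) with hG
  have hG1 : G (Fin.last (m + 1)) = cyc A n := if_pos rfl
  have hG2 : ∀ r : Fin (m + 1), G r.castSucc = DGFunctor.id (A.tensorPower n) := fun r =>
    if_neg (Fin.castSucc_lt_last r).ne
  have hγ : ∀ i, (G i).map (rowEl α (w i) ((cyc A n).tw y i) (y (i + 1))) ∈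
      (A.tensorPower n).deg ((G i).obj ((cyc A n).tw y i)) ((G i).obj (y (i + 1)))
        (rowDeg c (w i)) :=
    fun i => (G i).map_mem (rowEl_mem hα _ _ _)
  have htw0 : (cyc A n).tw (wordObj S (mergeLast rowT w)) 0 =
      (cyc A n).obj ((cyc A n).tw y (Fin.last (m + 1))) := by
    rw [DGFunctor.tw, if_pos rfl, DGFunctor.tw, if_neg (Fin.last_pos).ne']
    congr 1
    exact (funext fun j => by rw [wordObj_mergeLast S w h0, if_pos rfl])
  have htw : ∀ r : Fin (m + 1), r ≠ 0 → (cyc A n).tw (wordObj S (mergeLast rowT w)) r =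
      (cyc A n).tw y r.castSucc := by
    intro r hr
    rw [DGFunctor.tw, if_neg hr, DGFunctor.tw, if_neg (by simpa using hr),
      wordObj_mergeLast S w h0, if_neg hr]
  have hsucc : ∀ r : Fin (m + 1), wordObj S (mergeLast rowT w) (r + 1) = y (r.castSucc + 1) := by
    intro r
    funext j
    rw [hy, wordObj_add_one, wordObj_add_one, prefixWord_mergeLast _ (Nat.lt_succ_iff.1 r.2),
      lastObj_mul]
    · rfl
    · exact prefixWord_ne_one w h0 _ _ (Or.inl (by omega))
  rw [chainTable_apply (A := A.tensorPower n) (cyc A n) (lastFaceTable m) (· < ·) hγ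
    (y := wordObj S (mergeLast rowT w)), wordEl, matEl_eq]
  · have h1 : ∀ r, (A.tensorPower n).evalWord
        (fun i => (G i).map (rowEl α (w i) ((cyc A n).tw y i) (y (i + 1))))
        ((lastFaceTable m).word r)
        ((cyc A n).tw (wordObj S (mergeLast rowT w)) r)
        (wordObj S (mergeLast rowT w) (r + 1)) =
        ((if r = 0 then permSign (finRotate n) (rowPar c (w (Fin.last (m + 1)))) *
          DGCategory.compSign (rowPar c (rowT (w (Fin.last (m + 1))))) (rowPar c (w 0))
            else 1 : ℤ) : k) •
          rowEl α (mergeLast rowT w r) ((cyc A n).tw (wordObj S (mergeLast rowT w)) r)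
            (wordObj S (mergeLast rowT w) (r + 1)) := by
      intro r
      have hs := hsucc r
      by_cases hr : r = 0
      · subst hr
        have e0 : (0 : Fin (m + 2)) = Fin.castSucc 0 := rfl
        rw [if_pos rfl, lastFaceTable_zero, mergeLast_zero, Int.cast_mul]
        have hl : Fin.last (m + 1) + 1 = 0 := Fin.last_add_one _
        refine evalWord_rowEl_pair hα _ _ _ _ _ _ (map_rowEl_of_eq_cyc hG1 hα _ _ _)
          (map_rowEl_of_eq_id (hG2 0) _ _ _) ?_ ?_ ?_ ?_ ?_
        · rw [htw0, hG1]
        · exact hs.trans (id_map_rowEl (hG2 0) _).symm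
        -- The last row ends at `y 0`, and the rotation of `y 0` is the target of the first row by
        -- the definition of the twist.
        · refine Eq.trans ?_ (id_map_rowEl (hG2 0) _).symm
          rw [hG1, hl]
          exact (if_pos rfl).symm
        · intro j hj
          rw [rowT_apply] at hj
          rw [hG1]
          exact tw_wordObj_eq S w h0 _ _ hj
        · intro j hj
          rw [rowT_apply] at hj ⊢
          rw [hG1]
          exact wordObj_add_one_of_ne S w _ _ hj
      · rw [if_neg hr, Int.cast_one, one_smul, lastFaceTable_of_ne hr, mergeLast_of_ne _ _ hr]
        exact evalWord_rowEl_single _ _ _ (map_rowEl_of_eq_id (hG2 r) _ _ _)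
          ((htw r hr).trans (id_map_rowEl (hG2 r) _).symm)
          (hs.trans (id_map_rowEl (hG2 r) _).symm)
    simp only [h1]
    rw [chainEl_smul, smul_smul, smul_smul, ← Int.cast_prod, ← Int.cast_mul, ← Int.cast_mul,
      Finset.prod_ite_eq', if_pos (Finset.mem_univ _)]
    have h2 : KRel lt (fun p => (c p : ZMod 2))
        (permSign (finRotate n) (rowPar c (w (Fin.last (m + 1)))) *
          DGCategory.compSign (rowPar c (rowT (w (Fin.last (m + 1))))) (rowPar c (w 0)))
        (rowsList (mergeLast rowT w))
        (((List.finRange (m + 1)).flatMap (lastFaceTable m).word).flatMap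
          fun r => rowList (w r)) := by
      refine (KRel.flatMap (lt := lt) (e := fun p => (c p : ZMod 2)) (List.finRange (m + 1))
        (fun r => if r = 0 then permSign (finRotate n) (rowPar c (w (Fin.last (m + 1)))) *
          DGCategory.compSign (rowPar c (rowT (w (Fin.last (m + 1))))) (rowPar c (w 0)) else 1)
        (fun r => rowList (mergeLast rowT w r))
        (fun r => ((lastFaceTable m).word r).flatMap fun r => rowList (w r)) fun r _ => ?_).of_eq
        ?_ ?_ ?_
      · by_cases hr : r = 0
        · subst hr
          rw [if_pos rfl, lastFaceTable_zero, mergeLast_zero]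
          have hrot := (KRel.rotate (lt := lt) (e := fun p => (c p : ZMod 2))
            (fun j => (w (Fin.last (m + 1)) j).toList)).of_eq rfl
            (show _ = (List.finRange n).flatMap fun j =>
              (rowT (w (Fin.last (m + 1))) j).toList by simp only [rowT_apply]) rfl
          refine ((KRel.interleave (lt := lt) (e := fun p => (c p : ZMod 2))
            (fun j => (rowT (w (Fin.last (m + 1))) j).toList) (fun j => (w 0 j).toList)
            (List.finRange n)).trans (hrot.append (KRel.refl _))).of_eq
            ?_ rfl ?_
          · rw [ilvSign_finRange, mul_one, mul_comm]; rfl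
          · simp [rowList]
        · rw [if_neg hr, lastFaceTable_of_ne hr, mergeLast_of_ne _ _ hr, List.flatMap_singleton]
          exact KRel.refl _
      · rw [← List.ofFn_eq_map, List.prod_ofFn, Finset.prod_ite_eq', if_pos (Finset.mem_univ _)]
      · rw [rowsList_eq]
      · rw [List.flatMap_assoc]
    have hperm : ((List.finRange (m + 1)).flatMap (lastFaceTable m).word).Perm
        (List.finRange (m + 2)) := by
      refine (List.perm_ext_iff_of_nodup (table_nodup _ (List.nodup_finRange _))
        (List.nodup_finRange _)).2 fun q => ⟨fun _ => List.mem_finRange _, fun _ => ?_⟩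
      obtain ⟨q', hq', -⟩ := (lastFaceTable m).unique q
      exact List.mem_flatMap.2 ⟨q', List.mem_finRange _, hq'⟩
    have hn' : ((List.finRange (m + 2)).flatMap fun r => rowList (w r)).Nodup := by
      rwa [← rowsList_eq]
    have h3 := koszul_comp (lt := lt) (ltQ := fun a b : Fin (m + 2) => a < b)
      (e := fun p => (c p : ZMod 2)) (fun r => rowList (w r)) hperm (List.nodup_finRange _)
      ((List.pairwise_lt_finRange _).imp fun h => h.asymm) hn'
    rw [h2.koszul_eq ((h2.perm.trans (hperm.flatMap_right _)).nodup_iff.2 hn'), h3, rowsList_eq w]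
    simp only [intCast_rowDeg]
    congr 2
    ring
  · intro r
    by_cases hr : r = 0
    · subst hr; rw [lastFaceTable_zero]; simp
    · rw [lastFaceTable_of_ne hr]; simp
  · intro r
    rw [hsucc]
    by_cases hr : r = 0
    · subst hr
      rw [lastFaceTable_zero]
      exact (id_map_rowEl (hG2 0) _).symm
    · rw [lastFaceTable_of_ne hr]
      exact (id_map_rowEl (hG2 r) _).symm

include hα in
/-- The Hochschild differential of a chain given by a matrix of words. -/
theorem hochB_wordEl (h0 : w 0 0 ≠ 1) (hn : (rowsList w).Nodup) (lt : P → P → Prop)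
    [DecidableRel lt] [StrictTotal lt] :
    hochB (cyc A n) m (wordEl lt (fun p => (c p : ZMod 2)) α w) =
      (∑ i : Fin (m + 1), (-1 : ℤ) ^ (i : ℕ) •
        wordEl lt (fun p => (c p : ZMod 2)) α (mergeRow w i)) +
      (-1 : ℤ) ^ (m + 1) • wordEl lt (fun p => (c p : ZMod 2)) α (mergeLast rowT w) := by
  have hz : ∀ (l : ℕ) (x : Chain (cyc A n) m), (-1 : ℤ) ^ l • x = (-1 : k) ^ l • x := by
    intro l x
    rw [← Int.cast_smul_eq_zsmul k]
    push_cast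
    rfl
  simp only [← chainTable_faceTable w hα h0 hn lt, ← chainTable_lastFaceTable w hα h0 hn lt, hz]
  rw [wordEl, matEl_eq, map_smul]
  simp only [smul_comm _ (koszul lt (fun p => (c p : ZMod 2)) (rowsList w) : k)]
  rw [← Finset.smul_sum, ← smul_add]
  congr 1
  rw [hochB, chainEl, DirectSum.toModule_lof, LinearMap.add_apply, LinearMap.sum_apply]
  simp only [LinearMap.smul_apply, PiTensorProduct.lift.tprod]
  rfl

end HochB

end

section

open Shuffle

/-! ### The homotopy on matrices of words -/

section RowPhi

variable {P Q : Type} {m n : ℕ}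

theorem lift_ofList (w : Q → FreeMonoid P) (l : List Q) :
    (FreeMonoid.lift w (FreeMonoid.ofList l)) = (l.map w).prod := by
  rw [FreeMonoid.lift_apply]; rfl

theorem lift_ofList_ne_one {w : Q → FreeMonoid P} (hw : ∀ q, w q ≠ 1) {l : List Q} (h : l ≠ []) :
    FreeMonoid.lift w (FreeMonoid.ofList l) ≠ 1 := by
  cases l with
  | nil => exact absurd rfl h
  | cons q l =>
    rw [lift_ofList, List.map_cons, List.prod_cons]
    exact fun h' => hw q (List.append_eq_nil_iff.1 h').1

theorem toList_lift_ofList (w : Q → FreeMonoid P) (l : List Q) :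
    (FreeMonoid.lift w (FreeMonoid.ofList l)).toList = l.flatMap fun q => (w q).toList := by
  rw [FreeMonoid.lift_apply, FreeMonoid.toList_prod, List.map_map, List.flatMap_def]
  rfl

theorem table_perm {K : Type} (tb : Table Q K) {L : List K} (hL : L.Nodup) (hL' : ∀ q, q ∈ L)
    {J : List Q} (hJ : J.Nodup) (hJ' : ∀ q, q ∈ J) : (L.flatMap tb.word).Perm J := by
  refine (List.perm_ext_iff_of_nodup (table_nodup tb hL) hJ).2 fun q => ?_
  refine ⟨fun _ => hJ' q, fun _ => ?_⟩
  obtain ⟨q', hq', -⟩ := tb.unique q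
  exact List.mem_flatMap.2 ⟨q', hL' _, hq'⟩

theorem rowsList_table_perm (tb : Table Q (Fin m × Fin n)) (w : Q → FreeMonoid P)
    {J : List Q} (hJ : J.Nodup) (hJ' : ∀ q, q ∈ J) :
    (rowsList fun i j => FreeMonoid.lift w (FreeMonoid.ofList (tb.word (i, j)))).Perm
      (J.flatMap fun q => (w q).toList) := by
  simp only [rowsList, toList_lift_ofList]
  rw [← List.flatMap_assoc (f := tb.word)]
  exact (table_perm tb (nodup_byRows _ _) mem_byRows hJ hJ').flatMap_right _

/-- The shuffled sets start at the row `2` or later, so the first row stays in place. Therefore the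
corner entry remains nonempty. -/
theorem shuffles_symm_zero {N a b a' b' a'' b'' l l' : ℕ} {τ υ : Equiv.Perm (Fin (N + 1))}
    (ha : 2 ≤ a) (ha' : 2 ≤ a') (hl : 2 ≤ l) (hl' : 2 ≤ l')
    (hτ : τ ∈ shuffles (rowSet (N + 1) a b) (rowSet (N + 1) a' b'))
    (hυ : υ ∈ shuffles (rowSet (N + 1) l a'') (rowSet (N + 1) l' b'')) :
    (τ * υ).symm 0 = 0 := by
  have h : ∀ {a a' : ℕ} {b b'} {σ : Equiv.Perm (Fin (N + 1))}, 2 ≤ a → 2 ≤ a' →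
      σ ∈ shuffles (rowSet (N + 1) a b) (rowSet (N + 1) a' b') → σ 0 = 0 := by
    intro a a' b b' σ ha ha' hσ
    refine (Finset.mem_filter.1 hσ).2.2 0 ?_
    simp only [rowSet, Finset.mem_union, Finset.mem_filter, Finset.mem_univ, true_and]
    rintro (h | h) <;> (have := h.1; simp at this; omega)
  rw [Equiv.symm_apply_eq, Equiv.Perm.mul_apply, h hl hl' hυ, h ha ha' hτ]

variable {X X' : Type*} [AddCommGroup X] [AddCommGroup X'] [NeZero n]

/-- A function of a nonempty list. -/
def ofCons {R : Type*} (F : R → List R → X) : List R → X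
  | [] => 0
  | a :: L => F a L

theorem ofCons_ofFn {R : Type*} (F : R → List R → X) (u : Fin (m + 1) → R) :
    ofCons F (List.ofFn u) = F (u 0) (List.ofFn fun i => u i.succ) := by
  rw [List.ofFn_succ]
  rfl

theorem bRow_eq_lift (w : Fin (m + 1) → Fin n → FreeMonoid P) (p q d r : ℕ)
    (c : Fin r → Fin (n - q)) (i : Fin (m + 2)) (j : Fin n) :
    bRow w p q d r c i j = FreeMonoid.lift (fun x : Fin (m + 1) × Fin n => w x.1 x.2)
      (FreeMonoid.ofList (bWord m n p q d r c ((i : ℕ) + 1) ((j : ℕ) + 1))) := by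
  rw [lift_ofList]
  rfl

theorem bWord_one_ne_nil (p q d r : ℕ) (c : Fin r → Fin (n - q)) :
    bWord m n p q d r c 1 1 ≠ [] := by
  simp [bWord]

/-- `rowPhi F` is an integral combination of values of `F` on matrices which rearrange the letters
of `w` and have a nonempty corner. An additive map may be moved inside once its effect on such
matrices is known. -/
theorem map_rowPhi (w : Fin (m + 1) → Fin n → FreeMonoid P) (hw : ∀ i j, w i j ≠ 1)
    (ψ : X →+ X') (F : (Fin n → FreeMonoid P) → List (Fin n → FreeMonoid P) → X)
    (F' : (Fin n → FreeMonoid P) → List (Fin n → FreeMonoid P) → X')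
    (h : ∀ u : Fin (m + 2) → Fin n → FreeMonoid P, u 0 0 ≠ 1 → (rowsList u).Perm (rowsList w) →
      ψ (F (u 0) (List.ofFn fun i : Fin (m + 1) => u i.succ)) =
        F' (u 0) (List.ofFn fun i : Fin (m + 1) => u i.succ)) :
    ψ (rowPhi F (w 0) (List.ofFn fun i : Fin m => w i.succ)) =
      rowPhi F' (w 0) (List.ofFn fun i : Fin m => w i.succ) := by
  rw [← sum_bRow_eq_rowPhi w F (ofCons F) fun _ _ => rfl,
    ← sum_bRow_eq_rowPhi w F' (ofCons F') fun _ _ => rfl, map_sum]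
  refine Finset.sum_congr rfl fun p hp => ?_
  rw [map_sum]
  refine Finset.sum_congr rfl fun q hq => ?_
  rw [map_sum]
  refine Finset.sum_congr rfl fun d hd => ?_
  rw [map_sum]
  refine Finset.sum_congr rfl fun r hr => ?_
  rw [map_sum]
  refine Finset.sum_congr rfl fun c _ => ?_
  rw [map_sum]
  refine Finset.sum_congr rfl fun τ hτ => ?_
  rw [map_sum]
  refine Finset.sum_congr rfl fun υ hυ => ?_
  rw [map_zsmul]
  congr 1
  rw [ofCons_ofFn, ofCons_ofFn]
  rw [Finset.mem_Icc] at hp hq hd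
  rw [Finset.mem_range] at hr
  refine h (fun i => bRow w p q d r c ((τ * υ).symm i)) ?_ ?_
  · rw [shuffles_symm_zero le_rfl (by omega) (by omega) (by omega) hτ hυ, bRow_eq_lift]
    exact lift_ofList_ne_one (fun q => hw q.1 q.2) (bWord_one_ne_nil _ _ _ _ _)
  · rw [show (fun i => bRow w p q d r c ((τ * υ).symm i)) = fun i j => _ from
      funext fun i => funext fun j => bRow_eq_lift w p q d r c ((τ * υ).symm i) j]
    exact rowsList_table_perm (bTable m n p q d r hp.1 hp.2 hq.1 hq.2 hd.1 hd.2 hr c (τ * υ))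
      (fun x : Fin (m + 1) × Fin n => w x.1 x.2) (nodup_byRows _ _) mem_byRows

end RowPhi

variable {k : Type w} [Field k] {A : DGCategory.{u, v} k} {n : ℕ} [NeZero n]
variable {P : Type} [Inhabited P] {T S : P → A.Obj} {c : P → ℤ} {α : ∀ p, A.Mor (T p) (S p)}
variable {m : ℕ}

section Ev

variable (lt : P → P → Prop) [DecidableRel lt] (e : P → ZMod 2) (α : ∀ p, A.Mor (T p) (S p))

variable (A n m) in
/-- The inclusion of the chains of degree `m`. -/
def inc : Chain (cyc A n) m →ₗ[k] Hoch (cyc A n) :=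
  DirectSum.lof k ℕ (fun m => Chain (cyc A n) m) m

/-- The chain given by a list of rows of words. -/
def rowsEl (ρ : Fin n → FreeMonoid P) (L : List (Fin n → FreeMonoid P)) : Hoch (cyc A n) :=
  inc A n L.length (wordEl lt e α fun i : Fin (L.length + 1) => (ρ :: L).get i)

-- The length of the list of rows equals `m` only propositionally, so the degree has to be
-- transported.
omit [NeZero n] in
theorem inc_wordEl_congr {m' : ℕ} (h : m' = m) (w' : Fin (m' + 1) → Fin n → FreeMonoid P)
    (w : Fin (m + 1) → Fin n → FreeMonoid P) (hw : List.ofFn w' = List.ofFn w) :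
    inc A n m' (wordEl lt e α w') = inc A n m (wordEl lt e α w) := by
  subst h
  rw [List.ofFn_injective hw]

omit [NeZero n] in
theorem rowsEl_ofFn (w : Fin (m + 1) → Fin n → FreeMonoid P) :
    rowsEl lt e α (w 0) (List.ofFn fun i : Fin m => w i.succ) = inc A n m (wordEl lt e α w) := by
  refine inc_wordEl_congr lt e α (List.length_ofFn) _ _ ?_
  refine (List.ofFn_get (w 0 :: List.ofFn fun i : Fin m => w i.succ)).trans ?_
  rw [List.ofFn_succ]

end Ev

/-- The Hochschild differential on all chains. -/
def totB (A : DGCategory.{u, v} k) (n : ℕ) [NeZero n] : Hoch (cyc A n) →ₗ[k] Hoch (cyc A n) :=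
  DirectSum.toModule k ℕ (Hoch (cyc A n)) fun m =>
    match m with
      | 0 => 0
      | m + 1 => DirectSum.lof k ℕ (fun m => Chain (cyc A n) m) m ∘ₗ hochB (cyc A n) m

theorem totB_inc_zero (x : Chain (cyc A n) 0) : totB A n (inc A n 0 x) = 0 := by
  rw [totB, inc, DirectSum.toModule_lof, LinearMap.zero_apply]

theorem totB_inc_succ (x : Chain (cyc A n) (m + 1)) :
    totB A n (inc A n (m + 1) x) = inc A n m (hochB (cyc A n) m x) := by
  rw [totB, inc, DirectSum.toModule_lof]
  rfl

/-- With the Koszul signs built into `wordEl`, the Hochschild differential is the formal boundary of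
the list of rows. -/
theorem totB_rowsEl (hα : ∀ p, α p ∈ A.deg (T p) (S p) (c p)) (lt : P → P → Prop)
    [DecidableRel lt] [StrictTotal lt] (w : Fin (m + 1) → Fin n → FreeMonoid P) (h0 : w 0 0 ≠ 1)
    (hn : (rowsList w).Nodup) :
    totB A n (rowsEl lt (fun p => (c p : ZMod 2)) α (w 0) (List.ofFn fun i : Fin m => w i.succ)) =
      bd rowT (rowsEl lt (fun p => (c p : ZMod 2)) α) (w 0)
        (List.ofFn fun i : Fin m => w i.succ) := by
  rw [rowsEl_ofFn]
  cases m with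
  | zero => rw [totB_inc_zero, List.ofFn_zero, bd_nil]
  | succ m =>
    rw [totB_inc_succ, hochB_wordEl w hα h0 hn,
      bd_ofFn rowT w (rowsEl lt (fun p => (c p : ZMod 2)) α) (ofCons (rowsEl lt (fun p => (c p : ZMod 2)) α)) fun _ _ => rfl, map_add,
      map_sum, map_zsmul]
    simp only [map_zsmul, ofCons_ofFn]
    congr 1
    · refine Finset.sum_congr rfl fun i _ => ?_
      rw [rowsEl_ofFn lt _ α (mergeRow w i)]
    · rw [rowsEl_ofFn lt _ α (mergeLast rowT w)]

omit [NeZero n] [Inhabited P] in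
/-- The linear map given by multilinear maps on matrices, on a chain given by words. -/
theorem ofMatrix_matEl {N : Type*} [AddCommGroup N] [Module k N]
    (φ : ∀ x : Fin (m + 1) → Fin n → A.Obj, MultilinearMap k (fun q : Fin (m + 1) × Fin n =>
      A.Mor ((cyc A n).tw x q.1 q.2) (x (q.1 + 1) q.2)) N)
    (w : Fin (m + 1) → Fin n → FreeMonoid P) (y : Fin (m + 1) → Fin n → A.Obj) :
    ofMatrix φ (matEl α w y) = φ y fun q =>
      A.evalWord α (w q.1 q.2).toList ((cyc A n).tw y q.1 q.2) (y (q.1 + 1) q.2) := by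
  rw [ofMatrix, matEl, DirectSum.toModule_lof, LinearMap.comp_apply, LinearEquiv.coe_coe]
  have h := nestEquiv_tprod (k := k) (V := fun i j => A.Mor ((cyc A n).tw y i j) (y (i + 1) j))
    fun q : Fin (m + 1) × Fin n =>
      A.evalWord α (w q.1 q.2).toList ((cyc A n).tw y q.1 q.2) (y (q.1 + 1) q.2)
  dsimp only at h
  -- The factors have their types in the tensor power, which match the nested tensor product only
  -- after unfolding.
  erw [← h]
  rw [LinearEquiv.symm_apply_apply, PiTensorProduct.lift.tprod]

/-- Matrices of nonempty composable words in distinct letters. -/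
structure Good (T S : P → A.Obj) (w : Fin (m + 1) → Fin n → FreeMonoid P) : Prop where
  ne : ∀ i j, w i j ≠ 1
  nodup : (rowsList w).Nodup
  tw : ∀ i j, (cyc A n).tw (wordObj S w) i j = T ((w i j).toList.headD default)

/-- On a matrix of words, the homotopy substitutes these words into its tables, and
`matrixTable_words` takes care of the Koszul signs. The sum of the tables is the formal homotopy by
`sum_bRow_eq_rowPhi`. -/
theorem mapPhi'_wordEl (hα : ∀ p, α p ∈ A.deg (T p) (S p) (c p)) (lt : P → P → Prop)
    [DecidableRel lt] [StrictTotal lt] (w : Fin (m + 1) → Fin n → FreeMonoid P)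
    (hw : Good T S w) :
    inc A n (m + 1) (mapPhi' A n m (wordEl lt (fun p => (c p : ZMod 2)) α w)) =
      rowPhi (rowsEl lt (fun p => (c p : ZMod 2)) α) (w 0)
        (List.ofFn fun i : Fin m => w i.succ) := by
  have hz : ∀ (z : ℤ) (x : Hoch (cyc A n)), z • x = (z : k) • x := fun z x =>
    (Int.cast_smul_eq_zsmul k z x).symm
  rw [wordEl, map_smul, map_smul, mapPhi', ofMatrix_matEl,
    ← sum_bRow_eq_rowPhi w (rowsEl lt (fun p => (c p : ZMod 2)) α) (ofCons (rowsEl lt (fun p => (c p : ZMod 2)) α)) fun _ _ => rfl]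
  rw [sum_apply, map_sum, Finset.smul_sum, ← Finset.sum_attach (Finset.Icc 1 (m + 1))]
  refine Finset.sum_congr rfl fun p _ => ?_
  rw [sum_apply, map_sum, Finset.smul_sum, ← Finset.sum_attach (Finset.Icc 2 n)]
  refine Finset.sum_congr rfl fun q _ => ?_
  rw [sum_apply, map_sum, Finset.smul_sum, ← Finset.sum_attach (Finset.Icc 1 p.1)]
  refine Finset.sum_congr rfl fun d _ => ?_
  rw [sum_apply, map_sum, Finset.smul_sum, ← Finset.sum_attach (Finset.range d.1)]
  refine Finset.sum_congr rfl fun r _ => ?_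
  rw [sum_apply, map_sum, Finset.smul_sum]
  refine Finset.sum_congr rfl fun c' _ => ?_
  rw [sum_apply, map_sum, Finset.smul_sum]
  refine Finset.sum_congr rfl fun τ hτ => ?_
  rw [sum_apply, map_sum, Finset.smul_sum]
  refine Finset.sum_congr rfl fun υ hυ => ?_
  rw [_root_.smul_apply, map_smul, smul_comm, hz]
  congr 1
  have hp := Finset.mem_Icc.1 p.2
  have hq := Finset.mem_Icc.1 q.2
  have hd := Finset.mem_Icc.1 d.2
  have hr := Finset.mem_range.1 r.2
  rw [ofCons_ofFn, rowsEl_ofFn lt _ α fun i => bRow w p q d r c' ((τ * υ).symm i), ← map_smul]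
  congr 1
  refine (matrixTable_words (bTable m n p.1 q.1 d.1 r.1 hp.1 hp.2 hq.1 hq.2 hd.1 hd.2 hr c'
    (τ * υ)) hα (fun x : Fin (m + 1) × Fin n => w x.1 x.2) (fun q => hw.ne q.1 q.2)
    (fun q => hw.tw q.1 q.2) (fun q => wordObj_add_one_of_ne S w _ _ (hw.ne q.1 q.2))
    (byRows (m + 1) n) (nodup_byRows _ _) mem_byRows (sorted_byRows _ _) hw.nodup ?_).trans ?_
  · dsimp only [bTable]
    rw [shuffles_symm_zero le_rfl (by omega) (by omega) (by omega) hτ hυ]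
    exact bWord_one_ne_nil _ _ _ _ _
  · rw [show (fun i => bRow w p q d r c' ((τ * υ).symm i)) = fun i j => _ from
      funext fun i => funext fun j => bRow_eq_lift w p q d r c' ((τ * υ).symm i) j]
    rfl

end

/-! ### Faces and rotations of composable matrices of words -/

section

open Shuffle

variable {k : Type w} [Field k] {A : DGCategory.{u, v} k} {n : ℕ} [NeZero n]
variable {P : Type} [Inhabited P] {T S : P → A.Obj} {c : P → ℤ} {α : ∀ p, A.Mor (T p) (S p)}
variable {m : ℕ}

section Good

omit [NeZero n] [Inhabited P] in
theorem rowsList_mergeRow_perm (w : Fin (m + 2) → Fin n → FreeMonoid P) (i : Fin (m + 1)) :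
    (rowsList (mergeRow w i)).Perm (rowsList w) := by
  rw [rowsList_eq, rowsList_eq, ← flatMap_faceTable i, List.flatMap_assoc]
  refine List.Perm.flatMap_left _ fun r _ => ?_
  rcases lt_trichotomy (r : ℕ) i with h | h | h
  · rw [faceTable_of_lt h, mergeRow, if_pos h, List.flatMap_singleton]
  · obtain rfl : r = i := Fin.ext h
    rw [faceTable_self, mergeRow, if_neg (lt_irrefl _), if_pos rfl]
    simp only [rowList, Pi.mul_apply, FreeMonoid.toList_mul, List.flatMap_cons, List.flatMap_nil,
      List.append_nil]
    exact (List.flatMap_append_perm _ _ _).symm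
  · rw [faceTable_of_gt h, mergeRow, if_neg (not_lt.2 h.le), if_neg h.ne', List.flatMap_singleton]

omit [Inhabited P] in
theorem rowList_rowT_perm (u : Fin n → FreeMonoid P) : (rowList (rowT u)).Perm (rowList u) := by
  simp only [rowList, rowT_apply]
  rw [← List.flatMap_map (f := fun j => (finRotate n).symm j) (g := fun j => (u j).toList)]
  refine List.Perm.flatMap_right _ ?_
  refine (List.perm_ext_iff_of_nodup ((List.nodup_finRange _).map (finRotate n).symm.injective)
    (List.nodup_finRange _)).2 fun q => ⟨fun _ => List.mem_finRange _, fun _ => ?_⟩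
  exact List.mem_map.2 ⟨finRotate n q, List.mem_finRange _, Equiv.symm_apply_apply _ _⟩

omit [Inhabited P] in
theorem rowsList_mergeLast_perm (w : Fin (m + 2) → Fin n → FreeMonoid P) :
    (rowsList (mergeLast rowT w)).Perm (rowsList w) := by
  rw [rowsList_eq, rowsList_eq]
  refine List.Perm.trans ?_ ((table_perm (lastFaceTable m) (List.nodup_finRange _)
    List.mem_finRange (List.nodup_finRange _) List.mem_finRange).flatMap_right _)
  rw [List.flatMap_assoc]
  refine List.Perm.flatMap_left _ fun r _ => ?_
  by_cases hr : r = 0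
  · subst hr
    rw [lastFaceTable_zero, mergeLast_zero]
    refine List.Perm.trans ?_ ((rowList_rowT_perm (w (Fin.last _))).append_right (rowList (w 0)) |>.trans
      (by simp))
    simp only [rowList, Pi.mul_apply, FreeMonoid.toList_mul]
    exact (List.flatMap_append_perm _ _ _).symm
  · rw [lastFaceTable_of_ne hr, mergeLast_of_ne _ _ hr, List.flatMap_singleton]

omit [Inhabited P] in
theorem rowsList_rowT_perm (w : Fin (m + 1) → Fin n → FreeMonoid P) :
    (rowsList fun i => rowT (w i)).Perm (rowsList w) := by
  rw [rowsList_eq, rowsList_eq]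
  exact List.Perm.flatMap_left _ fun r _ => rowList_rowT_perm _

theorem wordObj_rowT (w : Fin (m + 1) → Fin n → FreeMonoid P) (hw : ∀ i j, w i j ≠ 1)
    (i : Fin (m + 1)) : wordObj S (fun i => rowT (w i)) i = (cyc A n).obj (wordObj S w i) := by
  funext j
  obtain ⟨i, rfl⟩ : ∃ i', i' + 1 = i := ⟨i - 1, sub_add_cancel _ _⟩
  rw [wordObj_add_one_of_ne]
  · change _ = wordObj S w (i + 1) ((finRotate n).symm j)
    rw [wordObj_add_one_of_ne S w _ _ (hw _ _), rowT_apply]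
  · rw [rowT_apply]; exact hw _ _

omit [Inhabited P] in
theorem headD_mul (u u' : FreeMonoid P) (h : u ≠ 1) (p : P) :
    (u * u').toList.headD p = u.toList.headD p := by
  rw [FreeMonoid.toList_mul]
  have h : u.toList ≠ [] := h
  cases hu : u.toList with
  | nil => exact absurd hu h
  | cons a l => rfl

theorem Good.rowT {w : Fin (m + 1) → Fin n → FreeMonoid P} (hw : Good T S w) :
    Good (m := m) T S (fun i => Shuffle.rowT (w i)) where
  ne i j := by rw [rowT_apply]; exact hw.ne _ _
  nodup := (rowsList_rowT_perm w).nodup_iff.2 hw.nodup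
  tw i j := by
    rw [rowT_apply, ← hw.tw]
    by_cases hi : i = 0
    · subst hi
      rw [DGFunctor.tw, if_pos rfl, DGFunctor.tw, if_pos rfl, wordObj_rowT w hw.ne]
    · rw [DGFunctor.tw, if_neg hi, DGFunctor.tw, if_neg hi, wordObj_rowT w hw.ne]

-- This is needed because the homotopy is also applied to the faces. The first letter of a product
-- is the first letter of its left factor, so the targets remain correct.
omit [NeZero n] in
theorem Good.mergeRow {w : Fin (m + 2) → Fin n → FreeMonoid P} (hw : Good T S w)
    (i : Fin (m + 1)) : Good T S (mergeRow w i) where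
  ne r j := by
    rw [DG.mergeRow]
    split_ifs
    · exact hw.ne _ _
    · exact one_of_mul (hw.ne _ _)
    · exact hw.ne _ _
  nodup := (rowsList_mergeRow_perm w i).nodup_iff.2 hw.nodup
  tw r j := by
    have h2 : i.succ.succAbove r = 0 ↔ r = 0 := Fin.succAbove_eq_zero_iff (Fin.succ_ne_zero i)
    have h3 : (cyc A n).tw (wordObj S (DG.mergeRow w i)) r =
        (cyc A n).tw (wordObj S w) (i.succ.succAbove r) := by
      simp only [DGFunctor.tw, h2, wordObj_mergeRow]
    rw [h3, hw.tw]
    rcases lt_trichotomy (r : ℕ) i with h | h | h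
    · rw [show i.succ.succAbove r = r.castSucc from if_pos (Nat.lt_succ_of_lt h), DG.mergeRow,
        if_pos h]
    · obtain rfl : r = i := Fin.ext h
      rw [show r.succ.succAbove r = r.castSucc from if_pos (Nat.lt_succ_self _), DG.mergeRow,
        if_neg (lt_irrefl _), if_pos rfl, Pi.mul_apply, headD_mul _ _ (hw.ne _ _)]
    · rw [show i.succ.succAbove r = r.succ from if_neg (not_lt.2 (Nat.succ_le_of_lt h)),
        DG.mergeRow, if_neg (not_lt.2 h.le), if_neg h.ne']

theorem Good.mergeLast {w : Fin (m + 2) → Fin n → FreeMonoid P} (hw : Good T S w) :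
    Good T S (mergeLast Shuffle.rowT w) where
  ne r j := by
    by_cases hr : r = 0
    · subst hr
      rw [mergeLast_zero]
      exact one_of_mul (hw.ne _ _)
    · rw [mergeLast_of_ne _ _ hr]
      exact hw.ne _ _
  nodup := (rowsList_mergeLast_perm w).nodup_iff.2 hw.nodup
  tw r j := by
    by_cases hr : r = 0
    · subst hr
      rw [mergeLast_zero, Pi.mul_apply, headD_mul _ _ (by rw [rowT_apply]; exact hw.ne _ _),
        rowT_apply, ← hw.tw, DGFunctor.tw, if_pos rfl, DGFunctor.tw, if_neg (Fin.last_pos).ne']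
      change wordObj S _ 0 ((finRotate n).symm j) = _
      rw [wordObj_mergeLast S w (hw.ne _ _), if_pos rfl]
    · rw [mergeLast_of_ne _ _ hr, ← hw.tw, DGFunctor.tw, if_neg hr, DGFunctor.tw,
        if_neg (by simpa using hr), wordObj_mergeLast S w (hw.ne _ _), if_neg hr]

end Good

/-! ### The matrix of letters -/

/-- The matrix of single letters. -/
def letters (m n : ℕ) (i : Fin (m + 1)) (j : Fin n) : FreeMonoid (Fin (m + 1) × Fin n) :=
  FreeMonoid.of (i, j)

omit [NeZero n] in
theorem rowsList_letters : rowsList (letters m n) = byRows (m + 1) n := by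
  simp [rowsList, letters]

theorem wordObj_letters (x : Fin (m + 1) → Fin n → A.Obj) :
    wordObj (fun q : Fin (m + 1) × Fin n => x (q.1 + 1) q.2) (letters m n) = x := by
  funext i j
  obtain ⟨i, rfl⟩ : ∃ i', i' + 1 = i := ⟨i - 1, sub_add_cancel _ _⟩
  rw [wordObj_add_one_of_ne _ _ _ _ (FreeMonoid.of_ne_one _)]
  rfl

theorem good_letters (x : Fin (m + 1) → Fin n → A.Obj) :
    Good (fun q : Fin (m + 1) × Fin n => (cyc A n).tw x q.1 q.2)
      (fun q : Fin (m + 1) × Fin n => x (q.1 + 1) q.2) (letters m n) where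
  ne i j := FreeMonoid.of_ne_one _
  nodup := by rw [rowsList_letters]; exact nodup_byRows _ _
  tw i j := by rw [wordObj_letters]; rfl

/-- Linear maps on chains in matrix form are determined by the values on matrices of homogeneous
letters. -/
theorem chain_ext {N : Type*} [AddCommGroup N] [Module k N] {φ ψ : Chain (cyc A n) m →ₗ[k] N}
    (h : ∀ (x : Fin (m + 1) → Fin n → A.Obj) (c : Fin (m + 1) × Fin n → ℤ)
      (α : ∀ q : Fin (m + 1) × Fin n, A.Mor ((cyc A n).tw x q.1 q.2) (x (q.1 + 1) q.2)),
      (∀ q, α q ∈ A.deg _ _ (c q)) →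
      φ (wordEl (S := fun q : Fin (m + 1) × Fin n => x (q.1 + 1) q.2) rowLt
        (fun q => (c q : ZMod 2)) α (letters m n)) =
      ψ (wordEl (S := fun q : Fin (m + 1) × Fin n => x (q.1 + 1) q.2) rowLt
        (fun q => (c q : ZMod 2)) α (letters m n))) : φ = ψ := by
  classical
  refine DirectSum.linearMap_ext k fun x => ?_
  -- Single letters, read row by row, have the Koszul sign one, so this word chain is the plain
  -- tensor of its entries.
  have key : ∀ χ : Chain (cyc A n) m →ₗ[k] N, ∀ (c : Fin (m + 1) × Fin n → ℤ)
      (α : ∀ q : Fin (m + 1) × Fin n, A.Mor ((cyc A n).tw x q.1 q.2) (x (q.1 + 1) q.2)),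
      χ (wordEl (S := fun q : Fin (m + 1) × Fin n => x (q.1 + 1) q.2) rowLt
        (fun q => (c q : ZMod 2)) α (letters m n)) =
      (χ ∘ₗ DirectSum.lof k (Fin (m + 1) → (A.tensorPower n).Obj)
        (fun x => ⨂[k] i, (A.tensorPower n).Mor ((cyc A n).tw x i) (x (i + 1))) x)
        (nestEquiv k (fun i j => A.Mor ((cyc A n).tw x i j) (x (i + 1) j))
          (PiTensorProduct.tprod k α)) := by
    intro χ c α
    rw [wordEl, rowsList_letters, koszul_eq_one _ _ (sorted_byRows _ _), Int.cast_one, one_smul,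
      wordObj_letters, matEl, nestEquiv_tprod, LinearMap.comp_apply]
    have h1 : ∀ (i : Fin (m + 1)) (j : Fin n), A.evalWord α (letters m n i j).toList
        ((cyc A n).tw x i j) (x (i + 1) j) = α (i, j) := fun i j =>
      DGCategory.evalWord_singleton α (i, j)
    simp only [h1]
  let E : (⨂[k] q : Fin (m + 1) × Fin n, A.Mor ((cyc A n).tw x q.1 q.2) (x (q.1 + 1) q.2)) →ₗ[k]
      ⨂[k] i, (A.tensorPower n).Mor ((cyc A n).tw x i) (x (i + 1)) :=
    (nestEquiv k (fun i j => A.Mor ((cyc A n).tw x i j) (x (i + 1) j))).toLinearMap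
  have h2 : (φ ∘ₗ DirectSum.lof k (Fin (m + 1) → (A.tensorPower n).Obj)
        (fun x => ⨂[k] i, (A.tensorPower n).Mor ((cyc A n).tw x i) (x (i + 1))) x) ∘ₗ E =
      (ψ ∘ₗ DirectSum.lof k (Fin (m + 1) → (A.tensorPower n).Obj)
        (fun x => ⨂[k] i, (A.tensorPower n).Mor ((cyc A n).tw x i) (x (i + 1))) x) ∘ₗ E :=
    DGCategory.tensor_ext fun c α hα =>
      (key φ c α).symm.trans ((h x c α hα).trans (key ψ c α))
  refine LinearMap.ext fun y => ?_
  obtain ⟨z, rfl⟩ : ∃ z, E z = y := (nestEquiv k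
    (fun i j => A.Mor ((cyc A n).tw x i j) (x (i + 1) j))).surjective y
  exact LinearMap.congr_fun h2 z

/-! ### The homotopy formula -/

/-- The homotopy without averaging. -/
def totPhi' (A : DGCategory.{u, v} k) (n : ℕ) [NeZero n] : Hoch (cyc A n) →ₗ[k] Hoch (cyc A n) :=
  DirectSum.toModule k ℕ _ fun m => DirectSum.lof k ℕ (fun m => Chain (cyc A n) m) (m + 1) ∘ₗ
    mapPhi' A n m

theorem totPhi'_inc (x : Chain (cyc A n) m) :
    totPhi' A n (inc A n m x) = inc A n (m + 1) (mapPhi' A n m x) := by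
  rw [totPhi', inc, DirectSum.toModule_lof]
  rfl

/-- Operators on functions compose in the reverse order: the differential after the homotopy is
`rowPhi` of the function obtained by `bd`. All matrices which occur in the homotopy have a nonempty
corner, as needed for `totB_rowsEl`. -/
theorem totB_totPhi' (hα : ∀ p, α p ∈ A.deg (T p) (S p) (c p)) (lt : P → P → Prop)
    [DecidableRel lt] [StrictTotal lt] {w : Fin (m + 1) → Fin n → FreeMonoid P}
    (hw : Good T S w) :
    totB A n (totPhi' A n (inc A n m (wordEl lt (fun p => (c p : ZMod 2)) α w))) =
      rowPhi (bd rowT (rowsEl lt (fun p => (c p : ZMod 2)) α)) (w 0)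
        (List.ofFn fun i : Fin m => w i.succ) := by
  rw [totPhi'_inc, mapPhi'_wordEl hα lt w hw]
  exact map_rowPhi w hw.ne (totB A n).toAddMonoidHom _ _ fun u hu h =>
    totB_rowsEl hα lt u hu (h.nodup_iff.2 hw.nodup)

/-- Here the homotopy is evaluated on the faces of `w`, which are good matrices again. -/
theorem totPhi'_totB (hα : ∀ p, α p ∈ A.deg (T p) (S p) (c p)) (lt : P → P → Prop)
    [DecidableRel lt] [StrictTotal lt] {w : Fin (m + 1) → Fin n → FreeMonoid P}
    (hw : Good T S w) :
    totPhi' A n (totB A n (inc A n m (wordEl lt (fun p => (c p : ZMod 2)) α w))) =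
      bd rowT (rowPhi (rowsEl lt (fun p => (c p : ZMod 2)) α)) (w 0)
        (List.ofFn fun i : Fin m => w i.succ) := by
  cases m with
  | zero => rw [totB_inc_zero, map_zero, List.ofFn_zero, bd_nil]
  | succ m =>
    rw [totB_inc_succ, totPhi'_inc, hochB_wordEl w hα (hw.ne _ _) hw.nodup,
      bd_ofFn rowT w (rowPhi (rowsEl lt (fun p => (c p : ZMod 2)) α))
        (ofCons (rowPhi (rowsEl lt (fun p => (c p : ZMod 2)) α))) fun _ _ => rfl, map_add,
      map_sum, map_add, map_sum]
    simp only [map_zsmul, ofCons_ofFn]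
    congr 1
    · refine Finset.sum_congr rfl fun i _ => ?_
      rw [mapPhi'_wordEl hα lt (mergeRow w i) (hw.mergeRow i)]
    · rw [mapPhi'_wordEl hα lt (mergeLast rowT w) hw.mergeLast]

theorem totPhi'_homotopy (hα : ∀ p, α p ∈ A.deg (T p) (S p) (c p)) (lt : P → P → Prop)
    [DecidableRel lt] [StrictTotal lt] {w : Fin (m + 1) → Fin n → FreeMonoid P}
    (hw : Good T S w) :
    totB A n (totPhi' A n (inc A n m (wordEl lt (fun p => (c p : ZMod 2)) α w))) +
      totPhi' A n (totB A n (inc A n m (wordEl lt (fun p => (c p : ZMod 2)) α w))) =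
      colSum rowX n (List.ofFn fun i : Fin m => w i.succ)
        (rowsEl lt (fun p => (c p : ZMod 2)) α
          (rowK 1 (w 0 * (List.ofFn fun i : Fin m => w i.succ).prod) * rowX 0 (w 0))) -
        inc A n m (wordEl lt (fun p => (c p : ZMod 2)) α w) := by
  rw [totB_totPhi' hα lt hw, totPhi'_totB hα lt hw, rowPhi_bd, rowsEl_ofFn]

end

section

open Shuffle

variable {k : Type w} [Field k] {A : DGCategory.{u, v} k} {n : ℕ} [NeZero n]
variable {P : Type} [Inhabited P] {T S : P → A.Obj} {c : P → ℤ} {α : ∀ p, A.Mor (T p) (S p)}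
variable {m : ℕ}

/-! ### The action of the cycle -/

omit [Inhabited P] in
theorem cyc_map_rowEl_tw (hα : ∀ p, α p ∈ A.deg (T p) (S p) (c p)) (u : Fin n → FreeMonoid P)
    (a b : Fin n → A.Obj) {a' b' : (A.tensorPower n).Obj} (ha : a' = (cyc A n).obj a)
    (hb : b' = (cyc A n).obj b) {I : Type} {T' S' : I → (A.tensorPower n).Obj}
    (β : ∀ i, (A.tensorPower n).Mor (T' i) (S' i)) (i : I) (hT : T' i = (cyc A n).obj a)
    (hS : S' i = (cyc A n).obj b) (hβ : HEq (β i) ((cyc A n).map (rowEl α u a b))) :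
    (A.tensorPower n).evalWord β [i] a' b' =
      (permSign (finRotate n) (rowPar c u) : k) • rowEl α (rowT u) a' b' := by
  subst ha hb
  rw [← cyc_map_rowEl hα]
  refine eq_of_heq (HEq.trans ?_ hβ)
  rw [← hT, ← hS, DGCategory.evalWord_singleton]

/-- Each row contributes the sign of rotating its factors, which is the change of its Koszul sign by
`KRel.rotate`. So on word chains the action only rotates the columns. -/
theorem act_wordEl (hα : ∀ p, α p ∈ A.deg (T p) (S p) (c p)) (lt : P → P → Prop)
    [DecidableRel lt] [StrictTotal lt] (w : Fin (m + 1) → Fin n → FreeMonoid P)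
    (hw : ∀ i j, w i j ≠ 1) (hn : (rowsList w).Nodup) :
    act (cyc A n) m (wordEl lt (fun p => (c p : ZMod 2)) α w) =
      wordEl lt (fun p => (c p : ZMod 2)) α fun i => rowT (w i) := by
  set y := wordObj S w with hy
  have hy' : wordObj S (fun i => rowT (w i)) = fun i => (cyc A n).obj (y i) :=
    funext fun i => wordObj_rowT w hw i
  have hγ : ∀ i, (cyc A n).map (rowEl α (w i) ((cyc A n).tw y i) (y (i + 1))) ∈
      (A.tensorPower n).deg ((cyc A n).obj ((cyc A n).tw y i)) ((cyc A n).obj (y (i + 1)))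
        (rowDeg c (w i)) :=
    fun i => (cyc A n).map_mem (rowEl_mem hα _ _ _)
  have h1 : act (cyc A n) m (matEl α w y) = chainTable (A := A.tensorPower n) (cyc A n) (idTable m)
      (· < ·) (fun i => (cyc A n).obj ((cyc A n).tw y i)) (fun i => (cyc A n).obj (y (i + 1)))
      (fun i => (cyc A n).map (rowEl α (w i) ((cyc A n).tw y i) (y (i + 1)))) := by
    rw [matEl_eq, act, chainEl, DirectSum.toModule_lof, PiTensorProduct.lift.tprod]
    rfl
  have hid : (List.finRange (m + 1)).flatMap (idTable m).word = List.finRange (m + 1) := by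
    simp [idTable]
  rw [wordEl, map_smul, h1, chainTable_apply (A := A.tensorPower n) (cyc A n) (idTable m) (· < ·) hγ
    (fun r => List.cons_ne_nil _ _) (y := wordObj S fun i => rowT (w i)), hid, koszul_eq_one _ _
      ((List.pairwise_lt_finRange _).imp fun h => h.asymm), Int.cast_one, one_smul, wordEl, matEl_eq]
  · have h2 : ∀ r, (A.tensorPower n).evalWord
        (fun i => (cyc A n).map (rowEl α (w i) ((cyc A n).tw y i) (y (i + 1))))
        ((idTable m).word r) ((cyc A n).tw (wordObj S fun i => rowT (w i)) r)
        (wordObj S (fun i => rowT (w i)) (r + 1)) =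
        (permSign (finRotate n) (rowPar c (w r)) : k) • rowEl α (rowT (w r))
          ((cyc A n).tw (wordObj S fun i => rowT (w i)) r)
          (wordObj S (fun i => rowT (w i)) (r + 1)) := by
      intro r
      refine cyc_map_rowEl_tw hα (w r) ((cyc A n).tw y r) (y (r + 1)) ?_ ?_ _ r rfl rfl HEq.rfl
      · rw [hy', DGFunctor.tw, DGFunctor.tw]
        split_ifs <;> rfl
      · rw [hy']
    simp only [h2]
    rw [chainEl_smul, smul_smul, ← Int.cast_prod, ← Int.cast_mul]
    have h3 : KRel lt (fun p => (c p : ZMod 2)) (∏ i, permSign (finRotate n) (rowPar c (w i)))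
        (rowsList fun i => rowT (w i)) (rowsList w) := by
      refine (KRel.flatMap (lt := lt) (e := fun p => (c p : ZMod 2)) (List.finRange (m + 1))
        (fun r => permSign (finRotate n) (rowPar c (w r))) (fun r => rowList (rowT (w r)))
        (fun r => rowList (w r)) fun r _ => (KRel.rotate (lt := lt) (e := fun p => (c p : ZMod 2))
          (fun j => (w r j).toList)).of_eq rfl ?_ rfl).of_eq ?_ ?_ ?_
      · simp only [rowList, rowT_apply]
      · rw [← List.ofFn_eq_map, List.prod_ofFn]
      · rw [rowsList_eq]
      · rw [rowsList_eq]
    rw [h3.koszul_eq ((h3.perm.nodup_iff).2 hn), mul_comm]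
  · intro r
    rw [hy']
    rfl

omit [Inhabited P] in
theorem rowT_mul' (u u' : Fin n → FreeMonoid P) : rowT (u * u') = rowT u * rowT u' := by
  funext j
  simp only [rowT_apply, Pi.mul_apply]

omit [Inhabited P] in
theorem mergeRow_rowT (w : Fin (m + 2) → Fin n → FreeMonoid P) (i : Fin (m + 1)) :
    mergeRow (fun i => rowT (w i)) i = fun r => rowT (mergeRow w i r) := by
  funext r
  simp only [mergeRow]
  split_ifs
  · rfl
  · rw [rowT_mul']
  · rfl

omit [Inhabited P] in
theorem mergeLast_rowT (w : Fin (m + 2) → Fin n → FreeMonoid P) :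
    mergeLast rowT (fun i => rowT (w i)) = fun r => rowT (mergeLast rowT w r) := by
  funext r
  simp only [mergeLast]
  split_ifs
  · rw [rowT_mul']
  · rfl

/-- Rotation is multiplicative on rows, hence it commutes with all ways of merging rows. -/
theorem hochB_act : hochB (cyc A n) m ∘ₗ act (cyc A n) (m + 1) =
    act (cyc A n) m ∘ₗ hochB (cyc A n) m := by
  refine chain_ext fun x c α hα => ?_
  have hg := good_letters (A := A) x
  rw [LinearMap.comp_apply, LinearMap.comp_apply, act_wordEl hα rowLt _ hg.ne hg.nodup,
    hochB_wordEl _ hα (hg.ne _ _) hg.nodup, hochB_wordEl _ hα (hg.rowT.ne _ _) hg.rowT.nodup,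
    map_add, map_sum, map_zsmul]
  simp only [map_zsmul]
  congr 1
  · refine Finset.sum_congr rfl fun i _ => ?_
    rw [act_wordEl hα rowLt _ (hg.mergeRow i).ne (hg.mergeRow i).nodup, mergeRow_rowT]
  · rw [act_wordEl hα rowLt _ hg.mergeLast.ne hg.mergeLast.nodup, mergeLast_rowT]

omit [Inhabited P] in
theorem iterate_rowT (s : ℕ) (u : Fin n → FreeMonoid P) (j : Fin n) :
    (rowT^[s] u) j = u (((finRotate n).symm ^ s) j) := by
  induction s generalizing u with
  | zero => rfl
  | succ s ih => rw [Function.iterate_succ_apply, ih, rowT_apply, pow_succ']; rfl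

theorem act_pow_wordEl (hα : ∀ p, α p ∈ A.deg (T p) (S p) (c p)) (lt : P → P → Prop)
    [DecidableRel lt] [StrictTotal lt] (s : ℕ) {w : Fin (m + 1) → Fin n → FreeMonoid P}
    (hw : Good T S w) :
    (act (cyc A n) m ^ s) (wordEl lt (fun p => (c p : ZMod 2)) α w) =
      wordEl lt (fun p => (c p : ZMod 2)) α fun i => rowT^[s] (w i) := by
  induction s generalizing w with
  | zero => rfl
  | succ s ih =>
    rw [pow_succ, Module.End.mul_apply, act_wordEl hα lt w hw.ne hw.nodup, ih hw.rowT]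
    rfl

theorem finRotate_symm_pow (n : ℕ) [NeZero n] : (finRotate n).symm ^ n = 1 := by
  obtain ⟨n, rfl⟩ := Nat.exists_eq_succ_of_ne_zero (NeZero.ne n)
  have h : (finRotate (n + 1)).symm = (finRotate (n + 1))⁻¹ := rfl
  rw [h, inv_pow, inv_eq_one]
  have h2 : ∀ s : ℕ, ∀ i, ((finRotate (n + 1) ^ s) i : ℕ) = (i + s) % (n + 1) := by
    intro s
    induction s with
    | zero => intro i; simp [Nat.mod_eq_of_lt i.2]
    | succ s ih =>
      intro i
      rw [pow_succ', Equiv.Perm.mul_apply, finRotate_apply, Fin.val_add, ih, Fin.coe_ofNat_eq_mod,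
        ← Nat.add_mod, add_assoc]
  ext i
  exact (h2 _ i).trans ((Nat.add_mod_right _ _).trans (Nat.mod_eq_of_lt i.2))

/-- On word chains the action rotates the columns without further signs, and `n` rotations are the
identity. -/
theorem act_pow : act (cyc A n) m ^ n = 1 := by
  refine chain_ext fun x c α hα => ?_
  rw [act_pow_wordEl hα rowLt n (good_letters (A := A) x), Module.End.one_apply]
  congr 1
  funext i j
  rw [iterate_rowT, finRotate_symm_pow]
  rfl

end

section

open Shuffle

variable {k : Type w} [Field k] {A : DGCategory.{u, v} k} {n : ℕ}
variable {P Q : Type} [Inhabited P] {T S : P → A.Obj} {c : P → ℤ} {α : ∀ p, A.Mor (T p) (S p)}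
variable {m : ℕ}

/-! ### Columns of words -/

/-- The objects of the chain given by a column of words. -/
def colObj (S : P → A.Obj) (v : Fin (m + 1) → FreeMonoid P) (i : Fin (m + 1)) : A.Obj :=
  lastObj S (v (i - 1))

/-- The letters of a column of words. -/
def colList (v : Fin (m + 1) → FreeMonoid P) : List P :=
  (List.finRange (m + 1)).flatMap fun i => (v i).toList

/-- The chain given by a column of words in homogeneous letters with the parities `e`. -/
def colEl (lt : P → P → Prop) [DecidableRel lt] (e : P → ZMod 2) (α : ∀ p, A.Mor (T p) (S p))
    (v : Fin (m + 1) → FreeMonoid P) : Chain (DGFunctor.id A) m :=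
  (koszul lt e (colList v) : k) • chainEl (DGFunctor.id A) (colObj S v) fun i =>
    A.evalWord α (v i).toList ((DGFunctor.id A).tw (colObj S v) i) (colObj S v (i + 1))

omit [Inhabited P] in
theorem intCast_wdeg (u : FreeMonoid P) : (((u.toList.map c).sum : ℤ) : ZMod 2) =
    wdeg (fun p => (c p : ZMod 2)) u.toList := intCast_sum_map _

/-- A table with one column, applied to a family of words. -/
theorem chainTable_words [Fintype Q] [DecidableEq Q] [Inhabited Q] (tb : Table Q (Fin (m + 1)))
    {ltQ : Q → Q → Prop} [DecidableRel ltQ] [StrictTotal ltQ] {lt : P → P → Prop}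
    [DecidableRel lt] [StrictTotal lt] {T' S' : Q → A.Obj}
    (hα : ∀ p, α p ∈ A.deg (T p) (S p) (c p)) (w : Q → FreeMonoid P) (hw : ∀ q, w q ≠ 1)
    (hT : ∀ q, T' q = T ((w q).toList.headD default)) (hS : ∀ q, S' q = lastObj S (w q))
    (L : List Q) (hL : L.Nodup) (hL' : ∀ q, q ∈ L) (hs : L.Pairwise fun a b => ¬ ltQ b a)
    (hn : (L.flatMap fun q => (w q).toList).Nodup) (htb : ∀ r, tb.word r ≠ []) :
    (koszul lt (fun p => (c p : ZMod 2)) (L.flatMap fun q => (w q).toList) : k) •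
      chainTable (DGFunctor.id A) tb ltQ T' S'
        (fun q => A.evalWord α (w q).toList (T' q) (S' q)) =
    colEl lt (fun p => (c p : ZMod 2)) α
      fun i => FreeMonoid.lift w (FreeMonoid.ofList (tb.word i)) := by
  have hβ : ∀ q, A.evalWord α (w q).toList (T' q) (S' q) ∈
      A.deg (T' q) (S' q) (((w q).toList.map c).sum) := fun q =>
    DGCategory.evalWord_mem hα _ _ _
  rw [chainTable_apply (DGFunctor.id A) tb ltQ hβ htb
    (colObj S fun i => FreeMonoid.lift w (FreeMonoid.ofList (tb.word i))), smul_smul, colEl]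
  · have hlist : colList (fun i => FreeMonoid.lift w (FreeMonoid.ofList (tb.word i))) =
        ((List.finRange (m + 1)).flatMap tb.word).flatMap fun q => (w q).toList := by
      simp only [colList, toList_lift_ofList, List.flatMap_assoc]
    rw [hlist, koszul_comp (lt := lt) (ltQ := ltQ) (fun q => (w q).toList)
      (table_perm tb (List.nodup_finRange _) List.mem_finRange hL hL') hL hs hn]
    simp only [intCast_wdeg]
    congr 1
    · push_cast
      rw [mul_comm]
    · congr 1
      funext i
      rw [toList_lift_ofList]
      exact DGCategory.evalWord_flatMap α (fun q => (w q).toList) hw hT hS _ _ _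
  · intro r
    rw [colObj, add_sub_cancel_right, lastObj_lift w hw hS (u := FreeMonoid.ofList (tb.word r)) (htb r)]
    rfl

/-! ### The map `f` -/

variable [NeZero n]

variable (A n m) in
/-- The summand of `f` of a column `s`. -/
def mapFs (s : Fin n) : Chain (cyc A n) m →ₗ[k] Chain (DGFunctor.id A) m :=
  ofMatrix fun x => chainTable (DGFunctor.id A) (fTable m n s) rowLt
    (fun y => (cyc A n).tw x y.1 y.2) (fun y => x (y.1 + 1) y.2)

theorem fTable_ne_nil (s : Fin n) (r : Fin (m + 1)) : (fTable m n s).word r ≠ [] := by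
  simp only [fTable]
  split_ifs <;> simp

theorem mapFs_wordEl (s : Fin n) (hα : ∀ p, α p ∈ A.deg (T p) (S p) (c p)) (lt : P → P → Prop)
    [DecidableRel lt] [StrictTotal lt] {w : Fin (m + 1) → Fin n → FreeMonoid P}
    (hw : Good T S w) : mapFs A n m s (wordEl lt (fun p => (c p : ZMod 2)) α w) =
      colEl lt (fun p => (c p : ZMod 2)) α fun i =>
        FreeMonoid.lift (fun x : Fin (m + 1) × Fin n => w x.1 x.2)
          (FreeMonoid.ofList ((fTable m n s).word i)) := by
  rw [wordEl, map_smul, mapFs, ofMatrix_matEl]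
  exact chainTable_words (fTable m n s) hα (fun x : Fin (m + 1) × Fin n => w x.1 x.2)
    (fun q => hw.ne q.1 q.2) (fun q => hw.tw q.1 q.2)
    (fun q => wordObj_add_one_of_ne S w _ _ (hw.ne q.1 q.2))
    (byRows (m + 1) n) (nodup_byRows _ _) mem_byRows (sorted_byRows _ _) hw.nodup
    (fTable_ne_nil s)

theorem mapF_eq : mapF A n m = (n : k)⁻¹ • ∑ s, mapFs A n m s := by
  refine chain_ext fun x c α hα => ?_
  rw [LinearMap.smul_apply, LinearMap.sum_apply, wordEl, map_smul, mapF, ofMatrix_matEl,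
    _root_.smul_apply, sum_apply, smul_comm, Finset.smul_sum]
  congr 1
  refine Finset.sum_congr rfl fun s _ => ?_
  rw [map_smul, mapFs, ofMatrix_matEl]

theorem finRotate_symm_eq (j : Fin n) : (finRotate n).symm j = j - 1 := by
  obtain ⟨n, rfl⟩ := Nat.exists_eq_succ_of_ne_zero (NeZero.ne n)
  rw [Equiv.symm_apply_eq, finRotate_apply]
  exact (sub_add_cancel _ _).symm

/-- The table of `f` refers to the columns only relative to `s`, so renaming them by the inverse
rotation lowers `s` by one. -/
theorem fTable_map (s : Fin n) (r : Fin (m + 1)) :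
    ((fTable m n s).word r).map (fun x => (x.1, (finRotate n).symm x.2)) =
      (fTable m n (s - 1)).word r := by
  simp only [fTable, finRotate_symm_eq]
  split_ifs with h
  · simp only [List.map_append, List.map_flatMap, List.map_map, List.map_cons, List.map_nil]
    congr 2
    funext u
    congr 1
    funext i
    simp only [Function.comp]
    congr 1
    abel
  · rfl

theorem mapFs_act (s : Fin n) : mapFs A n m s ∘ₗ act (cyc A n) m = mapFs A n m (s - 1) := by
  refine chain_ext fun x c α hα => ?_
  have hg := good_letters (A := A) x
  rw [LinearMap.comp_apply, act_wordEl hα rowLt _ hg.ne hg.nodup, mapFs_wordEl _ hα rowLt hg,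
    mapFs_wordEl _ hα rowLt hg.rowT]
  congr 1
  funext i
  rw [← fTable_map, lift_ofList, lift_ofList, List.map_map]
  congr 2
  funext x
  rw [rowT_apply]
  rfl

/-- Rotation permutes the summands of `f` cyclically, so their sum is invariant. -/
theorem mapF_act : mapF A n m ∘ₗ act (cyc A n) m = mapF A n m := by
  rw [mapF_eq, LinearMap.smul_comp, show (∑ s, mapFs A n m s) ∘ₗ act (cyc A n) m = ∑ s, mapFs A n m s ∘ₗ act (cyc A n) m from
      LinearMap.ext fun x => by simp]
  simp only [mapFs_act, ← finRotate_symm_eq]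
  rw [Equiv.sum_comp (finRotate n).symm (mapFs A n m)]

/-- All summands of `f` are rotations of the first one. Thus `f` is an average over the powers of
`t`, of the same shape as the homotopy. -/
theorem sum_mapFs_act : ∑ s ∈ Finset.range n, mapFs A n m 0 ∘ₗ act (cyc A n) m ^ s =
    ∑ s, mapFs A n m s := by
  have h : ∀ (s : ℕ) (hs : s < n), mapFs A n m 0 ∘ₗ act (cyc A n) m ^ s =
      mapFs A n m (-⟨s, hs⟩) := by
    intro s
    induction s with
    | zero =>
      intro hs
      rw [show (⟨0, hs⟩ : Fin n) = 0 from rfl, neg_zero]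
      rfl
    | succ s ih =>
      intro hs
      have h1 : (⟨s + 1, hs⟩ : Fin n) = ⟨s, by omega⟩ + 1 := by
        obtain ⟨n, rfl⟩ := Nat.exists_eq_succ_of_ne_zero (NeZero.ne n)
        apply Fin.ext
        rw [Fin.val_add, Fin.coe_ofNat_eq_mod, Nat.add_mod_mod, Nat.mod_eq_of_lt hs]
      rw [pow_succ, Module.End.mul_eq_comp, ← LinearMap.comp_assoc, ih (by omega), mapFs_act, h1,
        neg_add, sub_eq_add_neg]
  rw [Finset.sum_range]
  exact Fintype.sum_equiv (Equiv.neg (Fin n)) _ _ fun s => h s s.2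

/-! ### The map `g` -/

/-- The normalisation `c' 0 = 0` keeps the corner entry nonempty, as required for the substitution
of words. -/
theorem mapG_colEl (hα : ∀ p, α p ∈ A.deg (T p) (S p) (c p)) (lt : P → P → Prop)
    [DecidableRel lt] [StrictTotal lt] {v : Fin (m + 1) → FreeMonoid P} (hv : ∀ i, v i ≠ 1)
    (hT : ∀ i, colObj S v i = T ((v i).toList.headD default)) (hn : (colList v).Nodup) :
    mapG A n m (colEl lt (fun p => (c p : ZMod 2)) α v) =
      ∑ c' ∈ (Finset.univ : Finset (Fin (m + 1) → Fin n)).filter (fun c' => c' 0 = 0),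
        (Equiv.Perm.sign (sigmaC c') : ℤ) • wordEl lt (fun p => (c p : ZMod 2)) α
          fun i j => if j = c' i then v (sigmaC c' i) else 1 := by
  have htw : ∀ i, (DGFunctor.id A).tw (colObj S v) i = colObj S v i := by
    intro i
    rw [DGFunctor.tw]
    split_ifs <;> rfl
  rw [colEl, map_smul, mapG, chainEl, DirectSum.toModule_lof, PiTensorProduct.lift.tprod, sum_apply,
    Finset.smul_sum]
  refine Finset.sum_congr (Finset.filter_congr_decidable _ _ _) fun c' hc' => ?_
  have hc' := (Finset.mem_filter.1 hc').2
  rw [_root_.smul_apply, smul_comm, ← Int.cast_smul_eq_zsmul k]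
  congr 1
  refine (matrixTable_words (gTable c') hα v hv (fun i => (htw i).trans (hT i)) (fun i => ?_)
    (List.finRange (m + 1)) (List.nodup_finRange _) List.mem_finRange
    ((List.pairwise_lt_finRange _).imp fun h => h.asymm) hn ?_).trans ?_
  · rw [colObj, add_sub_cancel_right]
  · simp [gTable, hc']
  · congr 1
    funext i j
    rw [lift_ofList]
    simp only [gTable]
    split_ifs <;> simp

theorem filter_ne_zero_finRange (n : ℕ) : ((List.finRange (n + 1)).filter fun u => u ≠ 0) =
    (List.finRange n).map Fin.succ := by
  rw [List.finRange_succ, List.filter_cons, if_neg (by simp), List.filter_eq_self.2]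
  intro u hu
  obtain ⟨i, -, rfl⟩ := List.mem_map.1 hu
  simp

/-- The first entry of the first summand of `f`. -/
theorem prod_fTable_zero :
    FreeMonoid.lift (fun x : Fin (m + 1) × Fin n => letters m n x.1 x.2)
      (FreeMonoid.ofList ((fTable m n 0).word 0)) =
    ((List.range' 1 (n - 1)).map (entry (List.ofFn (letters m n)).prod)).prod *
      FreeMonoid.of (0, 0) := by
  obtain ⟨n, rfl⟩ := Nat.exists_eq_succ_of_ne_zero (NeZero.ne n)
  have h1 : ∀ j : Fin (n + 1), (List.ofFn (letters m (n + 1))).prod j =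
      FreeMonoid.ofList ((List.finRange (m + 1)).map fun i' => (i', j)) := by
    intro j
    rw [Pi.list_prod_apply, List.map_ofFn, List.ofFn_eq_map]
    apply FreeMonoid.toList.injective
    rw [FreeMonoid.toList_prod, FreeMonoid.toList_ofList, List.map_map, ← List.flatMap_def]
    induction List.finRange (m + 1) with
    | nil => rfl
    | cons i l ih => rw [List.flatMap_cons, ih]; rfl
  have h2 : FreeMonoid.lift (fun x : Fin (m + 1) × Fin (n + 1) => letters m (n + 1) x.1 x.2) =
      MonoidHom.id _ := by
    ext x
    rfl
  have h3 : (List.range' 1 (n.succ - 1)).map (entry (List.ofFn (letters m (n + 1))).prod) =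
      (List.finRange n).map fun u => (List.ofFn (letters m (n + 1))).prod u.succ := by
    rw [List.range'_eq_map_range, List.map_map, ← List.map_coe_finRange_eq_range, List.map_map]
    refine List.map_congr_left fun u _ => ?_
    rw [Function.comp_apply, Function.comp_apply, entry_eq _ (by omega)]
    exact congrArg (List.ofFn (letters m (n + 1))).prod (Fin.ext (Nat.add_comm 1 u))
  have h4 : (fTable m (n + 1) 0).word 0 = ((List.finRange n).flatMap fun u =>
      (List.finRange (m + 1)).map fun i' => (i', u.succ)) ++ [(0, 0)] := by
    simp only [fTable, if_true]
    have := filter_ne_zero_finRange n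
    rw [this, List.flatMap_map]
    simp only [zero_add]
  have h5 : ((List.finRange n).map fun u => (List.ofFn (letters m (n + 1))).prod u.succ).prod =
      FreeMonoid.ofList ((List.finRange n).flatMap fun u =>
        (List.finRange (m + 1)).map fun i' => (i', u.succ)) := by
    simp only [h1]
    apply FreeMonoid.toList.injective
    rw [FreeMonoid.toList_prod, List.map_map, List.flatMap_def]
    rfl
  rw [h3, h5]
  have h6 := congrArg (fun φ => φ (FreeMonoid.ofList ((fTable m (n + 1) 0).word 0))) h2
  refine h6.trans ?_
  rw [h4]
  rfl

end

section

open Shuffle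

variable {k : Type w} [Field k] {A : DGCategory.{u, v} k} {n : ℕ} [NeZero n] {m : ℕ}

/-! ### The composition of `f` and `g` -/

omit [NeZero n] in
theorem lift_letters (u : FreeMonoid (Fin (m + 1) × Fin n)) :
    FreeMonoid.lift (fun x : Fin (m + 1) × Fin n => letters m n x.1 x.2) u = u := by
  have h : FreeMonoid.lift (fun x : Fin (m + 1) × Fin n => letters m n x.1 x.2) =
      MonoidHom.id _ := by
    ext x
    rfl
  rw [h]
  rfl

theorem fTable_zero_of_ne {i : Fin (m + 1)} (h : i ≠ 0) : (fTable m n 0).word i = [(i, 0)] := by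
  simp only [fTable, if_neg h]

theorem fTable_zero_zero : ∃ l, (fTable m n 0).word 0 = l ++ [(0, 0)] := by
  simp only [fTable, if_true]
  exact ⟨_, rfl⟩

theorem lastObj_fTable {S : Fin (m + 1) × Fin n → A.Obj} (i : Fin (m + 1)) :
    lastObj S (FreeMonoid.ofList ((fTable m n 0).word i)) = S (i, 0) := by
  by_cases h : i = 0
  · subst h
    obtain ⟨l, hl⟩ := fTable_zero_zero (m := m) (n := n)
    rw [lastObj, FreeMonoid.toList_ofList, hl, List.getLastD_eq_getLast?, List.getLast?_concat]
    rfl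
  · rw [fTable_zero_of_ne h]
    rfl

/-- The first entry of the first summand of `f` begins in the second column, whose twisted target is
the object of the first column. So the resulting column runs through the objects of the first
column. -/
theorem tw_headD_fTable (x : Fin (m + 1) → Fin n → A.Obj) (i : Fin (m + 1)) :
    (cyc A n).tw x (((fTable m n 0).word i).headD default).1
      (((fTable m n 0).word i).headD default).2 = x i 0 := by
  by_cases h : i = 0
  · subst h
    obtain ⟨n, rfl⟩ := Nat.exists_eq_succ_of_ne_zero (NeZero.ne n)
    simp only [fTable, if_true]
    have := filter_ne_zero_finRange n
    rw [this]
    cases n with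
    -- With one column there is no second column: the entry begins with the corner itself, and the
    -- rotation is trivial.
    | zero =>
      change (cyc A 1).tw x 0 0 = _
      rw [DGFunctor.tw, if_pos rfl]
      change x 0 ((finRotate 1).symm 0) = x 0 0
      rw [Subsingleton.elim ((finRotate 1).symm 0) 0]
    | succ n =>
      have h1 : ∀ y : Fin (m + 1) × Fin (n + 2), y = (0, 1) → (cyc A (n + 2)).tw x y.1 y.2 = x 0 0 := by
        rintro _ rfl
        rw [DGFunctor.tw, if_pos rfl]
        change x 0 ((finRotate (n + 2)).symm 1) = x 0 0
        rw [finRotate_symm_eq, sub_self]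
      refine h1 _ ?_
      rw [List.finRange_succ, List.finRange_succ]
      simp only [List.map_cons, List.flatMap_cons, List.cons_append, List.headD_cons]
      rfl
  · rw [fTable_zero_of_ne h]
    change (cyc A n).tw x i 0 = _
    rw [DGFunctor.tw, if_neg h]

theorem mapG_mapFs (x : Fin (m + 1) → Fin n → A.Obj) {c : Fin (m + 1) × Fin n → ℤ}
    {α : ∀ q : Fin (m + 1) × Fin n, A.Mor ((cyc A n).tw x q.1 q.2) (x (q.1 + 1) q.2)}
    (hα : ∀ q, α q ∈ A.deg _ _ (c q)) :
    mapG A n m (mapFs A n m 0 (wordEl (T := fun q : Fin (m + 1) × Fin n => (cyc A n).tw x q.1 q.2)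
      (S := fun q : Fin (m + 1) × Fin n => x (q.1 + 1) q.2) rowLt
        (fun q => (c q : ZMod 2)) α (letters m n))) =
      ∑ c' ∈ (Finset.univ : Finset (Fin (m + 1) → Fin n)).filter (fun c' => c' 0 = 0),
        (Equiv.Perm.sign (sigmaC c') : ℤ) •
          wordEl (T := fun q : Fin (m + 1) × Fin n => (cyc A n).tw x q.1 q.2)
            (S := fun q : Fin (m + 1) × Fin n => x (q.1 + 1) q.2) rowLt
            (fun q => (c q : ZMod 2)) α
          fun i j => if j = c' i then FreeMonoid.ofList ((fTable m n 0).word (sigmaC c' i)) else 1 := by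
  have hg := good_letters (A := A) x
  rw [mapFs_wordEl 0 hα rowLt hg]
  simp only [lift_letters]
  refine mapG_colEl hα rowLt (fun i => fTable_ne_nil 0 i) (fun i => ?_) ?_
  · rw [colObj, lastObj_fTable, FreeMonoid.toList_ofList, tw_headD_fTable, sub_add_cancel]
  · exact table_nodup (fTable m n 0) (List.nodup_finRange _)

/-- The first letter is the smallest one and stands first, so sorting leaves it in place. -/
theorem sigmaC_cons_zero_left (c : Fin m → Fin n) :
    sigmaC (Fin.cons 0 c : Fin (m + 1) → Fin n) =
      Equiv.Perm.decomposeFin.symm (0, sigmaC c) := by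
  rw [sigmaC_cons 0 c 0, Fin.cycleRange_zero, inv_one, one_mul]
  rw [Fin.val_zero, eq_comm, Finset.card_eq_zero, Finset.filter_eq_empty_iff]
  intro i _
  rw [Fin.lt_def, Fin.val_zero]
  omega

/-- A choice with `c' 0 = 0` is a free choice for the remaining rows. The first row lies in the
first column and is the product of the other columns, `rowK 1`, times the corner. Hence `g` after
the first summand of `f` is the full subdivision. -/
theorem colSum_letters {X : Type*} [AddCommGroup X]
    (F : (Fin n → FreeMonoid (Fin (m + 1) × Fin n)) →
      List (Fin n → FreeMonoid (Fin (m + 1) × Fin n)) → X) :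
    ∑ c' ∈ (Finset.univ : Finset (Fin (m + 1) → Fin n)).filter (fun c' => c' 0 = 0),
      (Equiv.Perm.sign (sigmaC c') : ℤ) • ofCons F (List.ofFn fun i j =>
        if j = c' i then FreeMonoid.ofList ((fTable m n 0).word (sigmaC c' i)) else 1) =
    colSum rowX n (List.ofFn fun i : Fin m => letters m n i.succ)
      (F (rowK 1 (letters m n 0 * (List.ofFn fun i : Fin m => letters m n i.succ).prod) *
        rowX 0 (letters m n 0))) := by
  rw [← sum_sigmaC rowX _ (List.length_ofFn)]
  symm
  refine Finset.sum_nbij' (fun c : Fin m → Fin n => (Fin.cons 0 c : Fin (m + 1) → Fin n)) Fin.tail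
    (fun c _ => by simp) (fun c _ => by simp) (fun c _ => Fin.tail_cons _ _) (fun c hc => ?_) fun c _ => ?_
  · rw [← (Finset.mem_filter.1 hc).2, Fin.cons_self_tail]
  · have h0 : (Equiv.Perm.decomposeFin.symm (0, sigmaC c) : Equiv.Perm (Fin (m + 1))) 0 = 0 :=
      Equiv.Perm.decomposeFin_symm_apply_zero _ _
    have h1 : ∀ i : Fin m, (Equiv.Perm.decomposeFin.symm (0, sigmaC c) :
        Equiv.Perm (Fin (m + 1))) i.succ = (sigmaC c i).succ := fun i => by
      rw [Equiv.Perm.decomposeFin_symm_apply_succ, Equiv.swap_self]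
      rfl
    rw [sigmaC_cons_zero_left, Equiv.Perm.decomposeFin.symm_sign, if_pos rfl, one_mul, ofCons_ofFn]
    congr 2
    · funext j
      rw [Fin.cons_zero, h0]
      have h2 := prod_fTable_zero (m := m) (n := n)
      rw [lift_letters] at h2
      rw [h2, List.ofFn_succ, List.prod_cons, Pi.mul_apply, rowK, rowX, mkRow, mkRow]
      by_cases hj : j = 0
      · subst hj
        rw [if_pos (Fin.val_zero n), if_pos (Fin.val_zero n), if_pos rfl, entry_eq _ (NeZero.pos n)]
        rfl
      · have hj' : ¬ (j : ℕ) = 0 := fun h => hj (Fin.ext (by simpa using h))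
        rw [if_neg hj', if_neg hj', if_neg hj, one_mul]
    · congr 1
      funext i j
      rw [Fin.cons_succ, h1, fTable_zero_of_ne (Fin.succ_ne_zero _), rowX, mkRow]
      by_cases hj : j = c i
      · subst hj
        rw [if_pos rfl, if_pos rfl, entry_eq _ (NeZero.pos n), List.getD_eq_getElem _ _ (by simp),
          List.getElem_ofFn]
        rfl
      · rw [if_neg (fun h => hj (Fin.ext h)), if_neg hj]

/-- The homotopy formula for the Hochschild part of the differential, before averaging. It holds for
chains, not only for their classes in the coinvariants. -/
theorem homotopy' : totB A n ∘ₗ totPhi' A n ∘ₗ inc A n m + totPhi' A n ∘ₗ totB A n ∘ₗ inc A n m =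
    inc A n m ∘ₗ mapG A n m ∘ₗ mapFs A n m 0 - inc A n m := by
  refine chain_ext fun x c α hα => ?_
  have hg := good_letters (A := A) x
  simp only [LinearMap.add_apply, LinearMap.sub_apply, LinearMap.comp_apply]
  rw [totPhi'_homotopy hα rowLt hg, mapG_mapFs x hα, map_sum, ← colSum_letters]
  congr 1
  refine Finset.sum_congr rfl fun c' _ => ?_
  rw [map_zsmul, ofCons_ofFn, ← rowsEl_ofFn]

end

section

open Shuffle

variable {k : Type w} [Field k]

/-! ### The internal differential -/

theorem sum_map_prefix {X : Type*} [AddCommMonoid X] {N : ℕ} (f : Fin N → X)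
    {u v : List (Fin N)} {i : Fin N} (h : List.finRange N = u ++ i :: v) :
    (u.map f).sum = ∑ i', if i' < i then f i' else 0 := by
  have hp := List.pairwise_lt_finRange N
  rw [h, List.pairwise_append, List.pairwise_cons] at hp
  rw [← List.sum_ofFn, List.ofFn_eq_map, h, List.map_append, List.map_cons, List.sum_append,
    List.sum_cons, if_neg (lt_irrefl _), zero_add,
    List.sum_eq_zero (l := v.map fun i' => if i' < i then f i' else 0), add_zero]
  · congr 1
    refine List.map_congr_left fun j hj => ?_
    rw [if_pos (hp.2.2 j hj i (by simp))]
  · intro x hx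
    obtain ⟨j, hj, rfl⟩ := List.mem_map.1 hx
    rw [if_neg (hp.2.1.1 j hj).asymm]

/-- The Leibniz rule for a multilinear map, applied to products of letters. -/
theorem sum_multilinear_eq_splitSum {P : Type} {N : ℕ} {M : Fin N → Type*}
    [∀ i, AddCommGroup (M i)] [∀ i, Module k (M i)] {X : Type*} [AddCommGroup X] [Module k X]
    (f : MultilinearMap k M X) (e : P → ZMod 2) (W : Fin N → List P) (β D : ∀ i, M i)
    (β' : P → ∀ i, M i) (hn : ((List.finRange N).flatMap W).Nodup)
    (hβ : ∀ p i, p ∉ W i → β' p i = β i)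
    (hD : ∀ i, D i = splitSum (fun l₁ p => (ksgn (wdeg e l₁) : k) • β' p i) [] (W i)) :
    ∑ i, (ksgn (∑ i', if i' < i then wdeg e (W i') else 0) : k) •
      f (Function.update β i (D i)) =
    splitSum (fun l₁ p => (ksgn (wdeg e l₁) : k) • f (β' p)) [] ((List.finRange N).flatMap W) := by
  have h := splitSum_flatMap (fun l₁ p => (ksgn (wdeg e l₁) : k) • f (β' p)) W []
    (List.finRange N)
  rw [List.flatMap_nil] at h
  rw [h, splitSum_congr _ (fun i => (ksgn (∑ i', if i' < i then wdeg e (W i') else 0) : k) •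
    f (Function.update β i (D i))), ← List.ofFn_eq_map, List.sum_ofFn]
  intro u i v huv
  have h1 := splitSum_shift (fun l₁ p => (ksgn (wdeg e l₁) : k) • f (β' p)) (u.flatMap W) [] (W i)
  rw [List.append_nil] at h1
  have h2 := map_splitSum ((ksgn (wdeg e (u.flatMap W)) : k) •
    f.toLinearMap β i).toAddMonoidHom (fun l₁ p => (ksgn (wdeg e l₁) : k) • β' p i) [] (W i)
  rw [List.nil_append, h1, ← sum_map_prefix _ huv,
    ← wdeg_flatMap]
  rw [hD i]
  refine Eq.trans ?_ h2.symm
  refine splitSum_congr' _ _ fun l₁ p hp => ?_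
  change _ = (ksgn (wdeg e (u.flatMap W)) : k) •
    f (Function.update β i ((ksgn (wdeg e l₁) : k) • β' p i))
  rw [f.map_update_smul, smul_smul, wdeg_append, ksgn_add, Int.cast_mul]
  congr 2
  funext i'
  by_cases hi : i' = i
  · subst hi; rw [Function.update_self]
  · rw [Function.update_of_ne hi, hβ]
    intro hp'
    have h3 : Std.Symm (Function.onFun List.Disjoint W) := ⟨fun _ _ h => h.symm⟩
    exact (List.nodup_flatMap.1 hn).2.forall (List.mem_finRange _) (List.mem_finRange _)
      hi hp' hp

variable {A : DGCategory.{u, v} k} {n : ℕ}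
variable {P : Type} [DecidableEq P] {T S : P → A.Obj} {c : P → ℤ} {α : ∀ p, A.Mor (T p) (S p)}
variable {m : ℕ}

theorem d_rowEl (hα : ∀ p, α p ∈ A.deg (T p) (S p) (c p)) (u : Fin n → FreeMonoid P)
    (hn : (rowList u).Nodup) (a b : Fin n → A.Obj) :
    (A.tensorPower n).d (rowEl α u a b) = splitSum (fun l₁ p =>
      (ksgn (wdeg (fun p => (c p : ZMod 2)) l₁) : k) •
        rowEl (Function.update α p (A.d (α p))) u a b) [] (rowList u) := by
  refine (DGCategory.tensorD_tprod (fun j => DGCategory.evalWord_mem hα _ _ _)).trans ?_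
  simp only [intCast_sum_map]
  refine sum_multilinear_eq_splitSum (PiTensorProduct.tprod k) _ (fun j => (u j).toList)
    (fun j => A.evalWord α (u j).toList (a j) (b j))
    (fun j => A.d (A.evalWord α (u j).toList (a j) (b j)))
    (fun p j => A.evalWord (Function.update α p (A.d (α p))) (u j).toList (a j) (b j)) hn
    (fun p j hp => DGCategory.evalWord_update_of_notMem _ _ _ _ hp _ _) fun j => ?_
  exact DGCategory.d_evalWord α hα _ ((List.nodup_flatMap.1 hn).1 j (List.mem_finRange _)) _ _

open scoped Classical in
/-- The chain with given factors, as a multilinear map. -/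
def chainMul {B : DGCategory.{u, v} k} (F : DGFunctor B B) (y : Fin (m + 1) → B.Obj) :
    MultilinearMap k (fun i => B.Mor (F.tw y i) (y (i + 1))) (Chain F m) :=
  (DirectSum.lof k (Fin (m + 1) → B.Obj)
    (fun x => ⨂[k] i, B.Mor (F.tw x i) (x (i + 1))) y).compMultilinearMap
      (PiTensorProduct.tprod k)

theorem chainMul_apply {B : DGCategory.{u, v} k} (F : DGFunctor B B) (y : Fin (m + 1) → B.Obj)
    (x : ∀ i, B.Mor (F.tw y i) (y (i + 1))) : chainMul F y x = chainEl F y x := rfl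

theorem intD_chainEl {B : DGCategory.{u, v} k} (F : DGFunctor B B) (y : Fin (m + 1) → B.Obj)
    {a : Fin (m + 1) → ℤ} (x : ∀ i, B.Mor (F.tw y i) (y (i + 1)))
    (hx : ∀ i, x i ∈ B.deg _ _ (a i)) :
    intD F m (chainEl F y x) = ∑ i, (ksgn (∑ i', if i' < i then (a i' : ZMod 2) else 0) : k) •
      chainEl F y (Function.update x i (B.d (x i))) := by
  rw [intD, chainEl, DirectSum.toModule_lof, LinearMap.comp_apply, DGCategory.tensorD_tprod hx,
    map_sum]
  refine Finset.sum_congr rfl fun i _ => ?_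
  rw [map_smul]
  rfl

theorem intD_matEl (hα : ∀ p, α p ∈ A.deg (T p) (S p) (c p))
    (w : Fin (m + 1) → Fin n → FreeMonoid P) (hn : (rowsList w).Nodup)
    (y : Fin (m + 1) → Fin n → A.Obj) :
    intD (cyc A n) m (matEl α w y) = splitSum (fun l₁ p =>
      (ksgn (wdeg (fun p => (c p : ZMod 2)) l₁) : k) •
        matEl (Function.update α p (A.d (α p))) w y) [] (rowsList w) := by
  simp only [matEl_eq]
  rw [rowsList_eq] at hn ⊢
  rw [intD_chainEl (B := A.tensorPower n) (cyc A n) y _ fun i => rowEl_mem hα _ _ _]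
  simp only [intCast_rowDeg, ← chainMul_apply]
  refine sum_multilinear_eq_splitSum (chainMul (B := A.tensorPower n) (cyc A n) y) _
    (fun i => rowList (w i))
    (fun i => rowEl α (w i) ((cyc A n).tw y i) (y (i + 1)))
    (fun i => (A.tensorPower n).d (rowEl α (w i) ((cyc A n).tw y i) (y (i + 1))))
    (fun p i => rowEl (Function.update α p (A.d (α p))) (w i) ((cyc A n).tw y i) (y (i + 1))) hn
    (fun p i hp => ?_) fun i => ?_
  · rw [rowEl, rowEl]
    congr 1
    funext j
    refine DGCategory.evalWord_update_of_notMem _ _ _ _ (fun h => hp ?_) _ _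
    exact List.mem_flatMap.2 ⟨j, List.mem_finRange _, h⟩
  · exact d_rowEl hα _ ((List.nodup_flatMap.1 hn).1 i (List.mem_finRange _)) _ _

variable [Inhabited P]

/-- The internal differential of a chain given by a matrix of words. -/
theorem intD_wordEl [Fintype P] (hα : ∀ p, α p ∈ A.deg (T p) (S p) (c p)) (lt : P → P → Prop)
    [DecidableRel lt] [StrictTotal lt] (w : Fin (m + 1) → Fin n → FreeMonoid P)
    (hn : (rowsList w).Nodup) {J : List P} (hJ : (rowsList w).Perm J) :
    intD (cyc A n) m (wordEl lt (fun p => (c p : ZMod 2)) α w) = (J.map fun p =>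
      (ksgn ((J.map fun p' => if lt p' p then (c p' : ZMod 2) else 0).sum) : k) •
        wordEl lt (fun q => (((c + Pi.single p 1 : P → ℤ) q : ℤ) : ZMod 2))
          (Function.update α p (A.d (α p))) w).sum := by
  rw [← (hJ.map _).sum_eq, wordEl, map_smul, intD_matEl hα w hn]
  have h := map_splitSum (DistribSMul.toAddMonoidHom (Chain (cyc A n) m)
    (koszul lt (fun p => (c p : ZMod 2)) (rowsList w) : k)) (fun l₁ p =>
      (ksgn (wdeg (fun p => (c p : ZMod 2)) l₁) : k) •
        matEl (Function.update α p (A.d (α p))) w (wordObj S w)) [] (rowsList w)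
  refine h.trans (splitSum_congr _ _ _ _ fun u p v huv => ?_)
  rw [DistribSMul.toAddMonoidHom_apply, List.nil_append, smul_smul, wordEl, smul_smul,
    DGCategory.cast_add_single, ← (hJ.map _).sum_eq]
  congr 1
  rw [huv] at hn ⊢
  -- The Leibniz sign counts the letters in front of `p` in the matrix. Together with the change of
  -- the Koszul sign for the new parity of `p`, it becomes a sign which depends only on the letters
  -- smaller than `p`, and not on the matrix.
  have h1 := koszul_add_single (lt := lt) (e := fun p => (c p : ZMod 2)) p u v hn
  have h2 := DGCategory.ksgn_mul_self (wdeg (fun p => (c p : ZMod 2)) u)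
  have h3 := DGCategory.ksgn_mul_self (((u ++ p :: v).map fun p' =>
    if lt p' p then (c p' : ZMod 2) else 0).sum)
  rw [← Int.cast_mul, ← Int.cast_mul]
  congr 1
  revert h1 h2 h3
  generalize ksgn (wdeg (fun p => (c p : ZMod 2)) u) = s
  generalize ksgn (((u ++ p :: v).map fun p' =>
    if lt p' p then (c p' : ZMod 2) else 0).sum) = s'
  intro h1 h2 h3
  linear_combination (-s * s') * h1 + (-s) * koszul lt (fun p => (c p : ZMod 2)) (u ++ p :: v) * h3 +
    s' * koszul lt ((fun p => (c p : ZMod 2)) + Pi.single p 1) (u ++ p :: v) * h2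

variable [NeZero n]

-- The signs in `intD_wordEl` do not depend on the matrix of words, so they are the same before and
-- after the rotation.
omit [DecidableEq P] [Inhabited P] in
theorem intD_act : intD (cyc A n) m ∘ₗ act (cyc A n) m = act (cyc A n) m ∘ₗ intD (cyc A n) m := by
  refine chain_ext fun x c α hα => ?_
  have hg := good_letters (A := A) x
  have hJ : (rowsList (letters m n)).Perm (byRows (m + 1) n) := by rw [rowsList_letters]
  rw [LinearMap.comp_apply, LinearMap.comp_apply, act_wordEl hα rowLt _ hg.ne hg.nodup,
    intD_wordEl hα rowLt _ hg.nodup hJ,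
    intD_wordEl hα rowLt _ hg.rowT.nodup ((rowsList_rowT_perm _).trans hJ), map_list_sum,
    List.map_map]
  congr 1
  refine List.map_congr_left fun p _ => ?_
  rw [Function.comp_apply, map_smul,
    act_wordEl (DGCategory.update_mem hα p) rowLt _ hg.ne hg.nodup]

-- The linearity of `rowPhi` in the function, obtained from `map_rowPhi` with values in families
-- indexed by letters.
omit [DecidableEq P] [Inhabited P] in
theorem rowPhi_sum {X : Type*} [AddCommGroup X] [Module k X]
    (w : Fin (m + 1) → Fin n → FreeMonoid P) (hw : ∀ i j, w i j ≠ 1) (J : List P) (s : P → k)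
    (F : P → (Fin n → FreeMonoid P) → List (Fin n → FreeMonoid P) → X) :
    rowPhi (fun a L => (J.map fun p => s p • F p a L).sum) (w 0)
      (List.ofFn fun i : Fin m => w i.succ) =
    (J.map fun p => s p • rowPhi (F p) (w 0) (List.ofFn fun i : Fin m => w i.succ)).sum := by
  have h1 := map_rowPhi w hw (AddMonoidHom.mk' (fun f : P → X => (J.map fun p => s p • f p).sum)
    fun f g => by simp only [Pi.add_apply, smul_add, List.sum_map_add]) (fun a L p => F p a L)
    (fun a L => (J.map fun p => s p • F p a L).sum) fun _ _ _ => rfl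
  have h2 := fun p => map_rowPhi w hw (Pi.evalAddMonoidHom (fun _ : P => X) p)
    (fun a L p => F p a L) (F p) fun _ _ _ => rfl
  rw [← h1]
  simp only [← h2]
  rfl

/-- The internal differential on all chains, without signs. -/
def totInt (A : DGCategory.{u, v} k) (n : ℕ) [NeZero n] : Hoch (cyc A n) →ₗ[k] Hoch (cyc A n) :=
  DirectSum.toModule k ℕ (Hoch (cyc A n)) fun m => inc A n m ∘ₗ intD (cyc A n) m

omit [DecidableEq P] [Inhabited P] in
theorem totInt_inc (x : Chain (cyc A n) m) :
    totInt A n (inc A n m x) = inc A n m (intD (cyc A n) m x) := by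
  rw [totInt, inc, DirectSum.toModule_lof]
  rfl

-- The homotopy only rearranges letters and multiplies them into words, so the Leibniz signs, which
-- depend on the original order alone, are the same on both sides.
omit [DecidableEq P] [Inhabited P] in
theorem intD_mapPhi' : inc A n (m + 1) ∘ₗ intD (cyc A n) (m + 1) ∘ₗ mapPhi' A n m =
    inc A n (m + 1) ∘ₗ mapPhi' A n m ∘ₗ intD (cyc A n) m := by
  refine chain_ext fun x c α hα => ?_
  have hg := good_letters (A := A) x
  have hJ : (rowsList (letters m n)).Perm (byRows (m + 1) n) := by rw [rowsList_letters]
  simp only [LinearMap.comp_apply]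
  rw [← totInt_inc, mapPhi'_wordEl hα rowLt _ hg, intD_wordEl hα rowLt _ hg.nodup hJ,
    map_list_sum, map_list_sum, List.map_map, List.map_map]
  refine (map_rowPhi _ hg.ne (totInt A n).toAddMonoidHom _ _ fun u hu h => ?_).trans
    ((rowPhi_sum _ hg.ne (byRows (m + 1) n) (fun p => (ksgn (((byRows (m + 1) n).map fun p' =>
      if rowLt p' p then (c p' : ZMod 2) else 0).sum) : k))
      (fun p => rowsEl rowLt (fun q => (((c + Pi.single p 1 : _ → ℤ) q : ℤ) : ZMod 2))
          (Function.update α p (A.d (α p))))).trans ?_)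
  · rw [rowsEl_ofFn]
    simp only [rowsEl_ofFn]
    rw [LinearMap.toAddMonoidHom_coe, totInt_inc, intD_wordEl hα rowLt _ (h.nodup_iff.2 hg.nodup) (h.trans hJ), map_list_sum,
      List.map_map]
    congr 1
    refine List.map_congr_left fun p _ => ?_
    rw [Function.comp_apply, map_smul]
  · congr 1
    refine List.map_congr_left fun p _ => ?_
    rw [Function.comp_apply, Function.comp_apply, map_smul, map_smul,
      mapPhi'_wordEl (DGCategory.update_mem hα p) rowLt _ hg]

end

section

open Shuffle

variable {k : Type w} [Field k] {A : DGCategory.{u, v} k} {n : ℕ} [NeZero n] {m : ℕ}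

/-! ### Total complexes -/

section Average

variable {V N : Type*} [AddCommGroup V] [Module k V] [AddCommGroup N] [Module k N]

theorem neg_one_pow_succ_smul_add (m : ℕ) (y : V) :
    (-1 : k) ^ (m + 1) • y + (-1 : k) ^ m • y = 0 := by
  rw [pow_succ, mul_neg_one, neg_smul, neg_add_cancel]

/-- Multiplication by `t` shifts the sum over its powers cyclically. -/
theorem sum_mul_pow_mul (φ t : Module.End k V) {n : ℕ} (h : t ^ n = 1) :
    (∑ s ∈ Finset.range n, φ * t ^ s) * t = ∑ s ∈ Finset.range n, φ * t ^ s := by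
  rw [Finset.sum_mul]
  simp only [mul_assoc, ← pow_succ]
  have h' := (Finset.sum_range_succ (fun s => φ * t ^ s) n).symm.trans
    (Finset.sum_range_succ' _ n)
  rw [h, pow_zero] at h'
  exact (add_right_cancel h').symm

/-- The powers of `t` disappear under `π`, so the average of the identity is the identity. This is
where `n` has to be invertible. -/
theorem average_sub_one (π : V →ₗ[k] N) (H t : Module.End k V) (ht : ∀ s x, π ((t ^ s) x) = π x)
    {n : ℕ} (hn : (n : k) ≠ 0) (x : V) :
    π (((n : k)⁻¹ • ∑ s ∈ Finset.range n, (H - 1) * t ^ s) x) =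
      π (((n : k)⁻¹ • ∑ s ∈ Finset.range n, H * t ^ s) x) - π x := by
  simp only [LinearMap.smul_apply, LinearMap.sum_apply, map_smul, map_sum, sub_mul, one_mul,
    LinearMap.sub_apply, map_sub, ht, Finset.sum_sub_distrib, Finset.sum_const,
    Finset.card_range, smul_sub]
  rw [← Nat.cast_smul_eq_nsmul k, smul_smul, inv_mul_cancel₀ hn, one_smul]

theorem exists_quotient_homotopy (U : Submodule k V) (D Φ : V →ₗ[k] V) (f : V →ₗ[k] N)
    (g : N →ₗ[k] V ⧸ U) (hD : U ≤ LinearMap.ker (U.mkQ ∘ₗ D)) (hf : U ≤ LinearMap.ker f)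
    (hΦ : U ≤ LinearMap.ker (U.mkQ ∘ₗ Φ))
    (h : ∀ x, U.mkQ (D (Φ x) + Φ (D x)) = g (f x) - U.mkQ x) :
    ∃ (d : V ⧸ U →ₗ[k] V ⧸ U) (f' : V ⧸ U →ₗ[k] N) (φ : V ⧸ U →ₗ[k] V ⧸ U),
      d ∘ₗ U.mkQ = U.mkQ ∘ₗ D ∧ f' ∘ₗ U.mkQ = f ∧ φ ∘ₗ U.mkQ = U.mkQ ∘ₗ Φ ∧
        d ∘ₗ φ + φ ∘ₗ d = g ∘ₗ f' - LinearMap.id := by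
  refine ⟨U.liftQ _ hD, U.liftQ _ hf, U.liftQ _ hΦ, U.liftQ_mkQ _ hD, U.liftQ_mkQ _ hf,
    U.liftQ_mkQ _ hΦ, Submodule.linearMap_qext _ (LinearMap.ext fun x => ?_)⟩
  have h := h x
  rw [map_add] at h
  exact h

end Average

omit [NeZero n] in
theorem hoch_ext {N : Type*} [AddCommGroup N] [Module k N] {φ ψ : Hoch (cyc A n) →ₗ[k] N}
    (h : ∀ m, φ ∘ₗ inc A n m = ψ ∘ₗ inc A n m) : φ = ψ :=
  DirectSum.linearMap_ext k h

omit [NeZero n] in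
theorem totAct_inc (x : Chain (cyc A n) m) :
    totAct (cyc A n) (inc A n m x) = inc A n m (act (cyc A n) m x) := by
  rw [totAct, inc, DirectSum.toModule_lof]
  rfl

omit [NeZero n] in
theorem totAct_pow_inc (s : ℕ) (x : Chain (cyc A n) m) :
    (totAct (cyc A n) ^ s) (inc A n m x) = inc A n m ((act (cyc A n) m ^ s) x) := by
  induction s generalizing x with
  | zero => rfl
  | succ s ih =>
    rw [pow_succ, pow_succ, Module.End.mul_apply, Module.End.mul_apply, totAct_inc, ih]

/-- The internal differential on all chains, with signs. -/
def totI (A : DGCategory.{u, v} k) (n : ℕ) [NeZero n] : Hoch (cyc A n) →ₗ[k] Hoch (cyc A n) :=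
  DirectSum.toModule k ℕ (Hoch (cyc A n)) fun m =>
    (-1 : k) ^ m • (DirectSum.lof k ℕ (fun m => Chain (cyc A n) m) m ∘ₗ intD (cyc A n) m)

theorem totI_inc (x : Chain (cyc A n) m) :
    totI A n (inc A n m x) = (-1 : k) ^ m • inc A n m (intD (cyc A n) m x) := by
  rw [totI, inc, DirectSum.toModule_lof]
  rfl

theorem totD_eq : totD (cyc A n) = totB A n + totI A n := by
  refine hoch_ext fun m => LinearMap.ext fun x => ?_
  rw [LinearMap.comp_apply, LinearMap.comp_apply, LinearMap.add_apply, totI_inc]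
  rw [totD, inc, DirectSum.toModule_lof, LinearMap.add_apply, totB, DirectSum.toModule_lof]
  rfl

theorem totB_act : Commute (totB A n) (totAct (cyc A n)) := by
  refine hoch_ext fun m => LinearMap.ext fun x => ?_
  rw [LinearMap.comp_apply, LinearMap.comp_apply, Module.End.mul_apply, Module.End.mul_apply,
    totAct_inc]
  cases m with
  | zero => rw [totB_inc_zero, totB_inc_zero, map_zero]
  | succ m =>
    rw [totB_inc_succ, totB_inc_succ, totAct_inc]
    exact congrArg (inc A n m) (LinearMap.congr_fun hochB_act x)

theorem totI_act : Commute (totI A n) (totAct (cyc A n)) := by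
  refine hoch_ext fun m => LinearMap.ext fun x => ?_
  rw [LinearMap.comp_apply, LinearMap.comp_apply, Module.End.mul_apply, Module.End.mul_apply,
    totAct_inc, totI_inc, totI_inc, map_smul, totAct_inc]
  exact congrArg (fun x => (-1 : k) ^ m • inc A n m x) (LinearMap.congr_fun intD_act x)

theorem totD_act : Commute (totD (cyc A n)) (totAct (cyc A n)) := by
  rw [totD_eq]
  exact totB_act.add_left totI_act

theorem totAct_pow : totAct (cyc A n) ^ n = 1 := by
  refine hoch_ext fun m => LinearMap.ext fun x => ?_
  rw [LinearMap.comp_apply, LinearMap.comp_apply, totAct_pow_inc, act_pow]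
  rfl

/-- The internal differential commutes with the homotopy. As the latter raises the degree by one,
the signs `(-1) ^ m` turn this into anticommutation. -/
theorem totI_totPhi' : totI A n * totPhi' A n + totPhi' A n * totI A n = 0 := by
  refine hoch_ext fun m => LinearMap.ext fun x => ?_
  rw [LinearMap.comp_apply, LinearMap.add_apply, Module.End.mul_apply, Module.End.mul_apply,
    totPhi'_inc, totI_inc, totI_inc, map_smul, totPhi'_inc]
  have h := LinearMap.congr_fun (intD_mapPhi' (A := A) (n := n) (m := m)) x
  simp only [LinearMap.comp_apply] at h
  rw [h]
  exact neg_one_pow_succ_smul_add m _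

/-- The composition of the first summand of `f` with `g`. -/
def totGF (A : DGCategory.{u, v} k) (n : ℕ) [NeZero n] : Hoch (cyc A n) →ₗ[k] Hoch (cyc A n) :=
  DirectSum.toModule k ℕ (Hoch (cyc A n)) fun m => inc A n m ∘ₗ mapG A n m ∘ₗ mapFs A n m 0

theorem totGF_inc (x : Chain (cyc A n) m) :
    totGF A n (inc A n m x) = inc A n m (mapG A n m (mapFs A n m 0 x)) := by
  rw [totGF, inc, DirectSum.toModule_lof]
  rfl

theorem totB_totPhi'_add : totB A n * totPhi' A n + totPhi' A n * totB A n = totGF A n - 1 := by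
  refine hoch_ext fun m => (homotopy' (A := A) (n := n) (m := m)).trans ?_
  refine LinearMap.ext fun x => ?_
  rw [LinearMap.comp_apply (totGF A n - 1), LinearMap.sub_apply, LinearMap.sub_apply, totGF_inc]
  rfl

/-- The homotopy formula for the total differential, before averaging and without passing to the
coinvariants; the internal differential contributes nothing. -/
theorem totD_totPhi' : totD (cyc A n) * totPhi' A n + totPhi' A n * totD (cyc A n) =
    totGF A n - 1 := by
  rw [totD_eq, ← totB_totPhi'_add, ← add_zero (totB A n * totPhi' A n + _), ← totI_totPhi',
    add_mul, mul_add]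
  abel

theorem totPhi_eq : totPhi A n =
    (n : k)⁻¹ • ∑ s ∈ Finset.range n, totPhi' A n * totAct (cyc A n) ^ s := by
  refine hoch_ext fun m => LinearMap.ext fun x => ?_
  rw [LinearMap.comp_apply, LinearMap.comp_apply, LinearMap.smul_apply, LinearMap.sum_apply]
  simp only [Module.End.mul_apply, totAct_pow_inc, totPhi'_inc]
  rw [totPhi, inc, DirectSum.toModule_lof, mapPhi, LinearMap.comp_apply, LinearMap.smul_apply,
    LinearMap.sum_apply, map_smul, map_sum]
  rfl

theorem totPhi_act : totPhi A n * totAct (cyc A n) = totPhi A n := by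
  rw [totPhi_eq, smul_mul_assoc]
  exact congrArg ((n : k)⁻¹ • ·) (sum_mul_pow_mul (totPhi' A n) _ totAct_pow)

/-- The differential commutes with `t`, so the formula `totD_totPhi'` can be averaged over the
powers of `t`. -/
theorem totD_totPhi : totD (cyc A n) * totPhi A n + totPhi A n * totD (cyc A n) =
    (n : k)⁻¹ • ∑ s ∈ Finset.range n, (totGF A n - 1) * totAct (cyc A n) ^ s := by
  rw [totPhi_eq, smul_mul_assoc, mul_smul_comm, ← smul_add, Finset.mul_sum, Finset.sum_mul,
    ← Finset.sum_add_distrib]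
  congr 1
  refine Finset.sum_congr rfl fun s _ => ?_
  rw [← totD_totPhi', add_mul, mul_assoc, mul_assoc, mul_assoc, (totD_act.pow_right s).eq]

theorem totF_act : totF A n ∘ₗ totAct (cyc A n) = totF A n := by
  refine hoch_ext fun m => LinearMap.ext fun x => ?_
  rw [LinearMap.comp_apply, LinearMap.comp_apply, LinearMap.comp_apply, totAct_inc]
  have h := LinearMap.congr_fun (mapF_act (A := A) (n := n) (m := m)) x
  rw [LinearMap.comp_apply] at h
  rw [totF, inc, DirectSum.toModule_lof, DirectSum.toModule_lof, LinearMap.comp_apply,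
    LinearMap.comp_apply, h]

omit [NeZero n] in
theorem mkQ_act : (coinvRel (cyc A n)).mkQ ∘ₗ totAct (cyc A n) = (coinvRel (cyc A n)).mkQ := by
  refine LinearMap.ext fun x => ?_
  rw [LinearMap.comp_apply, eq_comm, ← sub_eq_zero, ← map_sub]
  exact (Submodule.Quotient.mk_eq_zero _).2 (Submodule.subset_span ⟨x, rfl⟩)

omit [NeZero n] in
theorem mkQ_act_pow (s : ℕ) (x : Hoch (cyc A n)) :
    (coinvRel (cyc A n)).mkQ ((totAct (cyc A n) ^ s) x) = (coinvRel (cyc A n)).mkQ x := by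
  induction s generalizing x with
  | zero => rfl
  | succ s ih =>
    rw [pow_succ, Module.End.mul_apply, ih]
    exact LinearMap.congr_fun mkQ_act x

omit [NeZero n] in
theorem coinvRel_le_ker {N : Type*} [AddCommGroup N] [Module k N] {φ : Hoch (cyc A n) →ₗ[k] N}
    (h : φ ∘ₗ totAct (cyc A n) = φ) : coinvRel (cyc A n) ≤ LinearMap.ker φ := by
  refine Submodule.span_le.2 ?_
  rintro _ ⟨x, rfl⟩
  have := LinearMap.congr_fun h x
  rw [LinearMap.comp_apply] at this
  rw [SetLike.mem_coe, LinearMap.mem_ker, map_sub, this, sub_self]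

/-- This writes the composition as the projection of an average over the powers of `t`, in order to
compare it with the averaged homotopy formula. -/
theorem totG_totF : totG A n ∘ₗ totF A n = (coinvRel (cyc A n)).mkQ ∘ₗ
    ((n : k)⁻¹ • ∑ s ∈ Finset.range n, totGF A n * totAct (cyc A n) ^ s) := by
  refine hoch_ext fun m => LinearMap.ext fun x => ?_
  simp only [LinearMap.comp_apply]
  rw [totF, inc, DirectSum.toModule_lof, totG, LinearMap.comp_apply, LinearMap.comp_apply,
    DirectSum.toModule_lof, LinearMap.comp_apply, mapF_eq, ← sum_mapFs_act]
  congr 1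
  change inc A n m _ = ((n : k)⁻¹ • ∑ s ∈ Finset.range n, totGF A n * totAct (cyc A n) ^ s)
    (inc A n m x)
  rw [LinearMap.smul_apply, LinearMap.smul_apply, map_smul, map_smul, LinearMap.sum_apply,
    LinearMap.sum_apply, map_sum, map_sum]
  congr 1
  refine Finset.sum_congr rfl fun s _ => ?_
  rw [Module.End.mul_apply, totAct_pow_inc, totGF_inc]
  rfl

theorem mkQ_homotopy (hn : (n : k) ≠ 0) (x : Hoch (cyc A n)) :
    (coinvRel (cyc A n)).mkQ (totD (cyc A n) (totPhi A n x) + totPhi A n (totD (cyc A n) x)) =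
      totG A n (totF A n x) - (coinvRel (cyc A n)).mkQ x := by
  have h := LinearMap.congr_fun (totD_totPhi (A := A) (n := n)) x
  rw [LinearMap.add_apply, Module.End.mul_apply, Module.End.mul_apply] at h
  have h2 := LinearMap.congr_fun (totG_totF (A := A) (n := n)) x
  rw [LinearMap.comp_apply, LinearMap.comp_apply] at h2
  rw [h, h2]
  exact average_sub_one (coinvRel (cyc A n)).mkQ (totGF A n) _ mkQ_act_pow hn x

end

end DG

end

/-! ### Passage to the coinvariants -/

theorem theorem3p1 {k : Type w} [Field k] (A : DG.DGCategory.{u, v} k) (n : ℕ) [NeZero n]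
    (hn : (n : k) ≠ 0) :
    ∃ (d : DG.Coinv (DG.cyc A n) →ₗ[k] DG.Coinv (DG.cyc A n))
      (f : DG.Coinv (DG.cyc A n) →ₗ[k] DG.Hoch (DG.DGFunctor.id A))
      (Φ : DG.Coinv (DG.cyc A n) →ₗ[k] DG.Coinv (DG.cyc A n)),
      d ∘ₗ (DG.coinvRel (DG.cyc A n)).mkQ =
          (DG.coinvRel (DG.cyc A n)).mkQ ∘ₗ DG.totD (DG.cyc A n) ∧
      f ∘ₗ (DG.coinvRel (DG.cyc A n)).mkQ = DG.totF A n ∧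
      Φ ∘ₗ (DG.coinvRel (DG.cyc A n)).mkQ =
          (DG.coinvRel (DG.cyc A n)).mkQ ∘ₗ DG.totPhi A n ∧
      d ∘ₗ Φ + Φ ∘ₗ d = DG.totG A n ∘ₗ f - LinearMap.id := by
  have hd : ((DG.coinvRel (DG.cyc A n)).mkQ ∘ₗ DG.totD (DG.cyc A n)) ∘ₗ
      DG.totAct (DG.cyc A n) = (DG.coinvRel (DG.cyc A n)).mkQ ∘ₗ DG.totD (DG.cyc A n) := by
    have h : DG.totD (DG.cyc A n) ∘ₗ DG.totAct (DG.cyc A n) =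
      DG.totAct (DG.cyc A n) ∘ₗ DG.totD (DG.cyc A n) := DG.totD_act.eq
    rw [LinearMap.comp_assoc, h, ← LinearMap.comp_assoc, DG.mkQ_act]
  -- As an average, the homotopy already absorbs `t` on the right; so it descends without having to
  -- commute with `t`.
  have hΦ : ((DG.coinvRel (DG.cyc A n)).mkQ ∘ₗ DG.totPhi A n) ∘ₗ
      DG.totAct (DG.cyc A n) = (DG.coinvRel (DG.cyc A n)).mkQ ∘ₗ DG.totPhi A n := by
    have h : DG.totPhi A n ∘ₗ DG.totAct (DG.cyc A n) = DG.totPhi A n := DG.totPhi_act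
    rw [LinearMap.comp_assoc, h]
  exact DG.exists_quotient_homotopy (DG.coinvRel (DG.cyc A n)) (DG.totD (DG.cyc A n))
    (DG.totPhi A n) (DG.totF A n) (DG.totG A n) (DG.coinvRel_le_ker hd)
    (DG.coinvRel_le_ker DG.totF_act) (DG.coinvRel_le_ker hΦ) (DG.mkQ_homotopy hn)
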